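/- Let $M^n$ be an oriented smooth manifold (Hausdorff, second countable, without boundary, not necessarily compact), and let $L^k\subset M$, $k<n$, be a connected, oriented submanifold which is closed as a subset. Let $f:L\to\mathbb R$ be continuous, let $\Omega$ be a $C^1$ form of degree $n-k-1$ on $M\setminus L$ with locally integrable coefficients on $M$, and let $H$ be a continuous form of degree $n-k$ on $M$. Conventions. A form $\omega$ with locally integrable coefficients defines the current $T_\omega(\eta)=\int_M\omega\wedge\eta$; the current $fL$ is $\eta\mapsto\int_L f\,\eta$; on currents $T$ of dimension $p$ one puts $dT(\eta)=(-1)^{n-p+1}T(d\eta)$, so that $dT_\omega=T_{d\omega}$ for $\omega$ of class $C^1$. Boundaries are oriented with the outward normal first. Denote by $B(p)$ any compact, oriented submanifold with boundary of $M$, of dimension $n-k$, which meets $L$ exactly in the point $p\in L$, transversely, with $p\notin\partial B(p)$ and $\mathrm{or}\,B(p)\wedge\mathrm{or}\,L=\mathrm{or}\,M$ at $p$. The form $\Omega$ is called weakly extendible if for some Riemannian metric on $M$ the following holds: on the collar $[0,\epsilon)\times S_1(\nu L)$ of the oriented blow-up of $L$, with blow-down map $(t,p,v)\mapsto\exp_p(tv)$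 (where $\epsilon$ is a small positive continuous function on $L$), the part without $dt$ of the pull-back of $\Omega$ extends continuously to $t=0$. Consider the statements * (a) $d\Omega=fL-H$ in the sense of currents; * (b1) $d\Omega=-H$ as forms on $M\setminus L$; * (b2) $\displaystyle\int_{B(p)}H+\int_{\partial B(p)}\Omega=f(p)$. Then: 1. (a) implies (b1), and (b2) for every $B(p)$ at every $p\in L$. 2. Conversely, assume that $\Omega$ is weakly extendible and that (b1) holds. If (b2) holds for one single $B(p)$, then $d\Omega=f(p)\,L-H$ in the sense of currents; in particular (a) holds if $f$ is constant. If for every $p\in L$ statement (b2) holds for some $B(p)$, then (a) holds. 3. If (a) holds, then $f$ is constant, $dH=0$ if $H$ is $C^1$, and $fL$ and $H$ are Poincaré dual to each other, that is, $fL$ and $T_H$ are closed currents and $fL-T_H=dR$ for some current $R$. -/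

import Mathlib

open Set MeasureTheory Topology Filter
open scoped Manifold ContDiff

universe uM uN v

noncomputable section

namespace BlowUpCurrents

/-- The model space `ℝⁿ` with its Euclidean norm and Lebesgue measure. -/
abbrev Eu (n : ℕ) : Type := EuclideanSpace ℝ (Fin n)

/-- The standard basis of `ℝⁿ`. -/
def stdFrame (n : ℕ) (i : Fin n) : Eu n := EuclideanSpace.single i (1 : ℝ)

/-! ## Differential forms on manifolds (possibly with boundary) -/

section Forms

variable {n : ℕ} {H : Type*} [TopologicalSpace H] (I : ModelWithCorners ℝ (Eu n) H)
  (M : Type*) [TopologicalSpace M] [ChartedSpace H M]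

/-- Differential forms of degree `p` on `M`, without any regularity. -/
abbrev DiffForm (p : ℕ) : Type _ := ∀ x : M, (TangentSpace I x) [⋀^Fin p]→L[ℝ] ℝ

variable {I M}

/-- The differential at `y` of the inverse of the preferred chart at `x₀`; its value on the
standard basis is the coordinate frame of that chart. -/
def chartSymmDeriv (I : ModelWithCorners ℝ (Eu n) H) {M : Type*} [TopologicalSpace M]
    [ChartedSpace H M] (x₀ : M) (y : Eu n) :
    Eu n →L[ℝ] TangentSpace I ((extChartAt I x₀).symm y) :=
  mfderivWithin 𝓘(ℝ, Eu n) I (extChartAt I x₀).symm (range I) y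

/-- The coordinate expression of a form in the preferred chart at `x₀`: its pull-back by the inverse
of the chart. It is meaningful on `(extChartAt I x₀).target`. -/
def localForm {p : ℕ} (α : DiffForm I M p) (x₀ : M) (y : Eu n) : (Eu n) [⋀^Fin p]→L[ℝ] ℝ :=
  (α ((extChartAt I x₀).symm y)).compContinuousLinearMap (chartSymmDeriv I x₀ y)

/-- `α` is of class `C^r` on the open set `U`: so are its coefficients in the charts. -/
def IsCkOn {p : ℕ} (r : ℕ∞ω) (α : DiffForm I M p) (U : Set M) : Prop :=
  ∀ x₀ : M, ContDiffOn ℝ r (localForm α x₀)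
    ((extChartAt I x₀).target ∩ (extChartAt I x₀).symm ⁻¹' U)

/-- `α` has locally integrable coefficients (in charts, with respect to Lebesgue measure). -/
def HasLocallyIntegrableCoeffs {p : ℕ} (α : DiffForm I M p) : Prop :=
  ∀ x₀ : M, LocallyIntegrableOn (localForm α x₀) (extChartAt I x₀).target volume

/-- The exterior derivative, computed at `x` in the preferred chart at `x`. -/
def dForm {p : ℕ} (α : DiffForm I M p) : DiffForm I M (p + 1) := fun x =>
  (extDerivWithin (localForm α x) (range I) (extChartAt I x x)).compContinuousLinearMap
    (mfderiv I 𝓘(ℝ, Eu n) (extChartAt I x) x : TangentSpace I x →L[ℝ] Eu n)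

/-- A test form: a smooth form with compact support. -/
def IsTestForm {p : ℕ} (α : DiffForm I M p) : Prop :=
  IsCkOn ∞ α univ ∧ IsCompact (closure {x : M | α x ≠ 0})

/-- The pull-back of a form by a map. -/
def pullback {n' : ℕ} {H' : Type*} [TopologicalSpace H'] {I' : ModelWithCorners ℝ (Eu n') H'}
    {M' : Type*} [TopologicalSpace M'] [ChartedSpace H' M'] {p : ℕ}
    (φ : M' → M) (α : DiffForm I M p) : DiffForm I' M' p := fun x =>
  (α (φ x)).compContinuousLinearMap (mfderiv I' I φ x)

end Forms

/-! ## The wedge product -/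

section Wedge

variable {V : Type*} [AddCommGroup V] [Module ℝ V] [TopologicalSpace V]

/-- The wedge product of alternating forms, normalized as a sum over shuffles:
`(α ∧ β)(v₁, …, v_{p+q}) = ∑ sign(σ) α(v_{σ1}, …, v_{σp}) β(v_{σ(p+1)}, …, v_{σ(p+q)})`. -/
def wedge {p q r : ℕ} (h : p + q = r) (α : V [⋀^Fin p]→L[ℝ] ℝ) (β : V [⋀^Fin q]→L[ℝ] ℝ) :
    V [⋀^Fin r]→L[ℝ] ℝ :=
  { ((LinearMap.mul' ℝ ℝ).compAlternatingMap
      (AlternatingMap.domCoprod α.toAlternatingMap β.toAlternatingMap)).domDomCongr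
        (finSumFinEquiv.trans (finCongr h)) with
    cont := by
      change Continuous fun v : Fin r → V => (LinearMap.mul' ℝ ℝ)
        (AlternatingMap.domCoprod α.toAlternatingMap β.toAlternatingMap
          (fun i => v ((finSumFinEquiv.trans (finCongr h)) i)))
      simp only [AlternatingMap.domCoprod_apply, _root_.sum_apply, map_sum]
      refine continuous_finsetSum _ fun σ _ => ?_
      induction σ using Quotient.inductionOn' with
      | h σ =>
        have hα : Continuous fun v : Fin p → V => α v := α.cont
        have hβ : Continuous fun v : Fin q → V => β v := β.cont
        refine Continuous.const_smul (c := Equiv.Perm.sign σ)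
          (g := fun v : Fin r → V =>
            α (fun i => v (finSumFinEquiv.trans (finCongr h) (σ (Sum.inl i)))) *
              β (fun i => v (finSumFinEquiv.trans (finCongr h) (σ (Sum.inr i))))) ?_ |>.congr ?_
        · exact (hα.comp (by fun_prop)).mul (hβ.comp (by fun_prop))
        · intro v
          rw [AlternatingMap.domCoprod.summand_mk'']
          rcases Int.units_eq_one_or (Equiv.Perm.sign σ) with hσ | hσ <;> simp [hσ] }

end Wedge

/-! ## Orientations and integration -/

/-- The sign (`1`, `0` or `-1`) of a tuple of vectors with respect to an orientation: `1` for
positively oriented bases, `-1` for negatively oriented ones and `0` for dependent tuples. -/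
def orientSign {V : Type*} [AddCommGroup V] [Module ℝ V] {n : ℕ}
    (o : Orientation ℝ V (Fin n)) (v : Fin n → V) : ℝ :=
  Real.sign (o.someVector v)

section Integration

variable {n : ℕ} {H : Type*} [TopologicalSpace H] (I : ModelWithCorners ℝ (Eu n) H)
  (M : Type*) [TopologicalSpace M] [ChartedSpace H M]

/-- An orientation of `M`: an orientation of every tangent space, such that the sign of the
coordinate frame of each chart is locally constant. -/
structure ManifoldOrientation where
  /-- the orientation of the tangent space at `x` -/
  orient : ∀ x : M, Orientation ℝ (TangentSpace I x) (Fin n)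
  locally_constant : ∀ x₀ : M, ∀ᶠ x in 𝓝 x₀,
    orientSign (orient ((extChartAt I x₀).symm (extChartAt I x₀ x)))
        (fun i => chartSymmDeriv I x₀ (extChartAt I x₀ x) (stdFrame n i)) =
      orientSign (orient ((extChartAt I x₀).symm (extChartAt I x₀ x₀)))
        (fun i => chartSymmDeriv I x₀ (extChartAt I x₀ x₀) (stdFrame n i))

variable {I M}

/-- The sign of the coordinate frame of the chart at `x₀`, as a function of the coordinates. -/
def ManifoldOrientation.chartSign (o : ManifoldOrientation I M) (x₀ : M) (y : Eu n) : ℝ :=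
  orientSign (o.orient ((extChartAt I x₀).symm y))
    (fun i => chartSymmDeriv I x₀ y (stdFrame n i))

variable (I M) in
/-- A smooth partition of unity subordinate to the cover of `M` by chart domains. -/
def chartPartition [IsManifold I ∞ M] [T2Space M] [SigmaCompactSpace M] :
    SmoothPartitionOfUnity M I M univ :=
  Classical.choose (SmoothPartitionOfUnity.exists_isSubordinate_chartAt_source I M)

/-- The integral over the oriented manifold `M` of a compactly supported form of top degree. -/
def integral [IsManifold I ∞ M] [T2Space M] [SigmaCompactSpace M]
    (o : ManifoldOrientation I M) (α : DiffForm I M n) : ℝ :=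
  ∑ᶠ i : M, ∫ y in (extChartAt I i).target,
    chartPartition I M i ((extChartAt I i).symm y) *
      (o.chartSign i y * localForm α i y (stdFrame n))

end Integration

section BoundaryIntegral

variable {m : ℕ} {B : Type*} [TopologicalSpace B] [ChartedSpace (EuclideanHalfSpace (m + 1)) B]

/-- The inclusion `y ↦ (0, y)` of `ℝᵐ` as the boundary of the half-space `{x | 0 ≤ x₀}`. -/
def toBoundary (y : Eu m) : Eu (m + 1) := WithLp.toLp 2 (Fin.cons 0 y.ofLp)

/-- The integral of a compactly supported `m`-form over the boundary of the oriented
`(m+1)`-manifold `B`. The boundary carries the orientation with the outward normal first; in a chart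
with values in `{x | 0 ≤ x₀}` the outward normal is `-e₀`, so the frame `e₁, …, eₘ` of the boundary
has the sign of `(-e₀, e₁, …, eₘ)`, which is minus that of the coordinate frame. For `m = 0` this is
the signed sum over the boundary points. -/
def boundaryIntegral [IsManifold (𝓡∂ (m + 1)) ∞ B] [T2Space B] [SigmaCompactSpace B]
    (o : ManifoldOrientation (𝓡∂ (m + 1)) B) (α : DiffForm (𝓡∂ (m + 1)) B m) : ℝ :=
  ∑ᶠ i : B, ∫ y in toBoundary ⁻¹' (extChartAt (𝓡∂ (m + 1)) i).target,
    chartPartition (𝓡∂ (m + 1)) B i ((extChartAt (𝓡∂ (m + 1)) i).symm (toBoundary y)) *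
      (-(o.chartSign i (toBoundary y)) *
        localForm α i (toBoundary y) (fun a => stdFrame (m + 1) a.succ))

end BoundaryIntegral

/-! ## Currents -/

section Currents

variable {n : ℕ} {M : Type*} [TopologicalSpace M] [ChartedSpace (Eu n) M]

variable (M n) in
/-- Functionals on `p`-forms. Only their values on test forms matter, see `EqAsCurrents`. -/
abbrev FormFunctional (p : ℕ) : Type _ := DiffForm (𝓡 n) M p → ℝ

/-- Two functionals are equal as currents if they agree on all test forms. -/
def EqAsCurrents {p : ℕ} (S T : FormFunctional n M p) : Prop :=
  ∀ η : DiffForm (𝓡 n) M p, IsTestForm η → S η = T η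

/-- Convergence to zero in the space of test forms: supports in a common compact set, and uniform
convergence to zero on compact sets of all derivatives of the coefficients in charts. -/
def TestFormsTendToZero {p : ℕ} (η : ℕ → DiffForm (𝓡 n) M p) : Prop :=
  (∀ j, IsTestForm (η j)) ∧
  (∃ K : Set M, IsCompact K ∧ ∀ j, ∀ x ∉ K, η j x = 0) ∧
  ∀ (x₀ : M) (K : Set (Eu n)), IsCompact K → K ⊆ (extChartAt (𝓡 n) x₀).target → ∀ r : ℕ,
    TendstoUniformlyOn (fun j => iteratedFDeriv ℝ r (localForm (η j) x₀)) 0 atTop K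

/-- `T` is a current of dimension `p`: a continuous linear functional on the test forms of
degree `p`. -/
structure IsCurrent {p : ℕ} (T : FormFunctional n M p) : Prop where
  map_add : ∀ η ζ, IsTestForm η → IsTestForm ζ → T (η + ζ) = T η + T ζ
  map_smul : ∀ (c : ℝ) (η), IsTestForm η → T (c • η) = c * T η
  continuous : ∀ η : ℕ → DiffForm (𝓡 n) M p, TestFormsTendToZero η →
    Tendsto (fun j => T (η j)) atTop (𝓝 0)

/-- The exterior derivative of a current `T` of dimension `p + 1`:
`dT(η) = (-1)^(n - (p + 1) + 1) T(dη)`. The sign makes it extend `d` on forms. -/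
def currentD {p : ℕ} (T : FormFunctional n M (p + 1)) : FormFunctional n M p := fun η =>
  (-1) ^ (n - (p + 1) + 1) * T (dForm η)

/-- `T` is a closed current: `dT = 0` (no condition in dimension `0`). -/
def IsClosedCurrent : {p : ℕ} → FormFunctional n M p → Prop
  | 0, _ => True
  | _ + 1, T => EqAsCurrents (currentD T) 0

/-- Two currents of dimension `p` are homologous: they differ by the exterior derivative of a
current. -/
def AreHomologous {p : ℕ} (S T : FormFunctional n M p) : Prop :=
  ∃ R : FormFunctional n M (p + 1), IsCurrent R ∧ EqAsCurrents (S - T) (currentD R)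

variable [IsManifold (𝓡 n) ∞ M] [T2Space M] [SigmaCompactSpace M]

/-- The current `η ↦ ∫_M α ∧ η` given by a form with locally integrable coefficients. -/
def currentOfForm (o : ManifoldOrientation (𝓡 n) M) {a p : ℕ} (h : a + p = n)
    (α : DiffForm (𝓡 n) M a) : FormFunctional n M p := fun η =>
  integral o fun x => wedge h (α x) (η x)

/-- The current `fL : η ↦ ∫_L f η`, for `L` the image of the closed embedding `ι : N → M` of an
oriented manifold `N`, and a function `f` on `L`, viewed on `N`. -/
def weightedCurrent {k : ℕ} {N : Type*} [TopologicalSpace N] [ChartedSpace (Eu k) N]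
    [IsManifold (𝓡 k) ∞ N] [T2Space N] [SigmaCompactSpace N]
    (oN : ManifoldOrientation (𝓡 k) N) (ι : N → M) (f : N → ℝ) : FormFunctional n M k := fun η =>
  integral oN fun q => f q • (pullback ι η : DiffForm (𝓡 k) N k) q

/-- The form `α` and the current `T` are Poincaré dual: both `T` and the current given by `α` are
closed currents, and they have the same class in the homology of the complex of currents. -/
def ArePoincareDual (o : ManifoldOrientation (𝓡 n) M) {a p : ℕ} (h : a + p = n)
    (T : FormFunctional n M p) (α : DiffForm (𝓡 n) M a) : Prop :=
  IsCurrent T ∧ IsCurrent (currentOfForm o h α) ∧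
    IsClosedCurrent T ∧ IsClosedCurrent (currentOfForm o h α) ∧
    AreHomologous T (currentOfForm o h α)

end Currents

/-! ## Transverse submanifolds with boundary -/

section Transverse

variable {k m : ℕ} {M : Type uM} [TopologicalSpace M] [ChartedSpace (Eu (m + 1 + k)) M]
  {N : Type uN} [TopologicalSpace N] [ChartedSpace (Eu k) N]

/-- A compact, `L`-transversely oriented submanifold with boundary `B(p)` of `M`, of dimension
`m + 1 = n - k`, that intersects `L = ι(N)` transversely in exactly one point `p = ι(point)`, which
is not on the boundary. It is given by a smooth embedding of a compact manifold with boundary.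

In the last two fields, `map center` and `ι point` are the same point of `M`, so that tangent
vectors at both are compared directly in the model space. -/
structure TransverseDisc (oM : ManifoldOrientation (𝓡 (m + 1 + k)) M)
    (oN : ManifoldOrientation (𝓡 k) N) (ι : N → M) where
  /-- the manifold with boundary -/
  carrier : Type v
  [top : TopologicalSpace carrier]
  [charted : ChartedSpace (EuclideanHalfSpace (m + 1)) carrier]
  [smooth : IsManifold (𝓡∂ (m + 1)) ∞ carrier]
  [t2 : T2Space carrier]
  [compact : CompactSpace carrier]
  /-- its orientation -/
  orientation : ManifoldOrientation (𝓡∂ (m + 1)) carrier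
  /-- its embedding in `M` -/
  map : carrier → M
  embedding : Manifold.IsSmoothEmbedding (𝓡∂ (m + 1)) (𝓡 (m + 1 + k)) ∞ map
  /-- the intersection point, on `N` -/
  point : N
  /-- the intersection point, on the submanifold with boundary -/
  center : carrier
  map_center : map center = ι point
  eq_center : ∀ b, map b ∈ range ι → b = center
  interior : (𝓡∂ (m + 1)).IsInteriorPoint center
  transverse :
    LinearMap.range (mfderiv (𝓡∂ (m + 1)) (𝓡 (m + 1 + k)) map center :
        Eu (m + 1) →L[ℝ] Eu (m + 1 + k)).toLinearMap ⊔
      LinearMap.range (mfderiv (𝓡 k) (𝓡 (m + 1 + k)) ι point :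
        Eu k →L[ℝ] Eu (m + 1 + k)).toLinearMap = ⊤
  /-- `ori B ∧ ori L = ori M` -/
  oriented : ∀ (v : Fin (m + 1) → TangentSpace (𝓡∂ (m + 1)) center)
      (w : Fin k → TangentSpace (𝓡 k) point),
    orientSign (oM.orient (ι point))
        (Fin.append
          (fun i => (mfderiv (𝓡∂ (m + 1)) (𝓡 (m + 1 + k)) map center (v i) : Eu (m + 1 + k)))
          (fun i => (mfderiv (𝓡 k) (𝓡 (m + 1 + k)) ι point (w i) : Eu (m + 1 + k)))) =
      orientSign (orientation.orient center) v * orientSign (oN.orient point) w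

attribute [instance] TransverseDisc.top TransverseDisc.charted TransverseDisc.smooth
  TransverseDisc.t2 TransverseDisc.compact

/-- The quantity `∫_B H + ∫_{∂B} Ω`. -/
def TransverseDisc.pairIntegral {oM : ManifoldOrientation (𝓡 (m + 1 + k)) M}
    {oN : ManifoldOrientation (𝓡 k) N} {ι : N → M} (B : TransverseDisc.{uM, uN, v} oM oN ι)
    (H : DiffForm (𝓡 (m + 1 + k)) M (m + 1)) (Ω : DiffForm (𝓡 (m + 1 + k)) M m) : ℝ :=
  integral B.orientation (pullback B.map H) + boundaryIntegral B.orientation (pullback B.map Ω)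

end Transverse

/-! ## Riemannian metrics, geodesics and weak extendibility to the oriented blow-up -/

section Riemannian

variable {n : ℕ} {M : Type*} [TopologicalSpace M] [ChartedSpace (Eu n) M]
  [IsManifold (𝓡 n) ∞ M]

variable (n M) in
/-- Smooth Riemannian metrics on `M`. -/
abbrev SmoothMetric : Type _ :=
  Bundle.ContMDiffRiemannianMetric (𝓡 n) ∞ (Eu n) (fun x : M => TangentSpace (𝓡 n) x)

/-- The coordinate expression of a metric in the chart at `x₀`. -/
def localMetric (g : SmoothMetric n M) (x₀ : M) (y : Eu n) (a b : Eu n) : ℝ :=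
  g.inner ((extChartAt (𝓡 n) x₀).symm y)
    (chartSymmDeriv (𝓡 n) x₀ y a) (chartSymmDeriv (𝓡 n) x₀ y b)

/-- `γ` is a geodesic of `g` on the open set `s` of times: in every chart, it satisfies the geodesic
equation, written as the Euler-Lagrange equation of the energy,
`d/dt (∑ⱼ g_{ij}(γ) γ̇ʲ) = ½ ∑_{j l} ∂ᵢ g_{jl}(γ) γ̇ʲ γ̇ˡ` for all `i`. -/
def IsGeodesicOn (g : SmoothMetric n M) (γ : ℝ → M) (s : Set ℝ) : Prop :=
  ContMDiffOn 𝓘(ℝ, ℝ) (𝓡 n) 2 γ s ∧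
  ∀ t ∈ s, ∀ x₀ : M, γ t ∈ (chartAt (Eu n) x₀).source → ∀ a : Eu n,
    deriv (fun τ => localMetric g x₀ (extChartAt (𝓡 n) x₀ (γ τ))
        (deriv (fun τ' => extChartAt (𝓡 n) x₀ (γ τ')) τ) a) t =
      (1 / 2) * fderiv ℝ (fun y => localMetric g x₀ y
          (deriv (fun τ' => extChartAt (𝓡 n) x₀ (γ τ')) t)
          (deriv (fun τ' => extChartAt (𝓡 n) x₀ (γ τ')) t))
        (extChartAt (𝓡 n) x₀ (γ t)) a

end Riemannian

section Extendible

variable {k m : ℕ} {M : Type*} [TopologicalSpace M] [ChartedSpace (Eu (m + 1 + k)) M]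
  [IsManifold (𝓡 (m + 1 + k)) ∞ M]
  {N : Type*} [TopologicalSpace N] [ChartedSpace (Eu k) N]

/-- `v` is normal to the submanifold `ι(N)` at `ι(q)`. -/
def IsNormalVector (g : SmoothMetric (m + 1 + k) M) (ι : N → M) (q : N)
    (v : TangentSpace (𝓡 (m + 1 + k)) (ι q)) : Prop :=
  ∀ u : TangentSpace (𝓡 k) q, g.inner (ι q) v (mfderiv (𝓡 k) (𝓡 (m + 1 + k)) ι q u) = 0

/-- A smooth orthonormal frame `e₀, …, eₘ` of the normal bundle of `ι(N)` over an open set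
`U ⊆ N`. -/
structure NormalFrame (g : SmoothMetric (m + 1 + k) M) (ι : N → M) where
  /-- the domain -/
  U : Set N
  isOpen : IsOpen U
  /-- the vector fields -/
  e : Fin (m + 1) → ∀ q : N, TangentSpace (𝓡 (m + 1 + k)) (ι q)
  smooth : ∀ i, ContMDiffOn (𝓡 k) (𝓡 (m + 1 + k)).tangent ∞
    (fun q => (⟨ι q, e i q⟩ : TangentBundle (𝓡 (m + 1 + k)) M)) U
  normal : ∀ i, ∀ q ∈ U, IsNormalVector g ι q (e i q)
  orthonormal : ∀ i j, ∀ q ∈ U, g.inner (ι q) (e i q) (e j q) = if i = j then 1 else 0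

/-- The normal vector with coordinates `w` in the frame. -/
def NormalFrame.vec {g : SmoothMetric (m + 1 + k) M} {ι : N → M} (F : NormalFrame g ι)
    (q : N) (w : Eu (m + 1)) : TangentSpace (𝓡 (m + 1 + k)) (ι q) :=
  ∑ i, w i • F.e i q

/-- The normal exponential map of `L = ι(N)`, together with a tubular neighbourhood: for normal
vectors `v` at `q` of length less than `radius q`, `exp q v` is the end point at time `1` of the
geodesic with initial velocity `v`, and these vectors are mapped diffeomorphically to an open subset
of `M` (the normal bundle being parametrized by orthonormal frames). The radius is a continuous
function, since `L` need not be compact. -/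
structure NormalTube (g : SmoothMetric (m + 1 + k) M) (ι : N → M) where
  /-- the radius of the tube -/
  radius : N → ℝ
  radius_continuous : Continuous radius
  radius_pos : ∀ q, 0 < radius q
  /-- the normal exponential map -/
  exp : ∀ q : N, TangentSpace (𝓡 (m + 1 + k)) (ι q) → M
  exp_zero : ∀ q, exp q 0 = ι q
  geodesic : ∀ q v, IsNormalVector g ι q v → g.inner (ι q) v v = 1 →
    IsGeodesicOn g (fun t : ℝ => exp q (t • v)) (Ioo (-radius q) (radius q))
  velocity : ∀ q v, IsNormalVector g ι q v → g.inner (ι q) v v = 1 →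
    HasDerivAt (fun t : ℝ => extChartAt (𝓡 (m + 1 + k)) (ι q) (exp q (t • v)))
      (mfderiv (𝓡 (m + 1 + k)) 𝓘(ℝ, Eu (m + 1 + k)) (extChartAt (𝓡 (m + 1 + k)) (ι q)) (ι q) v :
        Eu (m + 1 + k)) 0
  injOn : InjOn (fun z : Σ q : N, TangentSpace (𝓡 (m + 1 + k)) (ι q) => exp z.1 z.2)
    {z | IsNormalVector g ι z.1 z.2 ∧ g.inner (ι z.1) z.2 z.2 < radius z.1 ^ 2}
  smooth : ∀ F : NormalFrame g ι,
    ContMDiffOn ((𝓡 k).prod 𝓘(ℝ, Eu (m + 1))) (𝓡 (m + 1 + k)) ∞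
      (fun z : N × Eu (m + 1) => exp z.1 (F.vec z.1 z.2))
      {z | z.1 ∈ F.U ∧ ‖z.2‖ < radius z.1}
  localDiffeo : ∀ F : NormalFrame g ι, ∀ z : N × Eu (m + 1), z.1 ∈ F.U → ‖z.2‖ < radius z.1 →
    Function.Bijective (mfderiv ((𝓡 k).prod 𝓘(ℝ, Eu (m + 1))) (𝓡 (m + 1 + k))
      (fun z : N × Eu (m + 1) => exp z.1 (F.vec z.1 z.2)) z)

/-- The collar map `(t, q, u) ↦ exp_q (t u)` of the oriented blow-up at time `t`, in coordinates: `q`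
is read in the chart of `N` at `q₀`, and the unit normal vector `u` has the coordinates `w / ‖w‖` in
the frame. -/
def collarMap {g : SmoothMetric (m + 1 + k) M} {ι : N → M} (τ : NormalTube g ι)
    (F : NormalFrame g ι) (q₀ : N) (t : ℝ) (z : Eu k × Eu (m + 1)) : M :=
  τ.exp ((extChartAt (𝓡 k) q₀).symm z.1)
    (t • F.vec ((extChartAt (𝓡 k) q₀).symm z.1) (‖z.2‖⁻¹ • z.2))

/-- The restriction of the pull-back of `Ω` by the collar map to the slice at time `t` (its part
without `dt`, that is, of bidegree `(0, p)`), in the coordinates `(x, w)`. Here a form on the unit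
sphere bundle is recorded by its pull-back by the retraction `w ↦ w / ‖w‖`. -/
def collarForm {g : SmoothMetric (m + 1 + k) M} {ι : N → M} (τ : NormalTube g ι)
    (F : NormalFrame g ι) (q₀ : N) {p : ℕ} (Ω : DiffForm (𝓡 (m + 1 + k)) M p) (t : ℝ)
    (z : Eu k × Eu (m + 1)) : (Eu k × Eu (m + 1)) [⋀^Fin p]→L[ℝ] ℝ :=
  (Ω (collarMap τ F q₀ t z)).compContinuousLinearMap
    (mfderiv 𝓘(ℝ, Eu k × Eu (m + 1)) (𝓡 (m + 1 + k)) (collarMap τ F q₀ t) z)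

/-- `Ω` is weakly extendible to the oriented blow-up of `L = ι(N)`: for some Riemannian metric, the
part of bidegree `(0, p)` of its pull-back to the collar `[0, radius) × S₁(νL)` extends continuously
to `t = 0`. -/
def IsWeaklyExtendible (ι : N → M) {p : ℕ} (Ω : DiffForm (𝓡 (m + 1 + k)) M p) : Prop :=
  ∃ (g : SmoothMetric (m + 1 + k) M) (τ : NormalTube g ι),
    ∀ (F : NormalFrame g ι) (q₀ : N),
      ∃ Φ : ℝ × (Eu k × Eu (m + 1)) → (Eu k × Eu (m + 1)) [⋀^Fin p]→L[ℝ] ℝ,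
        ContinuousOn Φ {s | s.2.1 ∈ (extChartAt (𝓡 k) q₀).target ∧
          (extChartAt (𝓡 k) q₀).symm s.2.1 ∈ F.U ∧ s.2.2 ≠ 0 ∧
          0 ≤ s.1 ∧ s.1 < τ.radius ((extChartAt (𝓡 k) q₀).symm s.2.1)} ∧
        ∀ (t : ℝ) (z : Eu k × Eu (m + 1)), z.1 ∈ (extChartAt (𝓡 k) q₀).target →
          (extChartAt (𝓡 k) q₀).symm z.1 ∈ F.U → z.2 ≠ 0 →
          0 < t → t < τ.radius ((extChartAt (𝓡 k) q₀).symm z.1) →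
          Φ (t, z) = collarForm τ F q₀ Ω t z

end Extendible

/-- The equation `dΩ = fL - H` in the sense of currents. -/
def CurrentEquation {k m : ℕ}
    {M : Type*} [TopologicalSpace M] [ChartedSpace (Eu (m + 1 + k)) M]
    [IsManifold (𝓡 (m + 1 + k)) ∞ M] [T2Space M] [SigmaCompactSpace M]
    (oM : ManifoldOrientation (𝓡 (m + 1 + k)) M)
    {N : Type*} [TopologicalSpace N] [ChartedSpace (Eu k) N]
    [IsManifold (𝓡 k) ∞ N] [T2Space N] [SigmaCompactSpace N]
    (oN : ManifoldOrientation (𝓡 k) N) (ι : N → M) (f : N → ℝ)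
    (Ω : DiffForm (𝓡 (m + 1 + k)) M m) (H : DiffForm (𝓡 (m + 1 + k)) M (m + 1)) : Prop :=
  EqAsCurrents (currentD (currentOfForm oM (by omega : m + (k + 1) = m + 1 + k) Ω))
    (weightedCurrent oN ι f - currentOfForm oM rfl H)

end BlowUpCurrents

end

open BlowUpCurrents

noncomputable section

namespace BlowUpCurrents


/-! ## Algebra of alternating forms -/

section Algebra

open ContinuousAlternatingMap (alternatizeUncurryFin alternatizeUncurryFin_apply
  alternatizeUncurryFin_add alternatizeUncurryFin_smul alternatizeUncurryFinCLM
  alternatizeUncurryFin_alternatizeUncurryFinCLM_comp_of_symmetric compContinuousLinearMap_apply)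

variable {E : Type*} [NormedAddCommGroup E] [NormedSpace ℝ E]
  {E' : Type*} [NormedAddCommGroup E'] [NormedSpace ℝ E']

/-- The equivalence between the slots of a wedge product and the slots of its factors. -/
def slotEquiv {p q r : ℕ} (h : p + q = r) : Fin p ⊕ Fin q ≃ Fin r :=
  finSumFinEquiv.trans (finCongr h)

/-- The determinant form `v ↦ det (l i (v j))`, that is, the wedge product of the `l i`. -/
def detForm {p : ℕ} (l : Fin p → E →L[ℝ] ℝ) : E [⋀^Fin p]→L[ℝ] ℝ :=
  { (Matrix.detRowAlternating (R := ℝ) (n := Fin p)).compLinearMap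
      (LinearMap.pi fun i => (l i : E →ₗ[ℝ] ℝ)) with
    cont := by
      change Continuous fun v : Fin p → E => Matrix.det (fun j i => l i (v j))
      refine Continuous.matrix_det ?_
      refine continuous_pi fun j => continuous_pi fun i => ?_
      exact (l i).continuous.comp (continuous_apply j) }

theorem detForm_apply {p : ℕ} (l : Fin p → E →L[ℝ] ℝ) (v : Fin p → E) :
    detForm l v = Matrix.det (Matrix.of fun j i => l i (v j)) := rfl

theorem detForm_toAlternatingMap {p : ℕ} (l : Fin p → E →L[ℝ] ℝ) :
    (detForm l).toAlternatingMap = MultilinearMap.alternatization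
      ((MultilinearMap.mkPiAlgebra ℝ (Fin p) ℝ).compLinearMap fun i => (l i : E →ₗ[ℝ] ℝ)) := by
  ext v
  change detForm l v = _
  rw [detForm_apply, Matrix.det_apply, MultilinearMap.alternatization_apply]
  rfl

theorem detForm_compContinuousLinearMap {p : ℕ} (l : Fin p → E →L[ℝ] ℝ) (A : E' →L[ℝ] E) :
    (detForm l).compContinuousLinearMap A = detForm fun i => (l i).comp A := rfl

theorem wedge_apply_eq {p q r : ℕ} (h : p + q = r) (α : E [⋀^Fin p]→L[ℝ] ℝ)
    (β : E [⋀^Fin q]→L[ℝ] ℝ) (v : Fin r → E) :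
    wedge h α β v = LinearMap.mul' ℝ ℝ (AlternatingMap.domCoprod' (α.toAlternatingMap ⊗ₜ[ℝ]
      β.toAlternatingMap) fun i => v (slotEquiv h i)) := rfl

theorem wedge_add_left {p q r : ℕ} (h : p + q = r) (α α' : E [⋀^Fin p]→L[ℝ] ℝ)
    (β : E [⋀^Fin q]→L[ℝ] ℝ) : wedge h (α + α') β = wedge h α β + wedge h α' β := by
  ext v
  have : (α + α').toAlternatingMap = α.toAlternatingMap + α'.toAlternatingMap := rfl
  rw [ContinuousAlternatingMap.add_apply, wedge_apply_eq, wedge_apply_eq, wedge_apply_eq, this,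
    TensorProduct.add_tmul, map_add, AlternatingMap.add_apply, map_add]

theorem wedge_add_right {p q r : ℕ} (h : p + q = r) (α : E [⋀^Fin p]→L[ℝ] ℝ)
    (β β' : E [⋀^Fin q]→L[ℝ] ℝ) : wedge h α (β + β') = wedge h α β + wedge h α β' := by
  ext v
  have : (β + β').toAlternatingMap = β.toAlternatingMap + β'.toAlternatingMap := rfl
  rw [ContinuousAlternatingMap.add_apply, wedge_apply_eq, wedge_apply_eq, wedge_apply_eq, this,
    TensorProduct.tmul_add, map_add, AlternatingMap.add_apply, map_add]

theorem wedge_smul_left {p q r : ℕ} (h : p + q = r) (c : ℝ) (α : E [⋀^Fin p]→L[ℝ] ℝ)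
    (β : E [⋀^Fin q]→L[ℝ] ℝ) : wedge h (c • α) β = c • wedge h α β := by
  ext v
  have : (c • α).toAlternatingMap = c • α.toAlternatingMap := rfl
  rw [ContinuousAlternatingMap.smul_apply, wedge_apply_eq, wedge_apply_eq, this,
    ← TensorProduct.smul_tmul', map_smul, AlternatingMap.smul_apply, map_smul]

theorem wedge_smul_right {p q r : ℕ} (h : p + q = r) (c : ℝ) (α : E [⋀^Fin p]→L[ℝ] ℝ)
    (β : E [⋀^Fin q]→L[ℝ] ℝ) : wedge h α (c • β) = c • wedge h α β := by
  ext v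
  have : (c • β).toAlternatingMap = c • β.toAlternatingMap := rfl
  rw [ContinuousAlternatingMap.smul_apply, wedge_apply_eq, wedge_apply_eq, this,
    TensorProduct.tmul_smul, map_smul, AlternatingMap.smul_apply, map_smul]

theorem wedge_zero_left {p q r : ℕ} (h : p + q = r) (β : E [⋀^Fin q]→L[ℝ] ℝ) :
    wedge h (0 : E [⋀^Fin p]→L[ℝ] ℝ) β = 0 := by
  simpa using wedge_smul_left h 0 (0 : E [⋀^Fin p]→L[ℝ] ℝ) β

theorem wedge_zero_right {p q r : ℕ} (h : p + q = r) (α : E [⋀^Fin p]→L[ℝ] ℝ) :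
    wedge h α (0 : E [⋀^Fin q]→L[ℝ] ℝ) = 0 := by
  simpa using wedge_smul_right h 0 α (0 : E [⋀^Fin q]→L[ℝ] ℝ)

theorem wedge_neg_left {p q r : ℕ} (h : p + q = r) (α : E [⋀^Fin p]→L[ℝ] ℝ)
    (β : E [⋀^Fin q]→L[ℝ] ℝ) : wedge h (-α) β = -wedge h α β := by
  have h0 := wedge_add_left h (-α) α β
  rw [neg_add_cancel, wedge_zero_left] at h0
  exact eq_neg_of_add_eq_zero_left h0.symm

/-- The concatenation of two families of linear forms. -/
def joinForms {p q r : ℕ} (h : p + q = r) (l : Fin p → E →L[ℝ] ℝ) (m : Fin q → E →L[ℝ] ℝ) :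
    Fin r → E →L[ℝ] ℝ := fun i => Sum.elim l m ((slotEquiv h).symm i)

theorem wedge_detForm_apply {p q r : ℕ} (h : p + q = r) (l : Fin p → E →L[ℝ] ℝ)
    (m : Fin q → E →L[ℝ] ℝ) (v : Fin r → E) :
    wedge h (detForm l) (detForm m) v =
      Matrix.det (Matrix.of fun j i => Sum.elim l m i (v (slotEquiv h j))) := by
  rw [wedge_apply_eq, detForm_toAlternatingMap, detForm_toAlternatingMap,
    AlternatingMap.domCoprod'_apply, ← MultilinearMap.domCoprod_alternization,
    MultilinearMap.alternatization_apply, map_sum, Matrix.det_apply]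
  refine Finset.sum_congr rfl fun σ _ => ?_
  rw [Units.smul_def, Units.smul_def, map_zsmul]
  congr 1
  simp [MultilinearMap.domCoprod_apply]

theorem wedge_detForm {p q r : ℕ} (h : p + q = r) (l : Fin p → E →L[ℝ] ℝ)
    (m : Fin q → E →L[ℝ] ℝ) :
    wedge h (detForm l) (detForm m) = detForm (joinForms h l m) := by
  ext v
  rw [wedge_detForm_apply, detForm_apply, ← Matrix.det_submatrix_equiv_self (slotEquiv h)]
  congr 1
  ext i j
  simp [joinForms]

/-- The wedge product `l ∧ α` with a linear form. -/
def oneWedge {p : ℕ} (l : E →L[ℝ] ℝ) (α : E [⋀^Fin p]→L[ℝ] ℝ) : E [⋀^Fin (p + 1)]→L[ℝ] ℝ :=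
  alternatizeUncurryFin (l.smulRight α)

theorem oneWedge_apply {p : ℕ} (l : E →L[ℝ] ℝ) (α : E [⋀^Fin p]→L[ℝ] ℝ) (v : Fin (p + 1) → E) :
    oneWedge l α v = ∑ i : Fin (p + 1), (-1) ^ (i : ℕ) * (l (v i) * α (i.removeNth v)) := by
  simp [oneWedge, alternatizeUncurryFin_apply]

theorem oneWedge_add_right {p : ℕ} (l : E →L[ℝ] ℝ) (α β : E [⋀^Fin p]→L[ℝ] ℝ) :
    oneWedge l (α + β) = oneWedge l α + oneWedge l β := by
  ext v; simp [oneWedge_apply, mul_add, Finset.sum_add_distrib]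

theorem oneWedge_smul_right {p : ℕ} (l : E →L[ℝ] ℝ) (c : ℝ) (α : E [⋀^Fin p]→L[ℝ] ℝ) :
    oneWedge l (c • α) = c • oneWedge l α := by
  ext v
  simp only [oneWedge_apply, ContinuousAlternatingMap.smul_apply, smul_eq_mul, Finset.mul_sum]
  exact Finset.sum_congr rfl fun _ _ => by ring

theorem oneWedge_add_left {p : ℕ} (l m : E →L[ℝ] ℝ) (α : E [⋀^Fin p]→L[ℝ] ℝ) :
    oneWedge (l + m) α = oneWedge l α + oneWedge m α := by
  ext v; simp [oneWedge_apply, mul_add, add_mul, Finset.sum_add_distrib]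

theorem oneWedge_smul_left {p : ℕ} (l : E →L[ℝ] ℝ) (c : ℝ) (α : E [⋀^Fin p]→L[ℝ] ℝ) :
    oneWedge (c • l) α = c • oneWedge l α := by
  ext v
  simp only [oneWedge_apply, ContinuousAlternatingMap.smul_apply, smul_eq_mul, Finset.mul_sum,
    _root_.smul_apply]
  exact Finset.sum_congr rfl fun _ _ => by ring

theorem oneWedge_zero_left {p : ℕ} (α : E [⋀^Fin p]→L[ℝ] ℝ) :
    oneWedge (0 : E →L[ℝ] ℝ) α = 0 := by
  simpa using oneWedge_smul_left (0 : E →L[ℝ] ℝ) 0 α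

theorem oneWedge_compContinuousLinearMap {p : ℕ} (l : E →L[ℝ] ℝ) (α : E [⋀^Fin p]→L[ℝ] ℝ)
    (A : E' →L[ℝ] E) : (oneWedge l α).compContinuousLinearMap A =
      oneWedge (l.comp A) (α.compContinuousLinearMap A) := by
  ext v
  simp only [oneWedge_apply, compContinuousLinearMap_apply, Function.comp_apply]
  rfl

theorem oneWedge_detForm {p : ℕ} (l : E →L[ℝ] ℝ) (m : Fin p → E →L[ℝ] ℝ) :
    oneWedge l (detForm m) = detForm (Fin.cons l m) := by
  ext v
  rw [oneWedge_apply, detForm_apply, Matrix.det_succ_column_zero]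
  refine Finset.sum_congr rfl fun i _ => ?_
  rw [mul_assoc]
  congr 2

theorem oneWedge_anticomm {p : ℕ} (l m : E →L[ℝ] ℝ) (α : E [⋀^Fin p]→L[ℝ] ℝ) :
    oneWedge l (oneWedge m α) = -oneWedge m (oneWedge l α) := by
  have key : ∀ x : E →L[ℝ] ℝ, oneWedge x (oneWedge x α) = 0 := by
    intro x
    have := alternatizeUncurryFin_alternatizeUncurryFinCLM_comp_of_symmetric
      (f := x.smulRight (x.smulRight α)) (by
        intro a b
        simp only [ContinuousLinearMap.smulRight_apply, _root_.smul_apply]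
        rw [smul_comm])
    rw [← this]
    unfold oneWedge
    congr 1
    ext a : 1
    simp
  have h := key (l + m)
  rw [oneWedge_add_left, oneWedge_add_left l m α, oneWedge_add_right, oneWedge_add_right, key,
    key, zero_add, add_zero] at h
  exact eq_neg_of_add_eq_zero_left h

section FiniteDim

variable [FiniteDimensional ℝ E] [FiniteDimensional ℝ E']

theorem form_eq_sum_detForm {p : ℕ} (α : E [⋀^Fin p]→L[ℝ] ℝ) :
    α = ∑ I : Fin p → Fin (Module.finrank ℝ E),
      ((p.factorial : ℝ)⁻¹ * α fun i => Module.finBasis ℝ E (I i)) •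
        detForm fun i => LinearMap.toContinuousLinearMap ((Module.finBasis ℝ E).coord (I i)) := by
  set b := Module.finBasis ℝ E
  have hM : (α.toAlternatingMap : MultilinearMap ℝ (fun _ : Fin p => E) ℝ) =
      ∑ I : Fin p → Fin (Module.finrank ℝ E), (α fun i => b (I i)) •
        ((MultilinearMap.mkPiAlgebra ℝ (Fin p) ℝ).compLinearMap fun i => b.coord (I i)) := by
    refine Module.Basis.ext_multilinear (fun _ => b) fun J => ?_
    simp only [_root_.sum_apply, _root_.smul_apply,
      MultilinearMap.compLinearMap_apply, MultilinearMap.mkPiAlgebra_apply]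
    rw [Finset.sum_eq_single J]
    · simp
    · intro I _ hI
      obtain ⟨i, hi⟩ := Function.ne_iff.mp hI
      rw [Finset.prod_eq_zero (Finset.mem_univ i), smul_zero]
      simp [Ne.symm hi]
    · simp
  have h2 := congrArg MultilinearMap.alternatization hM
  rw [AlternatingMap.coe_alternatization, map_sum] at h2
  ext v
  have h3 := congrArg (fun f : E [⋀^Fin p]→ₗ[ℝ] ℝ => f v) h2
  have hp : (p.factorial : ℝ) ≠ 0 := by positivity
  simp only [Fintype.card_fin, AlternatingMap.smul_apply, nsmul_eq_mul] at h3
  have h4 : α v = (p.factorial : ℝ)⁻¹ * ((p.factorial : ℝ) * α.toAlternatingMap v) := by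
    rw [← mul_assoc, inv_mul_cancel₀ hp, one_mul]; rfl
  have hsum : ∀ (F : (Fin p → Fin (Module.finrank ℝ E)) → E [⋀^Fin p]→ₗ[ℝ] ℝ),
      (∑ I, F I) v = ∑ I, F I v := fun F =>
    map_sum (⟨⟨fun f : E [⋀^Fin p]→ₗ[ℝ] ℝ => f v, rfl⟩, fun _ _ => rfl⟩ :
      (E [⋀^Fin p]→ₗ[ℝ] ℝ) →+ ℝ) _ _
  rw [h4, h3, ContinuousAlternatingMap.sum_apply, hsum, Finset.mul_sum]
  refine Finset.sum_congr rfl fun I _ => ?_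
  have h5 : (detForm fun i => LinearMap.toContinuousLinearMap (b.coord (I i))) v =
      (detForm fun i => LinearMap.toContinuousLinearMap (b.coord (I i))).toAlternatingMap v := rfl
  rw [ContinuousAlternatingMap.smul_apply, h5, detForm_toAlternatingMap,
    MultilinearMap.alternatization_apply, MultilinearMap.alternatization_apply, smul_eq_mul,
    mul_assoc, Finset.mul_sum, Finset.mul_sum, Finset.mul_sum]
  refine Finset.sum_congr rfl fun σ _ => ?_
  simp only [MultilinearMap.domDomCongr_apply, _root_.smul_apply, Units.smul_def, zsmul_eq_mul,
    smul_eq_mul, MultilinearMap.compLinearMap_apply, MultilinearMap.mkPiAlgebra_apply]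
  rw [mul_left_comm _ (α _)]
  rfl

theorem form_induction {p : ℕ} {motive : E [⋀^Fin p]→L[ℝ] ℝ → Prop}
    (det : ∀ l, motive (detForm l)) (add : ∀ α β, motive α → motive β → motive (α + β))
    (smul : ∀ (c : ℝ) α, motive α → motive (c • α)) (α : E [⋀^Fin p]→L[ℝ] ℝ) : motive α := by
  have h0 : motive 0 := by simpa using smul 0 _ (det fun _ => 0)
  rw [form_eq_sum_detForm α]
  exact Finset.sum_induction _ motive add h0 fun I _ => smul _ _ (det _)

open scoped Classical in
instance {p : ℕ} : FiniteDimensional ℝ (E [⋀^Fin p]→L[ℝ] ℝ) := by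
  refine ⟨⟨Finset.univ.image fun I : Fin p → Fin (Module.finrank ℝ E) =>
    detForm fun i => LinearMap.toContinuousLinearMap ((Module.finBasis ℝ E).coord (I i)), ?_⟩⟩
  rw [eq_top_iff]
  intro α _
  rw [form_eq_sum_detForm α]
  refine Submodule.sum_mem _ fun I _ => Submodule.smul_mem _ _ (Submodule.subset_span ?_)
  simp

theorem wedge_compContinuousLinearMap {p q r : ℕ} (h : p + q = r) (α : E [⋀^Fin p]→L[ℝ] ℝ)
    (β : E [⋀^Fin q]→L[ℝ] ℝ) (A : E' →L[ℝ] E) :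
    (wedge h α β).compContinuousLinearMap A =
      wedge h (α.compContinuousLinearMap A) (β.compContinuousLinearMap A) := by
  induction α using form_induction with
  | add α α' h1 h2 =>
    have : (α + α').compContinuousLinearMap A = α.compContinuousLinearMap A +
      α'.compContinuousLinearMap A := rfl
    rw [this, wedge_add_left, wedge_add_left, ← h1, ← h2]
    rfl
  | smul c α h1 =>
    have : (c • α).compContinuousLinearMap A = c • α.compContinuousLinearMap A := rfl
    rw [this, wedge_smul_left, wedge_smul_left, ← h1]
    rfl
  | det l =>
    induction β using form_induction with
    | add α α' h1 h2 =>
      have : (α + α').compContinuousLinearMap A = α.compContinuousLinearMap A +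
        α'.compContinuousLinearMap A := rfl
      rw [this, wedge_add_right, wedge_add_right, ← h1, ← h2]
      rfl
    | smul c α h1 =>
      have : (c • α).compContinuousLinearMap A = c • α.compContinuousLinearMap A := rfl
      rw [this, wedge_smul_right, wedge_smul_right, ← h1]
      rfl
    | det m =>
      ext v
      rw [detForm_compContinuousLinearMap, detForm_compContinuousLinearMap,
        compContinuousLinearMap_apply, wedge_detForm_apply, wedge_detForm_apply]
      congr 1
      ext i j
      rcases j with j | j <;> rfl

theorem wedge_apply_of_ker {p q r : ℕ} (h : p + q = r) (α : E [⋀^Fin p]→L[ℝ] ℝ)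
    (β : E' [⋀^Fin q]→L[ℝ] ℝ) (B : E →L[ℝ] E') (v : Fin r → E)
    (hv : ∀ i, B (v (slotEquiv h (Sum.inl i))) = 0) :
    wedge h α (β.compContinuousLinearMap B) v =
      (α fun i => v (slotEquiv h (Sum.inl i))) * β fun j => B (v (slotEquiv h (Sum.inr j))) := by
  induction α using form_induction with
  | add α α' h1 h2 => rw [wedge_add_left, ContinuousAlternatingMap.add_apply, ContinuousAlternatingMap.add_apply, h1, h2, add_mul]
  | smul c α h1 => rw [wedge_smul_left, ContinuousAlternatingMap.smul_apply, ContinuousAlternatingMap.smul_apply, h1, smul_eq_mul, smul_eq_mul,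
      mul_assoc]
  | det l =>
    induction β using form_induction with
    | add β β' h1 h2 =>
      have : (β + β').compContinuousLinearMap B = β.compContinuousLinearMap B +
        β'.compContinuousLinearMap B := rfl
      rw [this, wedge_add_right, ContinuousAlternatingMap.add_apply, ContinuousAlternatingMap.add_apply, h1, h2, mul_add]
    | smul c β h1 =>
      have : (c • β).compContinuousLinearMap B = c • β.compContinuousLinearMap B := rfl
      rw [this, wedge_smul_right, ContinuousAlternatingMap.smul_apply, ContinuousAlternatingMap.smul_apply, h1, smul_eq_mul, smul_eq_mul,
        mul_left_comm]
    | det m =>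
      rw [detForm_compContinuousLinearMap, wedge_detForm_apply, detForm_apply, detForm_apply,
        ← Matrix.det_fromBlocks_zero₁₂ _
          (Matrix.of fun (j : Fin q) (i : Fin p) => l i (v (slotEquiv h (Sum.inr j))))]
      congr 1
      ext i j
      rcases i with i | i <;> rcases j with j | j <;> simp [hv]

theorem oneWedge_wedge {p q r : ℕ} (h : p + q = r) (h' : p + 1 + q = r + 1) (l : E →L[ℝ] ℝ)
    (α : E [⋀^Fin p]→L[ℝ] ℝ) (β : E [⋀^Fin q]→L[ℝ] ℝ) :
    oneWedge l (wedge h α β) = wedge h' (oneWedge l α) β := by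
  induction α using form_induction with
  | add α α' h1 h2 => rw [wedge_add_left, oneWedge_add_right, oneWedge_add_right,
      wedge_add_left, h1, h2]
  | smul c α h1 => rw [wedge_smul_left, oneWedge_smul_right, oneWedge_smul_right,
      wedge_smul_left, h1]
  | det m =>
    induction β using form_induction with
    | add β β' h1 h2 => rw [wedge_add_right, oneWedge_add_right, wedge_add_right, h1, h2]
    | smul c β h1 => rw [wedge_smul_right, oneWedge_smul_right, wedge_smul_right, h1]
    | det m' =>
      rw [wedge_detForm, oneWedge_detForm, oneWedge_detForm, wedge_detForm]
      congr 1
      funext i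
      obtain ⟨s, rfl⟩ := (slotEquiv h').surjective i
      rcases s with s | s
      · refine Fin.cases ?_ (fun s => ?_) s
        · have : slotEquiv h' (Sum.inl 0) = 0 := by ext; simp [slotEquiv]
          rw [this, Fin.cons_zero, ← this]
          simp [joinForms]
        · have : slotEquiv h' (Sum.inl s.succ) = (slotEquiv h (Sum.inl s)).succ := by
            ext; simp [slotEquiv]
          rw [this, Fin.cons_succ, ← this]
          simp [joinForms]
      · have : slotEquiv h' (Sum.inr s) = (slotEquiv h (Sum.inr s)).succ := by
          ext; simp [slotEquiv]; omega
        rw [this, Fin.cons_succ, ← this]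
        simp [joinForms]

theorem wedge_oneWedge {p q r : ℕ} (h : p + q = r) (h' : p + (q + 1) = r + 1) (l : E →L[ℝ] ℝ)
    (α : E [⋀^Fin p]→L[ℝ] ℝ) (β : E [⋀^Fin q]→L[ℝ] ℝ) :
    wedge h' α (oneWedge l β) = (-1 : ℝ) ^ p • oneWedge l (wedge h α β) := by
  induction α using form_induction with
  | add α α' h1 h2 => rw [wedge_add_left, wedge_add_left, oneWedge_add_right, h1, h2, smul_add]
  | smul c α h1 => rw [wedge_smul_left, wedge_smul_left, oneWedge_smul_right, h1, smul_comm]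
  | det m =>
    induction p generalizing r with
    | zero =>
      induction β using form_induction with
      | add β β' h1 h2 => rw [wedge_add_right, oneWedge_add_right, oneWedge_add_right,
          wedge_add_right, h1, h2, smul_add]
      | smul c β h1 => rw [wedge_smul_right, oneWedge_smul_right, oneWedge_smul_right,
          wedge_smul_right, h1, smul_comm]
      | det m' =>
        rw [wedge_detForm, oneWedge_detForm, oneWedge_detForm, wedge_detForm, pow_zero, one_smul]
        congr 1
        funext i
        obtain ⟨s, rfl⟩ := (slotEquiv h').surjective i
        rcases s with s | s
        · exact s.elim0
        · refine Fin.cases ?_ (fun s => ?_) s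
          · have : slotEquiv h' (Sum.inr 0) = 0 := by ext; simp [slotEquiv]
            rw [this, Fin.cons_zero, ← this]
            simp [joinForms]
          · have : slotEquiv h' (Sum.inr s.succ) = (slotEquiv h (Sum.inr s)).succ := by
              ext; simp [slotEquiv]
            rw [this, Fin.cons_succ, ← this]
            simp [joinForms]
    | succ p ih =>
      obtain ⟨r, rfl⟩ : ∃ r', r = r' + 1 := ⟨p + q, by omega⟩
      have hm : detForm m = oneWedge (m 0) (detForm fun i => m i.succ) := by
        rw [oneWedge_detForm]
        congr 1
        exact (Fin.cons_self_tail m).symm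
      rw [hm, ← oneWedge_wedge (by omega : p + (q + 1) = r + 1),
        ih (by omega : p + q = r), oneWedge_smul_right, oneWedge_anticomm,
        oneWedge_wedge (by omega : p + q = r) h, pow_succ]
      ext v
      simp

theorem alternatizeUncurryFin_eq_sum_oneWedge {p : ℕ} (A : E →L[ℝ] E [⋀^Fin p]→L[ℝ] ℝ) :
    alternatizeUncurryFin A = ∑ i, oneWedge
      (LinearMap.toContinuousLinearMap ((Module.finBasis ℝ E).coord i))
      (A (Module.finBasis ℝ E i)) := by
  have hA : A = ∑ i, (LinearMap.toContinuousLinearMap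
      ((Module.finBasis ℝ E).coord i)).smulRight (A (Module.finBasis ℝ E i)) := by
    ext1 x
    conv_lhs => rw [← (Module.finBasis ℝ E).sum_repr x]
    simp only [map_sum, map_smul, _root_.sum_apply, ContinuousLinearMap.smulRight_apply,
      LinearMap.coe_toContinuousLinearMap', Module.Basis.coord_apply]
  conv_lhs => rw [hA]
  exact map_sum (alternatizeUncurryFinCLM ℝ E ℝ) _ _

/-- The wedge product as a continuous bilinear map. -/
def wedgeCLM {p q r : ℕ} (h : p + q = r) :
    (E [⋀^Fin p]→L[ℝ] ℝ) →L[ℝ] (E [⋀^Fin q]→L[ℝ] ℝ) →L[ℝ] (E [⋀^Fin r]→L[ℝ] ℝ) :=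
  LinearMap.toContinuousBilinearMap
    (LinearMap.mk₂ ℝ (wedge h) (wedge_add_left h) (wedge_smul_left h) (wedge_add_right h)
        (fun c α β => wedge_smul_right h c α β))

@[simp]
theorem wedgeCLM_apply {p q r : ℕ} (h : p + q = r) (α : E [⋀^Fin p]→L[ℝ] ℝ)
    (β : E [⋀^Fin q]→L[ℝ] ℝ) : wedgeCLM h α β = wedge h α β := rfl

/-- The wedge product with a linear form as a continuous bilinear map. -/
def oneWedgeCLM {p : ℕ} :
    (E →L[ℝ] ℝ) →L[ℝ] (E [⋀^Fin p]→L[ℝ] ℝ) →L[ℝ] (E [⋀^Fin (p + 1)]→L[ℝ] ℝ) :=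
  LinearMap.toContinuousBilinearMap
    (LinearMap.mk₂ ℝ oneWedge oneWedge_add_left (fun c l α => oneWedge_smul_left l c α)
        oneWedge_add_right (fun c l α => oneWedge_smul_right l c α))

theorem alternatizeUncurryFin_wedge_left {p q r : ℕ} (h : p + q = r) (h' : p + 1 + q = r + 1)
    (A : E →L[ℝ] E [⋀^Fin p]→L[ℝ] ℝ) (β : E [⋀^Fin q]→L[ℝ] ℝ) :
    alternatizeUncurryFin (((wedgeCLM h).flip β).comp A) =
      wedge h' (alternatizeUncurryFin A) β := by
  rw [alternatizeUncurryFin_eq_sum_oneWedge, alternatizeUncurryFin_eq_sum_oneWedge A,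
    ← wedgeCLM_apply h', map_sum, _root_.sum_apply]
  refine Finset.sum_congr rfl fun i _ => ?_
  simp [oneWedge_wedge h h']

theorem alternatizeUncurryFin_wedge_right {p q r : ℕ} (h : p + q = r) (h' : p + (q + 1) = r + 1)
    (α : E [⋀^Fin p]→L[ℝ] ℝ) (B : E →L[ℝ] E [⋀^Fin q]→L[ℝ] ℝ) :
    alternatizeUncurryFin ((wedgeCLM h α).comp B) =
      (-1 : ℝ) ^ p • wedge h' α (alternatizeUncurryFin B) := by
  rw [alternatizeUncurryFin_eq_sum_oneWedge, alternatizeUncurryFin_eq_sum_oneWedge B,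
    ← wedgeCLM_apply h', map_sum, Finset.smul_sum]
  refine Finset.sum_congr rfl fun i _ => ?_
  simp only [ContinuousLinearMap.comp_apply, wedgeCLM_apply, wedge_oneWedge h h', smul_smul,
    ← mul_pow]
  simp

/-- The Leibniz rule. -/
theorem extDeriv_wedge {p q r : ℕ} (h : p + q = r) (h₁ : p + 1 + q = r + 1)
    (h₂ : p + (q + 1) = r + 1) {α : E → E [⋀^Fin p]→L[ℝ] ℝ} {β : E → E [⋀^Fin q]→L[ℝ] ℝ} {x : E}
    (hα : DifferentiableAt ℝ α x) (hβ : DifferentiableAt ℝ β x) :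
    extDeriv (fun y => wedge h (α y) (β y)) x =
      wedge h₁ (extDeriv α x) (β x) + (-1 : ℝ) ^ p • wedge h₂ (α x) (extDeriv β x) := by
  have hd := (wedgeCLM h).hasFDerivAt_of_bilinear hα.hasFDerivAt hβ.hasFDerivAt
  have hd' := hd.fderiv
  simp only [wedgeCLM_apply] at hd'
  rw [extDeriv, hd', alternatizeUncurryFin_add, extDeriv, extDeriv,
    ← alternatizeUncurryFin_wedge_left h h₁, ← alternatizeUncurryFin_wedge_right h h₂]
  exact add_comm _ _

theorem extDerivWithin_fun_smul_form {p : ℕ} {h : E → ℝ} {α : E → E [⋀^Fin p]→L[ℝ] ℝ} {x : E}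
    {s : Set E} (hs : UniqueDiffWithinAt ℝ s x) (hh : DifferentiableWithinAt ℝ h s x)
    (hα : DifferentiableWithinAt ℝ α s x) :
    extDerivWithin (fun y => h y • α y) s x =
      oneWedge (fderivWithin ℝ h s x) (α x) + h x • extDerivWithin α s x := by
  rw [extDerivWithin, fderivWithin_fun_smul hs hh hα, alternatizeUncurryFin_add,
    alternatizeUncurryFin_smul]
  exact add_comm _ _

theorem extDeriv_fun_smul_form {p : ℕ} {h : E → ℝ} {α : E → E [⋀^Fin p]→L[ℝ] ℝ} {x : E}
    (hh : DifferentiableAt ℝ h x) (hα : DifferentiableAt ℝ α x) :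
    extDeriv (fun y => h y • α y) x = oneWedge (fderiv ℝ h x) (α x) + h x • extDeriv α x := by
  simpa [extDerivWithin_univ] using extDerivWithin_fun_smul_form (s := univ) uniqueDiffWithinAt_univ
    hh.differentiableWithinAt hα.differentiableWithinAt

/-- The wedge pairing is nondegenerate. -/
theorem eq_zero_of_wedge_eq_zero {p q r : ℕ} (h : p + q = r) (b : Module.Basis (Fin r) ℝ E)
    {α : E [⋀^Fin p]→L[ℝ] ℝ} (hα : ∀ β : E [⋀^Fin q]→L[ℝ] ℝ, wedge h α β b = 0) : α = 0 := by
  apply ContinuousAlternatingMap.toAlternatingMap_injective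
  refine Module.Basis.ext_alternating b fun I hI => ?_
  let e := slotEquiv h
  obtain ⟨σ, hσ⟩ : ∃ σ : Equiv.Perm (Fin r), ∀ i, σ (e (Sum.inl i)) = I i := by
    have hinj : Function.Injective fun i : Fin p => e (Sum.inl i) :=
      e.injective.comp Sum.inl_injective
    let τ := (Equiv.ofInjective _ hinj).symm.trans (Equiv.ofInjective I hI)
    refine ⟨τ.extendSubtype, fun i => ?_⟩
    rw [Equiv.extendSubtype_apply_of_mem _ _ ⟨i, rfl⟩]
    simp only [τ, Equiv.trans_apply]
    have : (Equiv.ofInjective _ hinj).symm ⟨e (Sum.inl i), ⟨i, rfl⟩⟩ = i := by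
      rw [Equiv.symm_apply_eq]; rfl
    erw [this]
    rfl
  let l : Fin q → E →L[ℝ] ℝ := fun j =>
    LinearMap.toContinuousLinearMap (b.coord (σ (e (Sum.inr j))))
  let B : E →L[ℝ] (Fin q → ℝ) := ContinuousLinearMap.pi l
  let β : (Fin q → ℝ) [⋀^Fin q]→L[ℝ] ℝ := detForm fun j => ContinuousLinearMap.proj j
  have h1 := wedge_apply_of_ker h α β B (fun i => b (σ i)) (by
    intro i
    ext j
    simp only [B, l, ContinuousLinearMap.pi_apply, LinearMap.coe_toContinuousLinearMap',
      Module.Basis.coord_apply, Module.Basis.repr_self, Pi.zero_apply]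
    rw [Finsupp.single_apply, if_neg]
    intro hc
    have := e.injective (σ.injective hc)
    simp at this)
  have h2 : (β fun j => B (b (σ (slotEquiv h (Sum.inr j))))) = 1 := by
    rw [detForm_apply]
    convert Matrix.det_one (R := ℝ) (n := Fin q)
    ext i j
    simp only [Matrix.of_apply, B, l, ContinuousLinearMap.pi_apply, ContinuousLinearMap.proj_apply,
      LinearMap.coe_toContinuousLinearMap', Module.Basis.coord_apply, Module.Basis.repr_self,
      Matrix.one_apply, Finsupp.single_apply]
    congr 1
    refine propext ⟨fun hc => ?_, fun hc => by rw [hc]⟩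
    simpa using e.injective (σ.injective hc)
  have h3 : wedge h α (β.compContinuousLinearMap B) (fun i => b (σ i)) = 0 := by
    have := (wedge h α (β.compContinuousLinearMap B)).toAlternatingMap.map_perm b σ
    have h0 : (wedge h α (β.compContinuousLinearMap B)).toAlternatingMap b = 0 := hα _
    rw [h0, smul_zero] at this
    exact this
  rw [h1, h2, mul_one] at h3
  change α (fun i => b (I i)) = 0
  rw [← h3]
  congr 1
  funext i
  exact congrArg b (hσ i).symm

theorem oneWedge_eq_zero_of_ker {p : ℕ} (l : E →L[ℝ] ℝ) (α : E [⋀^Fin p]→L[ℝ] ℝ)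
    (hα : ∀ v : Fin p → E, (∀ i, l (v i) = 0) → α v = 0) : oneWedge l α = 0 := by
  by_cases hl : l = 0
  · rw [hl, oneWedge_zero_left]
  obtain ⟨x, hx⟩ : ∃ x, l x ≠ 0 := by
    by_contra! hc
    exact hl (ContinuousLinearMap.ext hc)
  let N := LinearMap.ker (l : E →ₗ[ℝ] ℝ)
  let b := Module.finBasis ℝ N
  let c := Module.Basis.mkFinCons x b (by
    intro a y hy h0
    have := congrArg l h0
    have hy' : l y = 0 := hy
    rw [map_add, map_smul, hy', add_zero, _root_.map_zero, smul_eq_mul] at this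
    exact (mul_eq_zero.mp this).resolve_right hx) (by
    intro z
    refine ⟨-(l z / l x), ?_⟩
    change l _ = 0
    rw [map_add, map_smul, smul_eq_mul]
    field_simp
    ring)
  have hc0 : c 0 = x := by simp [c]
  have hcs : ∀ i, l (c (Fin.succ i)) = 0 := by
    intro i
    have : c (Fin.succ i) = b i := by simp [c]
    rw [this]
    exact (b i).2
  apply ContinuousAlternatingMap.toAlternatingMap_injective
  refine Module.Basis.ext_alternating c fun I hI => ?_
  change oneWedge l α (fun i => c (I i)) = 0
  rw [oneWedge_apply]
  refine Finset.sum_eq_zero fun i _ => ?_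
  rcases Fin.eq_zero_or_eq_succ (I i) with h0 | ⟨j, hj⟩
  · rw [hα, mul_zero, mul_zero]
    intro j
    have hne : I (i.succAbove j) ≠ 0 := by
      rw [← h0]
      exact fun hc => Fin.succAbove_ne i j (hI hc)
    obtain ⟨j', hj'⟩ := Fin.exists_succ_eq.mpr hne
    change l (c (I (i.succAbove j))) = 0
    rw [← hj', hcs]
  · rw [hj, hcs]; simp

theorem form_apply_comp_basis {n : ℕ} (b : Module.Basis (Fin n) ℝ E) (w : E [⋀^Fin n]→L[ℝ] ℝ)
    (A : E →L[ℝ] E) : (w fun i => A (b i)) = LinearMap.det (A : E →ₗ[ℝ] E) * w b := by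
  have h1 := AlternatingMap.eq_smul_basis_det b w.toAlternatingMap
  have h2 : ∀ v, w v = w b * b.det v := fun v => by
    have := congrArg (fun f : E [⋀^Fin n]→ₗ[ℝ] ℝ => f v) h1
    simpa using this
  rw [h2 fun i => A (b i)]
  have := b.det_comp (A : E →ₗ[ℝ] E) b
  rw [Module.Basis.det_self, mul_one] at this
  rw [← this]
  rw [mul_comm]; rfl

end FiniteDim

end Algebra


/-! ## Analysis in vector spaces -/

section Analysis

variable {E : Type*} [NormedAddCommGroup E] [NormedSpace ℝ E]
  {F : Type*} [NormedAddCommGroup F] [NormedSpace ℝ F]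

theorem contDiff_of_contDiffOn_of_eq_zero {r : ℕ∞ω} {f : E → F} {U K : Set E} (hU : IsOpen U)
    (hf : ContDiffOn ℝ r f U) (hK : IsClosed K) (hKU : K ⊆ U) (h0 : ∀ x ∉ K, f x = 0) :
    ContDiff ℝ r f := by
  rw [contDiff_iff_contDiffAt]
  intro x
  by_cases hx : x ∈ U
  · exact hf.contDiffAt (hU.mem_nhds hx)
  · have : f =ᶠ[𝓝 x] fun _ => 0 := by
      filter_upwards [hK.isOpen_compl.mem_nhds fun h => hx (hKU h)] with y hy using h0 y hy
    exact contDiffAt_const.congr_of_eventuallyEq this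

theorem fderiv_eq_zero_of_eq_zero {f : E → F} {K : Set E} (hK : IsClosed K)
    (h0 : ∀ x ∉ K, f x = 0) {x : E} (hx : x ∉ K) : fderiv ℝ f x = 0 := by
  have : f =ᶠ[𝓝 x] fun _ => 0 := by
    filter_upwards [hK.isOpen_compl.mem_nhds hx] with y hy using h0 y hy
  rw [this.fderiv_eq]
  simp

theorem extDeriv_eq_zero_of_eq_zero {p : ℕ} {w : E → E [⋀^Fin p]→L[ℝ] ℝ} {K : Set E}
    (hK : IsClosed K) (h0 : ∀ x ∉ K, w x = 0) {x : E} (hx : x ∉ K) : extDeriv w x = 0 := by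
  rw [extDeriv, fderiv_eq_zero_of_eq_zero hK h0 hx]
  ext v
  simp [ContinuousAlternatingMap.alternatizeUncurryFin_apply]

variable [MeasurableSpace E] [BorelSpace E]

theorem integrable_of_continuousOn_of_eq_zero {μ : Measure E} [IsLocallyFiniteMeasure μ]
    {f : E → F} {S K : Set E} (hS : IsClosed S) (hf : ContinuousOn f S) (hK : IsCompact K)
    (h0 : ∀ x ∈ S, x ∉ K → f x = 0) : IntegrableOn f S μ := by
  have h1 : IntegrableOn f (K ∩ S) μ :=
    (hf.mono inter_subset_right).integrableOn_compact (hK.inter_right hS)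
  refine h1.of_forall_sdiff_eq_zero hS.measurableSet fun x hx => h0 x hx.1 fun h => hx.2 ⟨h, hx.1⟩

variable [FiniteDimensional ℝ E]

theorem integral_fderiv_apply_eq_zero (μ : Measure E) [μ.IsAddHaarMeasure] {f : E → ℝ}
    (hf : ContDiff ℝ 1 f) (hc : HasCompactSupport f) (v : E) : ∫ x, fderiv ℝ f x v ∂μ = 0 := by
  have hcont : Continuous fun x => fderiv ℝ f x v :=
    (hf.continuous_fderiv one_ne_zero).clm_apply continuous_const
  have hint : Integrable (fun x => fderiv ℝ f x v) μ :=
    hcont.integrable_of_hasCompactSupport (hc.fderiv_apply ℝ v)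
  have := integral_mul_fderiv_eq_neg_fderiv_mul_of_integrable (𝕜 := ℝ) (μ := μ)
    (f := fun _ : E => (1 : ℝ)) (g := f) (v := v) (by simp) (by simpa using hint)
    (by simpa using hf.continuous.integrable_of_hasCompactSupport hc)
    (fun x _ => differentiableAt_const _)
    (fun x _ => hf.differentiable one_ne_zero x)
  simpa using this

theorem integral_extDeriv_eq_zero (μ : Measure E) [μ.IsAddHaarMeasure] {p : ℕ}
    {w : E → E [⋀^Fin p]→L[ℝ] ℝ} (hw : ContDiff ℝ 1 w) (hc : HasCompactSupport w)
    (v : Fin (p + 1) → E) : ∫ x, extDeriv w x v ∂μ = 0 := by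
  have hcd : ∀ u : Fin p → E, ContDiff ℝ 1 fun x => w x u := fun u =>
    (ContinuousAlternatingMap.apply ℝ E ℝ u).contDiff.comp hw
  have hcs : ∀ u : Fin p → E, HasCompactSupport fun x => w x u := fun u =>
    hc.comp_left (g := fun a : E [⋀^Fin p]→L[ℝ] ℝ => a u) rfl
  have h1 : ∀ x, extDeriv w x v =
      ∑ i, (-1 : ℝ) ^ i.val * fderiv ℝ (fun y => w y (i.removeNth v)) x (v i) := fun x => by
    rw [extDeriv_apply (hw.differentiable one_ne_zero x) v]
    exact Finset.sum_congr rfl fun i _ => by simp [zsmul_eq_mul]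
  simp_rw [h1]
  rw [integral_finsetSum]
  · refine Finset.sum_eq_zero fun i _ => ?_
    rw [integral_const_mul, integral_fderiv_apply_eq_zero μ (hcd _) (hcs _), mul_zero]
  · intro i _
    refine Integrable.const_mul ?_ _
    exact (((hcd _).continuous_fderiv one_ne_zero).clm_apply
      continuous_const).integrable_of_hasCompactSupport ((hcs _).fderiv_apply ℝ _)

theorem eqOn_of_integral_smul_eq (μ : Measure E) [μ.IsAddHaarMeasure] {U : Set E} (hU : IsOpen U)
    {f g : E → ℝ} (hf : ContinuousOn f U) (hg : ContinuousOn g U)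
    (h : ∀ χ : E → ℝ, ContDiff ℝ ∞ χ → HasCompactSupport χ → tsupport χ ⊆ U →
      ∫ x, χ x * f x ∂μ = ∫ x, χ x * g x ∂μ) : EqOn f g U := by
  have hd : ContinuousOn (fun x => f x - g x) U := hf.sub hg
  have hcs : ∀ {χ : E → ℝ} {a : E → ℝ}, ContDiff ℝ ∞ χ → HasCompactSupport χ → tsupport χ ⊆ U →
      ContinuousOn a U → Integrable (fun x => χ x * a x) μ := by
    intro χ a h1 h2 h3 ha
    have h4 : IntegrableOn (fun x => χ x * a x) (tsupport χ) μ :=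
      (h1.continuous.continuousOn.mul (ha.mono h3)).integrableOn_compact h2
    rw [← integrableOn_univ]
    refine h4.of_forall_sdiff_eq_zero MeasurableSet.univ fun x hx => ?_
    rw [image_eq_zero_of_notMem_tsupport hx.2, zero_mul]
  have h1 := hU.ae_eq_zero_of_integral_contDiff_smul_eq_zero (μ := μ)
    (hd.locallyIntegrableOn hU.measurableSet) (by
      intro χ h1 h2 h3
      have := h χ h1 h2 h3
      simp only [smul_eq_mul, mul_sub]
      rw [integral_sub (hcs h1 h2 h3 hf) (hcs h1 h2 h3 hg), this, sub_self])
  have h2 : (fun x => f x - g x) =ᵐ[μ.restrict U] fun _ => (0 : ℝ) := by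
    rw [Filter.EventuallyEq, ae_restrict_iff' hU.measurableSet]
    exact h1
  have h3 := Measure.eqOn_open_of_ae_eq h2 hU hd continuousOn_const
  exact fun x hx => sub_eq_zero.mp (h3 hx)

/-- The fundamental lemma of the calculus of variations for forms. -/
theorem form_eq_zero_of_integral_wedge (μ : Measure E) [μ.IsAddHaarMeasure] {p q r : ℕ}
    (h : p + q = r) (b : Module.Basis (Fin r) ℝ E) {U : Set E} (hU : IsOpen U)
    {w : E → E [⋀^Fin p]→L[ℝ] ℝ} (hw : ContinuousOn w U)
    (hint : ∀ η : E → E [⋀^Fin q]→L[ℝ] ℝ, ContDiff ℝ ∞ η → HasCompactSupport η → tsupport η ⊆ U →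
      ∫ x, wedge h (w x) (η x) b ∂μ = 0) : ∀ x ∈ U, w x = 0 := by
  intro x hx
  refine eq_zero_of_wedge_eq_zero h b fun β => ?_
  have hcont : ContinuousOn (fun y => wedge h (w y) β b) U :=
    ((ContinuousAlternatingMap.apply ℝ E ℝ b).continuous.comp
      ((wedgeCLM (E := E) h).flip β).continuous).comp_continuousOn hw
  have := eqOn_of_integral_smul_eq μ hU hcont (continuousOn_const (c := (0 : ℝ))) (by
    intro χ h1 h2 h3
    have h4 := hint (fun y => χ y • β) (h1.smul contDiff_const) (h2.smul_right (f' := fun _ => β))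
      ((tsupport_smul_subset_left χ fun _ => β).trans h3)
    simp only [mul_zero, integral_zero]
    rw [← h4]
    refine integral_congr_ae (ae_of_all _ fun y => ?_)
    simp only [wedge_smul_right]
    rfl)
  exact this hx

theorem tendsto_integral_of_continuousOn {Z : Type*} [TopologicalSpace Z] [MeasurableSpace Z]
    [OpensMeasurableSpace Z] [T2Space Z] {μ : Measure Z} [IsFiniteMeasureOnCompacts μ]
    {δ : ℝ} (hδ : 0 < δ) {K : Set Z} (hK : IsCompact K) {f : ℝ → Z → ℝ}
    (hf : ContinuousOn (fun s : ℝ × Z => f s.1 s.2) (Icc 0 δ ×ˢ K))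
    (h0 : ∀ t ∈ Icc (0 : ℝ) δ, ∀ z ∉ K, f t z = 0) :
    Tendsto (fun t => ∫ z, f t z ∂μ) (𝓝[>] 0) (𝓝 (∫ z, f 0 z ∂μ)) := by
  obtain ⟨C, hC⟩ := (isCompact_Icc.prod hK).exists_bound_of_continuousOn hf
  have hmem : ∀ᶠ t in 𝓝[>] (0 : ℝ), t ∈ Icc (0 : ℝ) δ := by
    filter_upwards [Ioo_mem_nhdsGT hδ] with t ht using ⟨ht.1.le, ht.2.le⟩
  have hset : ∀ t ∈ Icc (0 : ℝ) δ, ∫ z, f t z ∂μ = ∫ z in K, f t z ∂μ := fun t ht =>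
    (setIntegral_eq_integral_of_forall_compl_eq_zero fun z hz => h0 t ht z hz).symm
  rw [hset 0 ⟨le_rfl, hδ.le⟩]
  refine Tendsto.congr' (f₁ := fun t => ∫ z in K, f t z ∂μ) ?_ ?_
  · filter_upwards [hmem] with t ht using (hset t ht).symm
  refine tendsto_integral_filter_of_dominated_convergence (fun _ => C) ?_ ?_ ?_ ?_
  · filter_upwards [hmem] with t ht
    refine ContinuousOn.aestronglyMeasurable_of_isCompact ?_ hK hK.measurableSet
    exact hf.comp (continuous_const.prodMk continuous_id).continuousOn fun z hz => ⟨ht, hz⟩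
  · filter_upwards [hmem] with t ht
    filter_upwards [ae_restrict_mem hK.measurableSet] with z hz using hC (t, z) ⟨ht, hz⟩
  · exact integrableOn_const hK.measure_lt_top.ne
  · filter_upwards [ae_restrict_mem hK.measurableSet] with z hz
    have h1 : ContinuousOn (fun t => f t z) (Icc 0 δ) :=
      hf.comp (continuous_id.prodMk continuous_const).continuousOn fun t ht => ⟨ht, hz⟩
    have h2 := h1 0 ⟨le_rfl, hδ.le⟩
    refine h2.mono_left ?_
    rw [nhdsWithin_le_iff]
    exact hmem

open scoped Convolution in
/-- A continuous function on a ball with vanishing distributional derivative is constant. -/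
theorem eq_of_integral_mul_fderiv_eq_zero (μ : Measure E) [μ.IsAddHaarMeasure] {x₀ : E} {r : ℝ}
    {g : E → ℝ} (hg : ContinuousOn g (Metric.ball x₀ r))
    (h : ∀ χ : E → ℝ, ContDiff ℝ ∞ χ → HasCompactSupport χ → tsupport χ ⊆ Metric.ball x₀ r →
      ∀ v : E, ∫ x, g x * fderiv ℝ χ x v ∂μ = 0) :
    ∀ x ∈ Metric.ball x₀ r, g x = g x₀ := by
  intro x hx
  have hr : 0 < r := lt_of_le_of_lt dist_nonneg hx
  obtain ⟨s, hxs, hsr⟩ := exists_between (show dist x x₀ < r from hx)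
  have hs : 0 < s := lt_of_le_of_lt dist_nonneg hxs
  let B := Metric.closedBall x₀ s
  have hBr : B ⊆ Metric.ball x₀ r := Metric.closedBall_subset_ball hsr
  let G : E → ℝ := B.indicator g
  have hGi : Integrable G μ :=
    ((hg.mono hBr).integrableOn_compact (isCompact_closedBall _ _)).integrable_indicator
      measurableSet_closedBall
  let d := (s - dist x x₀) / 2
  have hd : 0 < d := by simp only [d]; linarith
  let φ : ℕ → ContDiffBump (0 : E) := fun n =>
    ⟨d / 2 / (n + 1), d / (n + 1), by positivity, by gcongr; linarith⟩
  have hφ : Tendsto (fun n => (φ n).rOut) atTop (𝓝 0) := by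
    have := tendsto_one_div_add_atTop_nhds_zero_nat (𝕜 := ℝ)
    simpa [φ, div_eq_mul_inv] using this.const_mul d
  have hrout : ∀ n, (φ n).rOut ≤ d := fun n => by
    simp only [φ]
    refine div_le_self hd.le ?_
    have : (0 : ℝ) ≤ n := Nat.cast_nonneg n
    linarith
  have hcontG : ∀ y ∈ Metric.ball x₀ s, ContinuousAt G y := by
    intro y hy
    have h1 : ContinuousAt g y := hg.continuousAt
      (Metric.isOpen_ball.mem_nhds (Metric.ball_subset_ball hsr.le hy))
    refine h1.congr ?_
    filter_upwards [Metric.isOpen_ball.mem_nhds hy] with z hz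
    exact (indicator_of_mem (Metric.ball_subset_closedBall hz) g).symm
  have hlim : ∀ y ∈ Metric.ball x₀ s, Tendsto
      (fun n => ((φ n).normed μ ⋆[ContinuousLinearMap.lsmul ℝ ℝ, μ] G) y) atTop (𝓝 (G y)) := by
    intro y hy
    refine ContDiffBump.convolution_tendsto_right hφ
      (Filter.Eventually.of_forall fun _ => hGi.aestronglyMeasurable) ?_ tendsto_const_nhds
    exact (hcontG y hy).tendsto.comp tendsto_snd
  have hball : Metric.closedBall x₀ (dist x x₀) ⊆ Metric.ball x₀ s :=
    Metric.closedBall_subset_ball hxs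
  have hxmem : x ∈ Metric.closedBall x₀ (dist x x₀) := Metric.mem_closedBall.mpr le_rfl
  have hx0mem : x₀ ∈ Metric.closedBall x₀ (dist x x₀) := Metric.mem_closedBall_self dist_nonneg
  have hconst : ∀ n, ((φ n).normed μ ⋆[ContinuousLinearMap.lsmul ℝ ℝ, μ] G) x =
      ((φ n).normed μ ⋆[ContinuousLinearMap.lsmul ℝ ℝ, μ] G) x₀ := by
    intro n
    have hcs : HasCompactSupport ((φ n).normed μ) := (φ n).hasCompactSupport_normed
    have hcd : ContDiff ℝ ∞ ((φ n).normed μ) := (φ n).contDiff_normed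
    have hder := fun y => hcs.hasFDerivAt_convolution_left (ContinuousLinearMap.lsmul ℝ ℝ)
      (hcd.of_le (by simp)) hGi.locallyIntegrable y (μ := μ)
    have hzero : ∀ y ∈ Metric.closedBall x₀ (dist x x₀),
        (fderiv ℝ ((φ n).normed μ) ⋆[(ContinuousLinearMap.lsmul ℝ ℝ).precompL E, μ] G) y = 0 := by
      intro y hy
      ext v
      have hexist : ConvolutionExists (fderiv ℝ ((φ n).normed μ)) G
          ((ContinuousLinearMap.lsmul ℝ ℝ).precompL E) μ :=
        (hcs.fderiv ℝ).convolutionExists_left _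
          (hcd.continuous_fderiv (by simp)) hGi.locallyIntegrable
      have hχ : tsupport (fun t => (φ n).normed μ (y - t)) ⊆ Metric.ball x₀ s := by
        have h1 : tsupport (fun t => (φ n).normed μ (y - t)) ⊆ Metric.closedBall y d := by
          refine closure_minimal ?_ Metric.isClosed_closedBall
          intro t ht
          have : y - t ∈ Function.support ((φ n).normed μ) := ht
          rw [ContDiffBump.support_normed_eq, mem_ball_zero_iff] at this
          rw [Metric.mem_closedBall, dist_comm, dist_eq_norm]
          exact this.le.trans (hrout n)
        refine h1.trans fun t ht => ?_
        have h2 : dist t y ≤ d := ht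
        have h3 : dist y x₀ ≤ dist x x₀ := hy
        have h4 := dist_triangle t y x₀
        rw [Metric.mem_ball]
        simp only [d] at h2
        linarith
      have hcd' : ContDiff ℝ ∞ fun t => (φ n).normed μ (y - t) :=
        hcd.comp (contDiff_const.sub contDiff_id)
      have hcs' : HasCompactSupport fun t => (φ n).normed μ (y - t) :=
        HasCompactSupport.of_support_subset_isCompact (isCompact_closedBall x₀ s)
          ((subset_tsupport _).trans (hχ.trans Metric.ball_subset_closedBall))
      have h1 := h _ hcd' hcs' (hχ.trans (Metric.ball_subset_ball hsr.le)) v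
      have hfd : ∀ t, fderiv ℝ (fun t => (φ n).normed μ (y - t)) t v =
          -(fderiv ℝ ((φ n).normed μ) (y - t) v) := by
        intro t
        have h2 : HasFDerivAt (fun t => (φ n).normed μ (y - t))
            ((fderiv ℝ ((φ n).normed μ) (y - t)).comp (-ContinuousLinearMap.id ℝ E)) t := by
          refine HasFDerivAt.comp t ((hcd.differentiable (by simp)) _).hasFDerivAt ?_
          exact (hasFDerivAt_id t).const_sub y
        rw [h2.fderiv]
        simp
      have h5 : ∀ t, g t * fderiv ℝ (fun t => (φ n).normed μ (y - t)) t v =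
          -(fderiv ℝ ((φ n).normed μ) (y - t) v * G t) := by
        intro t
        by_cases ht : t ∈ B
        · rw [hfd, show G t = g t from indicator_of_mem ht g]; ring
        · have h6 : t ∉ tsupport (fun t => (φ n).normed μ (y - t)) := fun hc =>
            ht (Metric.ball_subset_closedBall (hχ hc))
          rw [show G t = 0 from indicator_of_notMem ht g, mul_zero, neg_zero,
            fderiv_of_notMem_tsupport ℝ h6]
          simp
      simp_rw [h5] at h1
      rw [integral_neg, neg_eq_zero] at h1
      rw [convolution_eq_swap, ContinuousLinearMap.integral_apply, zero_apply,
        ← h1]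
      · refine integral_congr_ae (ae_of_all _ fun t => ?_)
        simp [ContinuousLinearMap.precompL_apply]
      · exact (hexist y).integrable_swap
    rcases eq_or_ne x x₀ with rfl | hne
    · rfl
    refine (convex_closedBall x₀ (dist x x₀)).is_const_of_fderivWithin_eq_zero (𝕜 := ℝ)
      (fun y _ => (hder y).differentiableAt.differentiableWithinAt) (fun y hy => ?_) hxmem hx0mem
    have huniq : UniqueDiffWithinAt ℝ (Metric.closedBall x₀ (dist x x₀)) y :=
      uniqueDiffWithinAt_convex (convex_closedBall _ _) (by
        rw [interior_closedBall _ (dist_ne_zero.mpr hne)]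
        exact ⟨x₀, Metric.mem_ball_self (dist_pos.mpr hne)⟩) (subset_closure hy)
    rw [(hder y).hasFDerivWithinAt.fderivWithin huniq, hzero y hy]
  have h1 := hlim x (hball hxmem)
  have h2 := hlim x₀ (hball hx0mem)
  simp_rw [hconst] at h1
  have h3 := tendsto_nhds_unique h1 h2
  have h4 : ∀ y ∈ Metric.ball x₀ s, G y = g y := fun y hy =>
    indicator_of_mem (Metric.ball_subset_closedBall hy) g
  rw [h4 x (hball hxmem), h4 x₀ (hball hx0mem)] at h3
  exact h3

end Analysis

section HalfSpace

variable {m : ℕ}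

/-- The linear map `(t, y) ↦ (t, y₁, …, yₘ)`. -/
def consCLM (m : ℕ) : ℝ × Eu m →L[ℝ] Eu (m + 1) :=
  LinearMap.toContinuousLinearMap
    { toFun := fun s => WithLp.toLp 2 (Fin.cons s.1 s.2.ofLp)
      map_add' := fun s t => by
        ext i; refine Fin.cases ?_ (fun j => ?_) i <;> simp
      map_smul' := fun c s => by
        ext i; refine Fin.cases ?_ (fun j => ?_) i <;> simp }

@[simp]
theorem consCLM_zero (t : ℝ) (y : Eu m) : consCLM m (t, y) 0 = t := rfl

@[simp]
theorem consCLM_succ (t : ℝ) (y : Eu m) (i : Fin m) : consCLM m (t, y) i.succ = y i := rfl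

theorem toBoundary_eq (y : Eu m) : toBoundary y = consCLM m (0, y) := rfl

theorem measurePreserving_consCLM : MeasurePreserving (consCLM m) := by
  have h1 : MeasurePreserving (Prod.map id (WithLp.ofLp : Eu m → Fin m → ℝ))
      (volume : Measure (ℝ × Eu m)) volume :=
    (MeasurePreserving.id volume).prod (PiLp.volume_preserving_ofLp (Fin m))
  have h2 := (volume_preserving_piFinSuccAbove (fun _ : Fin (m + 1) => ℝ) 0).symm
  have h3 := PiLp.volume_preserving_toLp (Fin (m + 1))
  have h4 : ((WithLp.toLp 2 : (Fin (m + 1) → ℝ) → Eu (m + 1)) ∘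
      (MeasurableEquiv.piFinSuccAbove (fun _ : Fin (m + 1) => ℝ) 0).symm) ∘
      Prod.map id (WithLp.ofLp : Eu m → Fin m → ℝ) = consCLM m := by
    funext s
    ext i
    refine Fin.cases ?_ (fun j => ?_) i
    · simp [MeasurableEquiv.piFinSuccAbove]; rfl
    · simp [MeasurableEquiv.piFinSuccAbove]; rfl
  rw [← h4]
  exact (h3.comp h2).comp h1

theorem consCLM_injective : Function.Injective (consCLM m) := by
  rintro ⟨t, y⟩ ⟨t', y'⟩ h
  have h0 : consCLM m (t, y) 0 = consCLM m (t', y') 0 := by rw [h]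
  have h1 : ∀ i : Fin m, consCLM m (t, y) i.succ = consCLM m (t', y') i.succ := by
    intro i; rw [h]
  simp only [consCLM_zero] at h0
  simp only [consCLM_succ] at h1
  rw [h0, PiLp.ext h1]

theorem measurableEmbedding_consCLM : MeasurableEmbedding (consCLM m) :=
  (consCLM m).continuous.measurableEmbedding consCLM_injective

/-- The closed half-space. -/
def halfSpace (m : ℕ) : Set (Eu (m + 1)) := {x | 0 ≤ x 0}

theorem range_halfSpace : range (𝓡∂ (m + 1)) = halfSpace m :=
  range_modelWithCornersEuclideanHalfSpace (m + 1)

theorem continuous_zeroth : Continuous fun x : Eu (m + 1) => x 0 := by fun_prop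

theorem isClosed_halfSpace : IsClosed (halfSpace m) :=
  isClosed_le continuous_const continuous_zeroth

theorem halfSpace_mem_nhds {x : Eu (m + 1)} (hx : 0 < x 0) : halfSpace m ∈ 𝓝 x :=
  Filter.mem_of_superset ((isOpen_lt continuous_const continuous_zeroth).mem_nhds hx)
    fun y (h : 0 < y 0) => show 0 ≤ y 0 from h.le

theorem uniqueDiffOn_halfSpace : UniqueDiffOn ℝ (halfSpace m) := by
  rw [← range_halfSpace]
  exact (𝓡∂ (m + 1)).uniqueDiffOn

theorem integral_halfSpace {f : Eu (m + 1) → ℝ} (hf : IntegrableOn f (halfSpace m)) :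
    (∫ x in halfSpace m, f x = ∫ y : Eu m, ∫ t in Ioi (0 : ℝ), f (consCLM m (t, y))) ∧
      ∫ x in halfSpace m, f x = ∫ t in Ioi (0 : ℝ), ∫ y : Eu m, f (consCLM m (t, y)) := by
  have hpre : consCLM m ⁻¹' halfSpace m = Ici (0 : ℝ) ×ˢ (univ : Set (Eu m)) := by
    ext ⟨t, y⟩; simp [halfSpace]
  have h1 : ∫ x in halfSpace m, f x =
      ∫ s in Ici (0 : ℝ) ×ˢ (univ : Set (Eu m)), f (consCLM m s) := by
    rw [← hpre]
    exact (measurePreserving_consCLM.setIntegral_preimage_emb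
      measurableEmbedding_consCLM _ _).symm
  have h2 : IntegrableOn (fun s => f (consCLM m s)) (Ici (0 : ℝ) ×ˢ (univ : Set (Eu m))) := by
    rw [← hpre]
    exact (measurePreserving_consCLM.integrableOn_comp_preimage
      measurableEmbedding_consCLM).mpr hf
  rw [h1]
  have h3 : (volume : Measure (ℝ × Eu m)).restrict (Ici (0 : ℝ) ×ˢ (univ : Set (Eu m))) =
      (volume.restrict (Ioi (0 : ℝ))).prod volume := by
    rw [Measure.volume_eq_prod, ← Measure.prod_restrict, Measure.restrict_univ,
      Measure.restrict_congr_set Ioi_ae_eq_Ici]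
  rw [IntegrableOn, h3] at h2
  rw [h3]
  exact ⟨integral_prod_symm _ h2, integral_prod _ h2⟩

theorem fderivWithin_halfSpace_eq_zero {F : Type*} [NormedAddCommGroup F] [NormedSpace ℝ F]
    {f : Eu (m + 1) → F} {K : Set (Eu (m + 1))}
    (hK : IsClosed K) (h0 : ∀ x ∉ K, f x = 0) {x : Eu (m + 1)} (hx : x ∉ K) :
    fderivWithin ℝ f (halfSpace m) x = 0 := by
  have : f =ᶠ[𝓝 x] fun _ => 0 := by
    filter_upwards [hK.isOpen_compl.mem_nhds hx] with y hy using h0 y hy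
  rw [(this.filter_mono nhdsWithin_le_nhds).fderivWithin_eq this.self_of_nhds]
  simp

theorem integral_halfSpace_fderivWithin {f : Eu (m + 1) → ℝ} {K : Set (Eu (m + 1))}
    (hf : ContDiffOn ℝ 1 f (halfSpace m)) (hK : IsCompact K) (h0 : ∀ x ∉ K, f x = 0) :
    (∀ v : Eu (m + 1), IntegrableOn (fun x => fderivWithin ℝ f (halfSpace m) x v) (halfSpace m)) ∧
    (∀ w : Eu m, ∫ x in halfSpace m, fderivWithin ℝ f (halfSpace m) x (consCLM m (0, w)) = 0) ∧
    ∫ x in halfSpace m, fderivWithin ℝ f (halfSpace m) x (consCLM m (1, 0)) =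
      -∫ y, f (toBoundary y) := by
  have hcontD : ContinuousOn (fderivWithin ℝ f (halfSpace m)) (halfSpace m) :=
    hf.continuousOn_fderivWithin uniqueDiffOn_halfSpace le_rfl
  have hcont : ∀ v, ContinuousOn (fun x => fderivWithin ℝ f (halfSpace m) x v) (halfSpace m) :=
    fun v => hcontD.clm_apply continuousOn_const
  have hzero : ∀ x ∉ K, fderivWithin ℝ f (halfSpace m) x = 0 := fun x hx =>
    fderivWithin_halfSpace_eq_zero hK.isClosed h0 hx
  have hint : ∀ v : Eu (m + 1),
      IntegrableOn (fun x => fderivWithin ℝ f (halfSpace m) x v) (halfSpace m) := fun v =>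
    integrable_of_continuousOn_of_eq_zero isClosed_halfSpace (hcont v) hK
      fun x _ hx => by rw [hzero x hx]; rfl
  have hder : ∀ x : Eu (m + 1), 0 < x 0 →
      HasFDerivAt f (fderivWithin ℝ f (halfSpace m) x) x := fun x hx =>
    ((hf.differentiableOn one_ne_zero x (le_of_lt hx)).hasFDerivWithinAt).hasFDerivAt
      (halfSpace_mem_nhds hx)
  obtain ⟨C, hC⟩ := hK.isBounded.exists_norm_le
  refine ⟨hint, fun w => ?_, ?_⟩
  · rw [(integral_halfSpace (hint _)).2]
    refine setIntegral_eq_zero_of_forall_eq_zero fun t ht => ?_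
    have ht : (0 : ℝ) < t := ht
    have hi : ∀ y : Eu m, HasFDerivAt (fun y => f (consCLM m (t, y)))
        ((fderivWithin ℝ f (halfSpace m) (consCLM m (t, y))).comp
          ((consCLM m).comp (ContinuousLinearMap.inr ℝ ℝ (Eu m)))) y := by
      intro y
      refine HasFDerivAt.comp y (hder _ (by simpa using ht)) ?_
      exact (consCLM m).hasFDerivAt.comp y (hasFDerivAt_prodMk_right t y)
    have hg : ContDiff ℝ 1 fun y : Eu m => f (consCLM m (t, y)) := by
      rw [← contDiffOn_univ]
      refine hf.comp (s := univ) ?_ fun y _ => ?_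
      · exact ((consCLM m).contDiff.comp (contDiff_const.prodMk contDiff_id)).contDiffOn
      · exact ht.le
    have hgc : HasCompactSupport fun y : Eu m => f (consCLM m (t, y)) := by
      refine HasCompactSupport.of_support_subset_isCompact (isCompact_closedBall 0 C) ?_
      intro y hy
      have h1 : consCLM m (t, y) ∈ K := by
        by_contra hc; exact hy (h0 _ hc)
      have h2 := hC _ h1
      rw [mem_closedBall_zero_iff]
      refine le_trans ?_ h2
      rw [EuclideanSpace.norm_eq, EuclideanSpace.norm_eq]
      refine Real.sqrt_le_sqrt ?_
      rw [Fin.sum_univ_succ]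
      simp only [consCLM_succ]
      have := sq_nonneg ‖consCLM m (t, y) 0‖
      linarith
    refine Eq.trans ?_ (integral_fderiv_apply_eq_zero volume hg hgc w)
    refine integral_congr_ae (ae_of_all _ fun y => ?_)
    simp only [(hi y).fderiv]
    rfl
  · rw [(integral_halfSpace (hint _)).1, ← integral_neg]
    refine integral_congr_ae (ae_of_all _ fun y => ?_)
    simp only
    have hz : ∀ t : ℝ, C < t → consCLM m (t, y) ∉ K := by
      intro t ht hc
      have h2 := hC _ hc
      have h3 := PiLp.norm_apply_le (consCLM m (t, y)) 0
      rw [consCLM_zero, Real.norm_eq_abs] at h3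
      linarith [le_abs_self t]
    have hline : Continuous fun t : ℝ => consCLM m (t, y) :=
      (consCLM m).continuous.comp (by fun_prop)
    have h1 := integral_Ioi_of_hasDerivAt_of_tendsto (a := (0 : ℝ)) (m := (0 : ℝ))
      (f := fun t => f (consCLM m (t, y)))
      (f' := fun t => fderivWithin ℝ f (halfSpace m) (consCLM m (t, y)) (consCLM m (1, 0)))
      ?_ ?_ ?_ ?_
    · rw [h1, zero_sub, toBoundary_eq]
    · refine ContinuousWithinAt.comp (t := halfSpace m) (hf.continuousOn _ ?_)
        hline.continuousWithinAt ?_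
      · simp [halfSpace]
      · intro t ht; exact ht
    · intro t ht
      refine (hder (consCLM m (t, y)) ht).comp_hasDerivAt t ?_
      exact (consCLM m).hasFDerivAt.comp_hasDerivAt t
        ((hasDerivAt_id t).prodMk (hasDerivAt_const t y))
    · refine IntegrableOn.mono_set (t := Ici 0) ?_ Ioi_subset_Ici_self
      refine integrable_of_continuousOn_of_eq_zero isClosed_Ici ?_ (isCompact_Icc (a := 0) (b := C))
        ?_
      · exact (hcont _).comp hline.continuousOn fun t ht => ht
      · intro t ht htK
        rw [hzero _ (hz t ?_)]
        · rfl
        · by_contra hc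
          exact htK ⟨ht, not_lt.mp hc⟩
    · refine tendsto_const_nhds.congr' ?_
      filter_upwards [eventually_gt_atTop C] with t ht using (h0 _ (hz t ht)).symm

theorem consCLM_one_zero : consCLM m (1, 0) = stdFrame (m + 1) 0 := by
  ext i
  refine Fin.cases ?_ (fun j => ?_) i
  · simp [stdFrame]
  · simp [stdFrame]

theorem consCLM_stdFrame (j : Fin m) : consCLM m (0, stdFrame m j) = stdFrame (m + 1) j.succ := by
  ext i
  refine Fin.cases ?_ (fun j => ?_) i
  · simp [stdFrame]
  · simp [stdFrame]

/-- Stokes' theorem on the half-space. -/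
theorem integral_halfSpace_extDerivWithin {w : Eu (m + 1) → (Eu (m + 1)) [⋀^Fin m]→L[ℝ] ℝ}
    {K : Set (Eu (m + 1))} (hw : ContDiffOn ℝ 1 w (halfSpace m)) (hK : IsCompact K)
    (h0 : ∀ x ∉ K, w x = 0) :
    ∫ x in halfSpace m, extDerivWithin w (halfSpace m) x (stdFrame (m + 1)) =
      -∫ y, w (toBoundary y) fun a => stdFrame (m + 1) a.succ := by
  have hcd : ∀ u : Fin m → Eu (m + 1), ContDiffOn ℝ 1 (fun x => w x u) (halfSpace m) := fun u =>
    (ContinuousAlternatingMap.apply ℝ (Eu (m + 1)) ℝ u).contDiff.comp_contDiffOn hw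
  have hcz : ∀ u : Fin m → Eu (m + 1), ∀ x ∉ K, w x u = 0 := fun u x hx => by rw [h0 x hx]; rfl
  have h1 : ∀ x ∈ halfSpace m, extDerivWithin w (halfSpace m) x (stdFrame (m + 1)) =
      ∑ i : Fin (m + 1), (-1 : ℝ) ^ i.val * fderivWithin ℝ
        (fun y => w y (i.removeNth (stdFrame (m + 1)))) (halfSpace m) x (stdFrame (m + 1) i) :=
    fun x hx => by
      rw [extDerivWithin_apply (hw.differentiableOn one_ne_zero x hx)
        (uniqueDiffOn_halfSpace x hx)]
      exact Finset.sum_congr rfl fun i _ => by simp [zsmul_eq_mul]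
  rw [setIntegral_congr_fun isClosed_halfSpace.measurableSet h1, integral_finsetSum]
  · rw [Fin.sum_univ_succ, Finset.sum_eq_zero, add_zero]
    · rw [integral_const_mul, ← consCLM_one_zero,
        (integral_halfSpace_fderivWithin (hcd _) hK (hcz _)).2.2]
      simp
      rfl
    · intro j _
      rw [integral_const_mul, ← consCLM_stdFrame,
        (integral_halfSpace_fderivWithin (hcd _) hK (hcz _)).2.1, mul_zero]
  · intro i _
    exact ((integral_halfSpace_fderivWithin (hcd _) hK (hcz _)).1 _).const_mul _

end HalfSpace


/-! ## Pull-backs of forms to vector spaces, and coordinate expressions -/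

section Pull

open IsManifold (maximalAtlas)

variable {n : ℕ} {H : Type*} [TopologicalSpace H] {I : ModelWithCorners ℝ (Eu n) H}
  {M : Type*} [TopologicalSpace M] [ChartedSpace H M]
  {F : Type*} [NormedAddCommGroup F] [NormedSpace ℝ F]
  {G : Type*} [NormedAddCommGroup G] [NormedSpace ℝ G]

theorem diffForm_congr {p : ℕ} (α : DiffForm I M p) {x y : M} (h : x = y) :
    (α x : Eu n [⋀^Fin p]→L[ℝ] ℝ) = α y := by
  subst h; rfl

/-- The pull-back of a form to a vector space, by a map differentiable within `s`. -/
def pullMap {p : ℕ} (ψ : F → M) (s : Set F) (α : DiffForm I M p) (z : F) : F [⋀^Fin p]→L[ℝ] ℝ :=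
  (α (ψ z)).compContinuousLinearMap (mfderivWithin 𝓘(ℝ, F) I ψ s z)

/-- The coordinate expression of a form in any chart. -/
def chartForm {p : ℕ} (e : OpenPartialHomeomorph M H) (α : DiffForm I M p) (y : Eu n) :
    (Eu n) [⋀^Fin p]→L[ℝ] ℝ :=
  pullMap (e.extend I).symm (range I) α y

theorem localForm_eq_chartForm {p : ℕ} (α : DiffForm I M p) (x₀ : M) :
    localForm α x₀ = chartForm (chartAt H x₀) α := rfl

theorem extend_target_subset_range (e : OpenPartialHomeomorph M H) :
    (e.extend I).target ⊆ range I := by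
  rw [OpenPartialHomeomorph.extend_target]; exact inter_subset_right

theorem mdifferentiableWithinAt_extend_symm [IsManifold I ∞ M] {e : OpenPartialHomeomorph M H}
    (he : e ∈ maximalAtlas I ∞ M) {y : Eu n} (hy : y ∈ (e.extend I).target) :
    MDifferentiableWithinAt 𝓘(ℝ, Eu n) I (e.extend I).symm (range I) y := by
  rw [OpenPartialHomeomorph.extend_target] at hy
  have h1 : MDifferentiableWithinAt 𝓘(ℝ, Eu n) I I.symm (range I) y :=
    I.mdifferentiableOn_symm y hy.2
  have h2 : MDifferentiableAt I I e.symm (I.symm y) :=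
    (contMDiffAt_symm_of_mem_maximalAtlas he hy.1).mdifferentiableAt (by simp)
  exact h2.comp_mdifferentiableWithinAt y h1

theorem contMDiffWithinAt_extend_symm [IsManifold I ∞ M] {e : OpenPartialHomeomorph M H}
    (he : e ∈ maximalAtlas I ∞ M) {y : Eu n} (hy : y ∈ (e.extend I).target) :
    ContMDiffWithinAt 𝓘(ℝ, Eu n) I ∞ (e.extend I).symm (range I) y := by
  rw [OpenPartialHomeomorph.extend_target] at hy
  have h1 : ContMDiffWithinAt 𝓘(ℝ, Eu n) I ∞ I.symm (range I) y :=
    I.contMDiffOn_symm y hy.2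
  have h2 : ContMDiffAt I I ∞ e.symm (I.symm y) :=
    contMDiffAt_symm_of_mem_maximalAtlas he hy.1
  exact h2.comp_contMDiffWithinAt y h1

theorem mfderivWithin_eq_comp_fderivWithin [IsManifold I ∞ M] {e : OpenPartialHomeomorph M H}
    (he : e ∈ maximalAtlas I ∞ M) {ψ : F → M} {s : Set F} {z : F}
    (hψ : MDifferentiableWithinAt 𝓘(ℝ, F) I ψ s z) (hz : ψ z ∈ e.source)
    (hs : UniqueDiffWithinAt ℝ s z) :
    (mfderivWithin 𝓘(ℝ, F) I ψ s z : F →L[ℝ] Eu n) =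
      ContinuousLinearMap.comp (mfderivWithin 𝓘(ℝ, Eu n) I (e.extend I).symm (range I)
        (e.extend I (ψ z)) : Eu n →L[ℝ] Eu n) (fderivWithin ℝ (e.extend I ∘ ψ) s z) := by
  have hev : ψ =ᶠ[𝓝[s] z] (e.extend I).symm ∘ (e.extend I ∘ ψ) := by
    filter_upwards [hψ.continuousWithinAt.preimage_mem_nhdsWithin (e.open_source.mem_nhds hz)]
      with w hw
    exact (e.extend_left_inv hw).symm
  have hz' : (e.extend I).symm (e.extend I (ψ z)) = ψ z := e.extend_left_inv hz
  have hd : MDifferentiableWithinAt 𝓘(ℝ, F) 𝓘(ℝ, Eu n) (e.extend I ∘ ψ) s z :=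
    ((e.contMDiffAt_extend he hz).mdifferentiableAt (by simp)).comp_mdifferentiableWithinAt z hψ
  have hchain := mfderivWithin_comp (I := 𝓘(ℝ, F)) (I' := 𝓘(ℝ, Eu n)) (I'' := I) z
    (mdifferentiableWithinAt_extend_symm he (I := I) (y := (e.extend I ∘ ψ) z)
      ((e.extend I).map_source (by rwa [e.extend_source])))
    hd (fun w _ => mem_range_self _) hs.uniqueMDiffWithinAt
  have h1 : mfderivWithin 𝓘(ℝ, F) I ψ s z = _ := (hev.mfderivWithin_eq hz'.symm).trans hchain
  rw [mfderivWithin_eq_fderivWithin] at h1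
  exact h1

theorem pullMap_eq_chartForm [IsManifold I ∞ M] {p : ℕ} {e : OpenPartialHomeomorph M H}
    (he : e ∈ maximalAtlas I ∞ M) {ψ : F → M} {s : Set F} {z : F} (α : DiffForm I M p)
    (hψ : MDifferentiableWithinAt 𝓘(ℝ, F) I ψ s z) (hz : ψ z ∈ e.source)
    (hs : UniqueDiffWithinAt ℝ s z) :
    pullMap ψ s α z = (chartForm e α (e.extend I (ψ z))).compContinuousLinearMap
      (fderivWithin ℝ (e.extend I ∘ ψ) s z) := by
  have h1 := mfderivWithin_eq_comp_fderivWithin he hψ hz hs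
  have h2 : (α ((e.extend I).symm (e.extend I (ψ z))) : Eu n [⋀^Fin p]→L[ℝ] ℝ) = α (ψ z) :=
    diffForm_congr α (e.extend_left_inv hz)
  ext v
  change (α (ψ z) : Eu n [⋀^Fin p]→L[ℝ] ℝ) (fun i => mfderivWithin 𝓘(ℝ, F) I ψ s z (v i)) =
    (α ((e.extend I).symm (e.extend I (ψ z))) : Eu n [⋀^Fin p]→L[ℝ] ℝ) _
  rw [h2, h1]
  rfl

theorem pullMap_comp {p : ℕ} {ψ : F → M} {θ : G → F} {s : Set G} {t : Set F} {z : G}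
    (α : DiffForm I M p) (hψ : MDifferentiableWithinAt 𝓘(ℝ, F) I ψ t (θ z))
    (hθ : DifferentiableWithinAt ℝ θ s z) (hs : UniqueDiffWithinAt ℝ s z) (hst : MapsTo θ s t) :
    pullMap (ψ ∘ θ) s α z =
      (pullMap ψ t α (θ z)).compContinuousLinearMap (fderivWithin ℝ θ s z) := by
  have h := mfderivWithin_comp (I := 𝓘(ℝ, G)) (I' := 𝓘(ℝ, F)) (I'' := I) z hψ
    hθ.mdifferentiableWithinAt hst hs.uniqueMDiffWithinAt
  rw [mfderivWithin_eq_fderivWithin] at h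
  rw [pullMap, h]
  rfl

theorem pullMap_pullback {n' : ℕ} {H' : Type*} [TopologicalSpace H']
    {I' : ModelWithCorners ℝ (Eu n') H'} {M' : Type*} [TopologicalSpace M'] [ChartedSpace H' M']
    {p : ℕ} {φ : M' → M} {ψ : F → M'} {s : Set F} {z : F} (α : DiffForm I M p)
    (hφ : MDifferentiableAt I' I φ (ψ z)) (hψ : MDifferentiableWithinAt 𝓘(ℝ, F) I' ψ s z)
    (hs : UniqueDiffWithinAt ℝ s z) :
    pullMap ψ s (pullback φ α : DiffForm I' M' p) z = pullMap (φ ∘ ψ) s α z := by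
  have h := mfderiv_comp_mfderivWithin (I := 𝓘(ℝ, F)) (I' := I') (I'' := I) z hφ hψ
    hs.uniqueMDiffWithinAt
  rw [pullMap, pullMap, h]
  rfl

theorem pullMap_congr {p : ℕ} {ψ ψ' : F → M} {s : Set F} {z : F} (α : DiffForm I M p)
    (h : ψ =ᶠ[𝓝[s] z] ψ') (hz : ψ z = ψ' z) : pullMap ψ s α z = pullMap ψ' s α z := by
  have h1 : mfderivWithin 𝓘(ℝ, F) I ψ s z = _ := h.mfderivWithin_eq hz
  have h2 : (α (ψ z) : Eu n [⋀^Fin p]→L[ℝ] ℝ) = α (ψ' z) :=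
    diffForm_congr α hz
  ext v
  change (α (ψ z) : Eu n [⋀^Fin p]→L[ℝ] ℝ) (fun i => mfderivWithin 𝓘(ℝ, F) I ψ s z (v i)) =
    (α (ψ' z) : Eu n [⋀^Fin p]→L[ℝ] ℝ) _
  rw [h2, h1]
  rfl

/-! ### Regularity -/

theorem contDiffWithinAt_form_of_eval {p : ℕ} {E X : Type*} [NormedAddCommGroup E]
    [NormedSpace ℝ E] [FiniteDimensional ℝ E] [NormedAddCommGroup X] [NormedSpace ℝ X]
    {r : ℕ∞ω} {w : X → E [⋀^Fin p]→L[ℝ] ℝ} {s : Set X} {x : X}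
    (h : ∀ v : Fin p → E, ContDiffWithinAt ℝ r (fun y => w y v) s x) :
    ContDiffWithinAt ℝ r w s x := by
  rw [funext fun y => form_eq_sum_detForm (w y)]
  refine ContDiffWithinAt.sum fun I _ => ?_
  exact (contDiffWithinAt_const.mul (h _)).smul contDiffWithinAt_const

theorem contDiffWithinAt_form_apply {p : ℕ} {E X : Type*} [NormedAddCommGroup E]
    [NormedSpace ℝ E] [FiniteDimensional ℝ E] [NormedAddCommGroup X] [NormedSpace ℝ X]
    {r : ℕ∞ω} {w : X → E [⋀^Fin p]→L[ℝ] ℝ} {v : Fin p → X → E} {s : Set X} {x : X}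
    (hw : ContDiffWithinAt ℝ r w s x) (hv : ∀ i, ContDiffWithinAt ℝ r (v i) s x) :
    ContDiffWithinAt ℝ r (fun y => w y fun i => v i y) s x := by
  have h1 : ∀ y, (w y fun i => v i y) = ∑ I : Fin p → Fin (Module.finrank ℝ E),
      ((p.factorial : ℝ)⁻¹ * w y fun i => Module.finBasis ℝ E (I i)) *
        ∑ σ : Equiv.Perm (Fin p), (Equiv.Perm.sign σ : ℝ) *
          ∏ i, LinearMap.toContinuousLinearMap ((Module.finBasis ℝ E).coord (I i)) (v (σ i) y) := by
    intro y
    conv_lhs => rw [form_eq_sum_detForm (w y)]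
    rw [ContinuousAlternatingMap.sum_apply]
    refine Finset.sum_congr rfl fun I _ => ?_
    rw [ContinuousAlternatingMap.smul_apply, detForm_apply, Matrix.det_apply']
    rfl
  rw [funext h1]
  refine ContDiffWithinAt.sum fun I _ => ContDiffWithinAt.mul (contDiffWithinAt_const.mul ?_) ?_
  · exact ((ContinuousAlternatingMap.apply ℝ E ℝ fun i =>
      Module.finBasis ℝ E (I i)).contDiff.contDiffAt.comp_contDiffWithinAt x hw)
  · refine ContDiffWithinAt.sum fun σ _ => contDiffWithinAt_const.mul ?_
    refine contDiffWithinAt_prod fun i _ => ?_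
    exact (ContinuousLinearMap.contDiff _).contDiffAt.comp_contDiffWithinAt x (hv _)

theorem ContDiffWithinAt.compForm {p : ℕ} {E E' X : Type*} [NormedAddCommGroup E]
    [NormedSpace ℝ E] [FiniteDimensional ℝ E] [NormedAddCommGroup E'] [NormedSpace ℝ E']
    [FiniteDimensional ℝ E'] [NormedAddCommGroup X] [NormedSpace ℝ X]
    {r : ℕ∞ω} {w : X → E [⋀^Fin p]→L[ℝ] ℝ} {A : X → E' →L[ℝ] E} {s : Set X} {x : X}
    (hw : ContDiffWithinAt ℝ r w s x) (hA : ContDiffWithinAt ℝ r A s x) :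
    ContDiffWithinAt ℝ r (fun y => (w y).compContinuousLinearMap (A y)) s x := by
  refine contDiffWithinAt_form_of_eval fun v => ?_
  exact contDiffWithinAt_form_apply (v := fun i y => A y (v i)) hw
    fun i => hA.clm_apply contDiffWithinAt_const

end Pull


section PullRegularity

open IsManifold (maximalAtlas)

variable {n : ℕ} {H : Type*} [TopologicalSpace H] {I : ModelWithCorners ℝ (Eu n) H}
  {M : Type*} [TopologicalSpace M] [ChartedSpace H M]
  {F : Type*} [NormedAddCommGroup F] [NormedSpace ℝ F]

/-- `α` is of class `C^r` at the point `x`. -/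
def IsCkAt {p : ℕ} (r : ℕ∞ω) (α : DiffForm I M p) (x : M) : Prop :=
  ContDiffWithinAt ℝ r (localForm α x) (range I) (extChartAt I x x)

theorem extend_target_mem_nhdsWithin {e : OpenPartialHomeomorph M H} {y : Eu n}
    (hy : y ∈ (e.extend I).target) : (e.extend I).target ∈ 𝓝[range I] y := by
  have h := e.extend_target_mem_nhdsWithin (I := I) (y := (e.extend I).symm y)
    (by simpa [e.extend_source] using (e.extend I).map_target hy)
  rwa [(e.extend I).right_inv hy] at h

theorem extend_symm_mem_source {e : OpenPartialHomeomorph M H} {y : Eu n}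
    (hy : y ∈ (e.extend I).target) : (e.extend I).symm y ∈ e.source := by
  simpa [e.extend_source] using (e.extend I).map_target hy

theorem extend_mem_target {e : OpenPartialHomeomorph M H} {x : M} (hx : x ∈ e.source) :
    e.extend I x ∈ (e.extend I).target :=
  (e.extend I).map_source (by rwa [e.extend_source])

theorem preimage_extend_symm_mem_nhdsWithin {e : OpenPartialHomeomorph M H} {y : Eu n}
    (hy : y ∈ (e.extend I).target) {U : Set M} (hU : U ∈ 𝓝 ((e.extend I).symm y)) :
    (e.extend I).symm ⁻¹' U ∈ 𝓝[range I] y := by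
  have h := e.continuousAt_extend_symm (I := I) (x := (e.extend I).symm y)
    (extend_symm_mem_source hy)
  rw [(e.extend I).right_inv hy] at h
  exact mem_nhdsWithin_of_mem_nhds (h.preimage_mem_nhds hU)

theorem IsCkOn.isCkAt {p : ℕ} {r : ℕ∞ω} {α : DiffForm I M p} {U : Set M} (h : IsCkOn r α U)
    (hU : IsOpen U) {x : M} (hx : x ∈ U) : IsCkAt r α x := by
  have hx' := mem_extChartAt_target (I := I) x
  have hl : (extChartAt I x).symm (extChartAt I x x) = x := extChartAt_to_inv x
  refine (h x _ ⟨hx', by simpa [hl] using hx⟩).mono_of_mem_nhdsWithin ?_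
  refine inter_mem (extend_target_mem_nhdsWithin hx')
    (preimage_extend_symm_mem_nhdsWithin hx' (hU.mem_nhds ?_))
  change (extChartAt I x).symm (extChartAt I x x) ∈ U
  rwa [hl]

variable [IsManifold I ∞ M]

theorem eventually_mdifferentiableWithinAt {ψ : F → M} {s : Set F} {z : F}
    (hψ : ContMDiffWithinAt 𝓘(ℝ, F) I ∞ ψ s z) (hzs : z ∈ s) :
    ∀ᶠ w in 𝓝[s] z, MDifferentiableWithinAt 𝓘(ℝ, F) I ψ s w := by
  have : IsManifold I 1 M := .of_le (n := ∞) (by simp)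
  have h1 : ContMDiffWithinAt 𝓘(ℝ, F) I 1 ψ s z := hψ.of_le (by simp)
  have := (contMDiffWithinAt_iff_contMDiffWithinAt_nhdsWithin (by simp)).1 h1
  simp only [insert_eq_of_mem hzs] at this
  filter_upwards [this] with w hw
  exact hw.mdifferentiableWithinAt one_ne_zero

theorem contDiffWithinAt_extend_comp {e : OpenPartialHomeomorph M H} (he : e ∈ maximalAtlas I ∞ M)
    {ψ : F → M} {s : Set F} {z : F} (hψ : ContMDiffWithinAt 𝓘(ℝ, F) I ∞ ψ s z)
    (hz : ψ z ∈ e.source) : ContDiffWithinAt ℝ ∞ (e.extend I ∘ ψ) s z :=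
  ((e.contMDiffAt_extend he hz).comp_contMDiffWithinAt z hψ).contDiffWithinAt

theorem eventually_pullMap_eq {p : ℕ} {e : OpenPartialHomeomorph M H}
    (he : e ∈ maximalAtlas I ∞ M) {ψ : F → M} {s : Set F} {z : F} (α : DiffForm I M p)
    (hψ : ContMDiffWithinAt 𝓘(ℝ, F) I ∞ ψ s z) (hz : ψ z ∈ e.source)
    (hs : UniqueDiffOn ℝ s) (hzs : z ∈ s) :
    pullMap ψ s α =ᶠ[𝓝[s] z] fun w => (chartForm e α ((e.extend I ∘ ψ) w)).compContinuousLinearMap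
      (fderivWithin ℝ (e.extend I ∘ ψ) s w) := by
  filter_upwards [eventually_mdifferentiableWithinAt hψ hzs, self_mem_nhdsWithin,
    hψ.continuousWithinAt.preimage_mem_nhdsWithin (e.open_source.mem_nhds hz)] with w hw hws hwe
  exact pullMap_eq_chartForm he α hw hwe (hs w hws)

theorem contDiffWithinAt_pullMap [FiniteDimensional ℝ F] {p : ℕ} {r : ℕ∞ω} (hr : r + 1 ≤ ∞)
    {e : OpenPartialHomeomorph M H} (he : e ∈ maximalAtlas I ∞ M) {ψ : F → M} {s : Set F} {z : F}
    {α : DiffForm I M p} (hα : ContDiffWithinAt ℝ r (chartForm e α) (range I) (e.extend I (ψ z)))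
    (hψ : ContMDiffWithinAt 𝓘(ℝ, F) I ∞ ψ s z) (hz : ψ z ∈ e.source)
    (hs : UniqueDiffOn ℝ s) (hzs : z ∈ s) :
    ContDiffWithinAt ℝ r (pullMap ψ s α) s z := by
  have hθ := contDiffWithinAt_extend_comp he hψ hz
  refine ContDiffWithinAt.congr_of_eventuallyEq_of_mem ?_
    (eventually_pullMap_eq he α hψ hz hs hzs) hzs
  refine ContDiffWithinAt.compForm ?_ (hθ.fderivWithin_right hs hr hzs)
  exact ContDiffWithinAt.comp (t := range I) z hα (hθ.of_le (le_self_add.trans hr))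
    fun w _ => mem_range_self _

theorem IsCkAt.pullMap [FiniteDimensional ℝ F] {p : ℕ} {r : ℕ∞ω} (hr : r + 1 ≤ ∞)
    {ψ : F → M} {s : Set F} {z : F} {α : DiffForm I M p} (hα : IsCkAt r α (ψ z))
    (hψ : ContMDiffWithinAt 𝓘(ℝ, F) I ∞ ψ s z) (hs : UniqueDiffOn ℝ s) (hzs : z ∈ s) :
    ContDiffWithinAt ℝ r (pullMap ψ s α) s z :=
  contDiffWithinAt_pullMap hr (IsManifold.chart_mem_maximalAtlas (ψ z)) hα hψ
    (mem_chart_source H (ψ z)) hs hzs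

theorem IsCkAt.chartForm {p : ℕ} {r : ℕ∞ω} (hr : r + 1 ≤ ∞) {e : OpenPartialHomeomorph M H}
    (he : e ∈ maximalAtlas I ∞ M) {α : DiffForm I M p} {y : Eu n} (hy : y ∈ (e.extend I).target)
    (hα : IsCkAt r α ((e.extend I).symm y)) :
    ContDiffWithinAt ℝ r (chartForm e α) (range I) y :=
  hα.pullMap hr (contMDiffWithinAt_extend_symm he hy) I.uniqueDiffOn
    (extend_target_subset_range e hy)

theorem contDiffWithinAt_localForm_of_chartForm {p : ℕ} {r : ℕ∞ω} (hr : r + 1 ≤ ∞)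
    {e : OpenPartialHomeomorph M H} (he : e ∈ maximalAtlas I ∞ M) {α : DiffForm I M p} {x x₀ : M}
    (hx : x ∈ e.source) (hx₀ : x ∈ (chartAt H x₀).source)
    (hα : ContDiffWithinAt ℝ r (BlowUpCurrents.chartForm e α) (range I) (e.extend I x)) :
    ContDiffWithinAt ℝ r (localForm α x₀) (range I) (extChartAt I x₀ x) := by
  have hy : extChartAt I x₀ x ∈ (extChartAt I x₀).target := extend_mem_target hx₀
  have hl : ((chartAt H x₀).extend I).symm ((chartAt H x₀).extend I x) = x :=
    (chartAt H x₀).extend_left_inv hx₀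
  refine contDiffWithinAt_pullMap hr he (ψ := (extChartAt I x₀).symm) ?_
    (contMDiffWithinAt_extend_symm (IsManifold.chart_mem_maximalAtlas x₀) hy) ?_ I.uniqueDiffOn
    (extend_target_subset_range _ hy)
  · exact hl.symm ▸ hα
  · exact hl.symm ▸ hx

theorem isCkAt_of_chartForm {p : ℕ} {r : ℕ∞ω} (hr : r + 1 ≤ ∞) {e : OpenPartialHomeomorph M H}
    (he : e ∈ maximalAtlas I ∞ M) {α : DiffForm I M p} {x : M} (hx : x ∈ e.source)
    (hα : ContDiffWithinAt ℝ r (BlowUpCurrents.chartForm e α) (range I) (e.extend I x)) :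
    IsCkAt r α x :=
  contDiffWithinAt_localForm_of_chartForm hr he hx (mem_chart_source H x) hα

theorem isCkOn_of_isCkAt {p : ℕ} {r : ℕ∞ω} (hr : r + 1 ≤ ∞) {α : DiffForm I M p} {U : Set M}
    (h : ∀ x ∈ U, IsCkAt r α x) : IsCkOn r α U := by
  intro x₀ y hy
  refine ((h _ hy.2).chartForm hr (IsManifold.chart_mem_maximalAtlas x₀) hy.1).mono ?_
  exact inter_subset_left.trans (extend_target_subset_range _)

theorem extDerivWithin_pullMap_eq {p : ℕ} {e : OpenPartialHomeomorph M H}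
    (he : e ∈ maximalAtlas I ∞ M) {ψ : F → M} {s : Set F} {z : F} {α : DiffForm I M p}
    (hα : DifferentiableWithinAt ℝ (chartForm e α) (range I) (e.extend I (ψ z)))
    (hψ : ContMDiffWithinAt 𝓘(ℝ, F) I ∞ ψ s z) (hz : ψ z ∈ e.source)
    (hs : UniqueDiffOn ℝ s) (hzs : z ∈ s) (hzc : z ∈ closure (interior s)) :
    extDerivWithin (pullMap ψ s α) s z =
      (extDerivWithin (chartForm e α) (range I) (e.extend I (ψ z))).compContinuousLinearMap
        (fderivWithin ℝ (e.extend I ∘ ψ) s z) := by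
  have hθ := contDiffWithinAt_extend_comp he hψ hz
  have hev := eventually_pullMap_eq he α hψ hz hs hzs
  rw [hev.extDerivWithin_eq (hev.self_of_nhdsWithin hzs)]
  exact extDerivWithin_pullback (r := 2) hα (hθ.of_le (by norm_cast))
    (by simp) hs hzc hzs fun w _ => mem_range_self _

/-- The exterior derivative commutes with pull-backs. -/
theorem extDerivWithin_pullMap {p : ℕ} {ψ : F → M} {s : Set F} {z : F} {α : DiffForm I M p}
    (hα : IsCkAt 1 α (ψ z)) (hψ : ContMDiffWithinAt 𝓘(ℝ, F) I ∞ ψ s z)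
    (hs : UniqueDiffOn ℝ s) (hzs : z ∈ s) (hzc : z ∈ closure (interior s)) :
    extDerivWithin (pullMap ψ s α) s z = pullMap ψ s (dForm α) z := by
  have hx := mem_chart_source H (ψ z)
  have he := IsManifold.chart_mem_maximalAtlas (I := I) (n := ∞) (ψ z)
  rw [extDerivWithin_pullMap_eq he (hα.differentiableWithinAt one_ne_zero) hψ hx hs hzs hzc]
  have h := mfderiv_comp_mfderivWithin (I := 𝓘(ℝ, F)) (I' := I) (I'' := 𝓘(ℝ, Eu n)) z
    (((chartAt H (ψ z)).contMDiffAt_extend he hx).mdifferentiableAt (by simp))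
    (hψ.mdifferentiableWithinAt (by simp)) (hs z hzs).uniqueMDiffWithinAt
  rw [mfderivWithin_eq_fderivWithin] at h
  rw [h]
  rfl

theorem mem_closure_interior_range {y : Eu n} (hy : y ∈ range I) :
    y ∈ closure (interior (range I)) := I.range_subset_closure_interior hy

theorem chartForm_dForm {p : ℕ} {e : OpenPartialHomeomorph M H} (he : e ∈ maximalAtlas I ∞ M)
    {α : DiffForm I M p} {y : Eu n} (hy : y ∈ (e.extend I).target)
    (hα : IsCkAt 1 α ((e.extend I).symm y)) :
    chartForm e (dForm α) y = extDerivWithin (chartForm e α) (range I) y :=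
  (extDerivWithin_pullMap hα (contMDiffWithinAt_extend_symm he hy) I.uniqueDiffOn
    (extend_target_subset_range e hy)
    (mem_closure_interior_range (extend_target_subset_range e hy))).symm

theorem pullMap_dForm {p : ℕ} {ψ : F → M} {s : Set F} {z : F} {α : DiffForm I M p}
    (hα : IsCkAt 1 α (ψ z)) (hψ : ContMDiffWithinAt 𝓘(ℝ, F) I ∞ ψ s z) (hs : IsOpen s)
    (hzs : z ∈ s) : pullMap ψ s (dForm α) z = extDeriv (pullMap ψ s α) z := by
  rw [← extDerivWithin_pullMap hα hψ hs.uniqueDiffOn hzs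
    (subset_closure (by rwa [hs.interior_eq])), extDerivWithin,
    fderivWithin_of_isOpen hs hzs, extDeriv]

end PullRegularity


/-! ## Signs of frames -/

section Signs

open IsManifold (maximalAtlas)

theorem real_sign_mul (a b : ℝ) : Real.sign (a * b) = Real.sign a * Real.sign b := by
  rcases lt_trichotomy a 0 with ha | rfl | ha <;> rcases lt_trichotomy b 0 with hb | rfl | hb <;>
    simp [Real.sign_of_neg, Real.sign_of_pos, *, mul_pos_of_neg_of_neg, mul_neg_of_neg_of_pos,
      mul_neg_of_pos_of_neg]

theorem real_sign_mul_self (a : ℝ) : Real.sign a * a = |a| := by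
  rcases lt_trichotomy a 0 with ha | rfl | ha
  · simp [Real.sign_of_neg ha, abs_of_neg ha]
  · simp
  · simp [Real.sign_of_pos ha, abs_of_pos ha]

/-- The standard frame as a basis. -/
def stdBasis (n : ℕ) : Module.Basis (Fin n) ℝ (Eu n) := (EuclideanSpace.basisFun (Fin n) ℝ).toBasis

theorem coe_stdBasis (n : ℕ) : ⇑(stdBasis n) = stdFrame n := by
  ext i : 1
  simp [stdBasis, stdFrame]

theorem form_apply_comp_stdFrame {n : ℕ} (w : (Eu n) [⋀^Fin n]→L[ℝ] ℝ) (A : Eu n →L[ℝ] Eu n) :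
    (w fun i => A (stdFrame n i)) = A.det * w (stdFrame n) := by
  have := form_apply_comp_basis (stdBasis n) w A
  rwa [coe_stdBasis] at this

theorem orientSign_comp {V : Type*} [AddCommGroup V] [Module ℝ V] {n : ℕ}
    (b : Module.Basis (Fin n) ℝ V) (o : Orientation ℝ V (Fin n)) (A : V →ₗ[ℝ] V) (v : Fin n → V) :
    orientSign o (fun i => A (v i)) = Real.sign (LinearMap.det A) * orientSign o v := by
  unfold orientSign
  rw [← real_sign_mul]
  congr 1
  have h := AlternatingMap.eq_smul_basis_det b o.someVector
  have h2 : ∀ v, o.someVector v = o.someVector b * b.det v := fun v => by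
    have := congrArg (fun f : V [⋀^Fin n]→ₗ[ℝ] ℝ => f v) h
    simpa using this
  rw [h2 fun i => A (v i), h2 v]
  have := b.det_comp A v
  simp only [Function.comp_def] at this
  rw [this]; ring

theorem orientSign_eq_one_or {V : Type*} [AddCommGroup V] [Module ℝ V] {n : ℕ}
    (b : Module.Basis (Fin n) ℝ V) (o : Orientation ℝ V (Fin n)) :
    orientSign o b = -1 ∨ orientSign o b = 1 := by
  refine Real.sign_apply_eq_of_ne_zero _ ?_
  rw [AlternatingMap.map_basis_ne_zero_iff]
  exact Module.Ray.someVector_ne_zero o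

variable {n : ℕ} {H : Type*} [TopologicalSpace H] {I : ModelWithCorners ℝ (Eu n) H}
  {M : Type*} [TopologicalSpace M] [ChartedSpace H M]

/-- The sign of the frame induced by a map from the model space to `M`. -/
def pullSgn (o : ManifoldOrientation I M) (ψ : Eu n → M) (s : Set (Eu n)) (y : Eu n) : ℝ :=
  orientSign (o.orient (ψ y)) fun i => mfderivWithin 𝓘(ℝ, Eu n) I ψ s y (stdFrame n i)

/-- The sign of the coordinate frame of a chart. -/
def chartSgn (o : ManifoldOrientation I M) (e : OpenPartialHomeomorph M H) (y : Eu n) : ℝ :=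
  pullSgn o (e.extend I).symm (range I) y

theorem chartSign_eq_chartSgn (o : ManifoldOrientation I M) (x₀ : M) :
    o.chartSign x₀ = chartSgn o (chartAt H x₀) := rfl

theorem orient_congr (o : ManifoldOrientation I M) {x y : M} (h : x = y) :
    (o.orient x : Orientation ℝ (Eu n) (Fin n)) = o.orient y := by
  subst h; rfl

theorem orientSign_comp_stdFrame (o : Orientation ℝ (Eu n) (Fin n)) (A B : Eu n →L[ℝ] Eu n) :
    orientSign o (fun i => A (B (stdFrame n i))) =
      orientSign o (fun i => A (stdFrame n i)) * Real.sign B.det := by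
  have h1 := orientSign_comp (stdBasis n) o (A.comp B : Eu n →L[ℝ] Eu n).toLinearMap (stdFrame n)
  have h2 := orientSign_comp (stdBasis n) o A.toLinearMap (stdFrame n)
  have h3 : LinearMap.det (A.comp B : Eu n →L[ℝ] Eu n).toLinearMap =
      LinearMap.det A.toLinearMap * B.det := by
    rw [ContinuousLinearMap.det, ← LinearMap.det_comp]; rfl
  rw [h3, real_sign_mul] at h1
  refine h1.trans ?_
  refine Eq.trans ?_ (congrArg (· * Real.sign B.det) h2.symm)
  ring

theorem pullSgn_eq_chartSgn [IsManifold I ∞ M] (o : ManifoldOrientation I M)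
    {e : OpenPartialHomeomorph M H} (he : e ∈ maximalAtlas I ∞ M) {ψ : Eu n → M} {s : Set (Eu n)}
    {z : Eu n} (hψ : MDifferentiableWithinAt 𝓘(ℝ, Eu n) I ψ s z) (hz : ψ z ∈ e.source)
    (hs : UniqueDiffWithinAt ℝ s z) :
    pullSgn o ψ s z = chartSgn o e (e.extend I (ψ z)) *
      Real.sign (fderivWithin ℝ (e.extend I ∘ ψ) s z).det := by
  have h1 := mfderivWithin_eq_comp_fderivWithin he hψ hz hs
  have h2 := orientSign_comp_stdFrame (o.orient (ψ z)) (mfderivWithin 𝓘(ℝ, Eu n) I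
    (e.extend I).symm (range I) (e.extend I (ψ z))) (fderivWithin ℝ (e.extend I ∘ ψ) s z)
  have hz' : (e.extend I).symm (e.extend I (ψ z)) = ψ z := e.extend_left_inv hz
  refine Eq.trans ?_ (h2.trans ?_)
  · exact congrArg (fun A : Eu n →L[ℝ] Eu n =>
      orientSign (V := Eu n) (o.orient (ψ z)) fun i => A (stdFrame n i)) h1
  · refine congrArg (· * _) ?_
    exact congrArg (fun O : Orientation ℝ (Eu n) (Fin n) => orientSign O fun i =>
      (mfderivWithin 𝓘(ℝ, Eu n) I (e.extend I).symm (range I) (e.extend I (ψ z)) : Eu n →L[ℝ] Eu n)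
        (stdFrame n i)) (orient_congr o hz'.symm)

theorem pullSgn_eq_one_or (o : ManifoldOrientation I M) {ψ : Eu n → M} {s : Set (Eu n)} {z : Eu n}
    (h : Function.Injective (mfderivWithin 𝓘(ℝ, Eu n) I ψ s z)) :
    pullSgn o ψ s z = -1 ∨ pullSgn o ψ s z = 1 := by
  let A : Eu n →ₗ[ℝ] Eu n :=
    (mfderivWithin 𝓘(ℝ, Eu n) I ψ s z : Eu n →L[ℝ] Eu n).toLinearMap
  have hA : Function.Injective A := h
  let b := (stdBasis n).map (LinearEquiv.ofInjectiveEndo A hA)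
  have := orientSign_eq_one_or (V := Eu n) b (o.orient (ψ z))
  have hb : ⇑b = fun i => A (stdFrame n i) := by
    ext i : 1
    simp [b, coe_stdBasis]
  rw [hb] at this
  exact this

theorem chartSgn_extendCoordChange [IsManifold I ∞ M] (o : ManifoldOrientation I M)
    {e e' : OpenPartialHomeomorph M H} (he : e ∈ maximalAtlas I ∞ M)
    (he' : e' ∈ maximalAtlas I ∞ M) {y : Eu n} (hy : y ∈ (e.extend I).target)
    (hy' : (e.extend I).symm y ∈ e'.source) :
    chartSgn o e y = chartSgn o e' (I.extendCoordChange e e' y) *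
      Real.sign (fderivWithin ℝ (I.extendCoordChange e e') (range I) y).det :=
  pullSgn_eq_chartSgn o he' (mdifferentiableWithinAt_extend_symm he hy) hy'
    (I.uniqueDiffOn y (extend_target_subset_range e hy))

theorem chartForm_extendCoordChange [IsManifold I ∞ M] {p : ℕ} (α : DiffForm I M p)
    {e e' : OpenPartialHomeomorph M H} (he : e ∈ maximalAtlas I ∞ M)
    (he' : e' ∈ maximalAtlas I ∞ M) {y : Eu n} (hy : y ∈ (e.extend I).target)
    (hy' : (e.extend I).symm y ∈ e'.source) :
    chartForm e α y = (chartForm e' α (I.extendCoordChange e e' y)).compContinuousLinearMap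
      (fderivWithin ℝ (I.extendCoordChange e e') (range I) y) :=
  pullMap_eq_chartForm he' α (mdifferentiableWithinAt_extend_symm he hy) hy'
    (I.uniqueDiffOn y (extend_target_subset_range e hy))

theorem mfderiv_extend_mfderivWithin_extend_symm [IsManifold I ∞ M]
    {e : OpenPartialHomeomorph M H} (he : e ∈ maximalAtlas I ∞ M) {y : Eu n}
    (hy : y ∈ (e.extend I).target) (v : Eu n) :
    mfderiv I 𝓘(ℝ, Eu n) (e.extend I) ((e.extend I).symm y)
      (mfderivWithin 𝓘(ℝ, Eu n) I (e.extend I).symm (range I) y v) = v := by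
  have hr := extend_target_subset_range e hy
  have h := mfderiv_comp_mfderivWithin (I := 𝓘(ℝ, Eu n)) (I' := I) (I'' := 𝓘(ℝ, Eu n)) y
    ((e.contMDiffAt_extend he (extend_symm_mem_source hy)).mdifferentiableAt (by simp))
    (mdifferentiableWithinAt_extend_symm he hy) (I.uniqueDiffOn y hr).uniqueMDiffWithinAt
  have h2 : mfderivWithin 𝓘(ℝ, Eu n) 𝓘(ℝ, Eu n) (e.extend I ∘ (e.extend I).symm) (range I) y =
      ContinuousLinearMap.id ℝ (Eu n) := by
    rw [mfderivWithin_eq_fderivWithin]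
    refine Eq.trans (Filter.EventuallyEq.fderivWithin_eq_of_mem (f₁ := e.extend I ∘ (e.extend I).symm)
      (f := id) ?_ hr) (fderivWithin_id (I.uniqueDiffOn y hr))
    filter_upwards [extend_target_mem_nhdsWithin hy] with z hz
    exact (e.extend I).right_inv hz
  exact congrArg (fun L : Eu n →L[ℝ] Eu n => L v) (h.symm.trans h2)

theorem injective_mfderivWithin_extend_symm [IsManifold I ∞ M]
    {e : OpenPartialHomeomorph M H} (he : e ∈ maximalAtlas I ∞ M) {y : Eu n}
    (hy : y ∈ (e.extend I).target) :
    Function.Injective (mfderivWithin 𝓘(ℝ, Eu n) I (e.extend I).symm (range I) y) := fun a b hab =>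
  (mfderiv_extend_mfderivWithin_extend_symm he hy a).symm.trans
    ((congrArg _ hab).trans (mfderiv_extend_mfderivWithin_extend_symm he hy b))

theorem chartSgn_eq_one_or [IsManifold I ∞ M] (o : ManifoldOrientation I M)
    {e : OpenPartialHomeomorph M H} (he : e ∈ maximalAtlas I ∞ M) {y : Eu n}
    (hy : y ∈ (e.extend I).target) : chartSgn o e y = -1 ∨ chartSgn o e y = 1 :=
  pullSgn_eq_one_or o (injective_mfderivWithin_extend_symm he hy)

theorem eventually_real_sign_eq {X : Type*} {l : Filter X} {f : X → ℝ} {a : ℝ}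
    (h : Tendsto f l (𝓝 a)) (ha : a ≠ 0) : ∀ᶠ x in l, Real.sign (f x) = Real.sign a := by
  rcases ha.lt_or_gt with ha | ha
  · filter_upwards [h.eventually (gt_mem_nhds ha)] with x hx
    rw [Real.sign_of_neg hx, Real.sign_of_neg ha]
  · filter_upwards [h.eventually (lt_mem_nhds ha)] with x hx
    rw [Real.sign_of_pos hx, Real.sign_of_pos ha]

/-- The sign of the frame of an immersion between manifolds of the same dimension is locally
constant. -/
theorem eventually_pullSgn_eq [IsManifold I ∞ M] (o : ManifoldOrientation I M) {ψ : Eu n → M}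
    {s : Set (Eu n)} {z : Eu n} (hψ : ContMDiffWithinAt 𝓘(ℝ, Eu n) I ∞ ψ s z)
    (hs : UniqueDiffOn ℝ s) (hzs : z ∈ s)
    (hinj : Function.Injective (mfderivWithin 𝓘(ℝ, Eu n) I ψ s z)) :
    ∀ᶠ w in 𝓝[s] z, pullSgn o ψ s w = pullSgn o ψ s z := by
  have he := IsManifold.chart_mem_maximalAtlas (I := I) (n := ∞) (ψ z)
  have hx := mem_chart_source H (ψ z)
  have hθ : ContDiffWithinAt ℝ ∞ (extChartAt I (ψ z) ∘ ψ) s z :=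
    contDiffWithinAt_extend_comp he hψ hx
  have hc : ContinuousWithinAt (fun w => (fderivWithin ℝ (extChartAt I (ψ z) ∘ ψ) s w).det) s z :=
    ContinuousLinearMap.continuous_det.continuousAt.comp_continuousWithinAt
      (hθ.fderivWithin_right (m := 0) hs (by simp) hzs).continuousWithinAt
  have h0 : pullSgn o ψ s z ≠ 0 := by
    rcases pullSgn_eq_one_or o hinj with h | h <;> rw [h] <;> norm_num
  have hz := pullSgn_eq_chartSgn o he (hψ.mdifferentiableWithinAt (by simp)) hx (hs z hzs)
  have hdet : (fderivWithin ℝ (extChartAt I (ψ z) ∘ ψ) s z).det ≠ 0 := by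
    intro h
    apply h0
    rw [hz]
    change _ * Real.sign (fderivWithin ℝ (extChartAt I (ψ z) ∘ ψ) s z).det = 0
    rw [h]; simp
  have hloc := hψ.continuousWithinAt.eventually (o.locally_constant (ψ z))
  filter_upwards [eventually_mdifferentiableWithinAt hψ hzs, self_mem_nhdsWithin,
    hψ.continuousWithinAt.preimage_mem_nhdsWithin ((chartAt H (ψ z)).open_source.mem_nhds hx),
    eventually_real_sign_eq hc hdet, hloc] with w h1 h2 h3 h4 h5
  rw [hz, pullSgn_eq_chartSgn o he h1 h3 (hs w h2)]
  exact congrArg₂ (· * ·) h5 h4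

theorem eventually_chartSgn_eq [IsManifold I ∞ M] (o : ManifoldOrientation I M)
    {e : OpenPartialHomeomorph M H} (he : e ∈ maximalAtlas I ∞ M) {y : Eu n}
    (hy : y ∈ (e.extend I).target) : ∀ᶠ z in 𝓝[range I] y, chartSgn o e z = chartSgn o e y :=
  eventually_pullSgn_eq o (contMDiffWithinAt_extend_symm he hy) I.uniqueDiffOn
    (extend_target_subset_range e hy) (injective_mfderivWithin_extend_symm he hy)

theorem continuousOn_chartSgn [IsManifold I ∞ M] (o : ManifoldOrientation I M)
    {e : OpenPartialHomeomorph M H} (he : e ∈ maximalAtlas I ∞ M) :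
    ContinuousOn (chartSgn o e) (e.extend I).target := fun y hy =>
  (continuousWithinAt_const.congr_of_eventuallyEq (f := fun _ => chartSgn o e y)
    (eventually_chartSgn_eq o he hy) rfl).mono (extend_target_subset_range e)

end Signs


/-! ## Integration in charts -/

section IntegralChart

open IsManifold (maximalAtlas)

variable {n : ℕ} {H : Type*} [TopologicalSpace H] {I : ModelWithCorners ℝ (Eu n) H}
  {M : Type*} [TopologicalSpace M] [ChartedSpace H M]

theorem measurableSet_extend_target (e : OpenPartialHomeomorph M H) :
    MeasurableSet (e.extend I).target := by
  rw [OpenPartialHomeomorph.extend_target]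
  exact ((e.open_target.preimage I.continuous_symm).measurableSet).inter
    I.isClosed_range.measurableSet

theorem mem_extendCoordChange_source {e e' : OpenPartialHomeomorph M H} {y : Eu n} :
    y ∈ (I.extendCoordChange e e').source ↔
      y ∈ (e.extend I).target ∧ (e.extend I).symm y ∈ e'.source := by
  rw [ModelWithCorners.extendCoordChange, PartialEquiv.trans_source, mem_inter_iff, mem_preimage,
    e'.extend_source]
  rfl

theorem chartForm_eq_zero {p : ℕ} {α : DiffForm I M p} {e : OpenPartialHomeomorph M H} {y : Eu n}
    (h : α ((e.extend I).symm y) = 0) : chartForm e α y = 0 := by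
  ext v
  rw [chartForm, pullMap, h]
  rfl

theorem HasLocallyIntegrableCoeffs.of_isCkAt [IsManifold I ∞ M] {p : ℕ} {α : DiffForm I M p}
    (h : ∀ x, IsCkAt 0 α x) : HasLocallyIntegrableCoeffs α := by
  intro x₀
  refine ContinuousOn.locallyIntegrableOn ?_ (measurableSet_extend_target _)
  intro y hy
  exact (((h _).chartForm (by simp) (IsManifold.chart_mem_maximalAtlas x₀)
    hy).continuousWithinAt).mono (extend_target_subset_range _)

/-- A form which vanishes outside of a compact set and has locally integrable coefficients. -/
structure IsIntegrableForm {p : ℕ} (α : DiffForm I M p) : Prop where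
  coeffs : HasLocallyIntegrableCoeffs α
  exists_isCompact : ∃ K, IsCompact K ∧ ∀ x ∉ K, α x = 0

theorem localForm_add {p : ℕ} (α β : DiffForm I M p) (x₀ : M) :
    localForm (α + β) x₀ = localForm α x₀ + localForm β x₀ := rfl

theorem localForm_smul {p : ℕ} (c : ℝ) (α : DiffForm I M p) (x₀ : M) :
    localForm (c • α) x₀ = c • localForm α x₀ := rfl

theorem chartForm_add {p : ℕ} (e : OpenPartialHomeomorph M H) (α β : DiffForm I M p) :
    chartForm e (α + β) = chartForm e α + chartForm e β := rfl

theorem chartForm_smul {p : ℕ} (e : OpenPartialHomeomorph M H) (c : ℝ) (α : DiffForm I M p) :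
    chartForm e (c • α) = c • chartForm e α := rfl

theorem integrableOn_add {X E : Type*} [MeasurableSpace X] [NormedAddCommGroup E] {μ : Measure X}
    {s : Set X} {f g : X → E} (hf : IntegrableOn f s μ) (hg : IntegrableOn g s μ) :
    IntegrableOn (f + g) s μ := Integrable.add hf hg

theorem IsIntegrableForm.add {p : ℕ} {α β : DiffForm I M p} (hα : IsIntegrableForm α)
    (hβ : IsIntegrableForm β) : IsIntegrableForm (α + β) := by
  obtain ⟨K, hK, h0⟩ := hα.exists_isCompact
  obtain ⟨L, hL, h1⟩ := hβ.exists_isCompact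
  refine ⟨fun x₀ => ?_, K ∪ L, hK.union hL, fun x hx => ?_⟩
  · rw [localForm_add]
    intro y hy
    obtain ⟨u, hu, hu'⟩ := hα.coeffs x₀ y hy
    obtain ⟨v, hv, hv'⟩ := hβ.coeffs x₀ y hy
    exact ⟨u ∩ v, inter_mem hu hv, integrableOn_add (hu'.mono_set inter_subset_left)
      (hv'.mono_set inter_subset_right)⟩
  rw [mem_union, not_or] at hx
  rw [Pi.add_apply, h0 x hx.1, h1 x hx.2, add_zero]

theorem IsIntegrableForm.smul {p : ℕ} {α : DiffForm I M p} (hα : IsIntegrableForm α) (c : ℝ) :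
    IsIntegrableForm (c • α) := by
  obtain ⟨K, hK, h0⟩ := hα.exists_isCompact
  refine ⟨fun x₀ => (hα.coeffs x₀).smul c, K, hK, fun x hx => ?_⟩
  rw [Pi.smul_apply, h0 x hx, smul_zero]

theorem IsIntegrableForm.zero {p : ℕ} : IsIntegrableForm (0 : DiffForm I M p) := by
  refine ⟨fun x₀ => ?_, ∅, isCompact_empty, fun _ _ => rfl⟩
  have : localForm (0 : DiffForm I M p) x₀ = 0 := by
    funext y
    exact chartForm_eq_zero (e := chartAt H x₀) rfl
  rw [this]
  exact fun y _ => ⟨univ, univ_mem, integrable_zero (Eu n) (Eu n [⋀^Fin p]→L[ℝ] ℝ) _⟩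

theorem IsIntegrableForm.sum {ι : Type*} {p : ℕ} (s : Finset ι) {α : ι → DiffForm I M p}
    (h : ∀ i ∈ s, IsIntegrableForm (α i)) : IsIntegrableForm (∑ i ∈ s, α i) :=
  Finset.sum_induction _ IsIntegrableForm (fun _ _ => IsIntegrableForm.add) IsIntegrableForm.zero h

theorem integrableOn_mul_of_eq_zero {c g : Eu n → ℝ} {K T : Set (Eu n)} (hT : MeasurableSet T)
    (hK : IsCompact K) (hKT : K ⊆ T) (hc : ContinuousOn c K) (hg : LocallyIntegrableOn g T)
    (h0 : ∀ y ∈ T \ K, c y * g y = 0) : IntegrableOn (fun y => c y * g y) T :=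
  (IntegrableOn.continuousOn_mul hc (hg.integrableOn_compact_subset hKT hK)
    hK).of_forall_sdiff_eq_zero hT h0

variable [IsManifold I ∞ M] [T2Space M] [SigmaCompactSpace M]

theorem chartPartition_isSubordinate :
    (chartPartition I M).IsSubordinate fun x => (chartAt H x).source :=
  Classical.choose_spec (SmoothPartitionOfUnity.exists_isSubordinate_chartAt_source I M)

theorem chartPartition_eq_zero {i x : M} (hx : x ∉ (chartAt H i).source) :
    chartPartition I M i x = 0 := by
  by_contra h
  exact hx (chartPartition_isSubordinate i (subset_tsupport _ h))

theorem finite_chartPartition_ne_zero {K : Set M} (hK : IsCompact K) :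
    {i | ∃ x ∈ K, chartPartition I M i x ≠ 0}.Finite := by
  refine ((chartPartition I M).locallyFinite.finite_nonempty_inter_compact hK).subset ?_
  rintro i ⟨x, hx, hi⟩
  exact ⟨x, hi, hx⟩

theorem sum_chartPartition {s : Finset M} {x : M} (hs : ∀ i, chartPartition I M i x ≠ 0 → i ∈ s) :
    ∑ i ∈ s, chartPartition I M i x = 1 := by
  have := (chartPartition I M).sum_eq_one (mem_univ x)
  rwa [finsum_eq_sum_of_support_subset _ (s := s)] at this
  exact fun i hi => hs i hi

/-- The part of the integrand supported in one of the preferred charts. -/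
def integralTerm (o : ManifoldOrientation I M) (α : DiffForm I M n) (i : M) (y : Eu n) : ℝ :=
  chartPartition I M i ((extChartAt I i).symm y) *
    (o.chartSign i y * localForm α i y (stdFrame n))

theorem integrableOn_integralTerm (o : ManifoldOrientation I M) {α : DiffForm I M n}
    (hα : IsIntegrableForm α) (i : M) :
    IntegrableOn (integralTerm o α i) (extChartAt I i).target := by
  obtain ⟨K, hK, h0⟩ := hα.exists_isCompact
  have hsub : K ∩ tsupport (chartPartition I M i) ⊆ (chartAt H i).source :=
    inter_subset_right.trans (chartPartition_isSubordinate i)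
  have hcont : ContinuousOn (extChartAt I i) (K ∩ tsupport (chartPartition I M i)) :=
    (continuousOn_extChartAt i).mono (by rwa [extChartAt_source])
  have hTS : (extChartAt I i) '' (K ∩ tsupport (chartPartition I M i)) ⊆ (extChartAt I i).target := by
    rintro _ ⟨x, hx, rfl⟩
    exact extend_mem_target (hsub hx)
  have hloc : LocallyIntegrableOn (fun y => localForm α i y (stdFrame n))
      (extChartAt I i).target := by
    refine (locallyIntegrableOn_iff ?_).2 fun k hk hkc => ?_
    · rw [extChartAt_target]
      exact ((chartAt H i).open_target.preimage I.continuous_symm).isLocallyClosed.inter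
        I.isClosed_range.isLocallyClosed
    · exact (ContinuousAlternatingMap.apply ℝ (Eu n) ℝ (stdFrame n)).integrable_comp
        ((hα.coeffs i).integrableOn_compact_subset hk hkc)
  have := integrableOn_mul_of_eq_zero (c := fun y => chartPartition I M i ((extChartAt I i).symm y) *
    o.chartSign i y) (measurableSet_extend_target (chartAt H i))
    ((hK.inter_right (isClosed_tsupport _)).image_of_continuousOn hcont) hTS ?_ hloc ?_
  · refine this.congr_fun (fun y _ => ?_) (measurableSet_extend_target (chartAt H i))
    simp only [integralTerm]; ring
  · refine ContinuousOn.mul ?_ ((continuousOn_chartSgn o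
      (IsManifold.chart_mem_maximalAtlas i)).mono hTS)
    exact ((chartPartition I M i).contMDiff.continuous).comp_continuousOn
      ((continuousOn_extChartAt_symm i).mono hTS)
  · rintro y ⟨hy, hyK⟩
    by_cases hx : (extChartAt I i).symm y ∈ K
    · have : chartPartition I M i ((extChartAt I i).symm y) = 0 := by
        by_contra h
        exact hyK ⟨_, ⟨hx, subset_tsupport _ h⟩, (extChartAt I i).right_inv hy⟩
      rw [this, zero_mul, zero_mul]
    · have : localForm α i y = 0 := chartForm_eq_zero (e := chartAt H i) (h0 _ hx)
      simp [this]

theorem integral_eq_sum (o : ManifoldOrientation I M) {α : DiffForm I M n} {s : Finset M}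
    (hs : ∀ i x, chartPartition I M i x ≠ 0 → α x ≠ 0 → i ∈ s) :
    integral o α = ∑ i ∈ s, ∫ y in (extChartAt I i).target, integralTerm o α i y := by
  refine finsum_eq_sum_of_support_subset _ fun i hi => ?_
  by_contra his
  refine hi (Eq.trans (setIntegral_congr_fun (g := fun _ => (0 : ℝ))
    (measurableSet_extend_target (chartAt H i)) fun y hy => ?_) (by simp))
  change integralTerm o α i y = 0
  rw [integralTerm]
  by_cases hx : chartPartition I M i ((extChartAt I i).symm y) = 0
  · rw [hx, zero_mul]
  · have h0 : α ((extChartAt I i).symm y) = 0 := by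
      by_contra h
      exact his (hs i _ hx h)
    have : localForm α i y = 0 := chartForm_eq_zero (e := chartAt H i) h0
    simp [this]

theorem integral_add (o : ManifoldOrientation I M) {α β : DiffForm I M n}
    (hα : IsIntegrableForm α) (hβ : IsIntegrableForm β) :
    integral o (α + β) = integral o α + integral o β := by
  obtain ⟨K, hK, h0⟩ := hα.exists_isCompact
  obtain ⟨L, hL, h1⟩ := hβ.exists_isCompact
  have hfin := finite_chartPartition_ne_zero (I := I) (hK.union hL)
  have hK' : ∀ x, α x ≠ 0 → x ∈ K := fun x hx => by_contra fun h => hx (h0 x h)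
  have hL' : ∀ x, β x ≠ 0 → x ∈ L := fun x hx => by_contra fun h => hx (h1 x h)
  rw [integral_eq_sum o (α := α) (s := hfin.toFinset), integral_eq_sum o (α := β)
    (s := hfin.toFinset), integral_eq_sum o (α := α + β) (s := hfin.toFinset),
    ← Finset.sum_add_distrib]
  · refine Finset.sum_congr rfl fun i _ => ?_
    rw [← MeasureTheory.integral_add (integrableOn_integralTerm o hα i)
      (integrableOn_integralTerm o hβ i)]
    refine setIntegral_congr_fun (measurableSet_extend_target (chartAt H i)) fun y _ => ?_
    simp only [integralTerm, localForm_add, Pi.add_apply, ContinuousAlternatingMap.add_apply]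
    ring
  · intro i x hi hx
    rw [Finite.mem_toFinset]
    refine ⟨x, ?_, hi⟩
    by_contra h
    rw [mem_union, not_or] at h
    exact hx (by rw [Pi.add_apply, h0 x h.1, h1 x h.2, add_zero])
  · exact fun i x hi hx => by simpa using ⟨x, Or.inr (hL' x hx), hi⟩
  · exact fun i x hi hx => by simpa using ⟨x, Or.inl (hK' x hx), hi⟩

theorem integral_smul (o : ManifoldOrientation I M) (c : ℝ) (α : DiffForm I M n) :
    integral o (c • α) = c * integral o α := by
  unfold integral
  rw [← smul_eq_mul, smul_finsum]
  refine finsum_congr fun i => ?_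
  rw [← MeasureTheory.integral_smul]
  refine setIntegral_congr_fun (measurableSet_extend_target (chartAt H i)) fun y _ => ?_
  simp only [localForm_smul, Pi.smul_apply, ContinuousAlternatingMap.smul_apply, smul_eq_mul]
  ring

theorem integral_zero (o : ManifoldOrientation I M) : integral o (0 : DiffForm I M n) = 0 := by
  have := integral_smul o 0 (0 : DiffForm I M n)
  rwa [zero_smul, zero_mul] at this

theorem integral_sum {ι : Type*} (o : ManifoldOrientation I M) (s : Finset ι)
    {α : ι → DiffForm I M n} (h : ∀ i ∈ s, IsIntegrableForm (α i)) :
    integral o (∑ i ∈ s, α i) = ∑ i ∈ s, integral o (α i) := by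
  classical
  induction s using Finset.induction_on with
  | empty => simp [integral_zero]
  | insert a s ha ih =>
    rw [Finset.sum_insert ha, Finset.sum_insert ha, integral_add o (h a (by simp))
      (IsIntegrableForm.sum s fun i hi => h i (by simp [hi])), ih fun i hi => h i (by simp [hi])]

theorem integralTerm_eq (o : ManifoldOrientation I M) (α : DiffForm I M n) {i : M}
    {e : OpenPartialHomeomorph M H} (he : e ∈ maximalAtlas I ∞ M) {y : Eu n}
    (hy : y ∈ (I.extendCoordChange (chartAt H i) e).source) :
    integralTerm o α i y =
      |(fderivWithin ℝ (I.extendCoordChange (chartAt H i) e) (range I) y).det| •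
        (chartPartition I M i ((e.extend I).symm (I.extendCoordChange (chartAt H i) e y)) *
          (chartSgn o e (I.extendCoordChange (chartAt H i) e y) *
            chartForm e α (I.extendCoordChange (chartAt H i) e y) (stdFrame n))) := by
  rw [mem_extendCoordChange_source] at hy
  have hi := IsManifold.chart_mem_maximalAtlas (I := I) (n := ∞) i
  have h1 : (e.extend I).symm (I.extendCoordChange (chartAt H i) e y) = (extChartAt I i).symm y :=
    e.extend_left_inv hy.2
  rw [integralTerm, chartSign_eq_chartSgn, localForm_eq_chartForm,
    chartSgn_extendCoordChange o hi he hy.1 hy.2, chartForm_extendCoordChange α hi he hy.1 hy.2,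
    ContinuousAlternatingMap.compContinuousLinearMap_apply, h1, smul_eq_mul]
  have := form_apply_comp_stdFrame (chartForm e α (I.extendCoordChange (chartAt H i) e y))
    (fderivWithin ℝ (I.extendCoordChange (chartAt H i) e) (range I) y)
  simp only [Function.comp_def]
  rw [this, ← real_sign_mul_self]
  ring

theorem integral_term_eq_chart (o : ManifoldOrientation I M) {α : DiffForm I M n}
    (hα : IsIntegrableForm α) {e : OpenPartialHomeomorph M H} (he : e ∈ maximalAtlas I ∞ M)
    (h0 : ∀ x ∉ e.source, α x = 0) (i : M) :
    IntegrableOn (fun y => chartPartition I M i ((e.extend I).symm y) *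
      (chartSgn o e y * chartForm e α y (stdFrame n))) (e.extend I).target ∧
    ∫ y in (extChartAt I i).target, integralTerm o α i y =
      ∫ y in (e.extend I).target, chartPartition I M i ((e.extend I).symm y) *
        (chartSgn o e y * chartForm e α y (stdFrame n)) := by
  have hi := IsManifold.chart_mem_maximalAtlas (I := I) (n := ∞) i
  set θ := I.extendCoordChange (chartAt H i) e with hθ
  have hS : θ.source ⊆ (extChartAt I i).target := fun y hy =>
    (mem_extendCoordChange_source.1 hy).1
  have hT : θ.target ⊆ (e.extend I).target := fun y hy => by
    rw [hθ, ← PartialEquiv.symm_source, ModelWithCorners.extendCoordChange_symm] at hy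
    exact (mem_extendCoordChange_source.1 hy).1
  have hms : MeasurableSet θ.source := by
    rw [hθ, ModelWithCorners.extendCoordChange_source, I.image_eq]
    exact (((OpenPartialHomeomorph.open_source _).preimage I.continuous_symm).measurableSet).inter
      I.isClosed_range.measurableSet
  have hd : ∀ y ∈ θ.source, HasFDerivWithinAt θ (fderivWithin ℝ θ (range I) y) θ.source y := by
    intro y hy
    exact ((I.contDiffWithinAt_extendCoordChange hi he hy).differentiableWithinAt
      (by simp)).hasFDerivWithinAt.mono (hS.trans (extend_target_subset_range _))
  have hz1 : ∀ y ∈ (extChartAt I i).target \ θ.source, integralTerm o α i y = 0 := by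
    rintro y ⟨hy, hyS⟩
    have hx : (extChartAt I i).symm y ∉ e.source := fun h =>
      hyS (mem_extendCoordChange_source.2 ⟨hy, h⟩)
    have : localForm α i y = 0 := chartForm_eq_zero (e := chartAt H i) (h0 _ hx)
    simp [integralTerm, this]
  have hz2 : ∀ y ∈ (e.extend I).target \ θ.target,
      chartPartition I M i ((e.extend I).symm y) *
        (chartSgn o e y * chartForm e α y (stdFrame n)) = 0 := by
    rintro y ⟨hy, hyT⟩
    rw [chartPartition_eq_zero, zero_mul]
    intro h
    refine hyT ?_
    rw [hθ, ← PartialEquiv.symm_source, ModelWithCorners.extendCoordChange_symm]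
    exact mem_extendCoordChange_source.2 ⟨hy, h⟩
  have hint := (integrableOn_integralTerm o hα i).mono_set hS
  constructor
  · refine IntegrableOn.of_forall_sdiff_eq_zero (s := θ.target) ?_ (measurableSet_extend_target e) hz2
    rw [← θ.image_source_eq_target, integrableOn_image_iff_integrableOn_abs_det_fderiv_smul volume
      hms hd θ.injOn]
    exact hint.congr_fun (fun y hy => integralTerm_eq o α he hy) hms
  · refine (setIntegral_eq_of_subset_of_forall_sdiff_eq_zero
      (measurableSet_extend_target (chartAt H i)) hS hz1).trans ?_
    rw [setIntegral_eq_of_subset_of_forall_sdiff_eq_zero (measurableSet_extend_target _) hT hz2,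
      ← θ.image_source_eq_target, integral_image_eq_integral_abs_det_fderiv_smul volume
      hms hd θ.injOn]
    exact setIntegral_congr_fun hms fun y hy => integralTerm_eq o α he hy

/-- The integral of a form supported in a chart domain can be computed in this chart. -/
theorem integral_eq_chart (o : ManifoldOrientation I M) {α : DiffForm I M n}
    (hα : IsIntegrableForm α) {e : OpenPartialHomeomorph M H} (he : e ∈ maximalAtlas I ∞ M)
    (h0 : ∀ x ∉ e.source, α x = 0) :
    IntegrableOn (fun y => chartSgn o e y * chartForm e α y (stdFrame n)) (e.extend I).target ∧
    integral o α = ∫ y in (e.extend I).target, chartSgn o e y * chartForm e α y (stdFrame n) := by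
  obtain ⟨K, hK, hK0⟩ := hα.exists_isCompact
  have hfin := finite_chartPartition_ne_zero (I := I) hK
  have hK' : ∀ x, α x ≠ 0 → x ∈ K := fun x hx => by_contra fun h => hx (hK0 x h)
  have hsum : ∀ y ∈ (e.extend I).target, ∑ i ∈ hfin.toFinset,
      chartPartition I M i ((e.extend I).symm y) * (chartSgn o e y * chartForm e α y (stdFrame n)) =
      chartSgn o e y * chartForm e α y (stdFrame n) := by
    intro y hy
    by_cases hx : α ((e.extend I).symm y) = 0
    · have : chartForm e α y = 0 := chartForm_eq_zero hx
      simp [this]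
    · rw [← Finset.sum_mul, sum_chartPartition, one_mul]
      exact fun i hi => by simpa using ⟨_, hK' _ hx, hi⟩
  have hm := measurableSet_extend_target (I := I) e
  constructor
  · exact (integrable_finsetSum _ fun i _ => (integral_term_eq_chart o hα he h0 i).1).congr
      ((ae_restrict_iff' hm).2 (ae_of_all _ hsum))
  · rw [integral_eq_sum o (s := hfin.toFinset), ← setIntegral_congr_fun hm hsum,
      integral_finsetSum _ fun i _ => (integral_term_eq_chart o hα he h0 i).1]
    · exact Finset.sum_congr rfl fun i _ => (integral_term_eq_chart o hα he h0 i).2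
    · exact fun i x hi hx => by simpa using ⟨x, hK' x hx, hi⟩

end IntegralChart


/-! ## Operations on forms -/

section Operations

open IsManifold (maximalAtlas)

/-- A bilinear expression of an integrable and a continuous function is integrable on compact
sets. -/
theorem IntegrableOn.bilin_continuousOn {X E F G : Type*} [TopologicalSpace X] [MeasurableSpace X]
    [OpensMeasurableSpace X] [T2Space X] {μ : Measure X} [IsFiniteMeasureOnCompacts μ]
    [NormedAddCommGroup E] [NormedSpace ℝ E]
    [NormedAddCommGroup F] [NormedSpace ℝ F] [NormedAddCommGroup G] [NormedSpace ℝ G]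
    (B : E →L[ℝ] F →L[ℝ] G) {a : X → E} {b : X → F} {K : Set X} (hK : IsCompact K)
    (ha : IntegrableOn a K μ) (hb : ContinuousOn b K) :
    IntegrableOn (fun x => B (a x) (b x)) K μ := by
  obtain ⟨C, hC⟩ := hK.exists_bound_of_continuousOn hb
  refine Integrable.mono' (g := fun x => (‖B‖ * C) * ‖a x‖) (ha.norm.const_mul _) ?_ ?_
  · exact B.aestronglyMeasurable_comp₂ ha.aestronglyMeasurable
      (hb.aestronglyMeasurable_of_isCompact hK hK.measurableSet)
  · refine (ae_restrict_iff' hK.measurableSet).2 (ae_of_all _ fun x hx => ?_)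
    calc ‖B (a x) (b x)‖ ≤ ‖B‖ * ‖a x‖ * ‖b x‖ := B.le_opNorm₂ _ _
      _ ≤ ‖B‖ * ‖a x‖ * C := by gcongr; exact hC x hx
      _ = _ := by ring

variable {n : ℕ} {H : Type*} [TopologicalSpace H] {I : ModelWithCorners ℝ (Eu n) H}
  {M : Type*} [TopologicalSpace M] [ChartedSpace H M]
  {F : Type*} [NormedAddCommGroup F] [NormedSpace ℝ F]

/-- The wedge product of forms. -/
def wedgeForm {p q r : ℕ} (h : p + q = r) (α : DiffForm I M p) (β : DiffForm I M q) :
    DiffForm I M r := fun x => wedge h (α x) (β x)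

theorem pullMap_wedgeForm [FiniteDimensional ℝ F] {p q r : ℕ} (h : p + q = r) (α : DiffForm I M p)
    (β : DiffForm I M q) (ψ : F → M) (s : Set F) (z : F) :
    pullMap ψ s (wedgeForm h α β) z = wedge h (pullMap ψ s α z) (pullMap ψ s β z) :=
  wedge_compContinuousLinearMap (E := Eu n) (E' := F) h (α (ψ z)) (β (ψ z))
    (mfderivWithin 𝓘(ℝ, F) I ψ s z : F →L[ℝ] Eu n)

theorem chartForm_wedgeForm {p q r : ℕ} (h : p + q = r) (α : DiffForm I M p)
    (β : DiffForm I M q) (e : OpenPartialHomeomorph M H) (y : Eu n) :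
    chartForm e (wedgeForm h α β) y = wedge h (chartForm e α y) (chartForm e β y) :=
  pullMap_wedgeForm h α β _ _ y

theorem IsCkAt.add {p : ℕ} {r : ℕ∞ω} {α β : DiffForm I M p} {x : M} (hα : IsCkAt r α x)
    (hβ : IsCkAt r β x) : IsCkAt r (α + β) x := ContDiffWithinAt.add hα hβ

theorem IsCkAt.zero {p : ℕ} {r : ℕ∞ω} {x : M} : IsCkAt r (0 : DiffForm I M p) x := by
  have : localForm (0 : DiffForm I M p) x = fun _ => 0 := by
    funext y
    exact chartForm_eq_zero (e := chartAt H x) rfl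
  rw [IsCkAt, this]
  exact contDiffWithinAt_const

theorem IsCkAt.of_le {p : ℕ} {r r' : ℕ∞ω} {α : DiffForm I M p} {x : M} (hα : IsCkAt r α x)
    (h : r' ≤ r) : IsCkAt r' α x := ContDiffWithinAt.of_le hα h

theorem IsCkAt.wedgeForm {p q s : ℕ} {r : ℕ∞ω} (h : p + q = s) {α : DiffForm I M p}
    {β : DiffForm I M q} {x : M} (hα : IsCkAt r α x) (hβ : IsCkAt r β x) :
    IsCkAt r (wedgeForm h α β) x := by
  have : localForm (BlowUpCurrents.wedgeForm h α β) x =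
      fun y => wedgeCLM h (localForm α x y) (localForm β x y) := by
    funext y
    exact chartForm_wedgeForm h α β (chartAt H x) y
  rw [IsCkAt, this]
  exact (contDiffWithinAt_const.clm_apply hα).clm_apply hβ

theorem IsCkAt.fun_smul [IsManifold I ∞ M] {p : ℕ} {r : ℕ∞ω} (hr : r ≤ ∞) {g : M → ℝ}
    {α : DiffForm I M p} {x : M} (hg : ContMDiffAt I 𝓘(ℝ, ℝ) ∞ g x) (hα : IsCkAt r α x) :
    IsCkAt r (fun x => g x • α x : DiffForm I M p) x := by
  have h1 : ContDiffWithinAt ℝ ∞ (g ∘ (extChartAt I x).symm) (range I) (extChartAt I x x) := by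
    have h2 := contMDiffWithinAt_extend_symm (I := I) (IsManifold.chart_mem_maximalAtlas x)
      (mem_extChartAt_target (I := I) x)
    exact (ContMDiffAt.comp_contMDiffWithinAt_of_eq hg h2 (extChartAt_to_inv x)).contDiffWithinAt
  exact (h1.of_le hr).smul hα

theorem eventually_eq_extend_symm {e : OpenPartialHomeomorph M H} {y : Eu n}
    (hy : y ∈ (e.extend I).target) {P : M → Prop} (h : ∀ᶠ x in 𝓝 ((e.extend I).symm y), P x) :
    ∀ᶠ z in 𝓝[range I] y, P ((e.extend I).symm z) :=
  preimage_extend_symm_mem_nhdsWithin hy h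

theorem chartForm_congr {p : ℕ} {α β : DiffForm I M p} {e : OpenPartialHomeomorph M H} {y : Eu n}
    (h : α ((e.extend I).symm y) = β ((e.extend I).symm y)) : chartForm e α y = chartForm e β y := by
  rw [chartForm, pullMap, h]
  rfl

theorem eventuallyEq_chartForm {p : ℕ} {α β : DiffForm I M p} {e : OpenPartialHomeomorph M H}
    {y : Eu n} (hy : y ∈ (e.extend I).target)
    (h : ∀ᶠ x in 𝓝 ((e.extend I).symm y), α x = β x) :
    chartForm e α =ᶠ[𝓝[range I] y] chartForm e β :=
  (eventually_eq_extend_symm hy h).mono fun _ => chartForm_congr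

theorem eventually_extChartAt_to_inv {x : M} {P : M → Prop} (h : ∀ᶠ x' in 𝓝 x, P x') :
    ∀ᶠ x' in 𝓝 ((extChartAt I x).symm (extChartAt I x x)), P x' := by
  rwa [extChartAt_to_inv]

theorem IsCkAt.congr {p : ℕ} {r : ℕ∞ω} {α β : DiffForm I M p} {x : M} (hα : IsCkAt r α x)
    (h : ∀ᶠ x' in 𝓝 x, β x' = α x') : IsCkAt r β x :=
  ContDiffWithinAt.congr_of_eventuallyEq_of_mem hα
    (eventuallyEq_chartForm (e := chartAt H x) (mem_extChartAt_target x)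
      (eventually_extChartAt_to_inv h)) (mem_range_self _)

theorem dForm_congr {p : ℕ} {α β : DiffForm I M p} {x : M} (h : ∀ᶠ x' in 𝓝 x, α x' = β x') :
    dForm α x = dForm β x := by
  have h1 : localForm α x =ᶠ[𝓝[range I] (extChartAt I x x)] localForm β x :=
    eventuallyEq_chartForm (e := chartAt H x) (mem_extChartAt_target x)
      (eventually_extChartAt_to_inv h)
  rw [dForm, h1.extDerivWithin_eq_of_mem (mem_range_self _)]
  rfl

theorem dForm_eq_zero {p : ℕ} {α : DiffForm I M p} {x : M} (h : ∀ᶠ x' in 𝓝 x, α x' = 0) :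
    dForm α x = 0 := by
  have h1 : localForm α x =ᶠ[𝓝[range I] (extChartAt I x x)] fun _ => 0 := by
    filter_upwards [eventually_eq_extend_symm (e := chartAt H x) (mem_extChartAt_target (I := I) x)
      (eventually_extChartAt_to_inv h)] with y hy
    exact chartForm_eq_zero (e := chartAt H x) hy
  have h2 : extDerivWithin (localForm α x) (range I) (extChartAt I x x) = 0 := by
    rw [h1.extDerivWithin_eq_of_mem (mem_range_self _)]
    have := extDerivWithin_fun_smul (0 : ℝ) (fun _ : Eu n => (0 : Eu n [⋀^Fin p]→L[ℝ] ℝ))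
      (I.uniqueDiffOn (extChartAt I x x) (mem_range_self _))
    simpa using this
  ext v
  rw [dForm, h2]
  rfl

theorem dForm_add {p : ℕ} {α β : DiffForm I M p} {x : M} (hα : IsCkAt 1 α x)
    (hβ : IsCkAt 1 β x) : dForm (α + β) x = dForm α x + dForm β x := by
  have h := extDerivWithin_add (I.uniqueDiffOn (extChartAt I x x) (mem_range_self _))
    (hα.differentiableWithinAt one_ne_zero) (hβ.differentiableWithinAt one_ne_zero)
  ext v
  exact congrArg (fun w : Eu n [⋀^Fin (p + 1)]→L[ℝ] ℝ => w fun i =>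
    (mfderiv I 𝓘(ℝ, Eu n) (extChartAt I x) x : TangentSpace I x →L[ℝ] Eu n) (v i)) h

theorem dForm_sum {ι : Type*} {p : ℕ} (s : Finset ι) {α : ι → DiffForm I M p} {x : M}
    (h : ∀ i ∈ s, IsCkAt 1 (α i) x) :
    IsCkAt 1 (∑ i ∈ s, α i) x ∧ dForm (∑ i ∈ s, α i) x = ∑ i ∈ s, dForm (α i) x := by
  classical
  induction s using Finset.induction_on with
  | empty => simpa using ⟨IsCkAt.zero, dForm_eq_zero (Eventually.of_forall fun _ => rfl)⟩
  | insert a s ha ih =>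
    obtain ⟨h1, h2⟩ := ih fun i hi => h i (by simp [hi])
    rw [Finset.sum_insert ha, Finset.sum_insert ha, ← h2]
    exact ⟨(h a (by simp)).add h1, dForm_add (h a (by simp)) h1⟩

variable [IsManifold I ∞ M]

/-- A form is determined by its coordinate expression. -/
theorem eq_of_chartForm_eq {p : ℕ} {α β : DiffForm I M p} {e : OpenPartialHomeomorph M H}
    (he : e ∈ maximalAtlas I ∞ M) {x : M} (hx : x ∈ e.source)
    (h : chartForm e α (e.extend I x) = chartForm e β (e.extend I x)) : α x = β x := by
  have hy := extend_mem_target (I := I) hx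
  have hxx : (e.extend I).symm (e.extend I x) = x := e.extend_left_inv hx
  have hα : (α ((e.extend I).symm (e.extend I x)) : Eu n [⋀^Fin p]→L[ℝ] ℝ) = α x :=
    diffForm_congr α hxx
  have hβ : (β ((e.extend I).symm (e.extend I x)) : Eu n [⋀^Fin p]→L[ℝ] ℝ) = β x :=
    diffForm_congr β hxx
  let A : Eu n →L[ℝ] Eu n :=
    mfderivWithin 𝓘(ℝ, Eu n) I (e.extend I).symm (range I) (e.extend I x)
  have hsurj : Function.Surjective A :=
    LinearMap.surjective_of_injective (f := A.toLinearMap)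
      (injective_mfderivWithin_extend_symm he hy)
  have h' : (α x : Eu n [⋀^Fin p]→L[ℝ] ℝ).compContinuousLinearMap A =
      (β x : Eu n [⋀^Fin p]→L[ℝ] ℝ).compContinuousLinearMap A := by
    rw [← hα, ← hβ]; exact h
  change (α x : Eu n [⋀^Fin p]→L[ℝ] ℝ) = β x
  ext v
  choose u hu using fun i => hsurj (v i)
  rw [← funext hu]
  exact congrArg (fun w : Eu n [⋀^Fin p]→L[ℝ] ℝ => w u) h'

theorem eventually_isCkAt {p : ℕ} {r : ℕ∞ω} {α : DiffForm I M p} {x : M}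
    (h : ∀ᶠ x' in 𝓝 x, IsCkAt r α x') {e : OpenPartialHomeomorph M H}
    (hx : x ∈ e.source) :
    ∀ᶠ y in 𝓝[range I] (e.extend I x), y ∈ (e.extend I).target ∧
      IsCkAt r α ((e.extend I).symm y) := by
  have hy := extend_mem_target (I := I) hx
  rw [← e.extend_left_inv (I := I) hx] at h
  filter_upwards [extend_target_mem_nhdsWithin hy, eventually_eq_extend_symm hy h] with y h1 h2
  exact ⟨h1, h2⟩

theorem contDiffWithinAt_extDerivWithin {p : ℕ} {r : ℕ∞ω} {w : Eu n → Eu n [⋀^Fin p]→L[ℝ] ℝ}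
    {s : Set (Eu n)} (hs : UniqueDiffOn ℝ s) {y : Eu n} (hy : y ∈ s)
    (hw : ContDiffWithinAt ℝ (r + 1) w s y) : ContDiffWithinAt ℝ r (extDerivWithin w s) s y :=
  contDiffWithinAt_const.clm_apply
    (f := fun _ => ContinuousAlternatingMap.alternatizeUncurryFinCLM ℝ (Eu n) ℝ (n := p))
    (hw.fderivWithin_right hs le_rfl hy)

theorem IsCkAt.dForm {p : ℕ} {r : ℕ∞ω} {α : DiffForm I M p} {x : M}
    (h : ∀ᶠ x' in 𝓝 x, IsCkAt (r + 1) α x') : IsCkAt r (dForm α) x := by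
  have hx := mem_chart_source H x
  have he := IsManifold.chart_mem_maximalAtlas (I := I) (n := ∞) x
  refine ContDiffWithinAt.congr_of_eventuallyEq_of_mem
    (contDiffWithinAt_extDerivWithin I.uniqueDiffOn (mem_range_self _) h.self_of_nhds) ?_
    (mem_range_self _)
  filter_upwards [eventually_isCkAt h hx] with y hy
  exact chartForm_dForm he hy.1 (hy.2.of_le le_add_self)

theorem dForm_dForm {p : ℕ} {α : DiffForm I M p} {x : M} (h : ∀ᶠ x' in 𝓝 x, IsCkAt 2 α x') :
    dForm (dForm α) x = 0 := by
  have hx := mem_chart_source H x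
  have he := IsManifold.chart_mem_maximalAtlas (I := I) (n := ∞) x
  have hy := extend_mem_target (I := I) hx
  have hev : chartForm (chartAt H x) (dForm α) =ᶠ[𝓝[range I] (extChartAt I x x)]
      extDerivWithin (localForm α x) (range I) := by
    filter_upwards [eventually_isCkAt h hx] with y hy
    exact chartForm_dForm he hy.1 (hy.2.of_le (by norm_num))
  refine eq_of_chartForm_eq (β := (0 : DiffForm I M (p + 1 + 1))) he hx ?_
  have h3 : IsCkAt 1 (dForm α) x := IsCkAt.dForm (h.mono fun _ h => by
    rw [one_add_one_eq_two]; exact h)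
  rw [chartForm_dForm he hy (by rwa [(chartAt H x).extend_left_inv hx])]
  refine (hev.extDerivWithin_eq_of_mem (mem_range_self _)).trans ?_
  have h4 := extDerivWithin_extDerivWithin_apply h.self_of_nhds (by simp) I.uniqueDiffOn
    (mem_closure_interior_range (mem_range_self _)) (mem_range_self _)
  exact h4.trans (chartForm_eq_zero (e := chartAt H x) (α := (0 : DiffForm I M (p + 1 + 1))) rfl).symm

end Operations


/-! ## Test forms, and the theorem of Stokes -/

section TestForms

open IsManifold (maximalAtlas)

variable {n : ℕ} {H : Type*} [TopologicalSpace H] {I : ModelWithCorners ℝ (Eu n) H}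
  {M : Type*} [TopologicalSpace M] [ChartedSpace H M]

theorem isLocallyClosed_extend_target (e : OpenPartialHomeomorph M H) :
    IsLocallyClosed (e.extend I).target := by
  rw [OpenPartialHomeomorph.extend_target]
  exact (e.open_target.preimage I.continuous_symm).isLocallyClosed.inter
    I.isClosed_range.isLocallyClosed

variable [IsManifold I ∞ M]

theorem HasLocallyIntegrableCoeffs.wedgeForm {p q r : ℕ} (h : p + q = r) {α : DiffForm I M p}
    {β : DiffForm I M q} (hα : HasLocallyIntegrableCoeffs α) (hβ : ∀ x, IsCkAt 0 β x) :
    HasLocallyIntegrableCoeffs (wedgeForm h α β) := by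
  intro x₀
  refine (locallyIntegrableOn_iff (isLocallyClosed_extend_target (chartAt H x₀))).2
    fun K hK hKc => ?_
  have hb : ContinuousOn (localForm β x₀) K := fun y hy =>
    (((hβ _).chartForm (by simp) (IsManifold.chart_mem_maximalAtlas x₀)
      (hK hy)).continuousWithinAt).mono (hK.trans (extend_target_subset_range _))
  refine (IntegrableOn.bilin_continuousOn (wedgeCLM h) hKc
    ((hα x₀).integrableOn_compact_subset hK hKc) hb).congr_fun (fun y _ => ?_) hKc.measurableSet
  exact (chartForm_wedgeForm h α β (chartAt H x₀) y).symm

theorem isIntegrableForm_wedgeForm {p q r : ℕ} (h : p + q = r) {α : DiffForm I M p}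
    {β : DiffForm I M q} (hα : HasLocallyIntegrableCoeffs α) (hβ : ∀ x, IsCkAt 0 β x)
    {K : Set M} (hK : IsCompact K) (h0 : ∀ x ∉ K, β x = 0) :
    IsIntegrableForm (wedgeForm h α β) := by
  refine ⟨hα.wedgeForm h hβ, K, hK, fun x hx => ?_⟩
  change wedge h (α x) (β x) = 0
  rw [h0 x hx]
  exact wedge_zero_right (E := Eu n) h (α x)

theorem isTestForm_iff [T2Space M] {p : ℕ} {η : DiffForm I M p} :
    IsTestForm η ↔ (∀ x, IsCkAt ∞ η x) ∧ ∃ K, IsCompact K ∧ ∀ x ∉ K, η x = 0 := by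
  constructor
  · rintro ⟨h1, h2⟩
    exact ⟨fun x => h1.isCkAt isOpen_univ (mem_univ x), _, h2,
      fun x hx => by_contra fun h => hx (subset_closure h)⟩
  · rintro ⟨h1, K, hK, h0⟩
    refine ⟨isCkOn_of_isCkAt (by simp) fun x _ => h1 x, hK.of_isClosed_subset isClosed_closure ?_⟩
    exact closure_minimal (fun x hx => by_contra fun h => hx (h0 x h)) hK.isClosed

theorem IsTestForm.isCkAt {p : ℕ} {η : DiffForm I M p} (h : IsTestForm η) {r : ℕ∞ω} (hr : r ≤ ∞)
    (x : M) : IsCkAt r η x := (h.1.isCkAt isOpen_univ (mem_univ x)).of_le hr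

variable [T2Space M]

theorem IsTestForm.add {p : ℕ} {η ζ : DiffForm I M p} (h : IsTestForm η) (h' : IsTestForm ζ) :
    IsTestForm (η + ζ) := by
  rw [isTestForm_iff] at *
  obtain ⟨h1, K, hK, h0⟩ := h
  obtain ⟨h1', K', hK', h0'⟩ := h'
  refine ⟨fun x => (h1 x).add (h1' x), K ∪ K', hK.union hK', fun x hx => ?_⟩
  rw [mem_union, not_or] at hx
  rw [Pi.add_apply, h0 x hx.1, h0' x hx.2, add_zero]

theorem IsTestForm.fun_smul {p : ℕ} {η : DiffForm I M p} (h : IsTestForm η) {g : M → ℝ}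
    (hg : ContMDiff I 𝓘(ℝ, ℝ) ∞ g) : IsTestForm (fun x => g x • η x : DiffForm I M p) := by
  rw [isTestForm_iff] at *
  obtain ⟨h1, K, hK, h0⟩ := h
  refine ⟨fun x => (h1 x).fun_smul le_rfl (hg x), K, hK, fun x hx => ?_⟩
  rw [h0 x hx, smul_zero]

theorem dForm_eq_zero_of_eq_zero {p : ℕ} {η : DiffForm I M p} {K : Set M} (hK : IsClosed K)
    (h0 : ∀ x ∉ K, η x = 0) {x : M} (hx : x ∉ K) : dForm η x = 0 :=
  dForm_eq_zero (mem_of_superset (hK.isOpen_compl.mem_nhds hx) h0)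

theorem IsTestForm.dForm {p : ℕ} {η : DiffForm I M p} (h : IsTestForm η) :
    IsTestForm (dForm η) := by
  rw [isTestForm_iff] at *
  obtain ⟨h1, K, hK, h0⟩ := h
  exact ⟨fun x => IsCkAt.dForm (Eventually.of_forall fun x' => by simpa using h1 x'),
    K, hK, fun x hx => dForm_eq_zero_of_eq_zero hK.isClosed h0 hx⟩

open scoped Classical in
/-- The form on `M` with a given expression in a chart, extended by zero. -/
def ofChart {p : ℕ} (e : OpenPartialHomeomorph M H) (w : Eu n → Eu n [⋀^Fin p]→L[ℝ] ℝ) :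
    DiffForm I M p := fun x =>
  if x ∈ e.source then (w (e.extend I x)).compContinuousLinearMap
    (mfderiv I 𝓘(ℝ, Eu n) (e.extend I) x : TangentSpace I x →L[ℝ] Eu n) else 0

theorem ofChart_apply_eq_zero {p : ℕ} {e : OpenPartialHomeomorph M H}
    {w : Eu n → Eu n [⋀^Fin p]→L[ℝ] ℝ} {x : M}
    (h : x ∈ e.source → w (e.extend I x) = 0) : (ofChart e w : DiffForm I M p) x = 0 := by
  by_cases hx : x ∈ e.source
  · rw [ofChart, if_pos hx, h hx]; rfl
  · rw [ofChart, if_neg hx]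

theorem chartForm_ofChart {p : ℕ} {e : OpenPartialHomeomorph M H} (he : e ∈ maximalAtlas I ∞ M)
    (w : Eu n → Eu n [⋀^Fin p]→L[ℝ] ℝ) {y : Eu n} (hy : y ∈ (e.extend I).target) :
    chartForm e (ofChart e w : DiffForm I M p) y = w y := by
  ext v
  rw [chartForm, pullMap, ofChart, if_pos (extend_symm_mem_source hy), (e.extend I).right_inv hy]
  exact congrArg (w y) (funext fun i => mfderiv_extend_mfderivWithin_extend_symm he hy (v i))

theorem isTestForm_ofChart {p : ℕ} {e : OpenPartialHomeomorph M H} (he : e ∈ maximalAtlas I ∞ M)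
    {w : Eu n → Eu n [⋀^Fin p]→L[ℝ] ℝ} (hw : ContDiffOn ℝ ∞ w (range I)) {K : Set (Eu n)}
    (hK : IsCompact K) (hKt : K ⊆ (e.extend I).target) (h0 : ∀ y ∉ K, w y = 0) :
    IsTestForm (ofChart e w : DiffForm I M p) ∧
      IsCompact ((e.extend I).symm '' K) ∧ (e.extend I).symm '' K ⊆ e.source ∧
      ∀ x ∉ (e.extend I).symm '' K, (ofChart e w : DiffForm I M p) x = 0 := by
  have hKc : IsCompact ((e.extend I).symm '' K) :=
    hK.image_of_continuousOn ((e.continuousOn_extend_symm (I := I)).mono hKt)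
  have hz : ∀ x ∉ (e.extend I).symm '' K, (ofChart e w : DiffForm I M p) x = 0 := by
    refine fun x hx => ofChart_apply_eq_zero fun hxs => h0 _ fun hxK => hx ?_
    exact ⟨_, hxK, e.extend_left_inv hxs⟩
  refine ⟨isTestForm_iff.2 ⟨fun x => ?_, _, hKc, hz⟩, hKc, ?_, hz⟩
  · by_cases hx : x ∈ e.source
    · refine isCkAt_of_chartForm (by simp) he hx ?_
      refine (hw _ (mem_range_self _)).congr_of_eventuallyEq_of_mem ?_ (mem_range_self _)
      filter_upwards [extend_target_mem_nhdsWithin (extend_mem_target (I := I) hx)] with y hy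
      exact chartForm_ofChart he w hy
    · refine IsCkAt.zero.congr ?_
      have : ((e.extend I).symm '' K)ᶜ ∈ 𝓝 x := hKc.isClosed.isOpen_compl.mem_nhds (by
        rintro ⟨y, hy, rfl⟩
        exact hx (extend_symm_mem_source (hKt hy)))
      filter_upwards [this] with x' hx'
      exact hz x' hx'
  · rintro _ ⟨y, hy, rfl⟩
    exact extend_symm_mem_source (hKt hy)

end TestForms

section Pullback

open IsManifold (maximalAtlas)

variable {n : ℕ} {H : Type*} [TopologicalSpace H] {I : ModelWithCorners ℝ (Eu n) H}
  {M : Type*} [TopologicalSpace M] [ChartedSpace H M] [IsManifold I ∞ M]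
  {n' : ℕ} {H' : Type*} [TopologicalSpace H'] {I' : ModelWithCorners ℝ (Eu n') H'}
  {M' : Type*} [TopologicalSpace M'] [ChartedSpace H' M'] [IsManifold I' ∞ M']
  {φ : M' → M}

theorem chartForm_pullback {p : ℕ} (hφ : ContMDiff I' I ∞ φ) (α : DiffForm I M p)
    {e : OpenPartialHomeomorph M' H'} (he : e ∈ maximalAtlas I' ∞ M') {y : Eu n'}
    (hy : y ∈ (e.extend I').target) :
    chartForm e (pullback φ α : DiffForm I' M' p) y =
      pullMap (φ ∘ (e.extend I').symm) (range I') α y :=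
  pullMap_pullback α ((hφ _).mdifferentiableAt (by simp))
    (mdifferentiableWithinAt_extend_symm he hy) (I'.uniqueDiffOn _ (extend_target_subset_range e hy))

theorem contMDiffWithinAt_comp_extend_symm (hφ : ContMDiff I' I ∞ φ)
    {e : OpenPartialHomeomorph M' H'} (he : e ∈ maximalAtlas I' ∞ M') {y : Eu n'}
    (hy : y ∈ (e.extend I').target) :
    ContMDiffWithinAt 𝓘(ℝ, Eu n') I ∞ (φ ∘ (e.extend I').symm) (range I') y :=
  (hφ _).comp_contMDiffWithinAt y (contMDiffWithinAt_extend_symm he hy)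

theorem eventuallyEq_chartForm_pullback {p : ℕ} (hφ : ContMDiff I' I ∞ φ) (α : DiffForm I M p)
    {e : OpenPartialHomeomorph M' H'} (he : e ∈ maximalAtlas I' ∞ M') {y : Eu n'}
    (hy : y ∈ (e.extend I').target) :
    chartForm e (pullback φ α : DiffForm I' M' p) =ᶠ[𝓝[range I'] y]
      pullMap (φ ∘ (e.extend I').symm) (range I') α := by
  filter_upwards [extend_target_mem_nhdsWithin hy] with z hz
  exact chartForm_pullback hφ α he hz

theorem IsCkAt.pullback {p : ℕ} {r : ℕ∞ω} (hr : r + 1 ≤ ∞) (hφ : ContMDiff I' I ∞ φ)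
    {α : DiffForm I M p} {x : M'} (hα : IsCkAt r α (φ x)) :
    IsCkAt r (pullback φ α : DiffForm I' M' p) x := by
  have he := IsManifold.chart_mem_maximalAtlas (I := I') (n := ∞) x
  have hy := mem_extChartAt_target (I := I') x
  refine ContDiffWithinAt.congr_of_eventuallyEq_of_mem ?_
    (eventuallyEq_chartForm_pullback hφ α he hy) (mem_range_self _)
  refine IsCkAt.pullMap hr ?_ (contMDiffWithinAt_comp_extend_symm hφ he hy) I'.uniqueDiffOn
    (mem_range_self _)
  change IsCkAt r α (φ ((extChartAt I' x).symm (extChartAt I' x x)))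
  rwa [extChartAt_to_inv]

theorem dForm_pullback {p : ℕ} (hφ : ContMDiff I' I ∞ φ) {α : DiffForm I M p} {x : M'}
    (hα : IsCkAt 1 α (φ x)) :
    dForm (pullback φ α : DiffForm I' M' p) x =
      (pullback φ (dForm α) : DiffForm I' M' (p + 1)) x := by
  have he := IsManifold.chart_mem_maximalAtlas (I := I') (n := ∞) x
  have hy : (chartAt H' x).extend I' x ∈ ((chartAt H' x).extend I').target :=
    mem_extChartAt_target (I := I') x
  have hxx : ((chartAt H' x).extend I').symm ((chartAt H' x).extend I' x) = x :=
    extChartAt_to_inv x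
  refine eq_of_chartForm_eq he (mem_chart_source H' x) ?_
  rw [chartForm_dForm he hy, chartForm_pullback hφ _ he hy,
    ← extDerivWithin_pullMap _ (contMDiffWithinAt_comp_extend_symm hφ he hy) I'.uniqueDiffOn
    (mem_range_self _) (mem_closure_interior_range (mem_range_self _))]
  · exact (eventuallyEq_chartForm_pullback hφ α he hy).extDerivWithin_eq_of_mem (mem_range_self _)
  · change IsCkAt 1 α (φ (((chartAt H' x).extend I').symm ((chartAt H' x).extend I' x)))
    rwa [hxx]
  · rw [hxx]
    exact hα.pullback (by norm_cast) hφ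

end Pullback


section Stokes

open IsManifold (maximalAtlas)

variable {n : ℕ} {H : Type*} [TopologicalSpace H] {I : ModelWithCorners ℝ (Eu (n + 1)) H}
  {M : Type*} [TopologicalSpace M] [ChartedSpace H M] [IsManifold I ∞ M] [T2Space M]

/-- In a chart, a `C¹` form of codegree one with compact support in the chart domain is given, up to
the sign of the chart, by a `C¹` form with compact support. -/
theorem exists_chart_form (o : ManifoldOrientation I M) {e : OpenPartialHomeomorph M H}
    (he : e ∈ maximalAtlas I ∞ M) {β : DiffForm I M n} (hβ : ∀ x, IsCkAt 1 β x) {K : Set M}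
    (hK : IsCompact K) (hKe : K ⊆ e.source) (h0 : ∀ x ∉ K, β x = 0) :
    ∃ w : Eu (n + 1) → Eu (n + 1) [⋀^Fin n]→L[ℝ] ℝ, ContDiffOn ℝ 1 w (range I) ∧
      (∃ L, IsCompact L ∧ L ⊆ (e.extend I).target ∧ ∀ y ∉ L, w y = 0) ∧
      (∀ y ∈ (e.extend I).target, w y = chartSgn o e y • chartForm e β y) ∧
      ∀ y ∈ (e.extend I).target, extDerivWithin w (range I) y =
        chartSgn o e y • extDerivWithin (chartForm e β) (range I) y := by
  classical
  set T := (e.extend I).target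
  set w : Eu (n + 1) → Eu (n + 1) [⋀^Fin n]→L[ℝ] ℝ := fun y =>
    if y ∈ T then chartSgn o e y • chartForm e β y else 0
  set L := e.extend I '' K
  have hL : IsCompact L := hK.image_of_continuousOn
    ((e.continuousOn_extend (I := I)).mono (by rwa [e.extend_source]))
  have hLT : L ⊆ T := by
    rintro _ ⟨x, hx, rfl⟩
    exact extend_mem_target (hKe hx)
  have hw0 : ∀ y ∉ L, w y = 0 := by
    intro y hy
    by_cases hyT : y ∈ T
    · have : chartForm e β y = 0 :=
        chartForm_eq_zero (h0 _ fun h => hy ⟨_, h, (e.extend I).right_inv hyT⟩)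
      simp [w, this]
    · simp [w, hyT]
  have hev : ∀ y ∈ T, w =ᶠ[𝓝[range I] y] fun z => chartSgn o e y • chartForm e β z := by
    intro y hy
    filter_upwards [extend_target_mem_nhdsWithin hy, eventually_chartSgn_eq o he hy] with z hz hs
    simp only [w, hs]
    exact if_pos hz
  refine ⟨w, fun y hy => ?_, ⟨L, hL, hLT, hw0⟩, fun y hy => if_pos hy, fun y hy => ?_⟩
  · by_cases hyT : y ∈ T
    · exact (((hβ _).chartForm (by norm_cast) he hyT).const_smul _).congr_of_eventuallyEq_of_mem
        (hev y hyT) hy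
    · have : w =ᶠ[𝓝[range I] y] fun _ => 0 := by
        filter_upwards [mem_nhdsWithin_of_mem_nhds (hL.isClosed.isOpen_compl.mem_nhds
          (fun h => hyT (hLT h) : y ∈ Lᶜ))] with z hz
        exact hw0 z hz
      exact contDiffWithinAt_const.congr_of_eventuallyEq_of_mem this hy
  · have hy' := extend_target_subset_range e hy
    rw [(hev y hy).extDerivWithin_eq_of_mem hy', extDerivWithin_fun_smul _ _ (I.uniqueDiffOn y hy')]

variable [SigmaCompactSpace M]

theorem isIntegrableForm_of_continuous {p : ℕ} {β : DiffForm I M p} (hβ : ∀ x, IsCkAt 0 β x)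
    {K : Set M} (hK : IsCompact K) (h0 : ∀ x ∉ K, β x = 0) : IsIntegrableForm β :=
  ⟨.of_isCkAt hβ, K, hK, h0⟩

theorem isIntegrableForm_dForm {p : ℕ} {β : DiffForm I M p} (hβ : ∀ x, IsCkAt 1 β x)
    {K : Set M} (hK : IsCompact K) (h0 : ∀ x ∉ K, β x = 0) : IsIntegrableForm (dForm β) :=
  isIntegrableForm_of_continuous (fun _ => IsCkAt.dForm
    (Eventually.of_forall fun x' => by simpa using hβ x')) hK
    fun _ hx => dForm_eq_zero_of_eq_zero hK.isClosed h0 hx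

theorem integral_dForm_eq_chart (o : ManifoldOrientation I M) {e : OpenPartialHomeomorph M H}
    (he : e ∈ maximalAtlas I ∞ M) {β : DiffForm I M n} (hβ : ∀ x, IsCkAt 1 β x) {K : Set M}
    (hK : IsCompact K) (hKe : K ⊆ e.source) (h0 : ∀ x ∉ K, β x = 0) :
    ∃ w : Eu (n + 1) → Eu (n + 1) [⋀^Fin n]→L[ℝ] ℝ, ContDiffOn ℝ 1 w (range I) ∧
      (∃ L, IsCompact L ∧ L ⊆ (e.extend I).target ∧ ∀ y ∉ L, w y = 0) ∧
      (∀ y ∈ (e.extend I).target, w y = chartSgn o e y • chartForm e β y) ∧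
      integral o (dForm β) =
        ∫ y in range I, extDerivWithin w (range I) y (stdFrame (n + 1)) := by
  obtain ⟨w, hw, ⟨L, hL, hLT, hL0⟩, hw1, hw2⟩ := exists_chart_form o he hβ hK hKe h0
  refine ⟨w, hw, ⟨L, hL, hLT, hL0⟩, hw1, ?_⟩
  rw [(integral_eq_chart o (isIntegrableForm_dForm hβ hK h0) he fun x hx =>
    dForm_eq_zero_of_eq_zero hK.isClosed h0 fun h => hx (hKe h)).2,
    setIntegral_eq_of_subset_of_forall_sdiff_eq_zero I.isClosed_range.measurableSet
      (extend_target_subset_range e) _]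
  · refine setIntegral_congr_fun (measurableSet_extend_target e) fun y hy => ?_
    rw [hw2 y hy, chartForm_dForm he hy ((hβ _))]
    rfl
  · rintro y ⟨hy, hyT⟩
    have : w =ᶠ[𝓝[range I] y] fun _ => (0 : ℝ) • 0 := by
      filter_upwards [mem_nhdsWithin_of_mem_nhds (hL.isClosed.isOpen_compl.mem_nhds
        (fun h => hyT (hLT h) : y ∈ Lᶜ))] with z hz
      rw [hL0 z hz, zero_smul]
    rw [this.extDerivWithin_eq_of_mem hy, extDerivWithin_fun_smul _ _ (I.uniqueDiffOn y hy),
      zero_smul]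
    rfl

/-- Decomposition of the integral of an exact form by the partition of unity. -/
theorem integral_dForm_eq_sum (o : ManifoldOrientation I M) {β : DiffForm I M n}
    (hβ : ∀ x, IsCkAt 1 β x) {K : Set M} (hK : IsCompact K) (h0 : ∀ x ∉ K, β x = 0) :
    integral o (dForm β) = ∑ i ∈ (finite_chartPartition_ne_zero (I := I) hK).toFinset,
      integral o (dForm (fun x => chartPartition I M i x • β x : DiffForm I M n)) := by
  set s := (finite_chartPartition_ne_zero (I := I) hK).toFinset
  have hsm : ∀ i x, IsCkAt 1 (fun x => chartPartition I M i x • β x : DiffForm I M n) x :=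
    fun i x => (hβ x).fun_smul (by norm_cast) ((chartPartition I M i).contMDiff x)
  have hsum : β = ∑ i ∈ s, (fun x => chartPartition I M i x • β x : DiffForm I M n) := by
    funext x
    rw [Finset.sum_apply, ← Finset.sum_smul]
    by_cases hx : x ∈ K
    · rw [sum_chartPartition, one_smul]
      exact fun i hi => by simpa [s] using ⟨x, hx, hi⟩
    · rw [h0 x hx, smul_zero]
  have hd : dForm β = ∑ i ∈ s, dForm (fun x => chartPartition I M i x • β x : DiffForm I M n) := by
    funext x
    rw [Finset.sum_apply]
    conv_lhs => rw [hsum]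
    exact (dForm_sum s fun i _ => hsm i x).2
  rw [hd, integral_sum o s fun i _ => isIntegrableForm_dForm (hsm i) hK fun x hx => by
    rw [h0 x hx, smul_zero]]

/-- The theorem of Stokes for compactly supported forms on a manifold without boundary. -/
theorem integral_dForm_eq_zero {M : Type*} [TopologicalSpace M] [ChartedSpace (Eu (n + 1)) M]
    [IsManifold (𝓡 (n + 1)) ∞ M] [T2Space M] [SigmaCompactSpace M]
    (o : ManifoldOrientation (𝓡 (n + 1)) M) {β : DiffForm (𝓡 (n + 1)) M n}
    (hβ : ∀ x, IsCkAt 1 β x) {K : Set M} (hK : IsCompact K) (h0 : ∀ x ∉ K, β x = 0) :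
    integral o (dForm β) = 0 := by
  rw [integral_dForm_eq_sum o hβ hK h0]
  refine Finset.sum_eq_zero fun i _ => ?_
  obtain ⟨w, hw, ⟨L, hL, -, hL0⟩, -, h⟩ := integral_dForm_eq_chart o
    (IsManifold.chart_mem_maximalAtlas i)
    (fun x => (hβ x).fun_smul (by norm_cast) ((chartPartition (𝓡 (n + 1)) M i).contMDiff x))
    (hK.inter_right (isClosed_tsupport (chartPartition (𝓡 (n + 1)) M i)))
    (inter_subset_right.trans (chartPartition_isSubordinate i)) (fun x hx => by
      by_cases hxK : x ∈ K
      · have : chartPartition (𝓡 (n + 1)) M i x = 0 :=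
          by_contra fun h => hx ⟨hxK, subset_tsupport _ h⟩
        rw [this, zero_smul]
      · rw [h0 x hxK, smul_zero])
  rw [h]
  have hr : range (𝓡 (n + 1)) = univ := by simp
  rw [hr] at hw ⊢
  rw [setIntegral_univ]
  simp only [extDerivWithin_univ]
  exact integral_extDeriv_eq_zero volume (contDiffOn_univ.1 hw)
    (HasCompactSupport.intro hL fun x hx => hL0 x hx) _

/-- The theorem of Stokes on a compact manifold with boundary. -/
theorem integral_dForm_eq_boundaryIntegral {m : ℕ} {B : Type*} [TopologicalSpace B]
    [ChartedSpace (EuclideanHalfSpace (m + 1)) B] [IsManifold (𝓡∂ (m + 1)) ∞ B] [T2Space B]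
    [CompactSpace B] (o : ManifoldOrientation (𝓡∂ (m + 1)) B) {β : DiffForm (𝓡∂ (m + 1)) B m}
    (hβ : ∀ x, IsCkAt 1 β x) : integral o (dForm β) = boundaryIntegral o β := by
  have h0 : ∀ x ∉ (univ : Set B), β x = 0 := fun x hx => (hx (mem_univ x)).elim
  rw [integral_dForm_eq_sum o hβ isCompact_univ h0, boundaryIntegral,
    finsum_eq_sum_of_support_subset _
      (s := (finite_chartPartition_ne_zero (I := 𝓡∂ (m + 1)) (isCompact_univ (X := B))).toFinset)]
  · refine Finset.sum_congr rfl fun i _ => ?_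
    have hz : ∀ x ∉ tsupport (chartPartition (𝓡∂ (m + 1)) B i),
        chartPartition (𝓡∂ (m + 1)) B i x • β x = 0 := fun x hx => by
      rw [by_contra fun h => hx (subset_tsupport _ h), zero_smul]
    obtain ⟨w, hw, ⟨L, hL, hLT, hL0⟩, hw1, h⟩ := integral_dForm_eq_chart o
      (IsManifold.chart_mem_maximalAtlas i)
      (fun x => (hβ x).fun_smul (by norm_cast) ((chartPartition (𝓡∂ (m + 1)) B i).contMDiff x))
      (isClosed_tsupport (chartPartition (𝓡∂ (m + 1)) B i)).isCompact
      (chartPartition_isSubordinate i) hz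
    rw [h, range_halfSpace, integral_halfSpace_extDerivWithin (range_halfSpace ▸ hw) hL hL0,
      ← MeasureTheory.integral_neg]
    have hmeas : MeasurableSet (toBoundary ⁻¹' (extChartAt (𝓡∂ (m + 1)) i).target) := by
      refine (measurableSet_extend_target (I := 𝓡∂ (m + 1)) (chartAt _ i)).preimage ?_
      rw [funext toBoundary_eq]
      exact ((consCLM m).continuous.comp (by fun_prop)).measurable
    rw [← setIntegral_univ, setIntegral_eq_of_subset_of_forall_sdiff_eq_zero MeasurableSet.univ
      (subset_univ (toBoundary ⁻¹' (extChartAt (𝓡∂ (m + 1)) i).target))]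
    · refine setIntegral_congr_fun hmeas fun y hy => ?_
      rw [hw1 _ hy]
      change -(chartSgn o _ _ * (_ * _)) = _ * (-chartSgn o _ _ * _)
      ring_nf
      rfl
    · rintro y ⟨-, hy⟩
      rw [hL0 _ fun h => hy (hLT h)]
      simp
  · intro i hi
    by_contra his
    have hz : ∀ x, chartPartition (𝓡∂ (m + 1)) B i x = 0 := fun x => by
      by_contra h
      exact his (by simpa using ⟨x, h⟩)
    refine hi ?_
    simp [hz]

end Stokes


/-! ## The local model of a submanifold -/

section Flat

variable {m k : ℕ}

/-- The local model: the product of a normal and a tangential vector space. -/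
abbrev Pr (m k : ℕ) : Type := Eu (m + 1) × Eu k

instance : (volume : Measure (Pr m k)).IsAddHaarMeasure :=
  inferInstanceAs ((volume : Measure (Eu (m + 1))).prod (volume : Measure (Eu k))).IsAddHaarMeasure

/-- The standard frame of the normal factor. -/
def uFrame (m k : ℕ) (i : Fin (m + 1)) : Pr m k := (stdFrame (m + 1) i, 0)

/-- The standard frame of the tangential factor. -/
def yFrame (m k : ℕ) (j : Fin k) : Pr m k := (0, stdFrame k j)

/-- The standard frame of the product. -/
def pFrame (m k : ℕ) : Fin (m + 1 + k) → Pr m k := Fin.append (uFrame m k) (yFrame m k)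

/-- The standard frame of the product, as a basis. -/
def pBasis (m k : ℕ) : Module.Basis (Fin (m + 1 + k)) ℝ (Pr m k) :=
  ((stdBasis (m + 1)).prod (stdBasis k)).reindex finSumFinEquiv

theorem coe_pBasis : ⇑(pBasis m k) = pFrame m k := by
  ext i : 1
  refine Fin.addCases (fun a => ?_) (fun b => ?_) i
  · simp [pBasis, pFrame, uFrame, ← coe_stdBasis]
  · simp [pBasis, pFrame, yFrame, ← coe_stdBasis]

/-- The standard volume form. -/
def volForm (k : ℕ) : Eu k [⋀^Fin k]→L[ℝ] ℝ :=
  detForm fun i => LinearMap.toContinuousLinearMap ((stdBasis k).coord i)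

theorem volForm_stdFrame (k : ℕ) : volForm k (stdFrame k) = 1 := by
  rw [volForm, detForm_apply, ← coe_stdBasis]
  convert Matrix.det_one (R := ℝ) (n := Fin k)
  ext i j
  simp [Matrix.one_apply, Finsupp.single_apply]

theorem wedge_snd_pFrame (α : Pr m k [⋀^Fin (m + 1)]→L[ℝ] ℝ) (β : Eu k [⋀^Fin k]→L[ℝ] ℝ) :
    wedge rfl α (β.compContinuousLinearMap (ContinuousLinearMap.snd ℝ (Eu (m + 1)) (Eu k)))
      (pFrame m k) = α (uFrame m k) * β (stdFrame k) := by
  have h1 : ∀ i, pFrame m k (slotEquiv rfl (Sum.inl i)) = uFrame m k i := fun i => by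
    simp [pFrame, slotEquiv]
  have h2 : ∀ i, pFrame m k (slotEquiv rfl (Sum.inr i)) = yFrame m k i := fun i => by
    simp [pFrame, slotEquiv]
  rw [wedge_apply_of_ker rfl α β _ _ fun i => by rw [h1]; rfl]
  simp only [h1, h2]
  rfl

theorem wedge_oneWedge_comm {E : Type*} [NormedAddCommGroup E] [NormedSpace ℝ E]
    [FiniteDimensional ℝ E] {p q n : ℕ} (h' : p + (q + 1) = n) (h₁ : p + 1 + q = n)
    (l : E →L[ℝ] ℝ) (α : E [⋀^Fin p]→L[ℝ] ℝ) (β : E [⋀^Fin q]→L[ℝ] ℝ) :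
    wedge h' α (oneWedge l β) = (-1 : ℝ) ^ p • wedge h₁ (oneWedge l α) β := by
  obtain rfl : n = p + q + 1 := by omega
  rw [wedge_oneWedge rfl h', oneWedge_wedge rfl h₁]

theorem form_eq_zero_of_finrank_lt {E : Type*} [NormedAddCommGroup E] [NormedSpace ℝ E]
    [FiniteDimensional ℝ E] {p : ℕ} (h : Module.finrank ℝ E < p) (w : E [⋀^Fin p]→L[ℝ] ℝ) :
    w = 0 := by
  ext v
  refine w.toAlternatingMap.map_linearDependent v fun hv => ?_
  have := hv.fintype_card_le_finrank
  simp at this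
  omega

/-- The rescaling of the normal variable. -/
def scaleCLM (m k : ℕ) (ε : ℝ) : Pr m k →L[ℝ] Pr m k :=
  (ε • ContinuousLinearMap.fst ℝ (Eu (m + 1)) (Eu k)).prod
    (ContinuousLinearMap.snd ℝ (Eu (m + 1)) (Eu k))

@[simp]
theorem scaleCLM_apply (ε : ℝ) (z : Pr m k) : scaleCLM m k ε z = (ε • z.1, z.2) := rfl

theorem det_scaleCLM (ε : ℝ) : (scaleCLM m k ε).det = ε ^ (m + 1) := by
  have : (scaleCLM m k ε : Pr m k →ₗ[ℝ] Pr m k) =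
      LinearMap.prodMap (ε • LinearMap.id) LinearMap.id := by
    ext <;> simp
  rw [ContinuousLinearMap.det, this, LinearMap.det_prodMap]
  simp

theorem integral_eq_integral_scale {ε : ℝ} (hε : 0 < ε) (f : Pr m k → ℝ) :
    ∫ z, f z = ε ^ (m + 1) * ∫ z, f (scaleCLM m k ε z) := by
  have hsurj : scaleCLM m k ε '' univ = univ := by
    refine image_univ_of_surjective fun z => ⟨(ε⁻¹ • z.1, z.2), ?_⟩
    simp [smul_smul, hε.ne']
  have hinj : InjOn (scaleCLM m k ε) univ := by
    rintro ⟨a, b⟩ - ⟨c, d⟩ - h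
    simp only [scaleCLM_apply, Prod.mk.injEq] at h
    exact Prod.ext (smul_right_injective _ hε.ne' h.1) h.2
  have := integral_image_eq_integral_abs_det_fderiv_smul (volume : Measure (Pr m k))
    MeasurableSet.univ (fun x _ => (scaleCLM m k ε).hasFDerivWithinAt) hinj f
  rw [hsurj, setIntegral_univ, setIntegral_univ] at this
  rw [this, det_scaleCLM, abs_of_pos (pow_pos hε _), MeasureTheory.integral_smul,
    smul_eq_mul]

theorem continuous_of_continuousOn_of_eq_zero {X F : Type*} [TopologicalSpace X] [T2Space X]
    [TopologicalSpace F] [Zero F] {f : X → F} {D K : Set X} (hD : IsOpen D) (hf : ContinuousOn f D)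
    (hK : IsCompact K) (hKD : K ⊆ D) (h0 : ∀ x ∉ K, f x = 0) :
    Continuous f ∧ HasCompactSupport f := by
  refine ⟨continuous_iff_continuousAt.2 fun x => ?_, HasCompactSupport.intro hK h0⟩
  by_cases hx : x ∈ K
  · exact hf.continuousAt (hD.mem_nhds (hKD hx))
  · refine (continuousAt_const (y := (0 : F))).congr ?_
    filter_upwards [hK.isClosed.isOpen_compl.mem_nhds hx] with y hy
    exact (h0 y hy).symm

theorem continuousOn_integral_fst {f : Pr m k → ℝ} {A : Set (Eu (m + 1))} {B : Set (Eu k)}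
    (hA : IsOpen A) (hB : IsOpen B) (hf : ContinuousOn f (A ×ˢ B)) {K : Set (Eu (m + 1))}
    (hK : IsCompact K) (hKA : K ⊆ A) (h0 : ∀ u ∉ K, ∀ y, f (u, y) = 0) :
    ContinuousOn (fun y => ∫ u, f (u, y)) B := by
  refine continuousOn_integral_of_compact_support (f := fun y u => f (u, y)) hK ?_
    fun y u _ hu => h0 u hu y
  rintro ⟨y, u⟩ ⟨hy, -⟩
  refine ContinuousAt.continuousWithinAt ?_
  by_cases hu : u ∈ K
  · have h1 : ContinuousAt f (u, y) := hf.continuousAt ((hA.prod hB).mem_nhds ⟨hKA hu, hy⟩)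
    exact ContinuousAt.comp (f := Prod.swap) (g := f) h1 continuous_swap.continuousAt
  · refine (continuousAt_const (y := (0 : ℝ))).congr ?_
    filter_upwards [(hK.isClosed.isOpen_compl.preimage continuous_snd).mem_nhds
      (show (y, u) ∈ Prod.snd ⁻¹' Kᶜ from hu)] with z hz
    exact (h0 z.2 hz z.1).symm

/-- The domain of the local model. -/
def flatDomain (m : ℕ) {k : ℕ} (y₀ : Eu k) (r : ℝ) : Set (Pr m k) :=
  Metric.ball 0 r ×ˢ Metric.ball y₀ r

theorem isOpen_flatDomain (y₀ : Eu k) (r : ℝ) : IsOpen (flatDomain m y₀ r) :=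
  Metric.isOpen_ball.prod Metric.isOpen_ball

/-- The equation `dΩ = gL - H` in the local model, tested against `w`. -/
def FlatPairing (Ω : Pr m k → Pr m k [⋀^Fin m]→L[ℝ] ℝ) (H : Pr m k → Pr m k [⋀^Fin (m + 1)]→L[ℝ] ℝ)
    (w : Pr m k → Pr m k [⋀^Fin k]→L[ℝ] ℝ) : ℝ :=
  (-1) ^ (m + 1) * (∫ z, wedge (by omega : m + (k + 1) = m + 1 + k) (Ω z) (extDeriv w z)
    (pFrame m k)) + ∫ z, wedge rfl (H z) (w z) (pFrame m k)

/-- The equation `dΩ = gL - H` in the local model. -/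
def FlatEq (Ω : Pr m k → Pr m k [⋀^Fin m]→L[ℝ] ℝ) (H : Pr m k → Pr m k [⋀^Fin (m + 1)]→L[ℝ] ℝ)
    (y₀ : Eu k) (r : ℝ) (g : Eu k → ℝ) : Prop :=
  ∀ w : Pr m k → Pr m k [⋀^Fin k]→L[ℝ] ℝ, ContDiff ℝ ∞ w → ∀ K, IsCompact K →
    K ⊆ flatDomain m y₀ r → (∀ z ∉ K, w z = 0) →
      FlatPairing Ω H w = ∫ y, g y * w (0, y) (yFrame m k)

theorem oneWedge_snd_volForm (l : Eu k →L[ℝ] ℝ) :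
    oneWedge (l.comp (ContinuousLinearMap.snd ℝ (Eu (m + 1)) (Eu k)))
      ((volForm k).compContinuousLinearMap (ContinuousLinearMap.snd ℝ (Eu (m + 1)) (Eu k))) = 0 := by
  rw [← oneWedge_compContinuousLinearMap,
    form_eq_zero_of_finrank_lt (by simp) (oneWedge l (volForm k))]
  rfl

theorem extDeriv_const_form {E : Type*} [NormedAddCommGroup E] [NormedSpace ℝ E] {p : ℕ}
    (β : E [⋀^Fin p]→L[ℝ] ℝ) (x : E) : extDeriv (fun _ => β) x = 0 := by
  rw [extDeriv, fderiv_const_apply]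
  exact map_zero (ContinuousAlternatingMap.alternatizeUncurryFinCLM ℝ E ℝ (n := p))

theorem extDeriv_smul_const {E : Type*} [NormedAddCommGroup E] [NormedSpace ℝ E]
    [FiniteDimensional ℝ E] {p : ℕ} {f : E → ℝ} {x : E} (hf : DifferentiableAt ℝ f x)
    (β : E [⋀^Fin p]→L[ℝ] ℝ) :
    extDeriv (fun y => f y • β) x = oneWedge (fderiv ℝ f x) β := by
  rw [extDeriv_fun_smul_form hf (differentiableAt_const β), extDeriv_const_form, smul_zero, add_zero]

theorem fderiv_mul_fst_snd {χ : Eu (m + 1) → ℝ} {ψ : Eu k → ℝ} (hχ : Differentiable ℝ χ)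
    (hψ : Differentiable ℝ ψ) (z : Pr m k) :
    fderiv ℝ (fun z : Pr m k => χ z.1 * ψ z.2) z =
      ψ z.2 • (fderiv ℝ χ z.1).comp (ContinuousLinearMap.fst ℝ (Eu (m + 1)) (Eu k)) +
        χ z.1 • (fderiv ℝ ψ z.2).comp (ContinuousLinearMap.snd ℝ (Eu (m + 1)) (Eu k)) := by
  have h1 : HasFDerivAt (fun z : Pr m k => χ z.1)
      ((fderiv ℝ χ z.1).comp (ContinuousLinearMap.fst ℝ (Eu (m + 1)) (Eu k))) z :=
    (hχ z.1).hasFDerivAt.comp z hasFDerivAt_fst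
  have h2 : HasFDerivAt (fun z : Pr m k => ψ z.2)
      ((fderiv ℝ ψ z.2).comp (ContinuousLinearMap.snd ℝ (Eu (m + 1)) (Eu k))) z :=
    (hψ z.2).hasFDerivAt.comp z hasFDerivAt_snd
  exact (h1.mul h2).fderiv.trans (add_comm _ _)

end Flat


section FlatSlice

variable {m k : ℕ}

/-- The form `dχ ∧ Ω` in the local model. -/
def cutoffForm (χ : Eu (m + 1) → ℝ) (Ω : Pr m k → Pr m k [⋀^Fin m]→L[ℝ] ℝ) (z : Pr m k) :
    Pr m k [⋀^Fin (m + 1)]→L[ℝ] ℝ :=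
  oneWedge ((fderiv ℝ χ z.1).comp (ContinuousLinearMap.fst ℝ (Eu (m + 1)) (Eu k))) (Ω z)

theorem fderiv_eq_zero_of_eventually_const {E : Type*} [NormedAddCommGroup E] [NormedSpace ℝ E]
    {f : E → ℝ} {x : E} {c : ℝ} (h : ∀ᶠ y in 𝓝 x, f y = c) : fderiv ℝ f x = 0 := by
  rw [Filter.EventuallyEq.fderiv_eq (f := fun _ => c) h, fderiv_const_apply]

theorem continuousOn_cutoffForm {χ : Eu (m + 1) → ℝ} (hχ : ContDiff ℝ ∞ χ)
    (h1 : ∀ᶠ u in 𝓝 0, χ u = 1) {Ω : Pr m k → Pr m k [⋀^Fin m]→L[ℝ] ℝ} {D : Set (Pr m k)}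
    (hΩ : ∀ z ∈ D, z.1 ≠ 0 → ContinuousAt Ω z) : ContinuousOn (cutoffForm χ Ω) D := by
  refine fun z hz => ContinuousAt.continuousWithinAt ?_
  by_cases h0 : z.1 = 0
  · refine (continuousAt_const (y := (0 : Pr m k [⋀^Fin (m + 1)]→L[ℝ] ℝ))).congr ?_
    have : ∀ᶠ w : Pr m k in 𝓝 z, ∀ᶠ u in 𝓝 w.1, χ u = 1 := by
      rw [← h0] at h1
      exact continuous_fst.continuousAt.eventually (eventually_eventually_nhds.2 h1)
    filter_upwards [this] with w hw
    rw [cutoffForm, fderiv_eq_zero_of_eventually_const hw]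
    exact (oneWedge_zero_left _).symm
  · have hd : ContinuousAt (fun z : Pr m k =>
        (fderiv ℝ χ z.1).comp (ContinuousLinearMap.fst ℝ (Eu (m + 1)) (Eu k))) z :=
      (((hχ.continuous_fderiv (by simp)).comp continuous_fst).clm_comp
        continuous_const).continuousAt
    exact ((oneWedgeCLM (E := Pr m k) (p := m)).continuous.continuousAt.comp hd).clm_apply
      (hΩ z hz h0)

theorem integral_pr_eq {f : Pr m k → ℝ} (hf : Continuous f) (hc : HasCompactSupport f) :
    ∫ z, f z = ∫ y, ∫ u, f (u, y) :=
  integral_prod_symm _ (hf.integrable_of_hasCompactSupport hc)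

theorem continuous_apply_form {E X : Type*} [NormedAddCommGroup E] [NormedSpace ℝ E]
    [TopologicalSpace X] {p : ℕ} {w : X → E [⋀^Fin p]→L[ℝ] ℝ} {s : Set X} (hw : ContinuousOn w s)
    (v : Fin p → E) : ContinuousOn (fun x => w x v) s :=
  (ContinuousAlternatingMap.apply ℝ E ℝ v).continuous.comp_continuousOn hw

/-- The weight in the local model is given by an integral over a slice. -/
theorem FlatEq.integral_slice {Ω : Pr m k → Pr m k [⋀^Fin m]→L[ℝ] ℝ}
    {H : Pr m k → Pr m k [⋀^Fin (m + 1)]→L[ℝ] ℝ} {y₀ : Eu k} {r : ℝ} {g : Eu k → ℝ}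
    (h : FlatEq Ω H y₀ r g) (hg : ContinuousOn g (Metric.ball y₀ r))
    (hH : ContinuousOn H (flatDomain m y₀ r))
    (hΩ : ∀ z ∈ flatDomain m y₀ r, z.1 ≠ 0 → ContinuousAt Ω z)
    {χ : Eu (m + 1) → ℝ} (hχ : ContDiff ℝ ∞ χ) (h1 : ∀ᶠ u in 𝓝 0, χ u = 1)
    {L : Set (Eu (m + 1))} (hL : IsCompact L) (hLr : L ⊆ Metric.ball 0 r) (hχ0 : ∀ u ∉ L, χ u = 0)
    {y : Eu k} (hy : y ∈ Metric.ball y₀ r) :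
    ∫ u, (χ u * H (u, y) (uFrame m k) - cutoffForm χ Ω (u, y) (uFrame m k)) = g y := by
  have hT := continuous_apply_form (continuousOn_cutoffForm hχ h1 hΩ) (uFrame m k)
  have hH' : ContinuousOn (fun z : Pr m k => χ z.1 * H z (uFrame m k)) (flatDomain m y₀ r) :=
    (hχ.continuous.comp continuous_fst).continuousOn.mul (continuous_apply_form hH _)
  have hdχ : ∀ u ∉ L, fderiv ℝ χ u = 0 := fun u hu =>
    fderiv_eq_zero_of_eq_zero hL.isClosed hχ0 hu
  have hT0 : ∀ u ∉ L, ∀ y, cutoffForm χ Ω (u, y) (uFrame m k) = 0 := fun u hu y => by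
    rw [cutoffForm, hdχ u hu, ContinuousLinearMap.zero_comp, oneWedge_zero_left]
    rfl
  refine eqOn_of_integral_smul_eq volume Metric.isOpen_ball
    (f := fun y => ∫ u, (χ u * H (u, y) (uFrame m k) - cutoffForm χ Ω (u, y) (uFrame m k)))
    (continuousOn_integral_fst (f := fun z => χ z.1 * H z (uFrame m k) -
      cutoffForm χ Ω z (uFrame m k)) Metric.isOpen_ball Metric.isOpen_ball (hH'.sub hT) hL hLr
      fun u hu y => by rw [hχ0 u hu, hT0 u hu y]; ring) hg (fun ψ hψ hψc hψr => ?_) hy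
  have hdiffχ : Differentiable ℝ χ := hχ.differentiable (by simp)
  have hdiffψ : Differentiable ℝ ψ := hψ.differentiable (by simp)
  set w : Pr m k → Pr m k [⋀^Fin k]→L[ℝ] ℝ := fun z => (χ z.1 * ψ z.2) •
    (volForm k).compContinuousLinearMap (ContinuousLinearMap.snd ℝ (Eu (m + 1)) (Eu k)) with hw
  have hKD : L ×ˢ tsupport ψ ⊆ flatDomain m y₀ r := prod_mono hLr hψr
  have hK : IsCompact (L ×ˢ tsupport ψ) := hL.prod hψc
  have hzero : ∀ z : Pr m k, z ∉ L ×ˢ tsupport ψ → z.1 ∉ L ∨ ψ z.2 = 0 := by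
    intro z hz
    by_contra! hc
    exact hz ⟨hc.1, subset_tsupport _ hc.2⟩
  have hfeq := h w (((hχ.comp contDiff_fst).mul (hψ.comp contDiff_snd)).smul contDiff_const) _ hK
    hKD fun z hz => by
      rcases hzero z hz with h | h
      · simp [hw, hχ0 _ h]
      · simp [hw, h]
  have hdw : ∀ z, extDeriv w z = ψ z.2 •
      oneWedge ((fderiv ℝ χ z.1).comp (ContinuousLinearMap.fst ℝ (Eu (m + 1)) (Eu k)))
        ((volForm k).compContinuousLinearMap (ContinuousLinearMap.snd ℝ (Eu (m + 1)) (Eu k))) := by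
    intro z
    rw [hw, extDeriv_smul_const, fderiv_mul_fst_snd hdiffχ hdiffψ, oneWedge_add_left,
      oneWedge_smul_left, oneWedge_smul_left, oneWedge_snd_volForm, smul_zero, add_zero]
    exact ((hdiffχ _).comp z differentiableAt_fst).mul ((hdiffψ _).comp z differentiableAt_snd)
  have hc1 := continuous_of_continuousOn_of_eq_zero (isOpen_flatDomain y₀ r)
    ((hψ.continuous.comp continuous_snd).continuousOn.mul hT) hK hKD fun z hz => by
      rcases hzero z hz with h | h
      · change ψ z.2 * cutoffForm χ Ω (z.1, z.2) (uFrame m k) = 0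
        rw [hT0 _ h, mul_zero]
      · simp [h]
  have hc2 := continuous_of_continuousOn_of_eq_zero (isOpen_flatDomain y₀ r)
    ((hψ.continuous.comp continuous_snd).continuousOn.mul hH') hK hKD fun z hz => by
      rcases hzero z hz with h | h
      · simp [hχ0 _ h]
      · simp [h]
  have e1 : ∀ z, wedge (by omega : m + (k + 1) = m + 1 + k) (Ω z) (extDeriv w z) (pFrame m k) =
      (-1) ^ m * (ψ z.2 * cutoffForm χ Ω z (uFrame m k)) := by
    intro z
    rw [hdw, wedge_smul_right, wedge_oneWedge_comm _ rfl, ContinuousAlternatingMap.smul_apply,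
      ContinuousAlternatingMap.smul_apply, wedge_snd_pFrame, volForm_stdFrame, cutoffForm]
    simp only [smul_eq_mul]
    ring
  have e2 : ∀ z, wedge rfl (H z) (w z) (pFrame m k) = ψ z.2 * (χ z.1 * H z (uFrame m k)) := by
    intro z
    rw [hw, wedge_smul_right, ContinuousAlternatingMap.smul_apply, wedge_snd_pFrame,
      volForm_stdFrame, smul_eq_mul]
    ring
  have e3 : ∀ y, w (0, y) (yFrame m k) = ψ y := by
    intro y
    simp only [hw, ContinuousAlternatingMap.smul_apply, h1.self_of_nhds, smul_eq_mul, one_mul]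
    change ψ y * volForm k (stdFrame k) = ψ y
    rw [volForm_stdFrame, mul_one]
  rw [FlatPairing] at hfeq
  simp only [e1, e2, e3] at hfeq
  rw [integral_const_mul] at hfeq
  have hsgn : ((-1 : ℝ) ^ (m + 1)) * (-1) ^ m = -1 := by
    rw [pow_succ, mul_right_comm, ← pow_add, ← two_mul, pow_mul]
    simp
  rw [← mul_assoc, hsgn, neg_one_mul, neg_add_eq_sub] at hfeq
  have e5 := integral_sub (hc2.1.integrable_of_hasCompactSupport hc2.2)
    (hc1.1.integrable_of_hasCompactSupport hc1.2) (μ := volume)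
  have e4 := integral_pr_eq (hc2.1.sub hc1.1) (hc2.2.sub hc1.2)
  simp only [mul_comm (g _)] at hfeq
  refine Eq.trans ?_ (e4.symm.trans (e5.trans hfeq))
  refine integral_congr_ae (ae_of_all _ fun y => ?_)
  simp only [Pi.sub_apply, Pi.mul_apply, Function.comp_apply, ← mul_sub]
  rw [integral_const_mul]

end FlatSlice


section FlatConst

variable {m k : ℕ}

/-- A radial cut-off function. -/
def bump {E : Type*} [NormedAddCommGroup E] (s : E) : ℝ :=
  Real.smoothTransition (2 - ‖s‖ ^ 2)

theorem contDiff_bump {E : Type*} [NormedAddCommGroup E] [InnerProductSpace ℝ E] :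
    ContDiff ℝ ∞ (bump : E → ℝ) :=
  Real.smoothTransition.contDiff.comp (contDiff_const.sub (contDiff_norm_sq ℝ))

theorem bump_eq_one {E : Type*} [NormedAddCommGroup E] {s : E} (h : ‖s‖ ≤ 1) : bump s = 1 :=
  Real.smoothTransition.one_of_one_le (by nlinarith [norm_nonneg s])

theorem bump_eq_zero {E : Type*} [NormedAddCommGroup E] {s : E} (h : s ∉ Metric.closedBall 0 2) :
    bump s = 0 := by
  rw [mem_closedBall_zero_iff, not_le] at h
  exact Real.smoothTransition.zero_of_nonpos (by nlinarith)

theorem eventually_bump_eq_one {E : Type*} [NormedAddCommGroup E] :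
    ∀ᶠ s : E in 𝓝 0, bump s = 1 := by
  filter_upwards [Metric.ball_mem_nhds (0 : E) one_pos] with s hs
  exact bump_eq_one (mem_ball_zero_iff.1 hs).le

theorem contDiff_bump_smul {E : Type*} [NormedAddCommGroup E] [InnerProductSpace ℝ E] (c : ℝ) :
    ContDiff ℝ ∞ fun s : E => bump (c • s) := contDiff_bump.comp (contDiff_const_smul c)

theorem fderiv_bump_smul {E : Type*} [NormedAddCommGroup E] [InnerProductSpace ℝ E] (c : ℝ) (s : E) :
    fderiv ℝ (fun s : E => bump (c • s)) s = c • fderiv ℝ bump (c • s) := by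
  have h1 : HasFDerivAt (fun s : E => c • s) (c • ContinuousLinearMap.id ℝ E) s :=
    (ContinuousLinearMap.id ℝ E).hasFDerivAt.const_smul c
  have h2 := ((contDiff_bump (E := E)).differentiable (by simp) (c • s)).hasFDerivAt.comp s h1
  refine h2.fderiv.trans ?_
  ext v
  simp

theorem bump_inv_smul_eq_zero {E : Type*} [NormedAddCommGroup E] [InnerProductSpace ℝ E] {ε : ℝ}
    (hε : 0 < ε) {u : E} (hu : u ∉ Metric.closedBall 0 (2 * ε)) : bump (ε⁻¹ • u) = 0 := by
  refine bump_eq_zero fun h => hu ?_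
  rw [mem_closedBall_zero_iff] at h ⊢
  rw [norm_smul, Real.norm_of_nonneg (inv_nonneg.2 hε.le), inv_mul_le_iff₀ hε] at h
  linarith

theorem eventually_bump_smul_eq_one {E : Type*} [NormedAddCommGroup E] [InnerProductSpace ℝ E]
    (c : ℝ) : ∀ᶠ s : E in 𝓝 0, bump (c • s) = 1 := by
  have : Tendsto (fun s : E => c • s) (𝓝 0) (𝓝 0) := by
    simpa using (continuous_const_smul c).tendsto (0 : E)
  exact this.eventually eventually_bump_eq_one

theorem integral_fderiv_bump : ∫ s : Eu (m + 1), fderiv ℝ bump s = 0 := by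
  have hc : HasCompactSupport (bump : Eu (m + 1) → ℝ) :=
    HasCompactSupport.intro (isCompact_closedBall 0 2) fun s hs => bump_eq_zero hs
  ext v
  rw [ContinuousLinearMap.integral_apply]
  · exact integral_fderiv_apply_eq_zero volume (contDiff_bump.of_le (by simp)) hc v
  · exact (contDiff_bump.continuous_fderiv (by simp)).integrable_of_hasCompactSupport (hc.fderiv ℝ)

/-- The contraction of the volume form by a vector. -/
def contractVol (v : Eu (k + 1)) : Eu (k + 1) [⋀^Fin k]→L[ℝ] ℝ :=
  (volForm (k + 1)).curryLeft v

theorem oneWedge_contractVol (l : Eu (k + 1) →L[ℝ] ℝ) (v : Eu (k + 1)) :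
    oneWedge l (contractVol v) = l v • volForm (k + 1) := by
  ext x
  have h0 : oneWedge l (volForm (k + 1)) (Fin.cons v x) = 0 := by
    rw [form_eq_zero_of_finrank_lt (by simp) (oneWedge l (volForm (k + 1)))]; rfl
  rw [oneWedge_apply, Fin.sum_univ_succ] at h0
  rw [oneWedge_apply, ContinuousAlternatingMap.smul_apply, smul_eq_mul]
  have h1 : ∀ i : Fin (k + 1), contractVol v (i.removeNth x) =
      volForm (k + 1) (i.succ.removeNth (Fin.cons v x : Fin (k + 1 + 1) → Eu (k + 1))) := by
    intro i
    change volForm (k + 1) (Matrix.vecCons v (i.removeNth x)) = _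
    congr 1
    ext j : 1
    refine Fin.cases ?_ (fun j => ?_) j
    · simp [Fin.removeNth]
    · simp [Fin.removeNth]
  have h2 : (Fin.removeNth 0 (Fin.cons v x : Fin (k + 1 + 1) → Eu (k + 1))) = x := by
    ext j : 1; simp [Fin.removeNth]
  simp only [h1]
  simp only [Fin.val_zero, pow_zero, Fin.cons_zero, one_mul, h2, Fin.val_succ, pow_succ,
    Fin.cons_succ, mul_neg, mul_one, neg_mul, Finset.sum_neg_distrib] at h0
  linarith

theorem continuousOn_comp_scale {F : Type*} [TopologicalSpace F] {f : Pr m k → F} {y₀ : Eu k}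
    {r δ : ℝ} (hf : ContinuousOn f (flatDomain m y₀ r)) (hδ : δ * 2 < r) {K : Set (Eu k)}
    (hK : K ⊆ Metric.ball y₀ r) :
    ContinuousOn (fun s : ℝ × Pr m k => f (scaleCLM m k s.1 s.2))
      (Icc 0 δ ×ˢ (Metric.closedBall 0 2 ×ˢ K)) := by
  refine hf.comp ?_ ?_
  · have : Continuous fun s : ℝ × Pr m k => scaleCLM m k s.1 s.2 := by
      simp only [scaleCLM_apply]; fun_prop
    exact this.continuousOn
  · rintro ⟨ε, s, y⟩ ⟨hε, hs, hy⟩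
    refine ⟨?_, hK hy⟩
    rw [mem_closedBall_zero_iff] at hs
    change ε • s ∈ Metric.ball (0 : Eu (m + 1)) r
    rw [mem_ball_zero_iff, norm_smul, Real.norm_of_nonneg hε.1]
    calc ε * ‖s‖ ≤ δ * 2 := mul_le_mul hε.2 hs (norm_nonneg _) (hε.1.trans hε.2)
      _ < r := hδ

theorem _root_.ContinuousOn.wedge_apply {X E : Type*} [TopologicalSpace X] [NormedAddCommGroup E]
    [NormedSpace ℝ E] [FiniteDimensional ℝ E] {p q r : ℕ} (h : p + q = r)
    {a : X → E [⋀^Fin p]→L[ℝ] ℝ} {b : X → E [⋀^Fin q]→L[ℝ] ℝ} {s : Set X} (ha : ContinuousOn a s)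
    (hb : ContinuousOn b s) (v : Fin r → E) :
    ContinuousOn (fun x => wedge h (a x) (b x) v) s :=
  continuous_apply_form (((wedgeCLM h).continuous.comp_continuousOn ha).clm_apply hb) v

theorem contDiff_extDeriv {E : Type*} [NormedAddCommGroup E] [NormedSpace ℝ E]
    [FiniteDimensional ℝ E] {p : ℕ}
    {w : E → E [⋀^Fin p]→L[ℝ] ℝ} (hw : ContDiff ℝ ∞ w) : ContDiff ℝ ∞ (extDeriv w) :=
  (ContinuousAlternatingMap.alternatizeUncurryFinCLM ℝ E ℝ (n := p)).contDiff.comp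
    (hw.fderiv_right (by simp))

set_option maxHeartbeats 1000000 in
theorem FlatEq.integral_mul_fderiv_eq_zero {Ω : Pr m (k + 1) → Pr m (k + 1) [⋀^Fin m]→L[ℝ] ℝ}
    {H : Pr m (k + 1) → Pr m (k + 1) [⋀^Fin (m + 1)]→L[ℝ] ℝ} {y₀ : Eu (k + 1)} {r : ℝ}
    {g : Eu (k + 1) → ℝ} (h : FlatEq Ω H y₀ r g) (hr : 0 < r)
    (hH : ContinuousOn H (flatDomain m y₀ r)) {ψ : Eu (k + 1) → ℝ} (hψ : ContDiff ℝ ∞ ψ)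
    (hψc : HasCompactSupport ψ) (hψr : tsupport ψ ⊆ Metric.ball y₀ r) (v : Eu (k + 1)) :
    ∫ y, g y * fderiv ℝ ψ y v = 0 := by
  set S := ContinuousLinearMap.snd ℝ (Eu (m + 1)) (Eu (k + 1)) with hS
  set T := ContinuousLinearMap.fst ℝ (Eu (m + 1)) (Eu (k + 1)) with hTdef
  set K : Set (Pr m (k + 1)) := Metric.closedBall 0 2 ×ˢ tsupport ψ with hKdef
  have hK : IsCompact K := (isCompact_closedBall 0 2).prod hψc
  have hdψ : Differentiable ℝ ψ := hψ.differentiable (by simp)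
  have hdψ0 : ∀ y ∉ tsupport ψ, fderiv ℝ ψ y = 0 := fun y hy =>
    fderiv_eq_zero_of_eq_zero (isClosed_tsupport ψ) (fun x hx => image_eq_zero_of_notMem_tsupport hx)
      hy
  have hdb0 : ∀ s ∉ Metric.closedBall (0 : Eu (m + 1)) 2, fderiv ℝ bump s = 0 := fun s hs =>
    fderiv_eq_zero_of_eq_zero Metric.isClosed_closedBall (fun x hx => bump_eq_zero hx) hs
  set A : Pr m (k + 1) → Pr m (k + 1) [⋀^Fin (k + 1)]→L[ℝ] ℝ := fun z =>
    oneWedge ((fderiv ℝ bump z.1).comp T) ((contractVol v).compContinuousLinearMap S) with hA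
  set F : ℝ → Pr m (k + 1) → ℝ := fun ε z =>
    ε ^ m * (ψ z.2 * wedge rfl (H (scaleCLM m (k + 1) ε z)) (A z) (pFrame m (k + 1))) +
    ε ^ (m + 1) * (bump z.1 * fderiv ℝ ψ z.2 v * wedge rfl (H (scaleCLM m (k + 1) ε z))
      ((volForm (k + 1)).compContinuousLinearMap S) (pFrame m (k + 1))) with hF
  obtain ⟨δ, hδ, hδr⟩ : ∃ δ : ℝ, 0 < δ ∧ δ * 2 < r := ⟨r / 4, by positivity, by linarith⟩
  have hF0 : ∀ ε, ∀ z ∉ K, F ε z = 0 := by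
    intro ε z hz
    by_cases h1 : z.1 ∈ Metric.closedBall (0 : Eu (m + 1)) 2
    · have h2 : z.2 ∉ tsupport ψ := fun h2 => hz ⟨h1, h2⟩
      simp [hF, hdψ0 _ h2, image_eq_zero_of_notMem_tsupport h2]
    · have : A z = 0 := by
        rw [hA]; simp only [hdb0 _ h1, ContinuousLinearMap.zero_comp]
        exact oneWedge_zero_left _
      have h3 : wedge rfl (H (scaleCLM m (k + 1) ε z)) (A z) = 0 := by
        rw [this]; exact wedge_zero_right rfl _
      simp only [hF, h3, bump_eq_zero h1]
      simp
  have hAc : Continuous A := by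
    have h1 : Continuous fun z : Pr m (k + 1) => (fderiv ℝ bump z.1).comp T :=
      ((contDiff_bump.continuous_fderiv (by simp)).comp continuous_fst).clm_comp continuous_const
    exact ((oneWedgeCLM (E := Pr m (k + 1)) (p := k)).continuous.comp h1).clm_apply
      continuous_const
  have hFc : ContinuousOn (fun s : ℝ × Pr m (k + 1) => F s.1 s.2) (Icc 0 δ ×ˢ K) := by
    have hHc := continuousOn_comp_scale (m := m) hH hδr hψr
    have hw : ∀ {b : ℝ × Pr m (k + 1) → Pr m (k + 1) [⋀^Fin (k + 1)]→L[ℝ] ℝ}, Continuous b →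
        ContinuousOn (fun s : ℝ × Pr m (k + 1) => wedge rfl (H (scaleCLM m (k + 1) s.1 s.2)) (b s)
          (pFrame m (k + 1))) (Icc 0 δ ×ˢ K) := fun hb =>
      hHc.wedge_apply rfl hb.continuousOn _
    refine ContinuousOn.add ((by fun_prop : Continuous fun s : ℝ × Pr m (k + 1) =>
      s.1 ^ m).continuousOn.mul (ContinuousOn.mul ?_ (hw (hAc.comp continuous_snd))))
      ((by fun_prop : Continuous fun s : ℝ × Pr m (k + 1) => s.1 ^ (m + 1)).continuousOn.mul
        (ContinuousOn.mul ?_ (hw continuous_const)))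
    · exact (hψ.continuous.comp (continuous_snd.comp continuous_snd)).continuousOn
    · refine Continuous.continuousOn (Continuous.mul ?_ ?_)
      · exact contDiff_bump.continuous.comp (continuous_fst.comp continuous_snd)
      · exact ((hψ.continuous_fderiv (by simp)).comp
          (continuous_snd.comp continuous_snd)).clm_apply continuous_const
  have hlim := tendsto_integral_of_continuousOn (μ := volume) hδ hK hFc fun t _ => hF0 t
  have hval : ∀ ε ∈ Ioo 0 δ, ∫ z, F ε z = ∫ y, g y * fderiv ℝ ψ y v := by
    rintro ε ⟨hε, hεδ⟩
    have hdχ : Differentiable ℝ fun s : Eu (m + 1) => bump (ε⁻¹ • s) :=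
      (contDiff_bump_smul _).differentiable (by simp)
    set ζ : Pr m (k + 1) → Pr m (k + 1) [⋀^Fin k]→L[ℝ] ℝ := fun z =>
      (bump (ε⁻¹ • z.1) * ψ z.2) • (contractVol v).compContinuousLinearMap S with hζ
    have hζs : ContDiff ℝ ∞ ζ := (((contDiff_bump_smul _).comp contDiff_fst).mul
      (hψ.comp contDiff_snd)).smul contDiff_const
    have hK' : IsCompact (Metric.closedBall (0 : Eu (m + 1)) (2 * ε) ×ˢ tsupport ψ) :=
      (isCompact_closedBall _ _).prod hψc
    have hKD : Metric.closedBall (0 : Eu (m + 1)) (2 * ε) ×ˢ tsupport ψ ⊆ flatDomain m y₀ r :=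
      prod_mono (Metric.closedBall_subset_ball (by linarith)) hψr
    have hζ0 : ∀ z : Pr m (k + 1), z ∉ Metric.closedBall (0 : Eu (m + 1)) (2 * ε) ×ˢ tsupport ψ →
        ζ z = 0 := by
      intro z hz
      by_cases h1 : z.1 ∈ Metric.closedBall (0 : Eu (m + 1)) (2 * ε)
      · simp [hζ, image_eq_zero_of_notMem_tsupport fun h2 => hz ⟨h1, h2⟩]
      · simp [hζ, bump_inv_smul_eq_zero hε h1]
    have hdζ : ∀ z, extDeriv ζ z = (ψ z.2 * ε⁻¹) • oneWedge ((fderiv ℝ bump (ε⁻¹ • z.1)).comp T)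
        ((contractVol v).compContinuousLinearMap S) + (bump (ε⁻¹ • z.1) * fderiv ℝ ψ z.2 v) •
          (volForm (k + 1)).compContinuousLinearMap S := by
      intro z
      rw [hζ, extDeriv_smul_const, fderiv_mul_fst_snd hdχ hdψ, oneWedge_add_left,
        oneWedge_smul_left, oneWedge_smul_left, fderiv_bump_smul,
        ContinuousLinearMap.smul_comp, oneWedge_smul_left, smul_smul,
        ← oneWedge_compContinuousLinearMap (fderiv ℝ ψ z.2), oneWedge_contractVol]
      · congr 1
        exact smul_smul (bump (ε⁻¹ • z.1)) (fderiv ℝ ψ z.2 v)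
          ((volForm (k + 1)).compContinuousLinearMap S)
      · exact ((hdχ _).comp z differentiableAt_fst).mul ((hdψ _).comp z differentiableAt_snd)
    have hfeq := h (extDeriv ζ) (contDiff_extDeriv hζs) _ hK' hKD fun z hz =>
      extDeriv_eq_zero_of_eq_zero hK'.isClosed hζ0 hz
    have hdd : ∀ z, extDeriv (extDeriv ζ) z = 0 := fun z =>
      congrFun (extDeriv_extDeriv hζs
        (by rw [minSmoothness_of_isRCLikeNormedField]; exact WithTop.coe_le_coe.2 le_top)) z
    have e0 : ∀ z, wedge (by omega : m + (k + 1 + 1) = m + 1 + (k + 1)) (Ω z)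
        (extDeriv (extDeriv ζ) z) (pFrame m (k + 1)) = 0 := fun z => by
      rw [hdd, wedge_zero_right]; rfl
    have e1 : ∀ y, extDeriv ζ (0, y) (yFrame m (k + 1)) = fderiv ℝ ψ y v := by
      intro y
      have h1 : fderiv ℝ bump (ε⁻¹ • (0 : Eu (m + 1))) = 0 := by
        rw [smul_zero]; exact fderiv_eq_zero_of_eventually_const eventually_bump_eq_one
      have h2 : ((volForm (k + 1)).compContinuousLinearMap S) (yFrame m (k + 1)) = 1 :=
        volForm_stdFrame (k + 1)
      rw [hdζ]
      rw [ContinuousAlternatingMap.add_apply, ContinuousAlternatingMap.smul_apply,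
        ContinuousAlternatingMap.smul_apply, h1, h2, bump_eq_one (by simp),
        ContinuousLinearMap.zero_comp, oneWedge_zero_left]
      simp
    rw [FlatPairing] at hfeq
    simp only [e0, e1, MeasureTheory.integral_zero _ _, mul_zero, zero_add] at hfeq
    rw [← hfeq]
    refine Eq.trans ?_ (integral_eq_integral_scale hε _).symm
    rw [← integral_const_mul]
    refine integral_congr_ae (ae_of_all _ fun z => ?_)
    simp only [hF, hdζ, scaleCLM_apply, smul_smul, inv_mul_cancel₀ hε.ne', one_smul]
    rw [wedge_add_right, wedge_smul_right, wedge_smul_right, ContinuousAlternatingMap.add_apply,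
      ContinuousAlternatingMap.smul_apply, ContinuousAlternatingMap.smul_apply, smul_eq_mul,
      smul_eq_mul, pow_succ]
    have h3 : ε * ε⁻¹ = 1 := mul_inv_cancel₀ hε.ne'
    linear_combination (-(ε ^ m * (ψ z.2 * (wedge rfl (H (ε • z.1, z.2)) (A z))
      (pFrame m (k + 1))))) * h3
  have hlim2 : Tendsto (fun ε => ∫ z, F ε z) (𝓝[>] 0) (𝓝 (∫ y, g y * fderiv ℝ ψ y v)) := by
    refine tendsto_const_nhds.congr' ?_
    filter_upwards [Ioo_mem_nhdsGT hδ] with ε hε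
    exact (hval ε hε).symm
  rw [tendsto_nhds_unique hlim2 hlim]
  have hF0c := continuous_of_continuousOn_of_eq_zero (f := F 0) (D := univ ×ˢ Metric.ball y₀ r)
    (isOpen_univ.prod Metric.isOpen_ball) ?_ hK (prod_mono (subset_univ _) hψr) (hF0 0)
  · rw [integral_pr_eq hF0c.1 hF0c.2]
    refine Eq.trans (integral_congr_ae (ae_of_all _ fun y => ?_)) (MeasureTheory.integral_zero _ _)
    let L : (Eu (m + 1) →L[ℝ] ℝ) →L[ℝ] ℝ := LinearMap.toContinuousLinearMap
      { toFun := fun l => wedge rfl (H (0, y)) (oneWedge (l.comp T)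
          ((contractVol v).compContinuousLinearMap S)) (pFrame m (k + 1))
        map_add' := fun a b => by
          rw [ContinuousLinearMap.add_comp, oneWedge_add_left, wedge_add_right]; rfl
        map_smul' := fun c a => by
          rw [ContinuousLinearMap.smul_comp, oneWedge_smul_left, wedge_smul_right]; rfl }
    have h1 : ∀ u, F 0 (u, y) = (0 ^ m * ψ y) * L (fderiv ℝ bump u) := by
      intro u
      simp only [hF, scaleCLM_apply, zero_smul, zero_pow (Nat.succ_ne_zero m), zero_mul, add_zero]
      rw [← mul_assoc]
      rfl
    have hbi : Integrable (fun u : Eu (m + 1) => fderiv ℝ bump u) :=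
      (contDiff_bump.continuous_fderiv (by simp)).integrable_of_hasCompactSupport
        (HasCompactSupport.intro (isCompact_closedBall 0 2) hdb0)
    simp only [h1]
    rw [integral_const_mul, L.integral_comp_comm hbi, integral_fderiv_bump, map_zero, mul_zero]
  · have hHc : ContinuousOn (fun z : Pr m (k + 1) => H (scaleCLM m (k + 1) 0 z))
        (univ ×ˢ Metric.ball y₀ r) := by
      refine hH.comp (scaleCLM m (k + 1) 0).continuous.continuousOn ?_
      rintro ⟨s, y⟩ ⟨-, hy⟩
      exact ⟨by simpa using hr, hy⟩
    have h2 : F 0 = fun z => 0 ^ m * (ψ z.2 * wedge rfl (H (scaleCLM m (k + 1) 0 z)) (A z)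
        (pFrame m (k + 1))) := by
      funext z
      simp [hF]
    rw [h2]
    exact continuousOn_const.mul ((hψ.continuous.comp continuous_snd).continuousOn.mul
      (hHc.wedge_apply rfl hAc.continuousOn _))

/-- The weight in the local model is constant. -/
theorem FlatEq.const {Ω : Pr m k → Pr m k [⋀^Fin m]→L[ℝ] ℝ}
    {H : Pr m k → Pr m k [⋀^Fin (m + 1)]→L[ℝ] ℝ} {y₀ : Eu k} {r : ℝ} {g : Eu k → ℝ}
    (h : FlatEq Ω H y₀ r g) (hr : 0 < r) (hg : ContinuousOn g (Metric.ball y₀ r))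
    (hH : ContinuousOn H (flatDomain m y₀ r)) : ∀ y ∈ Metric.ball y₀ r, g y = g y₀ := by
  rcases k with _ | k
  · intro y _
    rw [Subsingleton.elim y y₀]
  · exact eq_of_integral_mul_fderiv_eq_zero volume hg fun ψ h1 h2 h3 v =>
      h.integral_mul_fderiv_eq_zero hr hH h1 h2 h3 v

end FlatConst


section PrEquiv

variable (m k : ℕ)

/-- The identification of the local model with `ℝⁿ`. -/
def prEquiv : Pr m k ≃L[ℝ] Eu (m + 1 + k) :=
  ((pBasis m k).equiv (stdBasis (m + 1 + k)) (Equiv.refl _)).toContinuousLinearEquiv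

variable {m k}

theorem prEquiv_pFrame (i : Fin (m + 1 + k)) :
    prEquiv m k (pFrame m k i) = stdFrame (m + 1 + k) i := by
  rw [← coe_pBasis, ← coe_stdBasis]
  exact (pBasis m k).equiv_apply i (stdBasis _) (Equiv.refl _)

theorem addHaar_stdBasis (n : ℕ) : (stdBasis n).addHaar = volume :=
  (EuclideanSpace.basisFun (Fin n) ℝ).addHaar_eq_volume

theorem addHaar_pBasis : (pBasis m k).addHaar = volume := by
  rw [pBasis, Module.Basis.addHaar_reindex, Module.Basis.prod_addHaar, addHaar_stdBasis,
    addHaar_stdBasis]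
  rfl

theorem measurePreserving_prEquiv : MeasurePreserving (prEquiv m k) := by
  refine ⟨(prEquiv m k).continuous.measurable, ?_⟩
  rw [← addHaar_pBasis, Module.Basis.map_addHaar, ← addHaar_stdBasis]
  congr 1
  refine Module.Basis.eq_of_apply_eq fun i => ?_
  rw [Module.Basis.map_apply, coe_pBasis, coe_stdBasis]
  exact prEquiv_pFrame i

theorem measurableEmbedding_prEquiv : MeasurableEmbedding (prEquiv m k) :=
  (prEquiv m k).toHomeomorph.measurableEmbedding

end PrEquiv

section AdaptedChart

open IsManifold (maximalAtlas)

variable {k m : ℕ} {M : Type*} [TopologicalSpace M] [ChartedSpace (Eu (m + 1 + k)) M]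
  {N : Type*} [TopologicalSpace N] [ChartedSpace (Eu k) N]

variable (k m) in
/-- A chart of `M` in which the submanifold `ι(N)` is given by the vanishing of the normal
variable. -/
structure AdaptedChart (ι : N → M) (q₀ : N) where
  /-- the chart -/
  chart : OpenPartialHomeomorph M (Eu (m + 1 + k))
  mem_maximalAtlas : chart ∈ maximalAtlas (𝓡 (m + 1 + k)) ∞ M
  /-- the size of the domain -/
  r : ℝ
  r_pos : 0 < r
  ball_subset : Metric.ball (extChartAt (𝓡 k) q₀ q₀) r ⊆ (extChartAt (𝓡 k) q₀).target
  mem_target : ∀ z ∈ flatDomain m (extChartAt (𝓡 k) q₀ q₀) r,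
    prEquiv m k z ∈ (chart.extend (𝓡 (m + 1 + k))).target
  symm_zero : ∀ y ∈ Metric.ball (extChartAt (𝓡 k) q₀ q₀) r,
    (chart.extend (𝓡 (m + 1 + k))).symm (prEquiv m k (0, y)) = ι ((extChartAt (𝓡 k) q₀).symm y)
  of_mem_range : ∀ z ∈ flatDomain m (extChartAt (𝓡 k) q₀ q₀) r,
    (chart.extend (𝓡 (m + 1 + k))).symm (prEquiv m k z) ∈ range ι → z.1 = 0

namespace AdaptedChart

variable {ι : N → M} {q₀ : N} (A : AdaptedChart k m ι q₀)

/-- The domain of the parametrization. -/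
def dom : Set (Pr m k) := flatDomain m (extChartAt (𝓡 k) q₀ q₀) A.r

/-- The parametrization of an open subset of `M`. -/
def map (z : Pr m k) : M := (A.chart.extend (𝓡 (m + 1 + k))).symm (prEquiv m k z)

/-- The coordinate expression of a form. -/
def form {p : ℕ} (α : DiffForm (𝓡 (m + 1 + k)) M p) : Pr m k → Pr m k [⋀^Fin p]→L[ℝ] ℝ :=
  A.dom.indicator fun z => (chartForm A.chart α (prEquiv m k z)).compContinuousLinearMap
    (prEquiv m k : Pr m k →L[ℝ] Eu (m + 1 + k))

theorem isOpen_dom : IsOpen A.dom := isOpen_flatDomain _ _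

end AdaptedChart

variable [IsManifold (𝓡 (m + 1 + k)) ∞ M]

theorem exists_adaptedChart {ι : N → M} (hι : IsEmbedding ι) {q₀ : N} {Ψ : Pr m k → M}
    {U : Set (Pr m k)} (hU : IsOpen U) (hU0 : (0, extChartAt (𝓡 k) q₀ q₀) ∈ U)
    (hΨ : ContMDiffOn 𝓘(ℝ, Pr m k) (𝓡 (m + 1 + k)) ∞ Ψ U)
    (hbij : Function.Bijective (mfderiv 𝓘(ℝ, Pr m k) (𝓡 (m + 1 + k)) Ψ
      (0, extChartAt (𝓡 k) q₀ q₀)))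
    (h0 : ∀ᶠ y in 𝓝 (extChartAt (𝓡 k) q₀ q₀), Ψ (0, y) = ι ((extChartAt (𝓡 k) q₀).symm y))
    {δ : ℝ} (hδ : 0 < δ) :
    ∃ A : AdaptedChart k m ι q₀, A.r ≤ δ ∧ ∀ z ∈ A.dom, A.map z = Ψ z := by
  set y₀ := extChartAt (𝓡 k) q₀ q₀ with hy₀
  set J := prEquiv m k with hJ
  set a := J (0, y₀) with ha
  set p := Ψ (0, y₀) with hp
  set c := chartAt (Eu (m + 1 + k)) p with hc
  set G : Eu (m + 1 + k) → Eu (m + 1 + k) := fun x => extChartAt (𝓡 (m + 1 + k)) p (Ψ (J.symm x))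
    with hG
  have hJa : J.symm a = (0, y₀) := J.symm_apply_apply _
  have hΨc : ContinuousOn Ψ U := hΨ.continuousOn
  have hΨat : ∀ z ∈ U, ContMDiffAt 𝓘(ℝ, Pr m k) (𝓡 (m + 1 + k)) ∞ Ψ z := fun z hz =>
    hΨ.contMDiffAt (hU.mem_nhds hz)
  -- the domain on which the coordinate expression is defined
  set V : Set (Eu (m + 1 + k)) := J.symm ⁻¹' (U ∩ Ψ ⁻¹' c.source) with hV
  have hVo : IsOpen V := (hΨc.isOpen_inter_preimage hU c.open_source).preimage J.symm.continuous
  have haV : a ∈ V := by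
    have : J.symm a ∈ U ∩ Ψ ⁻¹' c.source := by
      rw [hJa]
      exact ⟨hU0, mem_chart_source _ p⟩
    exact this
  have hGd : ∀ x ∈ V, ContDiffAt ℝ ∞ G x := by
    intro x hx
    rw [← contMDiffAt_iff_contDiffAt]
    exact (contMDiffAt_extChartAt' hx.2).comp x ((hΨat _ hx.1).comp x
      (J.symm : Eu (m + 1 + k) →L[ℝ] Pr m k).contDiff.contMDiff.contMDiffAt)
  have hbij' : Function.Bijective (fderiv ℝ G a) := by
    have h1 : MDifferentiableAt 𝓘(ℝ, Pr m k) (𝓡 (m + 1 + k)) Ψ (J.symm a) :=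
      (hΨat _ (hJa ▸ hU0)).mdifferentiableAt (by simp)
    have h2 : MDifferentiableAt 𝓘(ℝ, Eu (m + 1 + k)) 𝓘(ℝ, Pr m k) J.symm a :=
      J.symm.differentiableAt.mdifferentiableAt
    have h3 : MDifferentiableAt (𝓡 (m + 1 + k)) 𝓘(ℝ, Eu (m + 1 + k))
        (extChartAt (𝓡 (m + 1 + k)) p) (Ψ (J.symm a)) := mdifferentiableAt_extChartAt haV.2
    have h4 := mfderiv_comp a h3 (h1.comp a h2)
    have h5 := mfderiv_comp a h1 h2
    rw [h5] at h4
    have h6 : (fderiv ℝ G a : Eu (m + 1 + k) → Eu (m + 1 + k)) =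
        mfderiv (𝓡 (m + 1 + k)) 𝓘(ℝ, Eu (m + 1 + k)) (extChartAt (𝓡 (m + 1 + k)) p)
          (Ψ (J.symm a)) ∘ mfderiv 𝓘(ℝ, Pr m k) (𝓡 (m + 1 + k)) Ψ (J.symm a) ∘ J.symm := by
      rw [← mfderiv_eq_fderiv]
      refine (congrArg DFunLike.coe h4).trans ?_
      rw [mfderiv_eq_fderiv, J.symm.fderiv]
      rfl
    rw [h6]
    refine Function.Bijective.comp ?_ (Function.Bijective.comp ?_ J.symm.bijective)
    · exact (isInvertible_mfderiv_extChartAt (by simpa using haV.2)).bijective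
    · rw [hJa]; exact hbij
  set f' := ContinuousLinearEquiv.ofBijective (fderiv ℝ G a) (LinearMap.ker_eq_bot.2 hbij'.1)
    (LinearMap.range_eq_top.2 hbij'.2) with hf'
  have hGa : HasFDerivAt G (f' : Eu (m + 1 + k) →L[ℝ] Eu (m + 1 + k)) a := by
    rw [hf', ContinuousLinearEquiv.coe_ofBijective]
    exact ((hGd a haV).differentiableAt (by simp)).hasFDerivAt
  set h := (hGd a haV).toOpenPartialHomeomorph G hGa (by simp) with hh
  have hhG : (h : Eu (m + 1 + k) → Eu (m + 1 + k)) = G := rfl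
  have hah : a ∈ h.source := (hGd a haV).mem_toOpenPartialHomeomorph_source hGa (by simp)
  have hev : ∀ᶠ x in 𝓝 a, fderiv ℝ G x ∈ range ((↑) :
      (Eu (m + 1 + k) ≃L[ℝ] Eu (m + 1 + k)) → Eu (m + 1 + k) →L[ℝ] Eu (m + 1 + k)) := by
    have hcont : ContinuousAt (fderiv ℝ G) a := (hGd a haV).continuousAt_fderiv (by simp)
    refine hcont.eventually ?_
    rw [hGa.fderiv]
    exact ContinuousLinearEquiv.nhds f'
  obtain ⟨S, hSsub, hSo, haS⟩ := mem_nhds_iff.1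
    (inter_mem (inter_mem (hVo.mem_nhds haV) hev) (h.open_source.mem_nhds hah))
  set h' := h.restrOpen S hSo with hh'
  have hsrc : h'.source = S := by
    rw [hh', OpenPartialHomeomorph.restrOpen_source]
    exact inter_eq_right.2 fun x hx => (hSsub hx).2
  have hh'G : (h' : Eu (m + 1 + k) → Eu (m + 1 + k)) = G := rfl
  set e : OpenPartialHomeomorph M (Eu (m + 1 + k)) := c.trans h'.symm with he
  have hcG : ∀ x, G x = c (Ψ (J.symm x)) := fun x => rfl
  have hsymm : ∀ x ∈ S, e.symm x = Ψ (J.symm x) := by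
    intro x hx
    change c.symm (h' x) = _
    rw [hh'G, hcG, c.left_inv (hSsub hx).1.1.2]
  have htgt : e.target = S := by
    rw [he, OpenPartialHomeomorph.trans_target]
    change h'.source ∩ h' ⁻¹' c.target = S
    rw [hsrc]
    refine inter_eq_left.2 fun x hx => ?_
    rw [mem_preimage, hh'G, hcG]
    exact c.map_source (hSsub hx).1.1.2
  have htgt' : ∀ x, x ∈ (e.extend (𝓡 (m + 1 + k))).target ↔ x ∈ S := by
    intro x
    rw [← htgt]
    simp [mfld_simps]
  have hmem : e ∈ maximalAtlas (𝓡 (m + 1 + k)) ∞ M := by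
    refine OpenPartialHomeomorph.mem_maximalAtlas_of_contMDiffOn e ?_ ?_
    · intro x hx
      rw [he, OpenPartialHomeomorph.trans_source] at hx
      have hx2 : c x ∈ h'.target := hx.2
      have hx3 : h'.symm (c x) ∈ S := hsrc ▸ h'.map_target hx2
      obtain ⟨f₀, hf₀⟩ := (hSsub hx3).1.2
      have h1 : ContDiffAt ℝ ∞ h'.symm (c x) := by
        refine h'.contDiffAt_symm (f₀' := f₀) hx2 ?_ ?_
        · rw [hf₀]
          exact ((hGd _ (hSsub hx3).1.1).differentiableAt (by simp)).hasFDerivAt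
        · exact hGd _ (hSsub hx3).1.1
      have h2 : ContMDiffAt (𝓡 (m + 1 + k)) (𝓡 (m + 1 + k)) ∞ c x :=
        contMDiffAt_of_mem_maximalAtlas (IsManifold.chart_mem_maximalAtlas p) hx.1
      exact (h1.contMDiffAt.comp x h2).contMDiffWithinAt
    · intro x hx
      rw [htgt] at hx
      have h1 : ContMDiffAt (𝓡 (m + 1 + k)) (𝓡 (m + 1 + k)) ∞ (Ψ ∘ J.symm) x :=
        (hΨat _ (hSsub hx).1.1.1).comp x
          (J.symm : Eu (m + 1 + k) →L[ℝ] Pr m k).contDiff.contMDiff.contMDiffAt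
      refine (h1.congr_of_eventuallyEq ?_).contMDiffWithinAt
      filter_upwards [hSo.mem_nhds hx] with y hy using hsymm y hy
  have hball : ∀ ρ, flatDomain m y₀ ρ = Metric.ball (0, y₀) ρ := fun ρ => ball_prod_same 0 y₀ ρ
  have hSJ : J ⁻¹' S ∈ 𝓝 ((0 : Eu (m + 1)), y₀) := (hSo.preimage J.continuous).mem_nhds haS
  obtain ⟨r₁, hr₁, hr₁S⟩ := Metric.mem_nhds_iff.1 hSJ
  obtain ⟨r₂, hr₂, hr₂S⟩ := Metric.mem_nhds_iff.1
    (inter_mem (extChartAt_target_mem_nhds (I := 𝓡 k) q₀) h0)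
  set W : Set N := (extChartAt (𝓡 k) q₀).source ∩ extChartAt (𝓡 k) q₀ ⁻¹'
    Metric.ball y₀ (min r₁ r₂) with hW
  have hWo : IsOpen W :=
    (continuousOn_extChartAt q₀).isOpen_inter_preimage (isOpen_extChartAt_source q₀)
      Metric.isOpen_ball
  obtain ⟨O, hO, hOW⟩ := hι.isOpen_iff.1 hWo
  have hpO : Ψ (0, y₀) ∈ O := by
    have h1 : Ψ (0, y₀) = ι q₀ := by
      have := h0.self_of_nhds
      rwa [extChartAt_to_inv] at this
    have h2 : q₀ ∈ ι ⁻¹' O := by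
      rw [hOW]
      exact ⟨mem_extChartAt_source q₀, Metric.mem_ball_self (lt_min hr₁ hr₂)⟩
    rw [h1]; exact h2
  obtain ⟨r₃, hr₃, hr₃S⟩ := Metric.mem_nhds_iff.1
    (((hΨat _ hU0).continuousAt).preimage_mem_nhds (hO.mem_nhds hpO))
  refine ⟨⟨e, hmem, min (min r₁ r₂) (min r₃ δ), by positivity, ?_, ?_, ?_, ?_⟩,
    (min_le_right _ _).trans (min_le_right _ _), ?_⟩
  · exact fun y hy => (hr₂S (Metric.ball_subset_ball
      ((min_le_left _ _).trans (min_le_right _ _)) hy)).1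
  · intro z hz
    rw [hball] at hz
    exact (htgt' _).2 (hr₁S (Metric.ball_subset_ball
      ((min_le_left _ _).trans (min_le_left _ _)) hz))
  · intro y hy
    have h1 : J (0, y) ∈ S := by
      refine hr₁S (?_ : ((0 : Eu (m + 1)), y) ∈ Metric.ball (0, y₀) r₁)
      rw [← hball]
      exact ⟨Metric.mem_ball_self hr₁, Metric.ball_subset_ball
        ((min_le_left _ _).trans (min_le_left _ _)) hy⟩
    refine (hsymm _ h1).trans ?_
    rw [J.symm_apply_apply]
    exact (hr₂S (Metric.ball_subset_ball ((min_le_left _ _).trans (min_le_right _ _)) hy)).2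
  · intro z hz hzr
    rw [hball] at hz
    have hzS : J z ∈ S := hr₁S (Metric.ball_subset_ball
      ((min_le_left _ _).trans (min_le_left _ _)) hz)
    have hzO : Ψ z ∈ O := hr₃S (Metric.ball_subset_ball
      ((min_le_right _ _).trans (min_le_left _ _)) hz)
    have hez : e.symm (J z) = Ψ z := by rw [hsymm _ hzS, J.symm_apply_apply]
    obtain ⟨q, hq⟩ := hzr
    have hq' : ι q = Ψ z := hq.trans hez
    have hqW : q ∈ W := by
      rw [← hOW, mem_preimage, hq']; exact hzO
    have hb1 := Metric.ball_subset_ball (min_le_left _ _) hqW.2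
    have hb2 := Metric.ball_subset_ball (min_le_right _ _) hqW.2
    have hyS : J (0, extChartAt (𝓡 k) q₀ q) ∈ S := by
      refine hr₁S (?_ : ((0 : Eu (m + 1)), extChartAt (𝓡 k) q₀ q) ∈ Metric.ball (0, y₀) r₁)
      rw [← hball]
      exact ⟨Metric.mem_ball_self hr₁, hb1⟩
    have hey : e.symm (J (0, extChartAt (𝓡 k) q₀ q)) = Ψ z := by
      rw [hsymm _ hyS, J.symm_apply_apply, ← hq']
      exact (show Ψ (0, extChartAt (𝓡 k) q₀ q) = _ from (hr₂S hb2).2).trans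
        (congrArg ι ((extChartAt (𝓡 k) q₀).left_inv hqW.1))
    have hinj := e.symm.injOn (by rw [e.symm_source, htgt]; exact hzS)
      (by rw [e.symm_source, htgt]; exact hyS) (hez.trans hey.symm)
    rw [J.injective hinj]
  · intro z hz
    have hz' : z ∈ flatDomain m y₀ (min (min r₁ r₂) (min r₃ δ)) := hz
    rw [hball] at hz'
    refine (hsymm _ (hr₁S (Metric.ball_subset_ball
      ((min_le_left _ _).trans (min_le_left _ _)) hz'))).trans ?_
    rw [J.symm_apply_apply]

end AdaptedChart


section AdaptedForms

open IsManifold (maximalAtlas)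

variable {k m : ℕ} {M : Type*} [TopologicalSpace M] [ChartedSpace (Eu (m + 1 + k)) M]
  {N : Type*} [TopologicalSpace N] [ChartedSpace (Eu k) N] {ι : N → M} {q₀ : N}
  {p q r : ℕ}

namespace AdaptedChart

variable (A : AdaptedChart k m ι q₀)

theorem form_apply (α : DiffForm (𝓡 (m + 1 + k)) M p) {z : Pr m k} (hz : z ∈ A.dom) :
    A.form α z = (chartForm A.chart α (prEquiv m k z)).compContinuousLinearMap
      (prEquiv m k : Pr m k →L[ℝ] Eu (m + 1 + k)) := indicator_of_mem hz _

theorem form_of_notMem (α : DiffForm (𝓡 (m + 1 + k)) M p) {z : Pr m k} (hz : z ∉ A.dom) :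
    A.form α z = 0 := indicator_of_notMem hz _

theorem form_eq_zero {α : DiffForm (𝓡 (m + 1 + k)) M p} {z : Pr m k} (h : α (A.map z) = 0) :
    A.form α z = 0 := by
  by_cases hz : z ∈ A.dom
  · rw [A.form_apply α hz, chartForm_eq_zero h]
    rfl
  · exact A.form_of_notMem α hz

theorem form_wedgeForm (h : p + q = r) (α : DiffForm (𝓡 (m + 1 + k)) M p)
    (β : DiffForm (𝓡 (m + 1 + k)) M q) (z : Pr m k) :
    A.form (wedgeForm h α β) z = wedge h (A.form α z) (A.form β z) := by
  by_cases hz : z ∈ A.dom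
  · rw [A.form_apply _ hz, A.form_apply _ hz, A.form_apply _ hz, chartForm_wedgeForm,
      wedge_compContinuousLinearMap]
  · rw [A.form_of_notMem _ hz, A.form_of_notMem β hz, wedge_zero_right]

theorem map_mem_source {z : Pr m k} (hz : z ∈ A.dom) : A.map z ∈ A.chart.source :=
  extend_symm_mem_source (A.mem_target z hz)

theorem injOn_map : InjOn A.map A.dom := fun z hz z' hz' h =>
  (prEquiv m k).injective ((A.chart.extend (𝓡 (m + 1 + k))).symm.injOn (A.mem_target z hz)
    (A.mem_target z' hz') h)

theorem continuousOn_map : ContinuousOn A.map A.dom :=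
  (A.chart.continuousOn_extend_symm (I := 𝓡 (m + 1 + k))).comp
    (prEquiv m k).continuous.continuousOn A.mem_target

theorem mem_dom_zero {y : Eu k} (hy : y ∈ Metric.ball (extChartAt (𝓡 k) q₀ q₀) A.r) :
    ((0 : Eu (m + 1)), y) ∈ A.dom := ⟨Metric.mem_ball_self A.r_pos, hy⟩

theorem center_mem_dom : ((0 : Eu (m + 1)), extChartAt (𝓡 k) q₀ q₀) ∈ A.dom :=
  A.mem_dom_zero (Metric.mem_ball_self A.r_pos)

theorem isOpen_image_map {S : Set (Pr m k)} (hS : IsOpen S) (hSd : S ⊆ A.dom) :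
    IsOpen (A.map '' S) := by
  have h1 : A.map '' S = A.chart.symm '' (prEquiv m k '' S) := by
    rw [image_image]; rfl
  rw [h1]
  refine A.chart.symm.isOpen_image_of_subset_source ((prEquiv m k).toHomeomorph.isOpenMap S hS) ?_
  rintro _ ⟨z, hz, rfl⟩
  have := A.mem_target z (hSd hz)
  simpa [mfld_simps] using this

variable [IsManifold (𝓡 (m + 1 + k)) ∞ M]

theorem contMDiffAt_map {z : Pr m k} (hz : z ∈ A.dom) :
    ContMDiffAt 𝓘(ℝ, Pr m k) (𝓡 (m + 1 + k)) ∞ A.map z := by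
  have h1 : ContMDiffAt 𝓘(ℝ, Eu (m + 1 + k)) (𝓡 (m + 1 + k)) ∞
      (A.chart.extend (𝓡 (m + 1 + k))).symm (prEquiv m k z) := by
    have := contMDiffWithinAt_extend_symm A.mem_maximalAtlas (A.mem_target z hz)
    rwa [ModelWithCorners.range_eq_univ, contMDiffWithinAt_univ] at this
  exact h1.comp z (prEquiv m k : Pr m k →L[ℝ] Eu (m + 1 + k)).contDiff.contMDiff.contMDiffAt

theorem form_eq_pullMap (α : DiffForm (𝓡 (m + 1 + k)) M p) {z : Pr m k} (hz : z ∈ A.dom) :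
    A.form α z = pullMap A.map univ α z := by
  have h1 := mdifferentiableWithinAt_extend_symm A.mem_maximalAtlas (A.mem_target z hz)
  have h2 := pullMap_comp (θ := prEquiv m k) (s := univ) (z := z) α h1
    (prEquiv m k).differentiableAt.differentiableWithinAt uniqueDiffWithinAt_univ
    fun x _ => by rw [ModelWithCorners.range_eq_univ]; exact mem_univ _
  rw [fderivWithin_univ, ContinuousLinearEquiv.fderiv] at h2
  rw [A.form_apply α hz]
  exact h2.symm

theorem eventuallyEq_form (α : DiffForm (𝓡 (m + 1 + k)) M p) {z : Pr m k} (hz : z ∈ A.dom) :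
    A.form α =ᶠ[𝓝 z] pullMap A.map univ α := by
  filter_upwards [A.isOpen_dom.mem_nhds hz] with w hw using A.form_eq_pullMap α hw

theorem contDiffAt_form {s : ℕ∞ω} (hs : s + 1 ≤ ∞) {α : DiffForm (𝓡 (m + 1 + k)) M p}
    {z : Pr m k} (hz : z ∈ A.dom) (hα : IsCkAt s α (A.map z)) : ContDiffAt ℝ s (A.form α) z := by
  have := hα.pullMap hs (A.contMDiffAt_map hz).contMDiffWithinAt uniqueDiffOn_univ (mem_univ z)
  rw [contDiffWithinAt_univ] at this
  exact this.congr_of_eventuallyEq (A.eventuallyEq_form α hz)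

theorem form_dForm {α : DiffForm (𝓡 (m + 1 + k)) M p} {z : Pr m k} (hz : z ∈ A.dom)
    (hα : IsCkAt 1 α (A.map z)) : A.form (dForm α) z = extDeriv (A.form α) z := by
  have h1 := pullMap_dForm hα (A.contMDiffAt_map hz).contMDiffWithinAt isOpen_univ (mem_univ z)
  rw [A.form_eq_pullMap _ hz, h1]
  exact (A.eventuallyEq_form α hz).symm.extDeriv_eq

theorem contDiff_form {α : DiffForm (𝓡 (m + 1 + k)) M p} (hα : ∀ x, IsCkAt ∞ α x)
    {K : Set (Pr m k)} (hK : IsCompact K) (hKd : K ⊆ A.dom) (h0 : ∀ x ∉ A.map '' K, α x = 0) :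
    ContDiff ℝ ∞ (A.form α) ∧ ∀ z ∉ K, A.form α z = 0 := by
  have h1 : ∀ z ∉ K, A.form α z = 0 := by
    intro z hz
    by_cases hzd : z ∈ A.dom
    · refine A.form_eq_zero (h0 _ ?_)
      rintro ⟨w, hw, h⟩
      exact hz (A.injOn_map (hKd hw) hzd h ▸ hw)
    · exact A.form_of_notMem α hzd
  exact ⟨contDiff_of_contDiffOn_of_eq_zero A.isOpen_dom (fun z hz =>
    (A.contDiffAt_form (by simp) hz (hα _)).contDiffWithinAt) hK.isClosed hKd h1, h1⟩

theorem exists_testForm [T2Space M] {w : Pr m k → Pr m k [⋀^Fin p]→L[ℝ] ℝ}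
    (hw : ContDiff ℝ ∞ w) {K : Set (Pr m k)} (hK : IsCompact K) (hKd : K ⊆ A.dom)
    (h0 : ∀ z ∉ K, w z = 0) :
    ∃ η : DiffForm (𝓡 (m + 1 + k)) M p, IsTestForm η ∧ (∀ x ∉ A.map '' K, η x = 0) ∧
      A.form η = w := by
  set J := prEquiv m k with hJ
  set w' : Eu (m + 1 + k) → Eu (m + 1 + k) [⋀^Fin p]→L[ℝ] ℝ := fun x =>
    (w (J.symm x)).compContinuousLinearMap (J.symm : Eu (m + 1 + k) →L[ℝ] Pr m k) with hw'
  have hw's : ContDiff ℝ ∞ w' := by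
    refine contDiff_iff_contDiffAt.2 fun x => ?_
    rw [← contDiffWithinAt_univ]
    exact ContDiffWithinAt.compForm
      ((hw.comp (J.symm : Eu (m + 1 + k) →L[ℝ] Pr m k).contDiff).contDiffAt.contDiffWithinAt)
      contDiffWithinAt_const
  have himg : (A.chart.extend (𝓡 (m + 1 + k))).symm '' (J '' K) = A.map '' K := image_image _ _ _
  obtain ⟨h1, -, -, h2⟩ := isTestForm_ofChart A.mem_maximalAtlas hw's.contDiffOn
    (hK.image J.continuous) (image_subset_iff.2 fun z hz => A.mem_target z (hKd hz))
    fun x hx => by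
      have : w (J.symm x) = 0 := h0 _ fun hxK => hx ⟨_, hxK, J.apply_symm_apply x⟩
      rw [hw']
      simp only [this]
      rfl
  rw [himg] at h2
  refine ⟨_, h1, h2, funext fun z => ?_⟩
  by_cases hz : z ∈ A.dom
  · rw [A.form_apply _ hz, chartForm_ofChart A.mem_maximalAtlas w' (A.mem_target z hz), hw']
    ext v
    change w (J.symm (J z)) (fun i => J.symm (J (v i))) = w z v
    simp only [J.symm_apply_apply]
  · rw [A.form_of_notMem _ hz, h0 z fun h => hz (hKd h)]

/-- The sign of the coordinate frame of the parametrization. -/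
def sgn (o : ManifoldOrientation (𝓡 (m + 1 + k)) M) : ℝ :=
  chartSgn o A.chart (prEquiv m k (0, extChartAt (𝓡 k) q₀ q₀))

theorem sgn_mul_self (o : ManifoldOrientation (𝓡 (m + 1 + k)) M) : A.sgn o * A.sgn o = 1 := by
  rcases chartSgn_eq_one_or o A.mem_maximalAtlas (A.mem_target _ A.center_mem_dom) with h | h <;>
    · rw [sgn, h]; norm_num

end AdaptedChart

theorem constant_of_sign {X : Type*} [TopologicalSpace X] {S : Set X} (hS : IsPreconnected S)
    {f : X → ℝ} (hf : ContinuousOn f S) (h : ∀ x ∈ S, f x = -1 ∨ f x = 1) {x y : X} (hx : x ∈ S)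
    (hy : y ∈ S) : f x = f y :=
  hS.constant_of_mapsTo (T := {-1, 1}) (toFinite _).isDiscrete hf
    (fun x hx => by simpa using h x hx) hx hy

theorem isPreconnected_flatDomain (y₀ : Eu k) (r : ℝ) : IsPreconnected (flatDomain m y₀ r) :=
  ((convex_ball _ _).prod (convex_ball _ _)).isPreconnected

variable [IsManifold (𝓡 (m + 1 + k)) ∞ M]

namespace AdaptedChart

variable (A : AdaptedChart k m ι q₀)

theorem chartSgn_eq (o : ManifoldOrientation (𝓡 (m + 1 + k)) M) {z : Pr m k} (hz : z ∈ A.dom) :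
    chartSgn o A.chart (prEquiv m k z) = A.sgn o := by
  have hm : MapsTo (prEquiv m k) A.dom (A.chart.extend (𝓡 (m + 1 + k))).target := A.mem_target
  exact constant_of_sign (f := fun z => chartSgn o A.chart (prEquiv m k z))
    (isPreconnected_flatDomain _ _) ((continuousOn_chartSgn o A.mem_maximalAtlas).comp
      (prEquiv m k).continuous.continuousOn hm)
    (fun z hz => chartSgn_eq_one_or o A.mem_maximalAtlas (hm hz)) hz A.center_mem_dom

theorem integral_eq [T2Space M] [SigmaCompactSpace M] (o : ManifoldOrientation (𝓡 (m + 1 + k)) M)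
    {α : DiffForm (𝓡 (m + 1 + k)) M (m + 1 + k)} (hα : IsIntegrableForm α) {K : Set (Pr m k)}
    (hKd : K ⊆ A.dom) (h0 : ∀ x ∉ A.map '' K, α x = 0) :
    Integrable (fun z => A.form α z (pFrame m k)) ∧
      integral o α = A.sgn o * ∫ z, A.form α z (pFrame m k) := by
  set J := prEquiv m k with hJ
  obtain ⟨h1, h2⟩ := integral_eq_chart o hα A.mem_maximalAtlas fun x hx => h0 x (by
    rintro ⟨z, hz, rfl⟩
    exact hx (A.map_mem_source (hKd hz)))
  have hdT : A.dom ⊆ J ⁻¹' (A.chart.extend (𝓡 (m + 1 + k))).target := A.mem_target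
  have hmeas := (measurableSet_extend_target (I := 𝓡 (m + 1 + k)) A.chart).preimage
    J.continuous.measurable
  have hz : ∀ z ∈ J ⁻¹' (A.chart.extend (𝓡 (m + 1 + k))).target \ A.dom,
      chartSgn o A.chart (J z) * chartForm A.chart α (J z) (stdFrame (m + 1 + k)) = 0 := by
    rintro z ⟨hz, hzd⟩
    rw [chartForm_eq_zero (h0 _ ?_)]
    · exact mul_zero _
    rintro ⟨w, hw, h⟩
    have := (A.chart.extend (𝓡 (m + 1 + k))).symm.injOn (A.mem_target w (hKd hw)) hz h
    exact hzd (J.injective this ▸ hKd hw)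
  have hd : ∀ z ∈ A.dom, chartSgn o A.chart (J z) * chartForm A.chart α (J z)
      (stdFrame (m + 1 + k)) = A.sgn o * A.form α z (pFrame m k) := by
    intro z hz
    rw [hJ, A.chartSgn_eq o hz, A.form_apply α hz]
    congr 1
    exact congrArg _ (funext fun i => (prEquiv_pFrame i).symm)
  have h0' : ∀ z ∉ A.dom, A.form α z (pFrame m k) = 0 := fun z hz => by
    rw [A.form_of_notMem α hz]; rfl
  have hmp := measurePreserving_prEquiv (m := m) (k := k)
  constructor
  · have h3 : IntegrableOn (fun z => A.sgn o * (A.sgn o * A.form α z (pFrame m k))) A.dom := by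
      refine Integrable.const_mul ?_ _
      refine IntegrableOn.congr_fun ?_ hd A.isOpen_dom.measurableSet
      exact ((hmp.integrableOn_comp_preimage measurableEmbedding_prEquiv).2 h1).mono_set hdT
    refine IntegrableOn.integrable_of_forall_notMem_eq_zero ?_ h0'
    refine h3.congr_fun (fun z _ => ?_) A.isOpen_dom.measurableSet
    change A.sgn o * (A.sgn o * _) = _
    rw [← mul_assoc, A.sgn_mul_self, one_mul]
  · rw [h2, ← hmp.setIntegral_preimage_emb measurableEmbedding_prEquiv, ← integral_const_mul,
      ← setIntegral_eq_integral_of_forall_compl_eq_zero (s := A.dom)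
        (f := fun z => A.sgn o * A.form α z (pFrame m k)) fun z hz => by rw [h0' z hz, mul_zero]]
    refine (setIntegral_eq_of_subset_of_forall_sdiff_eq_zero hmeas hdT hz).trans ?_
    exact setIntegral_congr_fun A.isOpen_dom.measurableSet hd

end AdaptedChart

end AdaptedForms


section SubmanifoldIntegral

open IsManifold (maximalAtlas)

theorem IsCkAt.fun_smul_of_continuous {n : ℕ} {H : Type*} [TopologicalSpace H]
    {I : ModelWithCorners ℝ (Eu n) H} {M : Type*} [TopologicalSpace M] [ChartedSpace H M]
    {p : ℕ} {g : M → ℝ} (hg : Continuous g) {α : DiffForm I M p} {x : M} (hα : IsCkAt 0 α x) :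
    IsCkAt 0 (fun x => g x • α x : DiffForm I M p) x := by
  have h1 : ContDiffWithinAt ℝ 0 (g ∘ (extChartAt I x).symm) (range I) (extChartAt I x x) :=
    (contDiffWithinAt_zero (mem_range_self _)).2 ⟨_, extChartAt_target_mem_nhdsWithin x,
      (hg.comp_continuousOn (continuousOn_extChartAt_symm x)).mono inter_subset_right⟩
  exact h1.smul hα

variable {k m : ℕ} {M : Type*} [TopologicalSpace M] [ChartedSpace (Eu (m + 1 + k)) M]
  [IsManifold (𝓡 (m + 1 + k)) ∞ M]
  {N : Type*} [TopologicalSpace N] [ChartedSpace (Eu k) N] [IsManifold (𝓡 k) ∞ N] {ι : N → M}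

theorem isIntegrableForm_pullback [T2Space M] [T2Space N] [SigmaCompactSpace N]
    (hι : ContMDiff (𝓡 k) (𝓡 (m + 1 + k)) ∞ ι) (hcl : IsClosedEmbedding ι) {f : N → ℝ}
    (hf : Continuous f) {p : ℕ} {η : DiffForm (𝓡 (m + 1 + k)) M p} (hη : IsTestForm η) :
    IsIntegrableForm (fun q => f q • (pullback ι η : DiffForm (𝓡 k) N p) q : DiffForm (𝓡 k) N p) := by
  obtain ⟨K, hK, h0⟩ := (isTestForm_iff.1 hη).2
  have h1 : ∀ q, IsCkAt 0 (fun q => f q • (pullback ι η : DiffForm (𝓡 k) N p) q :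
      DiffForm (𝓡 k) N p) q := fun q =>
    IsCkAt.fun_smul_of_continuous (α := (pullback ι η : DiffForm (𝓡 k) N p)) hf
      (IsCkAt.pullback (r := 0) (by simp) hι (hη.isCkAt (by simp) (ι q)))
  refine ⟨HasLocallyIntegrableCoeffs.of_isCkAt h1, _, hcl.isCompact_preimage hK, fun q hq => ?_⟩
  simp only [pullback, h0 _ hq]
  exact smul_zero _

variable {q₀ : N} (A : AdaptedChart k m ι q₀)

/-- The sign of the coordinate frame of the chart of the submanifold. -/
def AdaptedChart.sgnN (_ : AdaptedChart k m ι q₀) (o : ManifoldOrientation (𝓡 k) N) : ℝ :=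
  chartSgn o (chartAt (Eu k) q₀) (extChartAt (𝓡 k) q₀ q₀)

theorem AdaptedChart.sgnN_mul_self (o : ManifoldOrientation (𝓡 k) N) :
    A.sgnN o * A.sgnN o = 1 := by
  rcases chartSgn_eq_one_or o (IsManifold.chart_mem_maximalAtlas (I := 𝓡 k) (n := ∞) q₀)
    (mem_extChartAt_target q₀) with h | h <;>
    · rw [sgnN, h]; norm_num

theorem AdaptedChart.form_zero_yFrame (hι : ContMDiff (𝓡 k) (𝓡 (m + 1 + k)) ∞ ι) {p : ℕ}
    (η : DiffForm (𝓡 (m + 1 + k)) M p) {y : Eu k}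
    (hy : y ∈ Metric.ball (extChartAt (𝓡 k) q₀ q₀) A.r) :
    chartForm (chartAt (Eu k) q₀) (pullback ι η : DiffForm (𝓡 k) N p) y =
      (A.form η (0, y)).compContinuousLinearMap (ContinuousLinearMap.inr ℝ (Eu (m + 1)) (Eu k)) := by
  have hy0 := A.mem_dom_zero hy
  have he := IsManifold.chart_mem_maximalAtlas (I := 𝓡 k) (n := ∞) q₀
  have h1 : pullMap (ι ∘ ((chartAt (Eu k) q₀).extend (𝓡 k)).symm) (range (𝓡 k)) η y =
      pullMap (A.map ∘ ContinuousLinearMap.inr ℝ (Eu (m + 1)) (Eu k)) univ η y := by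
    rw [ModelWithCorners.range_eq_univ]
    refine pullMap_congr η ?_ (A.symm_zero y hy).symm
    rw [nhdsWithin_univ]
    filter_upwards [Metric.isOpen_ball.mem_nhds hy] with y' hy'
    exact (A.symm_zero y' hy').symm
  have h2 := pullMap_comp (θ := ContinuousLinearMap.inr ℝ (Eu (m + 1)) (Eu k)) (s := univ)
    (t := univ) (z := y) η ((A.contMDiffAt_map hy0).mdifferentiableAt
      (by simp)).mdifferentiableWithinAt
    (ContinuousLinearMap.inr ℝ (Eu (m + 1)) (Eu k)).differentiableAt.differentiableWithinAt
    uniqueDiffWithinAt_univ (mapsTo_univ _ _)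
  rw [fderivWithin_univ, ContinuousLinearMap.fderiv] at h2
  rw [chartForm_pullback hι η he (A.ball_subset hy), h1, h2, A.form_eq_pullMap η hy0]
  rfl

set_option maxHeartbeats 1000000 in
theorem AdaptedChart.weightedCurrent_eq [T2Space M] [T2Space N] [SigmaCompactSpace N]
    (hι : ContMDiff (𝓡 k) (𝓡 (m + 1 + k)) ∞ ι) (hcl : IsClosedEmbedding ι)
    (o : ManifoldOrientation (𝓡 k) N) {f : N → ℝ} (hf : Continuous f)
    {η : DiffForm (𝓡 (m + 1 + k)) M k} (hη : IsTestForm η) {K : Set (Pr m k)}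
    (hKd : K ⊆ A.dom) (h0 : ∀ x ∉ A.map '' K, η x = 0) :
    weightedCurrent o ι f η = A.sgnN o *
      ∫ y, f ((extChartAt (𝓡 k) q₀).symm y) * A.form η (0, y) (yFrame m k) := by
  set γ : DiffForm (𝓡 k) N k := fun q => f q • (pullback ι η : DiffForm (𝓡 k) N k) q with hγ
  have he := IsManifold.chart_mem_maximalAtlas (I := 𝓡 k) (n := ∞) q₀
  set B := Metric.ball (extChartAt (𝓡 k) q₀ q₀) A.r with hB
  have hsupp : ∀ q, γ q ≠ 0 → ∃ y ∈ B, q = (extChartAt (𝓡 k) q₀).symm y := by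
    intro q hq
    have h1 : η (ι q) ≠ 0 := fun h => hq (by
      rw [hγ]
      simp only [pullback, h]
      exact smul_zero _)
    obtain ⟨z, hz, hzq⟩ : ι q ∈ A.map '' K := by_contra fun h => h1 (h0 _ h)
    have h2 := A.of_mem_range z (hKd hz) ⟨q, hzq.symm⟩
    refine ⟨z.2, (hKd hz).2, hcl.injective ?_⟩
    rw [← hzq, ← A.symm_zero z.2 (hKd hz).2, ← h2]
    rfl
  obtain ⟨-, h2⟩ := integral_eq_chart o (isIntegrableForm_pullback hι hcl hf hη) he fun q hq => by
    by_contra h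
    obtain ⟨y, hy, rfl⟩ := hsupp q h
    exact hq (extend_symm_mem_source (A.ball_subset hy))
  have hz : ∀ y ∈ (extChartAt (𝓡 k) q₀).target \ B, chartSgn o (chartAt (Eu k) q₀) y *
      chartForm (chartAt (Eu k) q₀) γ y (stdFrame k) = 0 := by
    rintro y ⟨hy, hyB⟩
    rw [chartForm_eq_zero]
    · exact mul_zero _
    by_contra h
    obtain ⟨y', hy', h'⟩ := hsupp _ h
    exact hyB ((extChartAt (𝓡 k) q₀).symm.injOn hy (A.ball_subset hy') h' ▸ hy')
  have hs : ∀ y ∈ B, chartSgn o (chartAt (Eu k) q₀) y = A.sgnN o := fun y hy =>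
    constant_of_sign (convex_ball _ _).isPreconnected
      ((continuousOn_chartSgn o he).mono A.ball_subset)
      (fun y hy => chartSgn_eq_one_or o he (A.ball_subset hy)) hy (Metric.mem_ball_self A.r_pos)
  have hd : ∀ y ∈ B, chartSgn o (chartAt (Eu k) q₀) y *
      chartForm (chartAt (Eu k) q₀) γ y (stdFrame k) =
      A.sgnN o * (f ((extChartAt (𝓡 k) q₀).symm y) * A.form η (0, y) (yFrame m k)) := by
    intro y hy
    rw [hs y hy]
    have h3 : chartForm (chartAt (Eu k) q₀) γ y = f ((extChartAt (𝓡 k) q₀).symm y) •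
        chartForm (chartAt (Eu k) q₀) (pullback ι η : DiffForm (𝓡 k) N k) y := rfl
    rw [h3, A.form_zero_yFrame hι η hy]
    rfl
  have h0' : ∀ y ∉ B, A.form η (0, y) (yFrame m k) = 0 := fun y hy => by
    have hz : ((0 : Eu (m + 1)), y) ∉ A.dom := fun h => hy h.2
    rw [A.form_of_notMem η hz]
    rfl
  refine h2.trans ?_
  have h4 : ∫ y in B, A.sgnN o * (f ((extChartAt (𝓡 k) q₀).symm y) *
      A.form η (0, y) (yFrame m k)) = ∫ y, A.sgnN o * (f ((extChartAt (𝓡 k) q₀).symm y) *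
      A.form η (0, y) (yFrame m k)) :=
    setIntegral_eq_integral_of_forall_compl_eq_zero fun y hy => by
      rw [h0' y hy, mul_zero, mul_zero]
  rw [← integral_const_mul, ← h4]
  refine (setIntegral_eq_of_subset_of_forall_sdiff_eq_zero
    (measurableSet_extend_target (I := 𝓡 k) (chartAt (Eu k) q₀)) A.ball_subset hz).trans ?_
  exact setIntegral_congr_fun Metric.isOpen_ball.measurableSet hd

end SubmanifoldIntegral

section IntegrationByParts

variable {n a b : ℕ} {M : Type*} [TopologicalSpace M] [ChartedSpace (Eu n) M]
  [IsManifold (𝓡 n) ∞ M]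

theorem dForm_wedgeForm {r : ℕ} (h : a + b = r) (h₁ : a + 1 + b = r + 1) (h₂ : a + (b + 1) = r + 1)
    {α : DiffForm (𝓡 n) M a} {β : DiffForm (𝓡 n) M b} {x : M} (hα : IsCkAt 1 α x)
    (hβ : IsCkAt 1 β x) :
    dForm (wedgeForm h α β) x = (wedgeForm h₁ (dForm α) β +
      (-1 : ℝ) ^ a • wedgeForm h₂ α (dForm β) :
        DiffForm (𝓡 n) M (r + 1)) x := by
  have he := IsManifold.chart_mem_maximalAtlas (I := 𝓡 n) (n := ∞) x
  have hy := mem_extChartAt_target (I := 𝓡 n) x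
  have hxx := extChartAt_to_inv (I := 𝓡 n) x
  have hα' : IsCkAt 1 α (((chartAt (Eu n) x).extend (𝓡 n)).symm (extChartAt (𝓡 n) x x)) :=
    hxx.symm ▸ hα
  have hβ' : IsCkAt 1 β (((chartAt (Eu n) x).extend (𝓡 n)).symm (extChartAt (𝓡 n) x x)) :=
    hxx.symm ▸ hβ
  have hγ' : IsCkAt 1 (wedgeForm h α β)
      (((chartAt (Eu n) x).extend (𝓡 n)).symm (extChartAt (𝓡 n) x x)) := hα'.wedgeForm h hβ'
  refine eq_of_chartForm_eq he (mem_chart_source _ x) ?_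
  change chartForm _ _ (extChartAt (𝓡 n) x x) = chartForm _ _ (extChartAt (𝓡 n) x x)
  have h1 := (hα'.chartForm (by norm_cast) he hy)
  have h2 := (hβ'.chartForm (by norm_cast) he hy)
  rw [chartForm_add, Pi.add_apply, chartForm_smul, Pi.smul_apply, chartForm_wedgeForm,
    chartForm_wedgeForm, chartForm_dForm he hy hγ', chartForm_dForm he hy hα',
    chartForm_dForm he hy hβ']
  rw [ModelWithCorners.range_eq_univ, contDiffWithinAt_univ] at h1 h2
  rw [ModelWithCorners.range_eq_univ, extDerivWithin_univ, extDerivWithin_univ,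
    extDerivWithin_univ, ← extDeriv_wedge h h₁ h₂ (h1.differentiableAt (by simp))
      (h2.differentiableAt (by simp))]
  congr 1
  funext y
  exact chartForm_wedgeForm h α β _ y

theorem wedgeForm_eq_zero_right {r : ℕ} (h : a + b = r) (α : DiffForm (𝓡 n) M a)
    {β : DiffForm (𝓡 n) M b} {x : M} (h0 : β x = 0) : wedgeForm h α β x = 0 := by
  change wedge h (α x) (β x) = 0
  rw [h0]
  exact wedge_zero_right (E := Eu n) h (α x)

theorem IsCkAt.of_eq_zero {p : ℕ} {s : ℕ∞ω} {α : DiffForm (𝓡 n) M p} {K : Set M} (hK : IsClosed K)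
    (h0 : ∀ x ∉ K, α x = 0) (h : ∀ x ∈ K, IsCkAt s α x) (x : M) : IsCkAt s α x := by
  by_cases hx : x ∈ K
  · exact h x hx
  · refine IsCkAt.zero.congr ?_
    filter_upwards [hK.isOpen_compl.mem_nhds hx] with y hy using h0 y hy

/-- Integration by parts. -/
theorem integral_wedgeForm_dForm [T2Space M] [SigmaCompactSpace M]
    (o : ManifoldOrientation (𝓡 n) M) (h₁ : a + 1 + b = n) (h₂ : a + (b + 1) = n)
    {α : DiffForm (𝓡 n) M a} {β : DiffForm (𝓡 n) M b} {K : Set M} (hK : IsCompact K)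
    (hα : ∀ x ∈ K, ∀ᶠ y in 𝓝 x, IsCkAt 1 α y) (hβ : ∀ x, IsCkAt 1 β x) (h0 : ∀ x ∉ K, β x = 0) :
    integral o (wedgeForm h₁ (dForm α) β) = (-1) ^ (a + 1) *
      integral o (wedgeForm h₂ α (dForm β)) := by
  obtain rfl : n = a + b + 1 := by omega
  have hz : ∀ x ∉ K, wedgeForm rfl α β x = 0 := fun x hx =>
    wedgeForm_eq_zero_right rfl α (h0 x hx)
  have hdz : ∀ x ∉ K, dForm β x = 0 := fun x hx => dForm_eq_zero_of_eq_zero hK.isClosed h0 hx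
  have hz1 : ∀ x ∉ K, wedgeForm h₁ (dForm α) β x = 0 := fun x hx =>
    wedgeForm_eq_zero_right h₁ _ (h0 x hx)
  have hz2 : ∀ x ∉ K, wedgeForm h₂ α (dForm β) x = 0 := fun x hx =>
    wedgeForm_eq_zero_right h₂ α (hdz x hx)
  have hc : ∀ x, IsCkAt 1 (wedgeForm rfl α β) x :=
    IsCkAt.of_eq_zero hK.isClosed hz fun x hx => (hα x hx).self_of_nhds.wedgeForm rfl (hβ x)
  have hc1 : ∀ x, IsCkAt 0 (wedgeForm h₁ (dForm α) β) x :=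
    IsCkAt.of_eq_zero hK.isClosed hz1 fun x hx =>
      (IsCkAt.dForm (r := 0) (by simpa using hα x hx)).wedgeForm h₁
        ((hβ x).of_le zero_le_one)
  have hc2 : ∀ x, IsCkAt 0 (wedgeForm h₂ α (dForm β)) x :=
    IsCkAt.of_eq_zero hK.isClosed hz2 fun x hx =>
      ((hα x hx).self_of_nhds.of_le zero_le_one).wedgeForm h₂ (IsCkAt.dForm (r := 0)
        (Eventually.of_forall fun x' => by simpa using hβ x'))
  have hd : dForm (wedgeForm rfl α β) = wedgeForm h₁ (dForm α) β +
      (-1 : ℝ) ^ a • wedgeForm h₂ α (dForm β) := by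
    funext x
    by_cases hx : x ∈ K
    · exact dForm_wedgeForm rfl h₁ h₂ (hα x hx).self_of_nhds (hβ x)
    · rw [dForm_eq_zero_of_eq_zero hK.isClosed hz hx, Pi.add_apply, Pi.smul_apply, hz1 x hx,
        hz2 x hx, smul_zero, add_zero]
  have h3 := integral_dForm_eq_zero o hc hK hz
  rw [hd, integral_add o (isIntegrableForm_of_continuous hc1 hK hz1)
    ((isIntegrableForm_of_continuous hc2 hK hz2).smul _), integral_smul] at h3
  rw [pow_succ]
  linarith

end IntegrationByParts


section Localization

open IsManifold (maximalAtlas)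

variable {n p : ℕ} {M : Type*} [TopologicalSpace M] [ChartedSpace (Eu n) M]
  [IsManifold (𝓡 n) ∞ M] [T2Space M] [SigmaCompactSpace M]

theorem isTestForm_zero : IsTestForm (0 : DiffForm (𝓡 n) M p) :=
  isTestForm_iff.2 ⟨fun _ => IsCkAt.zero, ∅, isCompact_empty, fun _ _ => rfl⟩

/-- An additive functional on test forms which vanishes locally is zero. -/
theorem eq_zero_of_locally_eq_zero {T : DiffForm (𝓡 n) M p → ℝ}
    (hadd : ∀ η ζ, IsTestForm η → IsTestForm ζ → T (η + ζ) = T η + T ζ)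
    (hloc : ∀ x, ∃ U ∈ 𝓝 x, ∀ η, IsTestForm η → ∀ K, IsCompact K → K ⊆ U → (∀ y ∉ K, η y = 0) →
      T η = 0) {η : DiffForm (𝓡 n) M p} (hη : IsTestForm η) : T η = 0 := by
  classical
  choose U hU hloc using hloc
  obtain ⟨K, hK, h0⟩ := (isTestForm_iff.1 hη).2
  obtain ⟨ρ, hρ⟩ := SmoothPartitionOfUnity.exists_isSubordinate (𝓡 n) (isClosed_univ (X := M))
    (fun x => interior (U x)) (fun x => isOpen_interior) fun x _ =>
      mem_iUnion.2 ⟨x, mem_interior_iff_mem_nhds.2 (hU x)⟩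
  have hfin := ρ.locallyFinite.finite_nonempty_inter_compact hK
  have h1 : η = ∑ i ∈ hfin.toFinset, (fun x => ρ i x • η x : DiffForm (𝓡 n) M p) := by
    funext x
    rw [Finset.sum_apply]
    by_cases hx : x ∈ K
    · have h2 := ρ.sum_eq_one (mem_univ x)
      rw [finsum_eq_sum_of_support_subset _ (s := hfin.toFinset) fun i hi => by
        rw [hfin.coe_toFinset]; exact ⟨x, hi, hx⟩] at h2
      rw [← Finset.sum_smul, h2, one_smul]
    · simp [h0 x hx]
  have hT0 : T 0 = 0 := by
    have := hadd 0 0 isTestForm_zero isTestForm_zero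
    rw [add_zero] at this
    linarith
  have hterm : ∀ i, IsTestForm (fun x => ρ i x • η x : DiffForm (𝓡 n) M p) ∧
      T (fun x => ρ i x • η x : DiffForm (𝓡 n) M p) = 0 := by
    intro i
    have h2 := hη.fun_smul (ρ i).contMDiff
    refine ⟨h2, hloc i _ h2 (tsupport (ρ i) ∩ K) (hK.inter_left (isClosed_tsupport _))
      (inter_subset_left.trans ((hρ i).trans interior_subset)) fun y hy => ?_⟩
    by_cases hyK : y ∈ K
    · rw [image_eq_zero_of_notMem_tsupport fun h => hy ⟨h, hyK⟩, zero_smul]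
    · rw [h0 y hyK, smul_zero]
  have hsum : ∀ s : Finset M, IsTestForm (∑ i ∈ s, (fun x => ρ i x • η x : DiffForm (𝓡 n) M p)) ∧
      T (∑ i ∈ s, (fun x => ρ i x • η x : DiffForm (𝓡 n) M p)) = 0 := by
    intro s
    induction s using Finset.induction_on with
    | empty => exact ⟨isTestForm_zero, hT0⟩
    | insert a s ha ih =>
      rw [Finset.sum_insert ha]
      exact ⟨(hterm a).1.add ih.1, by rw [hadd _ _ (hterm a).1 ih.1, (hterm a).2, ih.2, add_zero]⟩
  rw [h1]
  exact (hsum _).2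

/-- The fundamental lemma of the calculus of variations, on a manifold. -/
theorem eq_zero_of_integral_wedgeForm (o : ManifoldOrientation (𝓡 n) M) {a : ℕ} (h : a + p = n)
    {γ : DiffForm (𝓡 n) M a} {U : Set M} (hU : IsOpen U) (hγ : ∀ x ∈ U, IsCkAt 0 γ x)
    (hint : ∀ η : DiffForm (𝓡 n) M p, IsTestForm η → ∀ K, IsCompact K → K ⊆ U →
      (∀ x ∉ K, η x = 0) → integral o (wedgeForm h γ η) = 0) {x : M} (hx : x ∈ U) : γ x = 0 := by
  have he := IsManifold.chart_mem_maximalAtlas (I := 𝓡 n) (n := ∞) x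
  have hxt := mem_extChartAt_target (I := 𝓡 n) x
  have hev : ∀ᶠ y in 𝓝 (extChartAt (𝓡 n) x x),
      y ∈ (extChartAt (𝓡 n) x).target ∩ (extChartAt (𝓡 n) x).symm ⁻¹' U := by
    refine inter_mem (extChartAt_target_mem_nhds x) ?_
    refine (continuousAt_extChartAt_symm x).preimage_mem_nhds ?_
    rw [extChartAt_to_inv]
    exact hU.mem_nhds hx
  obtain ⟨ρ, hρ, hρs⟩ := Metric.mem_nhds_iff.1 hev
  set V := Metric.ball (extChartAt (𝓡 n) x x) ρ with hV
  have hxV : extChartAt (𝓡 n) x x ∈ V := Metric.mem_ball_self hρ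
  have hs : ∀ y ∈ V, chartSgn o (chartAt (Eu n) x) y =
      chartSgn o (chartAt (Eu n) x) (extChartAt (𝓡 n) x x) := fun y hy =>
    constant_of_sign (convex_ball _ _).isPreconnected
      ((continuousOn_chartSgn o he).mono fun y hy => (hρs hy).1)
      (fun y hy => chartSgn_eq_one_or o he (hρs hy).1) hy hxV
  have hc : ContinuousOn (chartForm (chartAt (Eu n) x) γ) V := by
    intro y hy
    have := ((hγ _ (hρs hy).2).chartForm (by simp) he (hρs hy).1).continuousWithinAt
    exact this.mono (by rw [ModelWithCorners.range_eq_univ]; exact subset_univ _)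
  have key := form_eq_zero_of_integral_wedge volume h (stdBasis n) Metric.isOpen_ball hc
    (fun w hw hwc hwV => ?_) _ hxV
  · refine eq_of_chartForm_eq (β := (0 : DiffForm (𝓡 n) M a)) he (mem_chart_source _ x)
      (key.trans ?_)
    exact (chartForm_eq_zero rfl).symm
  obtain ⟨h1, h2, h3, h4⟩ := isTestForm_ofChart (p := p) he hw.contDiffOn hwc
    (hwV.trans fun y hy => (hρs hy).1) fun y hy => image_eq_zero_of_notMem_tsupport hy
  have h5 := hint _ h1 _ h2 (by rintro _ ⟨y, hy, rfl⟩; exact (hρs (hwV hy)).2) h4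
  have hz : ∀ y ∉ ((chartAt (Eu n) x).extend (𝓡 n)).symm '' tsupport w,
      wedgeForm h γ (ofChart (chartAt (Eu n) x) w : DiffForm (𝓡 n) M p) y = 0 :=
    fun y hy => wedgeForm_eq_zero_right h γ (h4 y hy)
  have hγ' : IsIntegrableForm (wedgeForm h γ (ofChart (chartAt (Eu n) x) w)) := by
    refine ⟨.of_isCkAt (IsCkAt.of_eq_zero h2.isClosed hz fun y hy => ?_), _, h2, hz⟩
    refine (hγ y ?_).wedgeForm h (h1.isCkAt (by simp) y)
    obtain ⟨z, hz, rfl⟩ := hy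
    exact (hρs (hwV hz)).2
  have h6 := (integral_eq_chart o hγ' he fun y hy =>
    wedgeForm_eq_zero_right h γ (h4 y fun hy' => hy (h3 hy'))).2
  rw [h5] at h6
  have hd : ∀ y ∈ (extChartAt (𝓡 n) x).target, chartSgn o (chartAt (Eu n) x) y *
      chartForm (chartAt (Eu n) x) (wedgeForm h γ (ofChart (chartAt (Eu n) x) w)) y (stdFrame n) =
      chartSgn o (chartAt (Eu n) x) (extChartAt (𝓡 n) x x) *
        wedge h (chartForm (chartAt (Eu n) x) γ y) (w y) (stdBasis n) := by
    intro y hy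
    rw [chartForm_wedgeForm, chartForm_ofChart he w hy, coe_stdBasis]
    by_cases hyV : y ∈ V
    · rw [hs y hyV]
    · rw [image_eq_zero_of_notMem_tsupport fun h => hyV (hwV h), wedge_zero_right]
      exact (mul_zero _).trans (mul_zero _).symm
  have h7 := h6.trans (setIntegral_congr_fun
    (measurableSet_extend_target (I := 𝓡 n) (chartAt (Eu n) x)) hd)
  rw [integral_const_mul, setIntegral_eq_integral_of_forall_compl_eq_zero fun y hy => ?_] at h7
  · rcases mul_eq_zero.1 h7.symm with h8 | h8
    · rcases chartSgn_eq_one_or o he hxt with h9 | h9 <;> rw [h9] at h8 <;> norm_num at h8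
    · exact h8
  · rw [image_eq_zero_of_notMem_tsupport fun h => hy (hρs (hwV h)).1, wedge_zero_right]
    rfl

end Localization

section Pairing

open IsManifold (maximalAtlas)

variable {k m : ℕ} {M : Type*} [TopologicalSpace M] [ChartedSpace (Eu (m + 1 + k)) M]
  [IsManifold (𝓡 (m + 1 + k)) ∞ M] [T2Space M] [SigmaCompactSpace M]
  (oM : ManifoldOrientation (𝓡 (m + 1 + k)) M)
  {N : Type*} [TopologicalSpace N] [ChartedSpace (Eu k) N]
  [IsManifold (𝓡 k) ∞ N] [T2Space N] [SigmaCompactSpace N]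
  (oN : ManifoldOrientation (𝓡 k) N) {ι : N → M}
  {Ω : DiffForm (𝓡 (m + 1 + k)) M m} {H : DiffForm (𝓡 (m + 1 + k)) M (m + 1)}

theorem wedgeForm_add_left {n a b r : ℕ} {M : Type*} [TopologicalSpace M] [ChartedSpace (Eu n) M]
    (h : a + b = r) (α α' : DiffForm (𝓡 n) M a) (β : DiffForm (𝓡 n) M b) :
    wedgeForm h (α + α') β = wedgeForm h α β + wedgeForm h α' β :=
  funext fun x => wedge_add_left (E := Eu n) h (α x) (α' x) (β x)

theorem wedgeForm_add_right {n a b r : ℕ} {M : Type*} [TopologicalSpace M] [ChartedSpace (Eu n) M]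
    (h : a + b = r) (α : DiffForm (𝓡 n) M a) (β β' : DiffForm (𝓡 n) M b) :
    wedgeForm h α (β + β') = wedgeForm h α β + wedgeForm h α β' :=
  funext fun x => wedge_add_right (E := Eu n) h (α x) (β x) (β' x)

theorem wedgeForm_smul_right {n a b r : ℕ} {M : Type*} [TopologicalSpace M] [ChartedSpace (Eu n) M]
    (h : a + b = r) (c : ℝ) (α : DiffForm (𝓡 n) M a) (β : DiffForm (𝓡 n) M b) :
    wedgeForm h α (c • β) = c • wedgeForm h α β :=
  funext fun x => wedge_smul_right (E := Eu n) h c (α x) (β x)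

theorem IsTestForm.isIntegrableForm_wedgeForm {n a b r : ℕ} {M : Type*} [TopologicalSpace M]
    [ChartedSpace (Eu n) M] [IsManifold (𝓡 n) ∞ M] [T2Space M] (h : a + b = r)
    {α : DiffForm (𝓡 n) M a} (hα : HasLocallyIntegrableCoeffs α) {β : DiffForm (𝓡 n) M b}
    (hβ : IsTestForm β) : IsIntegrableForm (wedgeForm h α β) := by
  obtain ⟨K, hK, h0⟩ := (isTestForm_iff.1 hβ).2
  exact BlowUpCurrents.isIntegrableForm_wedgeForm h hα (fun x => hβ.isCkAt (by simp) x) hK h0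

theorem currentOfForm_add {n a b : ℕ} {M : Type*} [TopologicalSpace M]
    [ChartedSpace (Eu n) M] [IsManifold (𝓡 n) ∞ M] [T2Space M] [SigmaCompactSpace M]
    (o : ManifoldOrientation (𝓡 n) M) (h : a + b = n)
    {α : DiffForm (𝓡 n) M a} (hα : HasLocallyIntegrableCoeffs α) {η ζ : DiffForm (𝓡 n) M b}
    (hη : IsTestForm η) (hζ : IsTestForm ζ) :
    currentOfForm o h α (η + ζ) = currentOfForm o h α η + currentOfForm o h α ζ := by
  change integral o (wedgeForm h α (η + ζ)) = _
  rw [wedgeForm_add_right, integral_add o (hη.isIntegrableForm_wedgeForm h hα)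
    (hζ.isIntegrableForm_wedgeForm h hα)]
  rfl

theorem currentOfForm_smul {n a b : ℕ} {M : Type*} [TopologicalSpace M]
    [ChartedSpace (Eu n) M] [IsManifold (𝓡 n) ∞ M] [T2Space M] [SigmaCompactSpace M]
    (o : ManifoldOrientation (𝓡 n) M) (h : a + b = n)
    (α : DiffForm (𝓡 n) M a) (c : ℝ) (η : DiffForm (𝓡 n) M b) :
    currentOfForm o h α (c • η) = c * currentOfForm o h α η := by
  change integral o (wedgeForm h α (c • η)) = _
  rw [wedgeForm_smul_right, integral_smul]
  rfl

theorem IsTestForm.dForm_add {n b : ℕ} {M : Type*} [TopologicalSpace M]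
    [ChartedSpace (Eu n) M] [IsManifold (𝓡 n) ∞ M] {η ζ : DiffForm (𝓡 n) M b}
    (hη : IsTestForm η) (hζ : IsTestForm ζ) :
    BlowUpCurrents.dForm (η + ζ) = BlowUpCurrents.dForm η + BlowUpCurrents.dForm ζ :=
  funext fun x => BlowUpCurrents.dForm_add (hη.isCkAt (by norm_cast) x) (hζ.isCkAt (by norm_cast) x)

variable (Ω H) in
/-- The functional `dΩ + H`. -/
def pairing (η : DiffForm (𝓡 (m + 1 + k)) M k) : ℝ :=
  (-1) ^ (m + 1) * integral oM (wedgeForm (by omega : m + (k + 1) = m + 1 + k) Ω (dForm η)) +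
    integral oM (wedgeForm rfl H η)

theorem currentD_currentOfForm_eq (η : DiffForm (𝓡 (m + 1 + k)) M k) :
    currentD (currentOfForm oM (by omega : m + (k + 1) = m + 1 + k) Ω) η =
      (-1) ^ (m + 1) * integral oM
        (wedgeForm (by omega : m + (k + 1) = m + 1 + k) Ω (dForm η)) := by
  rw [currentD, show m + 1 + k - (k + 1) + 1 = m + 1 by omega]
  rfl

theorem currentEquation_iff {f : N → ℝ} : CurrentEquation oM oN ι f Ω H ↔
    ∀ η : DiffForm (𝓡 (m + 1 + k)) M k, IsTestForm η →
      pairing oM Ω H η = weightedCurrent oN ι f η := by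
  refine forall_congr' fun η => forall_congr' fun _ => ?_
  rw [currentD_currentOfForm_eq, pairing, Pi.sub_apply, eq_sub_iff_add_eq]
  rfl

theorem pairing_add (hΩ : HasLocallyIntegrableCoeffs Ω) (hH : HasLocallyIntegrableCoeffs H)
    {η ζ : DiffForm (𝓡 (m + 1 + k)) M k} (hη : IsTestForm η) (hζ : IsTestForm ζ) :
    pairing oM Ω H (η + ζ) = pairing oM Ω H η + pairing oM Ω H ζ := by
  have h1 := currentOfForm_add oM (by omega : m + (k + 1) = m + 1 + k) hΩ hη.dForm hζ.dForm
  have h2 := currentOfForm_add oM rfl hH hη hζ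
  rw [← hη.dForm_add hζ] at h1
  change integral oM (wedgeForm _ Ω (dForm (η + ζ))) = integral oM (wedgeForm _ Ω (dForm η)) +
    integral oM (wedgeForm _ Ω (dForm ζ)) at h1
  change integral oM (wedgeForm _ H (η + ζ)) = integral oM (wedgeForm _ H η) +
    integral oM (wedgeForm _ H ζ) at h2
  rw [pairing, h1, h2, pairing, pairing]
  ring

theorem AdaptedChart.pairing_eq {q₀ : N} (A : AdaptedChart k m ι q₀)
    (hΩ : HasLocallyIntegrableCoeffs Ω) (hH : HasLocallyIntegrableCoeffs H)
    {η : DiffForm (𝓡 (m + 1 + k)) M k} (hη : IsTestForm η) {K : Set (Pr m k)} (hK : IsCompact K)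
    (hKd : K ⊆ A.dom) (h0 : ∀ x ∉ A.map '' K, η x = 0) :
    pairing oM Ω H η = A.sgn oM * FlatPairing (A.form Ω) (A.form H) (A.form η) := by
  have hc : IsClosed (A.map '' K) :=
    (hK.image_of_continuousOn (A.continuousOn_map.mono hKd)).isClosed
  have h1 := (A.integral_eq oM (hη.dForm.isIntegrableForm_wedgeForm
    (by omega : m + (k + 1) = m + 1 + k) hΩ) hKd fun x hx =>
      wedgeForm_eq_zero_right _ _ (dForm_eq_zero_of_eq_zero hc h0 hx)).2
  have h2 := (A.integral_eq oM (hη.isIntegrableForm_wedgeForm rfl hH) hKd fun x hx =>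
      wedgeForm_eq_zero_right _ _ (h0 x hx)).2
  rw [pairing, h1, h2, FlatPairing, mul_add]
  simp only [A.form_wedgeForm]
  have h3 : ∀ z, wedge (by omega : m + (k + 1) = m + 1 + k) (A.form Ω z) (A.form (dForm η) z) =
      wedge (by omega : m + (k + 1) = m + 1 + k) (A.form Ω z) (extDeriv (A.form η) z) := by
    intro z
    by_cases hz : z ∈ A.dom
    · rw [A.form_dForm hz (hη.isCkAt (by norm_cast) _)]
    · rw [A.form_of_notMem Ω hz, wedge_zero_left, wedge_zero_left]
  simp only [h3]
  ring

/-- The equation of currents in an adapted chart. -/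
theorem AdaptedChart.flatEq {q₀ : N} (A : AdaptedChart k m ι q₀)
    (hι : ContMDiff (𝓡 k) (𝓡 (m + 1 + k)) ∞ ι) (hcl : IsClosedEmbedding ι)
    (hΩ : HasLocallyIntegrableCoeffs Ω) (hH : HasLocallyIntegrableCoeffs H)
    {f : N → ℝ} (hf : Continuous f) (h : CurrentEquation oM oN ι f Ω H) :
    FlatEq (A.form Ω) (A.form H) (extChartAt (𝓡 k) q₀ q₀) A.r
      fun y => A.sgn oM * A.sgnN oN * f ((extChartAt (𝓡 k) q₀).symm y) := by
  intro w hw K hK hKd h0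
  obtain ⟨η, hη, hη0, rfl⟩ := A.exists_testForm hw hK hKd h0
  have h1 := (currentEquation_iff oM oN).1 h η hη
  rw [A.pairing_eq oM hΩ hH hη hK hKd hη0, A.weightedCurrent_eq hι hcl oN hf hη hKd hη0] at h1
  have h2 := congrArg (A.sgn oM * ·) h1
  simp only [← mul_assoc, A.sgn_mul_self, one_mul] at h2
  rw [h2, ← integral_const_mul]
  simp only [mul_assoc]

theorem AdaptedChart.pairing_eq_of_flatEq {q₀ : N} (A : AdaptedChart k m ι q₀)
    (hι : ContMDiff (𝓡 k) (𝓡 (m + 1 + k)) ∞ ι) (hcl : IsClosedEmbedding ι)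
    (hΩ : HasLocallyIntegrableCoeffs Ω) (hH : HasLocallyIntegrableCoeffs H)
    {g : Eu k → ℝ} {c : ℝ} (hg : ∀ y ∈ Metric.ball (extChartAt (𝓡 k) q₀ q₀) A.r, g y = c)
    (h : FlatEq (A.form Ω) (A.form H) (extChartAt (𝓡 k) q₀ q₀) A.r g)
    {η : DiffForm (𝓡 (m + 1 + k)) M k} (hη : IsTestForm η) {K : Set (Pr m k)} (hK : IsCompact K)
    (hKd : K ⊆ A.dom) (h0 : ∀ x ∉ A.map '' K, η x = 0) :
    pairing oM Ω H η = weightedCurrent oN ι (fun _ => A.sgn oM * A.sgnN oN * c) η := by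
  obtain ⟨h1, h2⟩ := A.contDiff_form (fun x => hη.isCkAt le_rfl x) hK hKd h0
  rw [A.pairing_eq oM hΩ hH hη hK hKd h0, h _ h1 K hK hKd h2,
    A.weightedCurrent_eq hι hcl oN continuous_const hη hKd h0, integral_const_mul]
  have h3 : ∀ y, g y * A.form η (0, y) (yFrame m k) = c * A.form η (0, y) (yFrame m k) := by
    intro y
    by_cases hy : y ∈ Metric.ball (extChartAt (𝓡 k) q₀ q₀) A.r
    · rw [hg y hy]
    · have hz : ((0 : Eu (m + 1)), y) ∉ A.dom := fun h => hy h.2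
      rw [A.form_of_notMem η hz]
      exact (mul_zero _).trans (mul_zero _).symm
  simp only [h3]
  rw [integral_const_mul]
  linear_combination (-(A.sgn oM * c * ∫ y, A.form η (0, y) (yFrame m k))) * A.sgnN_mul_self oN

/-- The functional `dΩ + H` away from the submanifold. -/
theorem pairing_eq_integral (hΩ : IsCkOn 1 Ω (range ι)ᶜ) (hcl : IsClosed (range ι))
    (hH : HasLocallyIntegrableCoeffs H) {η : DiffForm (𝓡 (m + 1 + k)) M k} (hη : IsTestForm η)
    {K : Set M} (hK : IsCompact K) (hKι : K ⊆ (range ι)ᶜ) (h0 : ∀ x ∉ K, η x = 0) :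
    pairing oM Ω H η = integral oM (wedgeForm rfl (dForm Ω + H) η) := by
  have hΩ' : ∀ x ∈ K, ∀ᶠ y in 𝓝 x, IsCkAt 1 Ω y := fun x hx => by
    filter_upwards [hcl.isOpen_compl.mem_nhds (hKι hx)] with y hy
    exact hΩ.isCkAt hcl.isOpen_compl hy
  have h1 := integral_wedgeForm_dForm oM rfl (by omega : m + (k + 1) = m + 1 + k) hK hΩ'
    (fun x => hη.isCkAt (by norm_cast) x) h0
  have hz : ∀ y ∉ K, wedgeForm rfl (dForm Ω) η y = 0 := fun y hy =>
    wedgeForm_eq_zero_right rfl _ (h0 y hy)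
  have h2 : IsIntegrableForm (wedgeForm rfl (dForm Ω) η) := by
    refine ⟨.of_isCkAt (IsCkAt.of_eq_zero hK.isClosed hz fun y hy => ?_), _, hK, hz⟩
    exact (IsCkAt.dForm (r := 0) (by simpa using hΩ' y hy)).wedgeForm rfl
      (hη.isCkAt (by simp) y)
  rw [wedgeForm_add_left, integral_add oM h2 (hη.isIntegrableForm_wedgeForm rfl hH), h1, pairing]

end Pairing


section NormalSlices

open IsManifold (maximalAtlas)

variable {k m : ℕ} {M : Type*} [TopologicalSpace M] [ChartedSpace (Eu (m + 1 + k)) M]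
  [IsManifold (𝓡 (m + 1 + k)) ∞ M]
  {N : Type*} [TopologicalSpace N] [ChartedSpace (Eu k) N] [IsManifold (𝓡 k) ∞ N] {ι : N → M}

theorem surjective_of_injective_endo (T : Eu k →L[ℝ] Eu k) (h : Function.Injective T) :
    Function.Surjective T :=
  LinearMap.surjective_of_injective (f := T.toLinearMap) h

theorem injective_mfderiv_of_isSmoothEmbedding
    (hι : Manifold.IsSmoothEmbedding (𝓡 k) (𝓡 (m + 1 + k)) ∞ ι) (q : N) :
    Function.Injective (mfderiv (𝓡 k) (𝓡 (m + 1 + k)) ι q) := by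
  have h := hι.isImmersion.isImmersionAt q
  have hd := h.domChart_mem_maximalAtlas
  have hc := h.codChart_mem_maximalAtlas
  set y := h.domChart.extend (𝓡 k) q with hy
  have hyt : y ∈ (h.domChart.extend (𝓡 k)).target := extend_mem_target h.mem_domChart_source
  have hyq : (h.domChart.extend (𝓡 k)).symm y = q := h.domChart.extend_left_inv h.mem_domChart_source
  have h1 := mdifferentiableWithinAt_extend_symm hd hyt
  rw [ModelWithCorners.range_eq_univ, mdifferentiableWithinAt_univ] at h1
  have h2 : MDifferentiableAt (𝓡 k) (𝓡 (m + 1 + k)) ι ((h.domChart.extend (𝓡 k)).symm y) :=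
    (hι.contMDiff _).mdifferentiableAt (by simp)
  have h3 : MDifferentiableAt (𝓡 (m + 1 + k)) 𝓘(ℝ, Eu (m + 1 + k))
      (h.codChart.extend (𝓡 (m + 1 + k))) (ι ((h.domChart.extend (𝓡 k)).symm y)) := by
    rw [hyq]
    exact (h.codChart.contMDiffAt_extend hc h.mem_codChart_source).mdifferentiableAt (by simp)
  have hev : (h.codChart.extend (𝓡 (m + 1 + k))) ∘ ι ∘ (h.domChart.extend (𝓡 k)).symm =ᶠ[𝓝 y]
      h.equiv ∘ (·, 0) := by
    have := extend_target_mem_nhdsWithin hyt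
    rw [ModelWithCorners.range_eq_univ, nhdsWithin_univ] at this
    filter_upwards [this] with z hz using h.writtenInCharts hz
  have h4 : HasFDerivAt (h.equiv ∘ (·, 0)) ((h.equiv : Eu k × h.complement →L[ℝ] Eu (m + 1 + k)).comp
      (ContinuousLinearMap.inl ℝ (Eu k) h.complement)) y :=
    ((h.equiv : Eu k × h.complement →L[ℝ] Eu (m + 1 + k)).comp
      (ContinuousLinearMap.inl ℝ (Eu k) h.complement)).hasFDerivAt
  have h5 : mfderiv 𝓘(ℝ, Eu k) 𝓘(ℝ, Eu (m + 1 + k))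
      ((h.codChart.extend (𝓡 (m + 1 + k))) ∘ ι ∘ (h.domChart.extend (𝓡 k)).symm) y =
      (h.equiv : Eu k × h.complement →L[ℝ] Eu (m + 1 + k)).comp
      (ContinuousLinearMap.inl ℝ (Eu k) h.complement) := by
    rw [mfderiv_eq_fderiv, hev.fderiv_eq, h4.fderiv]
  have h6 := mfderiv_comp y h3 (h2.comp y h1)
  have h7 := mfderiv_comp y h2 h1
  rw [h5, h7] at h6
  have hinj := injective_mfderivWithin_extend_symm hd hyt
  rw [ModelWithCorners.range_eq_univ, mfderivWithin_univ] at hinj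
  have hsurj : Function.Surjective (mfderiv 𝓘(ℝ, Eu k) (𝓡 k) (h.domChart.extend (𝓡 k)).symm y :
      Eu k →L[ℝ] Eu k) := surjective_of_injective_endo _ hinj
  suffices hs : Function.Injective (mfderiv (𝓡 k) (𝓡 (m + 1 + k)) ι
      ((h.domChart.extend (𝓡 k)).symm y)) by rwa [hyq] at hs
  refine (injective_iff_map_eq_zero _).2 fun a ha => ?_
  obtain ⟨b, rfl⟩ := hsurj a
  have h8 := congrArg (fun L : Eu k →L[ℝ] Eu (m + 1 + k) => L b) h6
  change h.equiv (b, 0) = mfderiv (𝓡 (m + 1 + k)) 𝓘(ℝ, Eu (m + 1 + k))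
    (h.codChart.extend (𝓡 (m + 1 + k))) _ (mfderiv (𝓡 k) (𝓡 (m + 1 + k)) ι _ _) at h8
  have h9 : mfderiv (𝓡 (m + 1 + k)) 𝓘(ℝ, Eu (m + 1 + k)) (h.codChart.extend (𝓡 (m + 1 + k)))
      (ι ((h.domChart.extend (𝓡 k)).symm y)) (mfderiv (𝓡 k) (𝓡 (m + 1 + k)) ι
        ((h.domChart.extend (𝓡 k)).symm y)
        (mfderiv 𝓘(ℝ, Eu k) (𝓡 k) (h.domChart.extend (𝓡 k)).symm y b)) = 0 :=
    (congrArg _ ha).trans (map_zero _)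
  have h10 : ((b, 0) : Eu k × h.complement) = 0 :=
    h.equiv.injective ((h8.trans h9).trans (map_zero h.equiv).symm)
  have h11 : b = 0 := congrArg Prod.fst h10
  rw [h11]
  exact map_zero _

/-- An adapted chart is obtained by moving the submanifold along a transverse slice. -/
theorem exists_adaptedChart_of_slice
    (hι : Manifold.IsSmoothEmbedding (𝓡 k) (𝓡 (m + 1 + k)) ∞ ι) (q₀ : N)
    {b : Eu (m + 1) → Eu (m + 1 + k)} {V : Set (Eu (m + 1))} (hV : V ∈ 𝓝 0)
    (hb : ContDiffOn ℝ ∞ b V) (hb0 : b 0 = 0)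
    (hsup : LinearMap.range (fderiv ℝ b 0).toLinearMap ⊔
      LinearMap.range (mfderiv (𝓡 k) (𝓡 (m + 1 + k)) ι q₀ :
        Eu k →L[ℝ] Eu (m + 1 + k)).toLinearMap = ⊤) {δ : ℝ} (hδ : 0 < δ) :
    ∃ A : AdaptedChart k m ι q₀, A.r ≤ δ ∧ ∀ z ∈ A.dom, A.map z =
      (extChartAt (𝓡 (m + 1 + k)) (ι q₀)).symm (b z.1 +
        extChartAt (𝓡 (m + 1 + k)) (ι q₀) (ι ((extChartAt (𝓡 k) q₀).symm z.2))) := by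
  set y₀ := extChartAt (𝓡 k) q₀ q₀ with hy₀
  set p := ι q₀ with hp
  set R : Eu k → Eu (m + 1 + k) := fun y =>
    extChartAt (𝓡 (m + 1 + k)) p (ι ((extChartAt (𝓡 k) q₀).symm y)) with hR
  set G : Pr m k → Eu (m + 1 + k) := fun z => b z.1 + R z.2 with hG
  have hR0 : R y₀ = extChartAt (𝓡 (m + 1 + k)) p p := by
    rw [hR]; simp only [hy₀, extChartAt_to_inv]; rfl
  have hRt : ∀ᶠ y in 𝓝 y₀, y ∈ (extChartAt (𝓡 k) q₀).target ∧
      ι ((extChartAt (𝓡 k) q₀).symm y) ∈ (extChartAt (𝓡 (m + 1 + k)) p).source := by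
    refine inter_mem (extChartAt_target_mem_nhds q₀) ?_
    have hc : ContinuousAt (fun y => ι ((extChartAt (𝓡 k) q₀).symm y)) y₀ :=
      hι.isEmbedding.continuous.continuousAt.comp (continuousAt_extChartAt_symm q₀)
    refine hc.preimage_mem_nhds (extChartAt_source_mem_nhds' ?_)
    rw [hy₀, extChartAt_to_inv]
    exact mem_extChartAt_source p
  obtain ⟨W, hW, hWo, hyW⟩ := mem_nhds_iff.1 hRt
  obtain ⟨V', hV', hVo, h0V⟩ := mem_nhds_iff.1 hV
  have hRs : ContDiffOn ℝ ∞ R W := by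
    rw [← contMDiffOn_iff_contDiffOn]
    intro y hy
    have h1 : ContMDiffAt 𝓘(ℝ, Eu k) (𝓡 k) ∞ (extChartAt (𝓡 k) q₀).symm y :=
      (contMDiffOn_extChartAt_symm q₀).contMDiffAt (extChartAt_target_mem_nhds' (hW hy).1)
    have h2 := (hι.contMDiff _).comp y h1
    exact ((contMDiffAt_extChartAt' (by simpa using (hW hy).2)).comp y h2).contMDiffWithinAt
  have hGs : ContDiffOn ℝ ∞ G (V' ×ˢ W) :=
    ((hb.mono hV').comp contDiff_fst.contDiffOn fun z hz => hz.1).add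
      (hRs.comp contDiff_snd.contDiffOn fun z hz => hz.2)
  set U := (V' ×ˢ W) ∩ G ⁻¹' (extChartAt (𝓡 (m + 1 + k)) p).target with hU
  have hUo : IsOpen U :=
    hGs.continuousOn.isOpen_inter_preimage (hVo.prod hWo) (isOpen_extChartAt_target p)
  have hG0 : G (0, y₀) = extChartAt (𝓡 (m + 1 + k)) p p := by
    rw [hG]; simp only [hb0, zero_add, hR0]
  have hU0 : (0, y₀) ∈ U := ⟨⟨h0V, hyW⟩, by rw [mem_preimage, hG0]; exact mem_extChartAt_target p⟩
  have hGd : HasFDerivAt G ((fderiv ℝ b 0).comp (ContinuousLinearMap.fst ℝ (Eu (m + 1)) (Eu k)) +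
      (fderiv ℝ R y₀).comp (ContinuousLinearMap.snd ℝ (Eu (m + 1)) (Eu k))) (0, y₀) := by
    have h1 : DifferentiableAt ℝ b 0 := (hb.contDiffAt hV).differentiableAt (by simp)
    have h2 : DifferentiableAt ℝ R y₀ :=
      (hRs.contDiffAt (hWo.mem_nhds hyW)).differentiableAt (by simp)
    have h3 : HasFDerivAt (fun z : Pr m k => b z.1)
        ((fderiv ℝ b 0).comp (ContinuousLinearMap.fst ℝ (Eu (m + 1)) (Eu k))) (0, y₀) :=
      HasFDerivAt.comp (g := b) (f := Prod.fst) ((0 : Eu (m + 1)), y₀) h1.hasFDerivAt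
        hasFDerivAt_fst
    have h4 : HasFDerivAt (fun z : Pr m k => R z.2)
        ((fderiv ℝ R y₀).comp (ContinuousLinearMap.snd ℝ (Eu (m + 1)) (Eu k))) (0, y₀) :=
      HasFDerivAt.comp (g := R) (f := Prod.snd) ((0 : Eu (m + 1)), y₀) h2.hasFDerivAt
        hasFDerivAt_snd
    exact h3.add h4
  have hfR : fderiv ℝ R y₀ = (mfderiv (𝓡 k) (𝓡 (m + 1 + k)) ι q₀ :
      Eu k →L[ℝ] Eu (m + 1 + k)) := by
    rw [((hι.contMDiff q₀).mdifferentiableAt (by simp)).mfderiv, ModelWithCorners.range_eq_univ,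
      fderivWithin_univ]
    rfl
  have hbij : Function.Bijective (fderiv ℝ G (0, y₀)) := by
    have hs : Function.Surjective (fderiv ℝ G (0, y₀)) := by
      intro v
      have hv : v ∈ LinearMap.range (fderiv ℝ b 0).toLinearMap ⊔
        LinearMap.range (mfderiv (𝓡 k) (𝓡 (m + 1 + k)) ι q₀ :
          Eu k →L[ℝ] Eu (m + 1 + k)).toLinearMap := hsup ▸ Submodule.mem_top
      obtain ⟨_, ⟨a, rfl⟩, _, ⟨c, rfl⟩, h⟩ := Submodule.mem_sup.1 hv
      refine ⟨(a, c), ?_⟩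
      rw [hGd.fderiv, hfR]
      exact h
    have hd : Module.finrank ℝ (Pr m k) = Module.finrank ℝ (Eu (m + 1 + k)) := by simp
    exact ⟨(LinearMap.injective_iff_surjective_of_finrank_eq_finrank hd
      (f := (fderiv ℝ G (0, y₀)).toLinearMap)).2 hs, hs⟩
  have hcs : ∀ z ∈ U, ContMDiffAt 𝓘(ℝ, Eu (m + 1 + k)) (𝓡 (m + 1 + k)) ∞
      (extChartAt (𝓡 (m + 1 + k)) p).symm (G z) := fun z hz =>
    (contMDiffOn_extChartAt_symm p).contMDiffAt (extChartAt_target_mem_nhds' hz.2)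
  refine exists_adaptedChart hι.isEmbedding (Ψ := fun z => (extChartAt (𝓡 (m + 1 + k)) p).symm (G z))
    hUo hU0 (fun z hz => ?_) ?_ ?_ hδ
  · exact ((hcs z hz).comp z ((hGs.contDiffAt ((hVo.prod hWo).mem_nhds hz.1)).contMDiffAt
      )).contMDiffWithinAt
  · have h1 := mfderiv_comp (I := 𝓘(ℝ, Pr m k)) (I' := 𝓘(ℝ, Eu (m + 1 + k)))
      (I'' := 𝓡 (m + 1 + k)) ((0 : Eu (m + 1)), y₀) ((hcs _ hU0).mdifferentiableAt (by simp))
      hGd.differentiableAt.mdifferentiableAt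
    have h2 : (mfderiv 𝓘(ℝ, Pr m k) (𝓡 (m + 1 + k)) (fun z =>
        (extChartAt (𝓡 (m + 1 + k)) p).symm (G z)) (0, y₀) : Pr m k → Eu (m + 1 + k)) =
        (mfderiv 𝓘(ℝ, Eu (m + 1 + k)) (𝓡 (m + 1 + k)) (extChartAt (𝓡 (m + 1 + k)) p).symm
          (G (0, y₀)) : Eu (m + 1 + k) → Eu (m + 1 + k)) ∘ fderiv ℝ G (0, y₀) := by
      refine (congrArg DFunLike.coe h1).trans ?_
      rw [mfderiv_eq_fderiv]
      rfl
    rw [h2]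
    refine Function.Bijective.comp ?_ hbij
    have h3 := isInvertible_mfderivWithin_extChartAt_symm (I := 𝓡 (m + 1 + k)) (x := p) hU0.2
    rw [ModelWithCorners.range_eq_univ, mfderivWithin_univ] at h3
    exact h3.bijective
  · filter_upwards [hWo.mem_nhds hyW] with y hy
    change (extChartAt (𝓡 (m + 1 + k)) p).symm (b 0 + R y) = _
    rw [hb0, zero_add]
    exact (extChartAt (𝓡 (m + 1 + k)) p).left_inv (hW hy).2

theorem nonempty_adaptedChart
    (hι : Manifold.IsSmoothEmbedding (𝓡 k) (𝓡 (m + 1 + k)) ∞ ι) (q₀ : N) :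
    Nonempty (AdaptedChart k m ι q₀) := by
  set D : Eu k →L[ℝ] Eu (m + 1 + k) := mfderiv (𝓡 k) (𝓡 (m + 1 + k)) ι q₀ with hD
  have hinj : Function.Injective D := injective_mfderiv_of_isSmoothEmbedding hι q₀
  obtain ⟨C, hC⟩ := Submodule.exists_isCompl (LinearMap.range D.toLinearMap)
  have hdim : Module.finrank ℝ (Eu (m + 1)) = Module.finrank ℝ C := by
    have h1 := Submodule.finrank_add_eq_of_isCompl hC
    rw [LinearMap.finrank_range_of_inj (f := D.toLinearMap) hinj] at h1
    simp at h1 ⊢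
    omega
  let e := LinearEquiv.ofFinrankEq (Eu (m + 1)) C hdim
  let β : Eu (m + 1) →L[ℝ] Eu (m + 1 + k) := LinearMap.toContinuousLinearMap (C.subtype ∘ₗ e)
  have hβ : LinearMap.range β.toLinearMap = C := by
    change LinearMap.range (C.subtype ∘ₗ (e : Eu (m + 1) →ₗ[ℝ] C)) = C
    rw [LinearMap.range_comp, LinearEquiv.range, Submodule.map_top, Submodule.range_subtype]
  obtain ⟨A, -⟩ := exists_adaptedChart_of_slice hι q₀ (b := β) univ_mem β.contDiff.contDiffOn
    (map_zero β) (by rw [β.fderiv, hβ, sup_comm]; exact hC.sup_eq_top) one_pos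
  exact ⟨A⟩

end NormalSlices


section Global

open IsManifold (maximalAtlas)

variable {k m : ℕ} {M : Type*} [TopologicalSpace M] [ChartedSpace (Eu (m + 1 + k)) M]
  [IsManifold (𝓡 (m + 1 + k)) ∞ M]
  (oM : ManifoldOrientation (𝓡 (m + 1 + k)) M)
  {N : Type*} [TopologicalSpace N] [ChartedSpace (Eu k) N]
  [IsManifold (𝓡 k) ∞ N]
  (oN : ManifoldOrientation (𝓡 k) N) {ι : N → M}
  {Ω : DiffForm (𝓡 (m + 1 + k)) M m} {H : DiffForm (𝓡 (m + 1 + k)) M (m + 1)}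

theorem AdaptedChart.exists_isCompact_preimage {q₀ : N} (A : AdaptedChart k m ι q₀) {K : Set M}
    (hK : IsCompact K) (hKd : K ⊆ A.map '' A.dom) :
    ∃ K' : Set (Pr m k), IsCompact K' ∧ K' ⊆ A.dom ∧ A.map '' K' = K := by
  have hinv : ∀ z ∈ A.dom, (prEquiv m k).symm (A.chart.extend (𝓡 (m + 1 + k)) (A.map z)) = z :=
    fun z hz => by
      rw [AdaptedChart.map, (A.chart.extend (𝓡 (m + 1 + k))).right_inv (A.mem_target z hz),
        ContinuousLinearEquiv.symm_apply_apply]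
  refine ⟨(fun x => (prEquiv m k).symm (A.chart.extend (𝓡 (m + 1 + k)) x)) '' K,
    hK.image_of_continuousOn ((prEquiv m k).symm.continuous.comp_continuousOn
      ((A.chart.continuousOn_extend (I := 𝓡 (m + 1 + k))).mono fun x hx => ?_)), ?_, ?_⟩
  · obtain ⟨z, hz, rfl⟩ := hKd hx
    simpa using A.map_mem_source hz
  · rintro _ ⟨x, hx, rfl⟩
    obtain ⟨z, hz, rfl⟩ := hKd hx
    simp only [hinv z hz]
    exact hz
  · rw [image_image]
    refine (image_congr fun x hx => ?_).trans (image_id K)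
    obtain ⟨z, hz, rfl⟩ := hKd hx
    simp only [hinv z hz, id]

theorem AdaptedChart.map_zero_center {q₀ : N} (A : AdaptedChart k m ι q₀) :
    A.map (0, extChartAt (𝓡 k) q₀ q₀) = ι q₀ :=
  (A.symm_zero _ (Metric.mem_ball_self A.r_pos)).trans (by rw [extChartAt_to_inv])

theorem weightedCurrent_eq_zero [T2Space N] [SigmaCompactSpace N] {f : N → ℝ} {η : DiffForm (𝓡 (m + 1 + k)) M k}
    (h : ∀ q, η (ι q) = 0) : weightedCurrent oN ι f η = 0 := by
  rw [weightedCurrent, ← integral_zero oN]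
  congr 1
  funext q
  simp only [pullback, h q]
  exact smul_zero (f q)

variable [T2Space M] [T2Space N] [SigmaCompactSpace N]

theorem weightedCurrent_add (hι : ContMDiff (𝓡 k) (𝓡 (m + 1 + k)) ∞ ι) (hcl : IsClosedEmbedding ι)
    {f : N → ℝ} (hf : Continuous f) {η ζ : DiffForm (𝓡 (m + 1 + k)) M k}
    (hη : IsTestForm η) (hζ : IsTestForm ζ) :
    weightedCurrent oN ι f (η + ζ) = weightedCurrent oN ι f η + weightedCurrent oN ι f ζ := by
  rw [weightedCurrent, weightedCurrent, weightedCurrent,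
    ← integral_add oN (isIntegrableForm_pullback hι hcl hf hη)
      (isIntegrableForm_pullback hι hcl hf hζ)]
  congr 1
  funext q
  exact smul_add (f q) ((pullback ι η : DiffForm (𝓡 k) N k) q) ((pullback ι ζ : DiffForm (𝓡 k) N k) q)

variable [SigmaCompactSpace M]

theorem CurrentEquation.dForm_eq {f : N → ℝ} (h : CurrentEquation oM oN ι f Ω H)
    (hcl : IsClosed (range ι)) (hΩ : IsCkOn 1 Ω (range ι)ᶜ) (hH : IsCkOn 0 H univ) :
    ∀ x ∉ range ι, dForm Ω x = - H x := by
  have hH' : ∀ x, IsCkAt 0 H x := fun x => hH.isCkAt isOpen_univ (mem_univ x)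
  intro x hx
  have key := eq_zero_of_integral_wedgeForm oM (γ := dForm Ω + H) rfl hcl.isOpen_compl
    (fun y hy => ?_) (fun η hη K hK hKι h0 => ?_) hx
  · exact eq_neg_of_add_eq_zero_left key
  · refine IsCkAt.add (IsCkAt.dForm (r := 0) ?_) (hH' y)
    filter_upwards [hcl.isOpen_compl.mem_nhds hy] with z hz
    exact hΩ.isCkAt hcl.isOpen_compl hz
  · rw [← pairing_eq_integral oM hΩ hcl (.of_isCkAt hH') hη hK hKι h0,
      (currentEquation_iff oM oN).1 h η hη]
    exact weightedCurrent_eq_zero oN fun q => h0 _ fun hq => hKι hq (mem_range_self q)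

variable (ι Ω H) in
/-- Near `x`, the equation `dΩ = cL - H` holds. -/
def HasWeight (x : M) (c : ℝ) : Prop :=
  ∃ U ∈ 𝓝 x, ∀ η : DiffForm (𝓡 (m + 1 + k)) M k, IsTestForm η → ∀ K, IsCompact K → K ⊆ U →
    (∀ y ∉ K, η y = 0) → pairing oM Ω H η = weightedCurrent oN ι (fun _ => c) η

variable {oM oN}

theorem HasWeight.eventually {x : M} {c : ℝ} (h : HasWeight oM oN ι Ω H x c) :
    ∀ᶠ y in 𝓝 x, HasWeight oM oN ι Ω H y c := by
  obtain ⟨U, hU, h⟩ := h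
  filter_upwards [eventually_mem_nhds_iff.2 hU] with y hy using ⟨U, hy, h⟩

theorem AdaptedChart.hasWeight {q₀ : N} (A : AdaptedChart k m ι q₀)
    (hι : ContMDiff (𝓡 k) (𝓡 (m + 1 + k)) ∞ ι) (hcl : IsClosedEmbedding ι)
    (hΩ : HasLocallyIntegrableCoeffs Ω) (hH : HasLocallyIntegrableCoeffs H)
    {g : Eu k → ℝ} {c : ℝ} (hg : ∀ y ∈ Metric.ball (extChartAt (𝓡 k) q₀ q₀) A.r, g y = c)
    (h : FlatEq (A.form Ω) (A.form H) (extChartAt (𝓡 k) q₀ q₀) A.r g) :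
    HasWeight oM oN ι Ω H (ι q₀) (A.sgn oM * A.sgnN oN * c) := by
  refine ⟨A.map '' A.dom, (A.isOpen_image_map A.isOpen_dom subset_rfl).mem_nhds
    ⟨_, A.center_mem_dom, A.map_zero_center⟩, fun η hη K hK hKU h0 => ?_⟩
  obtain ⟨K', hK', hKd, rfl⟩ := A.exists_isCompact_preimage hK hKU
  exact A.pairing_eq_of_flatEq oM oN hι hcl hΩ hH hg h hη hK' hKd h0

theorem HasWeight.unique (hιe : Manifold.IsSmoothEmbedding (𝓡 k) (𝓡 (m + 1 + k)) ∞ ι)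
    (hcl : IsClosedEmbedding ι) {q : N} {c c' : ℝ} (h : HasWeight oM oN ι Ω H (ι q) c)
    (h' : HasWeight oM oN ι Ω H (ι q) c') : c = c' := by
  obtain ⟨A⟩ := nonempty_adaptedChart hιe q
  have hι : ContMDiff (𝓡 k) (𝓡 (m + 1 + k)) ∞ ι := hιe.contMDiff
  obtain ⟨U, hU, h⟩ := h
  obtain ⟨U', hU', h'⟩ := h'
  set z₀ : Pr m k := (0, extChartAt (𝓡 k) q q) with hz₀
  have hS : A.dom ∩ A.map ⁻¹' (U ∩ U') ∈ 𝓝 z₀ := by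
    refine inter_mem (A.isOpen_dom.mem_nhds A.center_mem_dom)
      ((A.continuousOn_map.continuousAt (A.isOpen_dom.mem_nhds A.center_mem_dom)).preimage_mem_nhds
        ?_)
    rw [A.map_zero_center]
    exact inter_mem hU hU'
  obtain ⟨φ, hφs, hφc, hφd, hφr, hφ1⟩ := exists_contDiff_tsupport_subset (n := ⊤) hS
  set w : Pr m k → Pr m k [⋀^Fin k]→L[ℝ] ℝ := fun z => φ z •
    (volForm k).compContinuousLinearMap (ContinuousLinearMap.snd ℝ (Eu (m + 1)) (Eu k)) with hw
  have hws : ContDiff ℝ ∞ w := hφd.smul contDiff_const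
  obtain ⟨η, hη, hη0, hηw⟩ := A.exists_testForm hws hφc (hφs.trans inter_subset_left)
    fun z hz => by rw [hw]; simp only [image_eq_zero_of_notMem_tsupport hz, zero_smul]
  have hKc : IsCompact (A.map '' tsupport φ) :=
    hφc.isCompact.image_of_continuousOn (A.continuousOn_map.mono (hφs.trans inter_subset_left))
  have hKU : A.map '' tsupport φ ⊆ U ∩ U' := by
    rintro _ ⟨z, hz, rfl⟩
    exact (hφs hz).2
  have h1 := (h η hη _ hKc (hKU.trans inter_subset_left) hη0).symm.trans
    (h' η hη _ hKc (hKU.trans inter_subset_right) hη0)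
  rw [A.weightedCurrent_eq hι hcl oN continuous_const hη (hφs.trans inter_subset_left) hη0,
    A.weightedCurrent_eq hι hcl oN continuous_const hη (hφs.trans inter_subset_left) hη0, hηw] at h1
  have hwy : ∀ y, w (0, y) (yFrame m k) = φ (0, y) := by
    intro y
    change φ (0, y) * volForm k (stdFrame k) = _
    rw [volForm_stdFrame, mul_one]
  simp only [hwy] at h1
  rw [integral_const_mul, integral_const_mul] at h1
  have hemb : IsClosedEmbedding fun y : Eu k => ((0 : Eu (m + 1)), y) :=
    ⟨isEmbedding_prodMkRight 0, by
      have : range (Prod.mk (0 : Eu (m + 1)) : Eu k → Pr m k) = Prod.fst ⁻¹' {0} := by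
        ext ⟨a, b⟩
        simp [eq_comm]
      rw [show (fun y : Eu k => ((0 : Eu (m + 1)), y)) = Prod.mk 0 from rfl, this]
      exact isClosed_singleton.preimage continuous_fst⟩
  have hpos : 0 < ∫ y : Eu k, φ (0, y) :=
    (hφd.continuous.comp hemb.continuous).integral_pos_of_hasCompactSupport_nonneg_nonzero
      (hφc.comp_isClosedEmbedding hemb) (fun y => (hφr (mem_range_self _)).1)
      (x := extChartAt (𝓡 k) q q) (by change φ z₀ ≠ 0; rw [hφ1]; exact one_ne_zero)
  have h2 := congrArg (A.sgnN oN * ·) h1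
  simp only [← mul_assoc, A.sgnN_mul_self, one_mul] at h2
  exact mul_right_cancel₀ hpos.ne' h2

theorem CurrentEquation.isLocallyConstant {f : N → ℝ} (h : CurrentEquation oM oN ι f Ω H)
    (hιe : Manifold.IsSmoothEmbedding (𝓡 k) (𝓡 (m + 1 + k)) ∞ ι) (hcl : IsClosedEmbedding ι)
    (hΩ : HasLocallyIntegrableCoeffs Ω) (hH : IsCkOn 0 H univ) (hf : Continuous f) :
    IsLocallyConstant f := by
  have hH' : ∀ x, IsCkAt 0 H x := fun x => hH.isCkAt isOpen_univ (mem_univ x)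
  rw [IsLocallyConstant.iff_eventually_eq]
  intro q
  obtain ⟨A⟩ := nonempty_adaptedChart hιe q
  have h1 := A.flatEq oM oN hιe.contMDiff hcl hΩ (.of_isCkAt hH') hf h
  have h2 := h1.const A.r_pos ?_ fun z hz =>
    (A.contDiffAt_form (s := 0) (by simp) hz (hH' _)).continuousAt.continuousWithinAt
  · have h3 : extChartAt (𝓡 k) q ⁻¹' Metric.ball (extChartAt (𝓡 k) q q) A.r ∈ 𝓝 q :=
      (continuousAt_extChartAt q).preimage_mem_nhds (Metric.ball_mem_nhds _ A.r_pos)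
    filter_upwards [h3, extChartAt_source_mem_nhds (I := 𝓡 k) q] with q' hq' hqs
    have h4 := h2 _ hq'
    simp only [(extChartAt (𝓡 k) q).left_inv hqs, extChartAt_to_inv] at h4
    have h5 := congrArg (A.sgnN oN * A.sgn oM * ·) h4
    linear_combination h5 + (- f q' * A.sgn oM ^ 2 + f q * A.sgn oM ^ 2) * A.sgnN_mul_self oN +
      (- f q' + f q) * A.sgn_mul_self oM
  · exact continuousOn_const.mul (hf.comp_continuousOn
      ((continuousOn_extChartAt_symm q).mono A.ball_subset))

/-- If the equation holds near each point of the connected submanifold, up to a continuous weight,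
and `dΩ = -H` elsewhere, then it holds globally with a constant weight. -/
theorem exists_currentEquation_const [ConnectedSpace N]
    (hιe : Manifold.IsSmoothEmbedding (𝓡 k) (𝓡 (m + 1 + k)) ∞ ι) (hcl : IsClosedEmbedding ι)
    (hΩ : IsCkOn 1 Ω (range ι)ᶜ) (hΩi : HasLocallyIntegrableCoeffs Ω) (hH : IsCkOn 0 H univ)
    (hd : ∀ x ∉ range ι, dForm Ω x = - H x)
    (hloc : ∀ q₀ : N, ∃ (A : AdaptedChart k m ι q₀) (g : Eu k → ℝ),
      ContinuousOn g (Metric.ball (extChartAt (𝓡 k) q₀ q₀) A.r) ∧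
      FlatEq (A.form Ω) (A.form H) (extChartAt (𝓡 k) q₀ q₀) A.r g) :
    ∃ c : ℝ, CurrentEquation oM oN ι (fun _ => c) Ω H := by
  have hH' : ∀ x, IsCkAt 0 H x := fun x => hH.isCkAt isOpen_univ (mem_univ x)
  have hHi : HasLocallyIntegrableCoeffs H := .of_isCkAt hH'
  have hι := hιe.contMDiff
  have hw : ∀ q, ∃ c, HasWeight oM oN ι Ω H (ι q) c := by
    intro q
    obtain ⟨A, g, hg, h⟩ := hloc q
    exact ⟨_, A.hasWeight hι hcl hΩi hHi (h.const A.r_pos hg fun z hz =>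
      (A.contDiffAt_form (s := 0) (by simp) hz (hH' _)).continuousAt.continuousWithinAt) h⟩
  choose c hc using hw
  have hlc : IsLocallyConstant c := by
    rw [IsLocallyConstant.iff_eventually_eq]
    intro q
    filter_upwards [hcl.continuous.continuousAt.eventually (hc q).eventually] with q' hq'
    exact (hc q').unique hιe hcl hq'
  obtain ⟨q₀⟩ : Nonempty N := inferInstance
  refine ⟨c q₀, (currentEquation_iff oM oN).2 fun η hη => ?_⟩
  have key := eq_zero_of_locally_eq_zero
    (T := fun η => pairing oM Ω H η - weightedCurrent oN ι (fun _ => c q₀) η)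
    (fun η ζ hη hζ => ?_) (fun x => ?_) hη
  · exact sub_eq_zero.1 key
  · rw [pairing_add oM hΩi hHi hη hζ, weightedCurrent_add oN hι hcl continuous_const hη hζ]
    ring
  · by_cases hx : x ∈ range ι
    · obtain ⟨q, rfl⟩ := hx
      obtain ⟨U, hU, h⟩ := hc q
      refine ⟨U, hU, fun η hη K hK hKU h0 => ?_⟩
      rw [hlc.apply_eq_of_preconnectedSpace q₀ q, h η hη K hK hKU h0, sub_self]
    · refine ⟨(range ι)ᶜ, hcl.isClosed_range.isOpen_compl.mem_nhds hx, fun η hη K hK hKU h0 => ?_⟩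
      rw [pairing_eq_integral oM hΩ hcl.isClosed_range hHi hη hK hKU h0,
        weightedCurrent_eq_zero oN fun q => h0 _ fun hq => hKU hq (mem_range_self q), sub_zero,
        ← integral_zero oM]
      congr 1
      funext x
      by_cases hxK : x ∈ K
      · have : (dForm Ω + H) x = 0 := by rw [Pi.add_apply, hd x (hKU hxK), neg_add_cancel]
        rw [wedgeForm, this]
        exact wedge_zero_left (E := Eu (m + 1 + k)) rfl _
      · exact wedgeForm_eq_zero_right rfl _ (h0 x hxK)

end Global


section FlatExtension

variable {m k : ℕ}

theorem wedge_comp_cast {E : Type*} [NormedAddCommGroup E] [NormedSpace ℝ E] {p q n n' : ℕ}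
    (h : p + q = n) (h' : p + q = n') (e : n = n') (α : E [⋀^Fin p]→L[ℝ] ℝ)
    (β : E [⋀^Fin q]→L[ℝ] ℝ) (v : Fin n' → E) :
    wedge h α β (v ∘ Fin.cast e) = wedge h' α β v := by
  subst e; rfl

theorem extDeriv_fun_smul {E : Type*} [NormedAddCommGroup E] [NormedSpace ℝ E] {p : ℕ}
    {ρ : E → ℝ} {α : E → E [⋀^Fin p]→L[ℝ] ℝ} {x : E} (hρ : DifferentiableAt ℝ ρ x)
    (hα : DifferentiableAt ℝ α x) : extDeriv (fun y => ρ y • α y) x =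
      oneWedge (fderiv ℝ ρ x) (α x) + ρ x • extDeriv α x := by
  have h := hρ.hasFDerivAt.smul hα.hasFDerivAt
  have h' : fderiv ℝ (fun y => ρ y • α y) x = _ := h.fderiv
  rw [extDeriv, h', ContinuousAlternatingMap.alternatizeUncurryFin_add,
    ContinuousAlternatingMap.alternatizeUncurryFin_smul]
  exact add_comm _ _

theorem fderiv_bump_apply {s v : Eu (m + 1)} :
    ∃ c : ℝ, fderiv ℝ (bump : Eu (m + 1) → ℝ) s v = c * inner ℝ s v ∧
      (c = 0 → fderiv ℝ (bump : Eu (m + 1) → ℝ) s = 0) := by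
  have h1 : HasDerivAt Real.smoothTransition (deriv Real.smoothTransition (2 - ‖s‖ ^ 2))
      (2 - ‖s‖ ^ 2) :=
    ((Real.smoothTransition.contDiff (n := 1)).differentiable one_ne_zero _).hasDerivAt
  have h2 : HasFDerivAt (fun s : Eu (m + 1) => 2 - ‖s‖ ^ 2) (-(2 • innerSL ℝ s)) s :=
    (hasStrictFDerivAt_norm_sq s).hasFDerivAt.const_sub 2
  have h3 : fderiv ℝ (bump : Eu (m + 1) → ℝ) s = _ := (h1.comp_hasFDerivAt s h2).fderiv
  refine ⟨-2 * deriv Real.smoothTransition (2 - ‖s‖ ^ 2), ?_, fun hc => ?_⟩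
  · rw [h3]
    simp
    ring
  · rw [h3, show deriv Real.smoothTransition (2 - ‖s‖ ^ 2) = 0 by linarith, zero_smul]

theorem inner_eq_zero_of_fderiv_bump {s v : Eu (m + 1)}
    (h0 : fderiv ℝ (bump : Eu (m + 1) → ℝ) s ≠ 0)
    (h : fderiv ℝ (bump : Eu (m + 1) → ℝ) s v = 0) : inner ℝ s v = 0 := by
  obtain ⟨c, h1, h2⟩ := fderiv_bump_apply (s := s) (v := v)
  rw [h] at h1
  exact (mul_eq_zero.1 h1.symm).resolve_left fun hc => h0 (h2 hc)

/-- The map moving every point with normal variable `u ≠ 0` to the sphere of radius `t`. -/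
def sphereMap (t : ℝ) (z : Pr m k) : Pr m k := (t • ‖z.1‖⁻¹ • z.1, z.2)

theorem hasFDerivAt_sphereMap (t : ℝ) {z : Pr m k} (hz : z.1 ≠ 0) :
    ∃ D : Pr m k →L[ℝ] Pr m k, HasFDerivAt (sphereMap t) D z ∧
      ∀ v : Pr m k, inner ℝ z.1 v.1 = 0 → D v = (t • ‖z.1‖⁻¹ • v.1, v.2) := by
  have h1 : HasFDerivAt (fun s : Eu (m + 1) => ‖s‖) (fderiv ℝ (fun s : Eu (m + 1) => ‖s‖) z.1) z.1 :=
    ((differentiableAt_id).norm ℝ hz).hasFDerivAt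
  set n' := fderiv ℝ (fun s : Eu (m + 1) => ‖s‖) z.1 with hn
  have h2 : ∀ v, inner ℝ z.1 v = 0 → n' v = 0 := by
    intro v hv
    have h3 := (h1.pow 2).unique (hasStrictFDerivAt_norm_sq z.1).hasFDerivAt
    have h4 := congrArg (fun L : Eu (m + 1) →L[ℝ] ℝ => L v) h3
    simp [hv] at h4
    exact h4.resolve_left hz
  have h5 : HasFDerivAt (fun s : Eu (m + 1) => ‖s‖⁻¹) (-(‖z.1‖ ^ 2)⁻¹ • n') z.1 :=
    (hasDerivAt_inv (norm_ne_zero_iff.2 hz)).comp_hasFDerivAt z.1 h1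
  have h6 := (h5.smul (hasFDerivAt_id z.1)).const_smul t
  have h7 := (HasFDerivAt.comp (g := t • ((fun s : Eu (m + 1) => ‖s‖⁻¹) • id)) (f := Prod.fst) z h6
    hasFDerivAt_fst).prodMk (hasFDerivAt_snd (p := z))
  refine ⟨_, h7, fun v hv => ?_⟩
  simp [h2 _ hv]

variable {y₀ : Eu k} {r : ℝ} {Ω : Pr m k → Pr m k [⋀^Fin m]→L[ℝ] ℝ}
    {H : Pr m k → Pr m k [⋀^Fin (m + 1)]→L[ℝ] ℝ}

set_option maxHeartbeats 1000000 in
/-- Stokes' theorem away from the submanifold. -/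
theorem integral_one_sub_cutoff (hΩ : ∀ z ∈ flatDomain m y₀ r, z.1 ≠ 0 → ContDiffAt ℝ 1 Ω z)
    (hd : ∀ z ∈ flatDomain m y₀ r, z.1 ≠ 0 → extDeriv Ω z = - H z)
    {χ : Eu (m + 1) → ℝ} (hχ : ContDiff ℝ ∞ χ) (h1 : ∀ᶠ u in 𝓝 0, χ u = 1)
    {w : Pr m k → Pr m k [⋀^Fin k]→L[ℝ] ℝ} (hw : ContDiff ℝ ∞ w) {K : Set (Pr m k)}
    (hK : IsCompact K) (hKd : K ⊆ flatDomain m y₀ r) (h0 : ∀ z ∉ K, w z = 0) :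
    ∫ z, (1 - χ z.1) * ((-1) ^ (m + 1) * wedge (by omega : m + (k + 1) = m + 1 + k) (Ω z)
      (extDeriv w z) (pFrame m k) + wedge rfl (H z) (w z) (pFrame m k)) =
      - ∫ z, wedge rfl (cutoffForm χ Ω z) (w z) (pFrame m k) := by
  set D := flatDomain m y₀ r with hDdef
  have hDo : IsOpen D := isOpen_flatDomain y₀ r
  have hr1 : m + k + 1 = m + 1 + k := by omega
  set ρ : Pr m k → ℝ := fun z => 1 - χ z.1 with hρ
  have hρs : ContDiff ℝ ∞ ρ := contDiff_const.sub (hχ.comp contDiff_fst)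
  set Ω' : Pr m k → Pr m k [⋀^Fin m]→L[ℝ] ℝ := fun z => ρ z • Ω z with hΩ'
  have hev : ∀ z : Pr m k, z.1 = 0 → ∀ᶠ x : Pr m k in 𝓝 z, χ x.1 = 1 := fun z hz => by
    rw [← hz] at h1
    exact continuous_fst.continuousAt.eventually h1
  have hΩ's : ∀ z ∈ D, ContDiffAt ℝ 1 Ω' z := by
    intro z hz
    by_cases hz0 : z.1 = 0
    · refine (contDiffAt_const (c := (0 : Pr m k [⋀^Fin m]→L[ℝ] ℝ))).congr_of_eventuallyEq ?_
      filter_upwards [hev z hz0] with x hx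
      simp only [hΩ', hρ, hx, sub_self, zero_smul]
    · exact (hρs.of_le (by norm_cast)).contDiffAt.smul (hΩ z hz hz0)
  set θ : Pr m k → Pr m k [⋀^Fin (m + k)]→L[ℝ] ℝ := fun z => wedge rfl (Ω' z) (w z) with hθ
  have hθ0 : ∀ z ∉ K, θ z = 0 := fun z hz => by rw [hθ]; simp only [h0 z hz]; exact wedge_zero_right _ _
  have hθs : ContDiff ℝ 1 θ := by
    refine contDiff_of_contDiffOn_of_eq_zero hDo (fun z hz => ?_) hK.isClosed hKd hθ0
    have h2 : ContDiffAt ℝ 1 w z := (hw.of_le (by norm_cast)).contDiffAt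
    exact ((wedgeCLM (E := Pr m k) (rfl : m + k = m + k)).isBoundedBilinearMap.contDiff.comp_contDiffAt
      z ((hΩ's z (hz)).prodMk h2)).contDiffWithinAt
  have hθc : HasCompactSupport θ := HasCompactSupport.intro hK hθ0
  have hst := integral_extDeriv_eq_zero volume hθs hθc (pFrame m k ∘ Fin.cast hr1)
  set A : Pr m k → ℝ := fun z => wedge rfl (cutoffForm χ Ω z) (w z) (pFrame m k) with hA
  have hAc : Continuous A ∧ HasCompactSupport A := by
    refine continuous_of_continuousOn_of_eq_zero hDo ?_ hK hKd fun z hz => ?_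
    · exact (continuousOn_cutoffForm hχ h1 fun z hz hz0 => (hΩ z hz hz0).continuousAt).wedge_apply rfl
        hw.continuous.continuousOn _
    · simp only [hA, h0 z hz, wedge_zero_right]; rfl
  have hdθ : Integrable fun z => extDeriv θ z (pFrame m k ∘ Fin.cast hr1) := by
    have h2 : ContDiff ℝ 0 (extDeriv θ) :=
      (ContinuousAlternatingMap.alternatizeUncurryFinCLM ℝ (Pr m k) ℝ (n := m + k)).contDiff.comp
        (hθs.fderiv_right (by norm_num))
    refine Continuous.integrable_of_hasCompactSupport ?_ (HasCompactSupport.intro hK fun z hz => ?_)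
    · exact (ContinuousAlternatingMap.apply ℝ (Pr m k) ℝ _).continuous.comp h2.continuous
    · rw [extDeriv_eq_zero_of_eq_zero hK.isClosed hθ0 hz]; rfl
  have key : ∀ z, (1 - χ z.1) * ((-1) ^ (m + 1) * wedge (by omega : m + (k + 1) = m + 1 + k) (Ω z)
      (extDeriv w z) (pFrame m k) + wedge rfl (H z) (w z) (pFrame m k)) =
      - A z - extDeriv θ z (pFrame m k ∘ Fin.cast hr1) := by
    intro z
    by_cases hz : z ∈ K
    · by_cases hz0 : z.1 = 0
      · have h2 : extDeriv θ z = 0 := by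
          have h3 : θ =ᶠ[𝓝 z] fun _ => 0 := by
            filter_upwards [hev z hz0] with x hx
            simp only [hθ, hΩ', hρ, hx, sub_self, zero_smul]
            exact wedge_zero_left _ _
          rw [extDeriv, h3.fderiv_eq, fderiv_const_apply]
          exact map_zero (ContinuousAlternatingMap.alternatizeUncurryFinCLM ℝ (Pr m k) ℝ (n := m + k))
        have h4 : cutoffForm χ Ω z = 0 := by
          rw [cutoffForm, hz0, fderiv_eq_zero_of_eventually_const h1, ContinuousLinearMap.zero_comp,
            oneWedge_zero_left]
        have h5 : χ z.1 = 1 := by rw [hz0]; exact h1.self_of_nhds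
        simp only [hA, h2, h4, h5, wedge_zero_left, sub_self, zero_mul]
        change (0 : ℝ) = -0 - 0
        simp
      · have hρd : DifferentiableAt ℝ ρ z := hρs.differentiable (by simp) z
        have h2 : extDeriv θ z = _ := extDeriv_wedge (rfl : m + k = m + k)
          (by omega : m + 1 + k = m + k + 1) (by omega : m + (k + 1) = m + k + 1)
          ((hΩ's z (hKd hz)).differentiableAt one_ne_zero) (hw.differentiable (by simp) z)
        have h3 : extDeriv Ω' z = _ := extDeriv_fun_smul hρd
          ((hΩ z (hKd hz) hz0).differentiableAt one_ne_zero)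
        have h4 : fderiv ℝ ρ z =
            (-1 : ℝ) • ((fderiv ℝ χ z.1).comp (ContinuousLinearMap.fst ℝ (Eu (m + 1)) (Eu k))) := by
          have := HasFDerivAt.comp (g := χ) (f := Prod.fst) z
            (hχ.differentiable (by simp) z.1).hasFDerivAt hasFDerivAt_fst
          exact (this.const_sub 1).fderiv.trans (neg_one_smul ℝ _).symm
        have h5 : oneWedge (fderiv ℝ ρ z) (Ω z) = (-1 : ℝ) • cutoffForm χ Ω z := by
          rw [h4, oneWedge_smul_left, cutoffForm]
        rw [h2, h3, h5, hd z (hKd hz) hz0, wedge_add_left, wedge_smul_left, wedge_smul_left,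
          wedge_neg_left, show Ω' z = ρ z • Ω z from rfl, wedge_smul_left]
        simp only [ContinuousAlternatingMap.add_apply, ContinuousAlternatingMap.smul_apply,
          ContinuousAlternatingMap.neg_apply, smul_eq_mul]
        rw [wedge_comp_cast _ rfl hr1, wedge_comp_cast _ rfl hr1, wedge_comp_cast _ (by omega) hr1]
        simp only [hA, hρ]
        ring
    · have h2 : extDeriv w z = 0 := extDeriv_eq_zero_of_eq_zero hK.isClosed h0 hz
      have h3 : extDeriv θ z = 0 := extDeriv_eq_zero_of_eq_zero hK.isClosed hθ0 hz
      simp only [hA, h2, h3, h0 z hz, wedge_zero_right]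
      change (1 - χ z.1) * ((-1) ^ (m + 1) * (0 : ℝ) + 0) = -0 - 0
      simp
  simp only [key]
  have hAi : Integrable fun z => -A z := (hAc.1.integrable_of_hasCompactSupport hAc.2).neg
  rw [integral_sub hAi hdθ, hst, integral_neg, sub_zero]


end FlatExtension


section FlatExtensionLimit

variable {m k : ℕ} {y₀ : Eu k} {r : ℝ} {Ω : Pr m k → Pr m k [⋀^Fin m]→L[ℝ] ℝ}
    {H : Pr m k → Pr m k [⋀^Fin (m + 1)]→L[ℝ] ℝ} {Φ : ℝ × Pr m k → Pr m k [⋀^Fin m]→L[ℝ] ℝ}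

theorem fderiv_bump_eq_zero_of_norm_lt {s : Eu (m + 1)} (h : ‖s‖ < 1 ∨ 2 < ‖s‖) :
    fderiv ℝ (bump : Eu (m + 1) → ℝ) s = 0 := by
  rcases h with h | h
  · refine fderiv_eq_zero_of_eventually_const (c := 1) ?_
    filter_upwards [Metric.isOpen_ball.mem_nhds (mem_ball_zero_iff.2 h)] with u hu
    exact bump_eq_one (mem_ball_zero_iff.1 hu).le
  · exact fderiv_eq_zero_of_eq_zero Metric.isClosed_closedBall (fun x hx => bump_eq_zero hx)
      (by rwa [mem_closedBall_zero_iff, not_le])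

/-- The rescaled cut-off form only sees the restriction of `Ω` to spheres. -/
theorem cutoffForm_scale (hΦ : ∀ t ∈ Ioo 0 r, ∀ z : Pr m k, z.1 ≠ 0 → z.2 ∈ Metric.ball y₀ r →
      Φ (t, z) = (Ω (sphereMap t z)).compContinuousLinearMap (fderiv ℝ (sphereMap t) z))
    {ε : ℝ} (hε : 0 < ε) (hεr : ε * 2 < r) {z : Pr m k} (hz : z.2 ∈ Metric.ball y₀ r) :
    (cutoffForm (fun u => bump (ε⁻¹ • u)) Ω (scaleCLM m k ε z)).compContinuousLinearMap
      (scaleCLM m k ε) = cutoffForm bump (fun z => Φ (ε * ‖z.1‖, z)) z := by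
  set l : Pr m k →L[ℝ] ℝ := (fderiv ℝ bump z.1).comp (ContinuousLinearMap.fst ℝ (Eu (m + 1)) (Eu k))
    with hl
  have h1 : (((fderiv ℝ (fun u : Eu (m + 1) => bump (ε⁻¹ • u)) (scaleCLM m k ε z).1).comp
      (ContinuousLinearMap.fst ℝ (Eu (m + 1)) (Eu k))).comp (scaleCLM m k ε)) = l := by
    rw [fderiv_bump_smul, scaleCLM_apply, smul_smul, inv_mul_cancel₀ hε.ne', one_smul]
    ext v
    · simp [hl, scaleCLM_apply, hε.ne']
    · simp [hl, scaleCLM_apply]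
  rw [cutoffForm, oneWedge_compContinuousLinearMap, h1, cutoffForm]
  by_cases h0 : fderiv ℝ (bump : Eu (m + 1) → ℝ) z.1 = 0
  · rw [hl, h0, ContinuousLinearMap.zero_comp, oneWedge_zero_left, oneWedge_zero_left]
  have h2 : 1 ≤ ‖z.1‖ ∧ ‖z.1‖ ≤ 2 := by
    by_contra hc
    refine h0 (fderiv_bump_eq_zero_of_norm_lt ?_)
    rw [not_and_or, not_le, not_le] at hc
    exact hc
  have hz0 : z.1 ≠ 0 := norm_pos_iff.1 (by linarith)
  have hn : ‖z.1‖ ≠ 0 := norm_ne_zero_iff.2 hz0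
  have ht : ε * ‖z.1‖ ∈ Ioo 0 r := ⟨by nlinarith, by nlinarith⟩
  obtain ⟨D, hD, hD'⟩ := hasFDerivAt_sphereMap (k := k) (ε * ‖z.1‖) hz0
  have h3 : sphereMap (ε * ‖z.1‖) z = scaleCLM m k ε z := by
    rw [sphereMap, scaleCLM_apply, smul_smul, mul_assoc, mul_inv_cancel₀ hn, mul_one]
  rw [hΦ _ ht z hz0 hz, hD.fderiv, h3]
  rw [← sub_eq_zero]
  have h4 := oneWedge_eq_zero_of_ker l ((Ω (scaleCLM m k ε z)).compContinuousLinearMap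
    (scaleCLM m k ε) + (-1 : ℝ) • (Ω (scaleCLM m k ε z)).compContinuousLinearMap D) fun v hv => ?_
  · rw [oneWedge_add_right, oneWedge_smul_right] at h4
    exact ((sub_eq_add_neg _ _).trans (congrArg _ (neg_one_smul ℝ _).symm)).trans h4
  · have h5 : ∀ i, scaleCLM m k ε (v i) = D (v i) := fun i => by
      rw [hD' _ (inner_eq_zero_of_fderiv_bump h0 (hv i)), scaleCLM_apply, smul_smul, mul_assoc,
        mul_inv_cancel₀ hn, mul_one]
    have h6 : (scaleCLM m k ε : Pr m k → Pr m k) ∘ v = D ∘ v := funext h5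
    change Ω (scaleCLM m k ε z) ((scaleCLM m k ε : Pr m k → Pr m k) ∘ v) +
      (-1 : ℝ) * Ω (scaleCLM m k ε z) (D ∘ v) = 0
    rw [h6]
    ring

theorem continuousOn_cutoffForm_extension {δ : ℝ} (hδ : δ * 3 < r)
    (hΦ : ContinuousOn Φ {s | 0 ≤ s.1 ∧ s.1 < r ∧ s.2.1 ≠ 0 ∧ s.2.2 ∈ Metric.ball y₀ r}) :
    ContinuousOn (fun s : ℝ × Pr m k => cutoffForm bump (fun z => Φ (s.1 * ‖z.1‖, z)) s.2)
      (Icc 0 δ ×ˢ {z | 1 / 2 < ‖z.1‖ ∧ ‖z.1‖ < 3 ∧ z.2 ∈ Metric.ball y₀ r}) := by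
  have h1 : Continuous fun s : ℝ × Pr m k =>
      (fderiv ℝ bump s.2.1).comp (ContinuousLinearMap.fst ℝ (Eu (m + 1)) (Eu k)) :=
    ((contDiff_bump.continuous_fderiv (by simp)).comp
      (continuous_fst.comp continuous_snd)).clm_comp continuous_const
  refine ((oneWedgeCLM (E := Pr m k) (p := m)).continuous.comp h1).continuousOn.clm_apply
    (hΦ.comp (f := fun s : ℝ × Pr m k => (s.1 * ‖s.2.1‖, s.2)) (by fun_prop) ?_)
  rintro ⟨t, z⟩ ⟨⟨h2, h3⟩, h4, h5, h6⟩
  have h7 : 0 < ‖z.1‖ := by linarith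
  refine ⟨mul_nonneg h2 h7.le, ?_, norm_pos_iff.1 h7, h6⟩
  calc t * ‖z.1‖ ≤ δ * 3 := mul_le_mul h3 h5.le h7.le (h2.trans h3)
    _ < r := hδ

set_option maxHeartbeats 1000000 in
/-- A form whose pull-back to the spheres extends continuously satisfies the equation of currents
in the local model, with a continuous weight. -/
theorem exists_flatEq_of_extension (hr : 0 < r)
    (hΩ : ∀ z ∈ flatDomain m y₀ r, z.1 ≠ 0 → ContDiffAt ℝ 1 Ω z)
    (hd : ∀ z ∈ flatDomain m y₀ r, z.1 ≠ 0 → extDeriv Ω z = - H z)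
    (hH : ContinuousOn H (flatDomain m y₀ r))
    (hint : ∀ w : Pr m k → Pr m k [⋀^Fin k]→L[ℝ] ℝ, ContDiff ℝ ∞ w → ∀ K, IsCompact K →
      K ⊆ flatDomain m y₀ r → (∀ z ∉ K, w z = 0) → Integrable fun z =>
        wedge (by omega : m + (k + 1) = m + 1 + k) (Ω z) (extDeriv w z) (pFrame m k))
    (hΦc : ContinuousOn Φ {s | 0 ≤ s.1 ∧ s.1 < r ∧ s.2.1 ≠ 0 ∧ s.2.2 ∈ Metric.ball y₀ r})
    (hΦ : ∀ t ∈ Ioo 0 r, ∀ z : Pr m k, z.1 ≠ 0 → z.2 ∈ Metric.ball y₀ r →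
      Φ (t, z) = (Ω (sphereMap t z)).compContinuousLinearMap (fderiv ℝ (sphereMap t) z)) :
    ∃ g, ContinuousOn g (Metric.ball y₀ r) ∧ FlatEq Ω H y₀ r g := by
  obtain ⟨δ, hδ, hδr⟩ : ∃ δ : ℝ, 0 < δ ∧ δ * 3 < r := ⟨r / 4, by positivity, by linarith⟩
  have hcut := continuousOn_cutoffForm_extension hδr hΦc
  set S : Set (Pr m k) := {z | 1 / 2 < ‖z.1‖ ∧ ‖z.1‖ < 3 ∧ z.2 ∈ Metric.ball y₀ r} with hS
  have hSo : IsOpen S := (isOpen_lt continuous_const (continuous_norm.comp continuous_fst)).inter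
    ((isOpen_lt (continuous_norm.comp continuous_fst) continuous_const).inter
      (Metric.isOpen_ball.preimage continuous_snd))
  set C : ℝ → Pr m k → Pr m k [⋀^Fin (m + 1)]→L[ℝ] ℝ := fun ε z =>
    cutoffForm bump (fun z => Φ (ε * ‖z.1‖, z)) z with hC
  set R : Set (Eu (m + 1)) := {s | 1 ≤ ‖s‖ ∧ ‖s‖ ≤ 2} with hR
  have hRc : IsCompact R := by
    refine (isCompact_closedBall (0 : Eu (m + 1)) 2).of_isClosed_subset ?_ fun s hs =>
      mem_closedBall_zero_iff.2 hs.2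
    exact (isClosed_le continuous_const continuous_norm).inter
      (isClosed_le continuous_norm continuous_const)
  have hC0 : ∀ ε, ∀ z : Pr m k, z.1 ∉ R → C ε z = 0 := by
    intro ε z hz
    have : fderiv ℝ (bump : Eu (m + 1) → ℝ) z.1 = 0 := by
      refine fderiv_bump_eq_zero_of_norm_lt ?_
      rw [hR, mem_setOf_eq, not_and_or, not_le, not_le] at hz
      exact hz
    rw [hC]
    simp only [cutoffForm, this, ContinuousLinearMap.zero_comp]
    exact oneWedge_zero_left _
  have hCc : ContinuousOn (C 0) (univ ×ˢ Metric.ball y₀ r) := by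
    intro z hz
    refine ContinuousAt.continuousWithinAt ?_
    by_cases hzR : z.1 ∈ R
    · have h1 : ContinuousOn (C 0) S :=
        hcut.comp (f := fun z => ((0 : ℝ), z)) (by fun_prop) fun z hz => ⟨⟨le_rfl, hδ.le⟩, hz⟩
      exact h1.continuousAt (hSo.mem_nhds ⟨by linarith [hzR.1], by linarith [hzR.2], hz.2⟩)
    · refine (continuousAt_const (y := (0 : Pr m k [⋀^Fin (m + 1)]→L[ℝ] ℝ))).congr ?_
      filter_upwards [(hRc.isClosed.isOpen_compl.preimage continuous_fst).mem_nhds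
        (show z ∈ Prod.fst ⁻¹' Rᶜ from hzR)] with x hx
      exact (hC0 0 x hx).symm
  refine ⟨fun y => - ∫ s, C 0 (s, y) (uFrame m k), ?_, fun w hw K hK hKd h0 => ?_⟩
  · refine ContinuousOn.neg (continuousOn_integral_fst isOpen_univ Metric.isOpen_ball
      (f := fun z => C 0 z (uFrame m k)) (continuous_apply_form hCc _) hRc (subset_univ _)
      fun u hu y => ?_)
    rw [hC0 0 (u, y) hu]; rfl
  set F : Pr m k → ℝ := fun z => (-1) ^ (m + 1) * wedge (by omega : m + (k + 1) = m + 1 + k) (Ω z)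
    (extDeriv w z) (pFrame m k) + wedge rfl (H z) (w z) (pFrame m k) with hF
  have hi1 := (hint w hw K hK hKd h0).const_mul ((-1) ^ (m + 1))
  have hi2 : Integrable fun z => wedge rfl (H z) (w z) (pFrame m k) := by
    obtain ⟨h1, h2⟩ := continuous_of_continuousOn_of_eq_zero (isOpen_flatDomain y₀ r)
      (hH.wedge_apply rfl hw.continuous.continuousOn (pFrame m k)) hK hKd fun z hz => by
        rw [h0 z hz, wedge_zero_right]; rfl
    exact h1.integrable_of_hasCompactSupport h2
  have hFi : Integrable F := hi1.add hi2
  have hpair : FlatPairing Ω H w = ∫ z, F z := by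
    rw [FlatPairing, hF, MeasureTheory.integral_add hi1 hi2, integral_const_mul]
  set f : ℝ → Pr m k → ℝ := fun ε z => wedge rfl (C ε z)
    ((w (scaleCLM m k ε z)).compContinuousLinearMap (scaleCLM m k ε)) (pFrame m k) with hf
  have hwc : Continuous fun s : ℝ × Pr m k =>
      (w (scaleCLM m k s.1 s.2)).compContinuousLinearMap (scaleCLM m k s.1) := by
    have h1 : ContDiff ℝ 0 fun s : ℝ × Pr m k => w (scaleCLM m k s.1 s.2) := by
      refine (hw.of_le (by simp)).comp ?_
      simp only [scaleCLM_apply]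
      fun_prop
    have h2 : ContDiff ℝ 0 fun s : ℝ × Pr m k => scaleCLM m k s.1 := by
      have h3 : ∀ ε, scaleCLM m k ε = ε • (ContinuousLinearMap.inl ℝ (Eu (m + 1)) (Eu k)).comp
          (ContinuousLinearMap.fst ℝ (Eu (m + 1)) (Eu k)) +
          (ContinuousLinearMap.inr ℝ (Eu (m + 1)) (Eu k)).comp
          (ContinuousLinearMap.snd ℝ (Eu (m + 1)) (Eu k)) := fun ε =>
        ContinuousLinearMap.ext fun v => by simp
      simp only [h3]
      fun_prop
    have h3 : ContDiff ℝ 0 fun s : ℝ × Pr m k =>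
        (w (scaleCLM m k s.1 s.2)).compContinuousLinearMap (scaleCLM m k s.1) := by
      refine contDiff_iff_contDiffAt.2 fun s => ?_
      rw [← contDiffWithinAt_univ]
      exact ContDiffWithinAt.compForm h1.contDiffAt.contDiffWithinAt h2.contDiffAt.contDiffWithinAt
    exact h3.continuous
  set K' : Set (Pr m k) := R ×ˢ (Prod.snd '' K) with hK'
  have hK'c : IsCompact K' := hRc.prod (hK.image continuous_snd)
  have hyK : ∀ y ∈ Prod.snd '' K, y ∈ Metric.ball y₀ r := by
    rintro _ ⟨z, hz, rfl⟩
    exact (hKd hz).2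
  have hf0 : ∀ ε, ∀ z ∉ K', f ε z = 0 := by
    intro ε z hz
    by_cases h1 : z.1 ∈ R
    · have h2 : w (scaleCLM m k ε z) = 0 := h0 _ fun h => hz ⟨h1, _, h, rfl⟩
      simp only [hf, h2]
      rw [show (0 : Pr m k [⋀^Fin k]→L[ℝ] ℝ).compContinuousLinearMap (scaleCLM m k ε) = 0 from rfl,
        wedge_zero_right]
      rfl
    · simp only [hf, hC0 ε z h1, wedge_zero_left]
      rfl
  have hfc : ContinuousOn (fun s : ℝ × Pr m k => f s.1 s.2) (Icc 0 δ ×ˢ K') := by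
    refine ContinuousOn.wedge_apply rfl (hcut.mono (prod_mono_right ?_)) hwc.continuousOn _
    rintro z ⟨h1, h2⟩
    exact ⟨by linarith [h1.1], by linarith [h1.2], hyK _ h2⟩
  have hlim := (tendsto_integral_of_continuousOn (μ := volume) hδ hK'c hfc fun t _ => hf0 t).neg
  have hval : ∀ ε ∈ Ioo 0 δ, ∫ z : Pr m k, (1 - bump (ε⁻¹ • z.1)) * F z = - ∫ z, f ε z := by
    rintro ε ⟨hε, hεδ⟩
    rw [hF, integral_one_sub_cutoff hΩ hd (contDiff_bump_smul _) (eventually_bump_smul_eq_one _) hw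
      hK hKd h0, integral_eq_integral_scale hε, ← integral_const_mul]
    congr 1
    refine integral_congr_ae (ae_of_all _ fun z => ?_)
    by_cases hz : z.2 ∈ Metric.ball y₀ r
    · simp only [hf, hC]
      rw [← cutoffForm_scale hΦ hε (by linarith) hz, ← wedge_compContinuousLinearMap]
      have h1 := form_apply_comp_basis (pBasis m k) (wedge rfl
        (cutoffForm (fun u => bump (ε⁻¹ • u)) Ω (scaleCLM m k ε z)) (w (scaleCLM m k ε z)))
        (scaleCLM m k ε)
      rw [show LinearMap.det (scaleCLM m k ε : Pr m k →ₗ[ℝ] Pr m k) = ε ^ (m + 1) from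
        det_scaleCLM ε, coe_pBasis] at h1
      exact h1.symm
    · have h2 : w (scaleCLM m k ε z) = 0 := h0 _ fun h => hz (hKd h).2
      rw [hf0 ε z fun h => hz (hyK _ h.2)]
      simp only [h2, wedge_zero_right]
      exact mul_zero _
  have hlim1 : Tendsto (fun ε : ℝ => ∫ z : Pr m k, (1 - bump (ε⁻¹ • z.1)) * F z) (𝓝[>] 0)
      (𝓝 (∫ z, F z)) := by
    refine tendsto_integral_filter_of_dominated_convergence (fun z => ‖F z‖)
      (Eventually.of_forall fun ε => ?_) (Eventually.of_forall fun ε => ae_of_all _ fun z => ?_)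
      hFi.norm ?_
    · refine AEStronglyMeasurable.mul ?_ hFi.aestronglyMeasurable
      exact (continuous_const.sub ((contDiff_bump_smul (E := Eu (m + 1)) ε⁻¹).continuous.comp
        continuous_fst)).aestronglyMeasurable
    · rw [norm_mul]
      refine mul_le_of_le_one_left (norm_nonneg _) ?_
      have h1 := Real.smoothTransition.nonneg (2 - ‖ε⁻¹ • z.1‖ ^ 2)
      have h2 := Real.smoothTransition.le_one (2 - ‖ε⁻¹ • z.1‖ ^ 2)
      rw [bump, Real.norm_eq_abs, abs_le]
      constructor <;> linarith
    · have h1 : ∀ᵐ u : Eu (m + 1), u ≠ 0 := Measure.ae_ne volume 0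
      have h2 : ∀ᵐ z : Pr m k, z.1 ≠ 0 := Measure.quasiMeasurePreserving_fst.ae h1
      filter_upwards [h2] with z hz
      refine tendsto_const_nhds.congr' ?_
      filter_upwards [Ioo_mem_nhdsGT (show 0 < ‖z.1‖ / 2 by positivity)] with ε hε
      rw [bump_inv_smul_eq_zero hε.1, sub_zero, one_mul]
      rw [mem_closedBall_zero_iff, not_le]
      linarith [hε.2]
  have hlim2 : Tendsto (fun ε : ℝ => - ∫ z, f ε z) (𝓝[>] 0) (𝓝 (∫ z, F z)) := by
    refine hlim1.congr' ?_
    filter_upwards [Ioo_mem_nhdsGT hδ] with ε hε using hval ε hε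
  rw [hpair, tendsto_nhds_unique hlim2 hlim]
  have hfp : ∀ u y, f 0 (u, y) = C 0 (u, y) (uFrame m k) * w (0, y) (yFrame m k) := by
    intro u y
    have h1 : (w (scaleCLM m k 0 (u, y))).compContinuousLinearMap (scaleCLM m k 0) =
        ((w (0, y)).compContinuousLinearMap
          (ContinuousLinearMap.inr ℝ (Eu (m + 1)) (Eu k))).compContinuousLinearMap
            (ContinuousLinearMap.snd ℝ (Eu (m + 1)) (Eu k)) := by
      have h2 : scaleCLM m k 0 (u, y) = (0, y) := by rw [scaleCLM_apply, zero_smul]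
      have h3 : scaleCLM m k 0 = (ContinuousLinearMap.inr ℝ (Eu (m + 1)) (Eu k)).comp
          (ContinuousLinearMap.snd ℝ (Eu (m + 1)) (Eu k)) := by
        refine ContinuousLinearMap.ext fun v => ?_
        rw [scaleCLM_apply, zero_smul]
        rfl
      rw [h2, h3]
      rfl
    simp only [hf, h1]
    exact wedge_snd_pFrame _ _
  have hf0c := continuous_of_continuousOn_of_eq_zero (f := f 0) (D := univ ×ˢ Metric.ball y₀ r)
    (isOpen_univ.prod Metric.isOpen_ball) ?_ hK'c
    (fun z hz => ⟨mem_univ _, hyK _ hz.2⟩) (hf0 0)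
  · rw [integral_pr_eq hf0c.1 hf0c.2, ← integral_neg]
    refine integral_congr_ae (ae_of_all _ fun y => ?_)
    simp only [hfp]
    rw [integral_mul_const, neg_mul]
  · exact hCc.wedge_apply rfl (hwc.comp (f := fun z => ((0 : ℝ), z)) (by fun_prop)).continuousOn _

end FlatExtensionLimit


section Frames

open Bundle InnerProductSpace

variable {EB : Type*} [NormedAddCommGroup EB] [NormedSpace ℝ EB] {HB : Type*} [TopologicalSpace HB]
  {IB : ModelWithCorners ℝ EB HB} {B : Type*} [TopologicalSpace B] [ChartedSpace HB B]
  {F : Type*} [NormedAddCommGroup F] [NormedSpace ℝ F]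
  {E : B → Type*} [TopologicalSpace (TotalSpace F E)] [∀ b, TopologicalSpace (E b)]
  [∀ b, AddCommGroup (E b)] [∀ b, Module ℝ (E b)] [∀ b, IsTopologicalAddGroup (E b)]
  [∀ b, ContinuousConstSMul ℝ (E b)] [FiberBundle F E] [VectorBundle ℝ F E]
  {EX : Type*} [NormedAddCommGroup EX] [NormedSpace ℝ EX] {HX : Type*} [TopologicalSpace HX]
  {IX : ModelWithCorners ℝ EX HX} {X : Type*} [TopologicalSpace X] [ChartedSpace HX X]
  {b : X → B} {x₀ : X}

variable (IX IB F) in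
/-- A section of a vector bundle along a map is smooth at a point. -/
def SmoothSectionAt (b : X → B) (v : ∀ x, E (b x)) (x₀ : X) : Prop :=
  ContMDiffAt IX (IB.prod 𝓘(ℝ, F)) ∞ (fun x => (⟨b x, v x⟩ : TotalSpace F E)) x₀

theorem smoothSectionAt_iff {v : ∀ x, E (b x)} : SmoothSectionAt IB F IX b v x₀ ↔
    ContMDiffAt IX IB ∞ b x₀ ∧ ContMDiffAt IX 𝓘(ℝ, F) ∞
      (fun x => (trivializationAt F E (b x₀)).linearMapAt ℝ (b x) (v x)) x₀ := by
  rw [SmoothSectionAt, contMDiffAt_totalSpace]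
  refine and_congr_right fun hb => Filter.EventuallyEq.contMDiffAt_iff ?_
  filter_upwards [hb.continuousAt.preimage_mem_nhds
    ((trivializationAt F E (b x₀)).open_baseSet.mem_nhds (mem_baseSet_trivializationAt F E (b x₀)))]
    with x hx
  rw [(trivializationAt F E (b x₀)).linearMapAt_apply, if_pos (show b x ∈ _ from hx)]

theorem SmoothSectionAt.sub {v w : ∀ x, E (b x)} (hv : SmoothSectionAt IB F IX b v x₀)
    (hw : SmoothSectionAt IB F IX b w x₀) :
    SmoothSectionAt IB F IX b (fun x => v x - w x) x₀ := by
  rw [smoothSectionAt_iff] at *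
  refine ⟨hv.1, ?_⟩
  simp only [map_sub]
  exact hv.2.sub hw.2

theorem SmoothSectionAt.smul {f : X → ℝ} (hf : ContMDiffAt IX 𝓘(ℝ) ∞ f x₀) {v : ∀ x, E (b x)}
    (hv : SmoothSectionAt IB F IX b v x₀) :
    SmoothSectionAt IB F IX b (fun x => f x • v x) x₀ := by
  rw [smoothSectionAt_iff] at *
  refine ⟨hv.1, ?_⟩
  simp only [map_smul]
  exact hf.smul hv.2

theorem SmoothSectionAt.sum {ι : Type*} {s : Finset ι} {v : ι → ∀ x, E (b x)}
    (hb : ContMDiffAt IX IB ∞ b x₀) (hv : ∀ i ∈ s, SmoothSectionAt IB F IX b (v i) x₀) :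
    SmoothSectionAt IB F IX b (fun x => ∑ i ∈ s, v i x) x₀ := by
  rw [smoothSectionAt_iff]
  refine ⟨hb, ?_⟩
  simp only [map_sum]
  exact ContMDiffAt.sum fun i hi => (smoothSectionAt_iff.1 (hv i hi)).2

theorem smoothSectionAt_symm (hb : ContMDiffAt IX IB ∞ b x₀) [ContMDiffVectorBundle ∞ F E IB]
    {y : B} (hy : b x₀ ∈ (trivializationAt F E y).baseSet) (a : F) :
    SmoothSectionAt IB F IX b (fun x => (trivializationAt F E y).symm (b x) a) x₀ := by
  have h1 := (trivializationAt F E y).contMDiffOn_symm (n := ∞) (IB := IB)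
  have h2 : (b x₀, a) ∈ (trivializationAt F E y).target :=
    (trivializationAt F E y).mem_target.2 hy
  have h3 := (h1.contMDiffAt ((trivializationAt F E y).open_target.mem_nhds h2)).comp x₀
    (hb.prodMk (contMDiffAt_const (c := a)))
  refine h3.congr_of_eventuallyEq ?_
  filter_upwards [hb.continuousAt.preimage_mem_nhds
    ((trivializationAt F E y).open_baseSet.mem_nhds hy)] with x hx
  exact (trivializationAt F E y).mk_symm hx a

theorem eventually_linearIndependent [FiniteDimensional ℝ F] {ι : Type*} [Finite ι]
    {v : ι → ∀ x, E (b x)} (hv : ∀ i, SmoothSectionAt IB F IX b (v i) x₀)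
    (hb : ContMDiffAt IX IB ∞ b x₀) (hli : LinearIndependent ℝ fun i => v i x₀) :
    ∀ᶠ x in 𝓝 x₀, LinearIndependent ℝ fun i => v i x := by
  set e := trivializationAt F E (b x₀) with he
  have hx₀ : b x₀ ∈ e.baseSet := mem_baseSet_trivializationAt F E (b x₀)
  have h1 : LinearIndependent ℝ fun i => e.linearMapAt ℝ (b x₀) (v i x₀) := by
    have h2 : Function.Injective (e.linearMapAt ℝ (b x₀)) := by
      have h3 := (e.continuousLinearEquivAt ℝ (b x₀) hx₀).injective
      rwa [e.coe_continuousLinearEquivAt_eq hx₀] at h3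
    exact hli.map' (e.linearMapAt ℝ (b x₀)) (LinearMap.ker_eq_bot.2 h2)
  have h3 : ContinuousAt (fun x i => e.linearMapAt ℝ (b x) (v i x)) x₀ :=
    continuousAt_pi.2 fun i => (smoothSectionAt_iff.1 (hv i)).2.continuousAt
  filter_upwards [h3.eventually h1.eventually] with x hx
  exact LinearIndependent.of_comp (e.linearMapAt ℝ (b x)) hx

variable [RiemannianBundle E] [IsContMDiffRiemannianBundle IB ∞ F E]

theorem SmoothSectionAt.inner {v w : ∀ x, E (b x)} (hv : SmoothSectionAt IB F IX b v x₀)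
    (hw : SmoothSectionAt IB F IX b w x₀) :
    ContMDiffAt IX 𝓘(ℝ) ∞ (fun x => ⟪v x, w x⟫_ℝ) x₀ :=
  ContMDiffAt.inner_bundle hv hw

theorem smoothSectionAt_gramSchmidt {n : ℕ} {f : Fin n → ∀ x, E (b x)}
    (hf : ∀ i, SmoothSectionAt IB F IX b (f i) x₀) (hb : ContMDiffAt IX IB ∞ b x₀)
    (hli : LinearIndependent ℝ fun i => f i x₀) (j : Fin n) :
    SmoothSectionAt IB F IX b (fun x => gramSchmidt ℝ (fun i => f i x) j) x₀ := by
  induction j using WellFoundedLT.induction with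
  | ind j ih =>
    have h1 : (fun x => gramSchmidt ℝ (fun i => f i x) j) = fun x => f j x - ∑ i ∈ Finset.Iio j,
        (⟪gramSchmidt ℝ (fun i => f i x) i, f j x⟫_ℝ * (⟪gramSchmidt ℝ (fun i => f i x) i,
          gramSchmidt ℝ (fun i => f i x) i⟫_ℝ)⁻¹) • gramSchmidt ℝ (fun i => f i x) i := by
      funext x
      have h2 := gramSchmidt_def'' ℝ (fun i => f i x) j
      rw [eq_sub_iff_add_eq]
      refine Eq.trans ?_ h2.symm
      congr 1
      refine Finset.sum_congr rfl fun i _ => ?_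
      rw [real_inner_self_eq_norm_sq, div_eq_mul_inv]
      rfl
    rw [h1]
    refine (hf j).sub (.sum hb fun i hi => .smul ?_ (ih i (Finset.mem_Iio.1 hi)))
    have h3 := ih i (Finset.mem_Iio.1 hi)
    exact (h3.inner (hf j)).mul ((h3.inner h3).inv₀
      (inner_self_ne_zero.2 (gramSchmidt_ne_zero i hli)))

theorem smoothSectionAt_gramSchmidtNormed {n : ℕ} {f : Fin n → ∀ x, E (b x)}
    (hf : ∀ i, SmoothSectionAt IB F IX b (f i) x₀) (hb : ContMDiffAt IX IB ∞ b x₀)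
    (hli : LinearIndependent ℝ fun i => f i x₀) (j : Fin n) :
    SmoothSectionAt IB F IX b (fun x => gramSchmidtNormed ℝ (fun i => f i x) j) x₀ := by
  have h1 := smoothSectionAt_gramSchmidt hf hb hli j
  have h2 : gramSchmidt ℝ (fun i => f i x₀) j ≠ 0 := gramSchmidt_ne_zero j hli
  refine SmoothSectionAt.smul (f := fun x => ‖gramSchmidt ℝ (fun i => f i x) j‖⁻¹) ?_ h1
  have h3 : (fun x => ‖gramSchmidt ℝ (fun i => f i x) j‖⁻¹) = fun x =>
      (√(⟪gramSchmidt ℝ (fun i => f i x) j, gramSchmidt ℝ (fun i => f i x) j⟫_ℝ))⁻¹ := by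
    funext x
    rw [real_inner_self_eq_norm_sq, Real.sqrt_sq (norm_nonneg _)]
  rw [h3]
  have h4 : ⟪gramSchmidt ℝ (fun i => f i x₀) j, gramSchmidt ℝ (fun i => f i x₀) j⟫_ℝ ≠ 0 :=
    inner_self_ne_zero.2 h2
  refine ContMDiffAt.inv₀ ?_ (Real.sqrt_ne_zero'.2 (lt_of_le_of_ne real_inner_self_nonneg h4.symm))
  exact (Real.contDiffAt_sqrt h4).contMDiffAt.comp x₀ (h1.inner h1)

end Frames

section NormalFrames

open Bundle InnerProductSpace

variable {k m : ℕ} {M : Type*} [TopologicalSpace M] [ChartedSpace (Eu (m + 1 + k)) M]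
  [IsManifold (𝓡 (m + 1 + k)) ∞ M]
  {N : Type*} [TopologicalSpace N] [ChartedSpace (Eu k) N] [IsManifold (𝓡 k) ∞ N] {ι : N → M}

theorem exists_complementary_frame {n : ℕ} (D : Eu k →L[ℝ] Eu n) (hD : Function.Injective D)
    (hn : n = m + 1 + k) : ∃ c : Fin (m + 1) → Eu n, ∀ X : Fin k → Eu k, LinearIndependent ℝ X →
      LinearIndependent ℝ fun j : Fin (k + (m + 1)) =>
        Fin.addCases (motive := fun _ => Eu n) (fun i => D (X i)) c j := by
  obtain ⟨C, hC⟩ := Submodule.exists_isCompl (LinearMap.range D.toLinearMap)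
  have hdim : Module.finrank ℝ C = m + 1 := by
    have h1 := Submodule.finrank_add_eq_of_isCompl hC
    rw [LinearMap.finrank_range_of_inj (f := D.toLinearMap) hD] at h1
    simp at h1 ⊢
    omega
  let c := Module.finBasisOfFinrankEq ℝ C hdim
  refine ⟨fun i => c i, fun X hX => ?_⟩
  have h1 : LinearIndependent ℝ fun i => D (X i) :=
    hX.map' D.toLinearMap (LinearMap.ker_eq_bot.2 hD)
  have h3 : LinearIndependent ℝ fun i => (c i : Eu n) :=
    c.linearIndependent.map' C.subtype (Submodule.ker_subtype C)
  have h4 := h1.sum_type h3 (hC.disjoint.mono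
    (Submodule.span_le.2 (by rintro _ ⟨i, rfl⟩; exact ⟨X i, rfl⟩))
    (Submodule.span_le.2 (by rintro _ ⟨i, rfl⟩; exact (c i).2)))
  have h5 := h4.comp finSumFinEquiv.symm finSumFinEquiv.symm.injective
  have h6 : Sum.elim (fun i => D (X i)) (fun i => (c i : Eu n)) ∘ finSumFinEquiv.symm =
    fun j : Fin (k + (m + 1)) => Fin.addCases (motive := fun _ => Eu n) (fun i => D (X i))
      (fun i => (c i : Eu n)) j := ?_
  · rwa [h6] at h5
  funext j
  refine Fin.addCases (fun i => ?_) (fun i => ?_) j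
  · rw [Function.comp_apply, finSumFinEquiv_symm_apply_castAdd, Fin.addCases_left]; rfl
  · rw [Function.comp_apply, finSumFinEquiv_symm_apply_natAdd, Fin.addCases_right]; rfl

set_option maxHeartbeats 1000000 in
theorem exists_normalFrame (g : SmoothMetric (m + 1 + k) M)
    (hι : Manifold.IsSmoothEmbedding (𝓡 k) (𝓡 (m + 1 + k)) ∞ ι) (q₀ : N) :
    ∃ F : NormalFrame g ι, q₀ ∈ F.U := by
  letI : RiemannianBundle (fun x : M => TangentSpace (𝓡 (m + 1 + k)) x) := ⟨g.toRiemannianMetric⟩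
  set T := trivializationAt (Eu k) (TangentSpace (𝓡 k)) q₀ with hT
  set S := trivializationAt (Eu (m + 1 + k)) (TangentSpace (𝓡 (m + 1 + k))) (ι q₀) with hS
  set D : Eu k →L[ℝ] Eu (m + 1 + k) := mfderiv (𝓡 k) (𝓡 (m + 1 + k)) ι q₀ with hD
  have hinj : Function.Injective D := injective_mfderiv_of_isSmoothEmbedding hι q₀
  obtain ⟨c, hc⟩ := exists_complementary_frame (m := m) D hinj rfl
  set V : Fin k → ∀ q, TangentSpace (𝓡 (m + 1 + k)) (ι q) := fun i q =>
    mfderiv (𝓡 k) (𝓡 (m + 1 + k)) ι q (T.symm q (stdFrame k i)) with hV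
  set W : Fin (m + 1) → ∀ q, TangentSpace (𝓡 (m + 1 + k)) (ι q) := fun i q =>
    S.symm (ι q) (S.linearMapAt ℝ (ι q₀) (c i)) with hW
  set f : Fin (k + (m + 1)) → ∀ q, TangentSpace (𝓡 (m + 1 + k)) (ι q) := fun j q =>
    Fin.addCases (motive := fun _ => TangentSpace (𝓡 (m + 1 + k)) (ι q)) (fun i => V i q)
      (fun i => W i q) j with hf
  have hfV : ∀ i, f (Fin.castAdd (m + 1) i) = V i := fun i => funext fun q => Fin.addCases_left i
  have hfW : ∀ i, f (Fin.natAdd k i) = W i := fun i => funext fun q => Fin.addCases_right i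
  have hb : ∀ q, ContMDiffAt (𝓡 k) (𝓡 (m + 1 + k)) ∞ ι q := fun q => hι.contMDiff q
  have hfs : ∀ q ∈ T.baseSet ∩ ι ⁻¹' S.baseSet, ∀ j,
      SmoothSectionAt (𝓡 (m + 1 + k)) (Eu (m + 1 + k)) (𝓡 k) ι (f j) q := by
    rintro q ⟨hq, hq'⟩ j
    refine Fin.addCases (fun i => ?_) (fun i => ?_) j
    · have h1 := (hι.contMDiff.contMDiff_tangentMap (m := ∞) (by simp)).contMDiffAt.comp q
        (smoothSectionAt_symm (IX := 𝓡 k) (b := id) contMDiffAt_id hq (stdFrame k i))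
      rw [hfV]
      exact h1
    · rw [hfW]
      exact smoothSectionAt_symm (hb q) hq' _
  have hq₀ : q₀ ∈ T.baseSet := mem_baseSet_trivializationAt _ _ _
  have hιq₀ : ι q₀ ∈ S.baseSet := mem_baseSet_trivializationAt _ _ _
  have hTs : ∀ q ∈ T.baseSet, ∀ v, T.symm q v = T.symmₗ ℝ q v := fun q hq v =>
    (congrFun (T.coe_symmₗ (R := ℝ) hq) v).symm
  have hli : LinearIndependent ℝ fun j => f j q₀ := by
    have h2 : LinearIndependent ℝ fun i => (T.symm q₀ (stdFrame k i) : Eu k) := by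
      have h3 : (fun i => (T.symm q₀ (stdFrame k i) : Eu k)) =
          T.symmₗ ℝ q₀ ∘ stdBasis k := by
        funext i
        rw [coe_stdBasis]
        exact hTs q₀ hq₀ _
      rw [h3]
      refine (stdBasis k).linearIndependent.map' (M' := Eu k) (T.symmₗ ℝ q₀)
        (LinearMap.ker_eq_bot.2 ?_)
      exact Function.LeftInverse.injective (g := T.linearMapAt ℝ q₀) (T.linearMapAt_symmₗ hq₀)
    have h4 : (fun j => (f j q₀ : Eu (m + 1 + k))) = fun j : Fin (k + (m + 1)) =>
        Fin.addCases (motive := fun _ => Eu (m + 1 + k))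
          (fun i => D (T.symm q₀ (stdFrame k i))) c j := by
      funext j
      refine Fin.addCases (fun i => ?_) (fun i => ?_) j
      · rw [hfV, Fin.addCases_left]
        rfl
      · rw [hfW, Fin.addCases_right]
        have h5 := S.symmₗ_linearMapAt (R := ℝ) hιq₀ (c i)
        rw [S.coe_symmₗ (R := ℝ) hιq₀] at h5
        exact h5
    have h5 := hc _ h2
    rw [← h4] at h5
    exact h5
  have hev : ∀ᶠ q in 𝓝 q₀, (q ∈ T.baseSet ∩ ι ⁻¹' S.baseSet) ∧ LinearIndependent ℝ fun j => f j q :=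
    Filter.Eventually.and ((T.open_baseSet.inter (S.open_baseSet.preimage
      hι.isEmbedding.continuous)).mem_nhds ⟨hq₀, hιq₀⟩) (eventually_linearIndependent (hfs q₀ ⟨hq₀, hιq₀⟩) (hb q₀) hli)
  obtain ⟨U, hU, hUo, hqU⟩ := eventually_nhds_iff.1 hev
  refine ⟨⟨U, hUo, fun i q => gramSchmidtNormed ℝ (fun j => f j q) (Fin.natAdd k i),
    fun i q hq => ContMDiffAt.contMDiffWithinAt ?_, fun i q hq u => ?_, fun i j q hq => ?_⟩, hqU⟩
  · exact smoothSectionAt_gramSchmidtNormed (hfs q (hU q hq).1) (hb q) (hU q hq).2 _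
  · set L : Eu k →ₗ[ℝ] ℝ := (g.inner (ι q) (gramSchmidtNormed ℝ (fun j => f j q)
      (Fin.natAdd k i))).toLinearMap ∘ₗ (mfderiv (𝓡 k) (𝓡 (m + 1 + k)) ι q).toLinearMap ∘ₗ
        T.symmₗ ℝ q with hL
    have h1 : L = 0 := by
      refine (stdBasis k).ext fun a => ?_
      have h2 : (⟪gramSchmidtNormed ℝ (fun j => f j q) (Fin.natAdd k i),
          f (Fin.castAdd (m + 1) a) q⟫_ℝ) = 0 := by
        rw [gramSchmidtNormed, inner_smul_left, gramSchmidt_inv_triangular, mul_zero]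
        rw [Fin.lt_def]
        simp
        omega
      rw [coe_stdBasis, LinearMap.zero_apply]
      rw [hfV] at h2
      have h3 := hTs q (hU q hq).1.1 (stdFrame k a)
      simp only [hV, h3] at h2
      exact h2
    have h2 := congrArg (fun L : Eu k →ₗ[ℝ] ℝ => L (T.linearMapAt ℝ q u)) h1
    have h3 : T.symmₗ ℝ q (T.linearMapAt ℝ q u) = u := T.symmₗ_linearMapAt (R := ℝ) (hU q hq).1.1 u
    have h4 : L (T.linearMapAt ℝ q u) = g.inner (ι q) (gramSchmidtNormed ℝ (fun j => f j q)
      (Fin.natAdd k i)) (mfderiv (𝓡 k) (𝓡 (m + 1 + k)) ι q u) := by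
      conv_rhs => rw [← h3]
      rfl
    exact h4.symm.trans h2
  · have h1 := orthonormal_iff_ite.1 (gramSchmidtNormed_orthonormal (𝕜 := ℝ) (hU q hq).2)
      (Fin.natAdd k i) (Fin.natAdd k j)
    simp only [Fin.natAdd_inj] at h1
    exact h1

end NormalFrames


section Tubes

open IsManifold (maximalAtlas)

variable {k m : ℕ} {M : Type*} [TopologicalSpace M] [ChartedSpace (Eu (m + 1 + k)) M]
  [IsManifold (𝓡 (m + 1 + k)) ∞ M]
  {N : Type*} [TopologicalSpace N] [ChartedSpace (Eu k) N] [IsManifold (𝓡 k) ∞ N] {ι : N → M}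
  {g : SmoothMetric (m + 1 + k) M}

theorem NormalFrame.vec_smul (F : NormalFrame g ι) (q : N) (c : ℝ) (w : Eu (m + 1)) :
    F.vec q (c • w) = c • F.vec q w := by
  simp only [NormalFrame.vec, Finset.smul_sum, PiLp.smul_apply, smul_eq_mul, mul_smul]

theorem bijective_of_injective_pr (T : Pr m k →L[ℝ] Eu (m + 1 + k)) (h : Function.Injective T) :
    Function.Bijective T :=
  ⟨h, (LinearMap.injective_iff_surjective_of_finrank_eq_finrank (f := T.toLinearMap)
    (by simp)).1 h⟩

theorem injective_mfderiv_chart_prod (q₀ : N) :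
    Function.Injective (mfderiv 𝓘(ℝ, Pr m k) ((𝓡 k).prod 𝓘(ℝ, Eu (m + 1)))
      (fun z : Pr m k => ((extChartAt (𝓡 k) q₀).symm z.2, z.1)) (0, extChartAt (𝓡 k) q₀ q₀)) := by
  set y₀ := extChartAt (𝓡 k) q₀ q₀ with hy₀
  set G : Pr m k → N × Eu (m + 1) := fun z => ((extChartAt (𝓡 k) q₀).symm z.2, z.1) with hG
  set P : N × Eu (m + 1) → Pr m k := fun z => (z.2, extChartAt (𝓡 k) q₀ z.1) with hP
  have hGs : ContMDiffAt 𝓘(ℝ, Pr m k) ((𝓡 k).prod 𝓘(ℝ, Eu (m + 1))) ∞ G (0, y₀) := by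
    refine ContMDiffAt.prodMk ?_ contDiffAt_fst.contMDiffAt
    have h0 : ContMDiffAt 𝓘(ℝ, Eu k) (𝓡 k) ∞ (extChartAt (𝓡 k) q₀).symm y₀ :=
      (contMDiffOn_extChartAt_symm q₀).contMDiffAt (extChartAt_target_mem_nhds q₀)
    exact ContMDiffAt.comp (I' := 𝓘(ℝ, Eu k)) (f := Prod.snd) ((0 : Eu (m + 1)), y₀) h0
      contDiffAt_snd.contMDiffAt
  have hG0 : G (0, y₀) = (q₀, 0) := by rw [hG]; simp only [hy₀, extChartAt_to_inv]
  have hPs : ContMDiffAt ((𝓡 k).prod 𝓘(ℝ, Eu (m + 1))) 𝓘(ℝ, Pr m k) ∞ P (G (0, y₀)) := by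
    rw [hG0]
    exact ContMDiffAt.prodMk_space contMDiffAt_snd
      (ContMDiffAt.comp (I' := 𝓡 k) (q₀, (0 : Eu (m + 1))) contMDiffAt_extChartAt contMDiffAt_fst)
  have h1 := mfderiv_comp ((0 : Eu (m + 1)), y₀) (hPs.mdifferentiableAt (by simp))
    (hGs.mdifferentiableAt (by simp))
  have h2 : P ∘ G =ᶠ[𝓝 (0, y₀)] id := by
    filter_upwards [continuousAt_snd.preimage_mem_nhds (extChartAt_target_mem_nhds (I := 𝓡 k) q₀)]
      with z hz
    exact Prod.ext rfl ((extChartAt (𝓡 k) q₀).right_inv hz)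
  rw [h2.mfderiv_eq, mfderiv_id] at h1
  exact Function.LeftInverse.injective (g := mfderiv ((𝓡 k).prod 𝓘(ℝ, Eu (m + 1))) 𝓘(ℝ, Pr m k) P
    (G (0, y₀))) fun v => (DFunLike.congr_fun h1 v).symm

theorem NormalTube.exists_adaptedChart (τ : NormalTube g ι) (F : NormalFrame g ι)
    (hι : IsEmbedding ι) {q₀ : N} (hq₀ : q₀ ∈ F.U) :
    ∃ A : AdaptedChart k m ι q₀,
      (∀ y ∈ Metric.ball (extChartAt (𝓡 k) q₀ q₀) A.r, (extChartAt (𝓡 k) q₀).symm y ∈ F.U ∧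
        A.r ≤ τ.radius ((extChartAt (𝓡 k) q₀).symm y)) ∧
      ∀ z ∈ A.dom, A.map z = τ.exp ((extChartAt (𝓡 k) q₀).symm z.2)
        (F.vec ((extChartAt (𝓡 k) q₀).symm z.2) z.1) := by
  set y₀ := extChartAt (𝓡 k) q₀ q₀ with hy₀
  set G : Pr m k → N × Eu (m + 1) := fun z => ((extChartAt (𝓡 k) q₀).symm z.2, z.1) with hG
  set E : N × Eu (m + 1) → M := fun z => τ.exp z.1 (F.vec z.1 z.2) with hE
  have hs0 : (extChartAt (𝓡 k) q₀).symm y₀ = q₀ := extChartAt_to_inv q₀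
  have hG0 : G (0, y₀) = (q₀, 0) := by rw [hG]; simp only [hs0]
  have hW : IsOpen {z : N × Eu (m + 1) | z.1 ∈ F.U ∧ ‖z.2‖ < τ.radius z.1} :=
    (F.isOpen.preimage continuous_fst).inter
      (isOpen_lt continuous_snd.norm (τ.radius_continuous.comp continuous_fst))
  have hGs : ContMDiffOn 𝓘(ℝ, Pr m k) ((𝓡 k).prod 𝓘(ℝ, Eu (m + 1))) ∞ G
      (univ ×ˢ (extChartAt (𝓡 k) q₀).target) := by
    refine ContMDiffOn.prodMk ?_ contDiff_fst.contMDiff.contMDiffOn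
    exact ContMDiffOn.comp (I' := 𝓘(ℝ, Eu k)) (contMDiffOn_extChartAt_symm q₀)
      contDiff_snd.contMDiff.contMDiffOn fun z hz => hz.2
  have hU := hGs.continuousOn.isOpen_inter_preimage
    (isOpen_univ.prod (isOpen_extChartAt_target q₀)) hW
  set U := (univ ×ˢ (extChartAt (𝓡 k) q₀).target) ∩
    G ⁻¹' {z : N × Eu (m + 1) | z.1 ∈ F.U ∧ ‖z.2‖ < τ.radius z.1} with hUdef
  have hU0 : ((0 : Eu (m + 1)), y₀) ∈ U := by
    refine ⟨⟨mem_univ _, mem_extChartAt_target q₀⟩, ?_⟩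
    rw [mem_preimage, hG0]
    exact ⟨hq₀, by rw [norm_zero]; exact τ.radius_pos q₀⟩
  have hev : ∀ᶠ y in 𝓝 y₀, (extChartAt (𝓡 k) q₀).symm y ∈ F.U ∧
      τ.radius q₀ / 2 < τ.radius ((extChartAt (𝓡 k) q₀).symm y) := by
    have hc : ContinuousAt (extChartAt (𝓡 k) q₀).symm y₀ := continuousAt_extChartAt_symm q₀
    refine Filter.Eventually.and
      (hc.preimage_mem_nhds (F.isOpen.mem_nhds (by rw [hs0]; exact hq₀))) ?_
    refine (τ.radius_continuous.continuousAt.comp hc).eventually (lt_mem_nhds ?_)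
    rw [Function.comp_apply, hs0]
    linarith [τ.radius_pos q₀]
  obtain ⟨ε, hε, hεb⟩ := Metric.eventually_nhds_iff_ball.1 hev
  have hbij : Function.Bijective (mfderiv 𝓘(ℝ, Pr m k) (𝓡 (m + 1 + k)) (E ∘ G) (0, y₀)) := by
    refine bijective_of_injective_pr _ ?_
    have hEs : ContMDiffAt ((𝓡 k).prod 𝓘(ℝ, Eu (m + 1))) (𝓡 (m + 1 + k)) ∞ E (G (0, y₀)) :=
      (τ.smooth F).contMDiffAt (hW.mem_nhds hU0.2)
    have hGa : ContMDiffAt 𝓘(ℝ, Pr m k) ((𝓡 k).prod 𝓘(ℝ, Eu (m + 1))) ∞ G (0, y₀) :=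
      hGs.contMDiffAt ((isOpen_univ.prod (isOpen_extChartAt_target q₀)).mem_nhds hU0.1)
    have h1 := mfderiv_comp ((0 : Eu (m + 1)), y₀) (hEs.mdifferentiableAt (by simp))
      (hGa.mdifferentiableAt (by simp))
    have h2 := (τ.localDiffeo F (G (0, y₀)) hU0.2.1 hU0.2.2).injective.comp
      (injective_mfderiv_chart_prod (m := m) q₀)
    intro v w h
    refine h2 ?_
    exact (DFunLike.congr_fun h1 v).symm.trans (h.trans (DFunLike.congr_fun h1 w))
  have h0 : ∀ᶠ y in 𝓝 y₀, (E ∘ G) (0, y) = ι ((extChartAt (𝓡 k) q₀).symm y) := by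
    refine Eventually.of_forall fun y => ?_
    change τ.exp _ (F.vec _ 0) = _
    rw [show F.vec ((extChartAt (𝓡 k) q₀).symm y) (0 : Eu (m + 1)) = 0 by
      rw [← zero_smul ℝ (0 : Eu (m + 1)), F.vec_smul, zero_smul], τ.exp_zero]
  obtain ⟨A, hAr, hA⟩ := BlowUpCurrents.exists_adaptedChart (m := m) hι (Ψ := E ∘ G) hU hU0
    ((τ.smooth F).comp (hGs.mono inter_subset_left) fun z hz => hz.2) hbij h0
    (lt_min hε (half_pos (τ.radius_pos q₀)))
  refine ⟨A, fun y hy => ?_, hA⟩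
  obtain ⟨h1, h2⟩ := hεb y (Metric.ball_subset_ball (hAr.trans (min_le_left _ _)) hy)
  exact ⟨h1, (hAr.trans (min_le_right _ _)).trans h2.le⟩

variable [T2Space M] [SigmaCompactSpace M]
  {Ω : DiffForm (𝓡 (m + 1 + k)) M m} {H : DiffForm (𝓡 (m + 1 + k)) M (m + 1)}

/-- The pull-back of a form by the collar map, in the coordinates of a tube. -/
theorem collarForm_eq (τ : NormalTube g ι) (F : NormalFrame g ι) {q₀ : N}
    (A : AdaptedChart k m ι q₀)
    (hA : ∀ z ∈ A.dom, A.map z = τ.exp ((extChartAt (𝓡 k) q₀).symm z.2)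
        (F.vec ((extChartAt (𝓡 k) q₀).symm z.2) z.1)) {t : ℝ} (ht : t ∈ Ioo 0 A.r) {z : Pr m k}
    (hz : z.1 ≠ 0) (hz' : z.2 ∈ Metric.ball (extChartAt (𝓡 k) q₀ q₀) A.r) :
    (collarForm τ F q₀ Ω t (z.2, z.1)).compContinuousLinearMap
        (ContinuousLinearEquiv.prodComm ℝ (Eu (m + 1)) (Eu k) : Pr m k →L[ℝ] Eu k × Eu (m + 1)) =
      (A.form Ω (sphereMap t z)).compContinuousLinearMap (fderiv ℝ (sphereMap t) z) := by
  have hd : ∀ {w : Pr m k}, w.1 ≠ 0 → w.2 ∈ Metric.ball (extChartAt (𝓡 k) q₀ q₀) A.r →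
      sphereMap t w ∈ A.dom := by
    intro w hw hw'
    refine ⟨?_, hw'⟩
    rw [mem_ball_zero_iff, sphereMap, norm_smul, norm_smul, norm_inv, norm_norm,
      inv_mul_cancel₀ (norm_ne_zero_iff.2 hw), mul_one, Real.norm_of_nonneg ht.1.le]
    exact ht.2
  set σ := ContinuousLinearEquiv.prodComm ℝ (Eu k) (Eu (m + 1)) with hσ
  have h1 : collarMap τ F q₀ t =ᶠ[𝓝[univ] (z.2, z.1)] A.map ∘ (sphereMap t ∘ σ) := by
    rw [nhdsWithin_univ]
    have ho : IsOpen {w : Eu k × Eu (m + 1) | w.2 ≠ 0 ∧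
        w.1 ∈ Metric.ball (extChartAt (𝓡 k) q₀ q₀) A.r} :=
      (isOpen_ne.preimage continuous_snd).inter (Metric.isOpen_ball.preimage continuous_fst)
    filter_upwards [ho.mem_nhds ⟨hz, hz'⟩] with w hw
    have h3 : A.map (sphereMap t (w.2, w.1)) = _ := hA _ (hd (w := (w.2, w.1)) hw.1 hw.2)
    refine Eq.trans ?_ h3.symm
    have h4 := F.vec_smul ((extChartAt (𝓡 k) q₀).symm w.1) t (‖w.2‖⁻¹ • w.2)
    exact congrArg (τ.exp ((extChartAt (𝓡 k) q₀).symm w.1)) h4.symm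
  obtain ⟨D, hD, -⟩ := hasFDerivAt_sphereMap (k := k) t hz
  have hD' : HasFDerivAt (sphereMap t ∘ σ) (D.comp (σ : Eu k × Eu (m + 1) →L[ℝ] Pr m k))
      (z.2, z.1) := HasFDerivAt.comp (g := sphereMap t) (f := σ) (z.2, z.1) hD σ.hasFDerivAt
  have h2 : collarForm τ F q₀ Ω t (z.2, z.1) =
      pullMap (I := 𝓡 (m + 1 + k)) (collarMap τ F q₀ t) univ Ω (z.2, z.1) := by
    rw [pullMap, mfderivWithin_univ]
    rfl
  have h3 := pullMap_comp (θ := sphereMap t ∘ σ) (s := univ) (t := univ) (z := (z.2, z.1)) Ω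
    ((A.contMDiffAt_map (hd hz hz')).mdifferentiableAt (by simp)).mdifferentiableWithinAt
    hD'.differentiableAt.differentiableWithinAt uniqueDiffWithinAt_univ (mapsTo_univ _ _)
  rw [h2, pullMap_congr Ω h1 (by rw [nhdsWithin_univ] at h1; exact h1.eq_of_nhds), h3,
    fderivWithin_univ, hD'.fderiv, hD.fderiv, A.form_eq_pullMap Ω (hd hz hz')]
  rfl

set_option maxHeartbeats 1000000 in
theorem exists_flatEq_of_isWeaklyExtendible
    (hιe : Manifold.IsSmoothEmbedding (𝓡 k) (𝓡 (m + 1 + k)) ∞ ι) (hcl : IsClosed (range ι))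
    (hΩ : IsCkOn 1 Ω (range ι)ᶜ) (hΩi : HasLocallyIntegrableCoeffs Ω) (hH : IsCkOn 0 H univ)
    (hd : ∀ x ∉ range ι, dForm Ω x = - H x) (hext : IsWeaklyExtendible ι Ω)
    (oM : ManifoldOrientation (𝓡 (m + 1 + k)) M) (q₀ : N) :
    ∃ (A : AdaptedChart k m ι q₀) (g : Eu k → ℝ),
      ContinuousOn g (Metric.ball (extChartAt (𝓡 k) q₀ q₀) A.r) ∧
      FlatEq (A.form Ω) (A.form H) (extChartAt (𝓡 k) q₀ q₀) A.r g := by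
  obtain ⟨g, τ, hext⟩ := hext
  obtain ⟨F, hF⟩ := exists_normalFrame g hιe q₀
  obtain ⟨A, hAF, hA⟩ := τ.exists_adaptedChart F hιe.isEmbedding hF
  obtain ⟨Φ, hΦc, hΦ⟩ := hext F q₀
  have hr : ∀ z ∈ A.dom, z.1 ≠ 0 → A.map z ∈ (range ι)ᶜ := fun z hz h h' =>
    h (A.of_mem_range z hz h')
  have hck : ∀ z ∈ A.dom, z.1 ≠ 0 → IsCkAt 1 Ω (A.map z) := fun z hz h =>
    hΩ.isCkAt hcl.isOpen_compl (hr z hz h)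
  refine ⟨A, ?_⟩
  refine exists_flatEq_of_extension (Φ := fun s => (Φ (s.1, (s.2.2, s.2.1))).compContinuousLinearMap
    (ContinuousLinearEquiv.prodComm ℝ (Eu (m + 1)) (Eu k) : Pr m k →L[ℝ] Eu k × Eu (m + 1)))
    A.r_pos (fun z hz h => A.contDiffAt_form (by norm_cast) hz (hck z hz h))
    (fun z hz h => ?_) (fun z hz => (A.contDiffAt_form (s := 0) (by simp) hz
      (hH.isCkAt isOpen_univ (mem_univ _))).continuousAt.continuousWithinAt) ?_ ?_ ?_
  · rw [← A.form_dForm hz (hck z hz h), A.form_eq_pullMap _ hz, A.form_eq_pullMap _ hz, pullMap,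
      pullMap, hd _ (hr z hz h)]
    rfl
  · intro w hw K hK hKd h0
    obtain ⟨η, hη, hη0, rfl⟩ := A.exists_testForm hw hK hKd h0
    have hc : IsClosed (A.map '' K) :=
      (hK.image_of_continuousOn (A.continuousOn_map.mono hKd)).isClosed
    have h1 := (A.integral_eq oM (hη.dForm.isIntegrableForm_wedgeForm
      (by omega : m + (k + 1) = m + 1 + k) hΩi) hKd fun x hx =>
        wedgeForm_eq_zero_right _ _ (dForm_eq_zero_of_eq_zero hc hη0 hx)).1
    simp only [A.form_wedgeForm] at h1
    refine h1.congr (ae_of_all _ fun z => ?_)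
    by_cases hz : z ∈ A.dom
    · simp only [A.form_dForm hz (hη.isCkAt (by norm_cast) _)]
    · simp only [A.form_of_notMem Ω hz, wedge_zero_left]
  · refine contDiffOn_zero.1 fun s hs => ContDiffWithinAt.compForm
      (contDiffOn_zero.2 ?_ s hs) contDiffWithinAt_const
    refine hΦc.comp (f := fun s : ℝ × Pr m k => (s.1, (s.2.2, s.2.1))) (by fun_prop) ?_
    rintro ⟨t, z⟩ ⟨h1, h2, h3, h4⟩
    exact ⟨A.ball_subset h4, (hAF _ h4).1, h3, h1, h2.trans_le (hAF _ h4).2⟩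
  · intro t ht z hz hz'
    rw [← collarForm_eq τ F A hA ht hz hz', hΦ t (z.2, z.1) (A.ball_subset hz') (hAF _ hz').1 hz
      ht.1 (ht.2.trans_le (hAF _ hz').2)]

end Tubes

section Discs

open IsManifold (maximalAtlas)

variable {k m : ℕ} {M : Type uM} [TopologicalSpace M] [ChartedSpace (Eu (m + 1 + k)) M]
  {N : Type uN} [TopologicalSpace N] [ChartedSpace (Eu k) N]
  {oM : ManifoldOrientation (𝓡 (m + 1 + k)) M} {oN : ManifoldOrientation (𝓡 k) N} {ι : N → M}

theorem pullMap_of_mem_nhds {n : ℕ} {H : Type*} [TopologicalSpace H]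
    {I : ModelWithCorners ℝ (Eu n) H} {M : Type*} [TopologicalSpace M] [ChartedSpace H M]
    {F : Type*} [NormedAddCommGroup F] [NormedSpace ℝ F] {p : ℕ} {ψ : F → M} {s : Set F}
    (α : DiffForm I M p) {z : F} (hs : s ∈ 𝓝 z) : pullMap ψ s α z = pullMap ψ univ α z := by
  rw [pullMap, pullMap, mfderivWithin_univ, mfderivWithin_of_mem_nhds hs]

namespace TransverseDisc

variable (B : TransverseDisc.{uM, uN, v} oM oN ι)

/-- The coordinates of the center. -/
def origin : Eu (m + 1) := extChartAt (𝓡∂ (m + 1)) B.center B.center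

/-- The parametrization by the chart at the center, which is put at the origin. -/
def param (u : Eu (m + 1)) : B.carrier := (extChartAt (𝓡∂ (m + 1)) B.center).symm (u + B.origin)

theorem param_zero : B.param 0 = B.center := by
  rw [param, zero_add]
  exact extChartAt_to_inv B.center

theorem range_mem_nhds : range (𝓡∂ (m + 1)) ∈ 𝓝 B.origin := mem_interior_iff_mem_nhds.1 B.interior

theorem target_mem_nhds : (extChartAt (𝓡∂ (m + 1)) B.center).target ∈ 𝓝 B.origin := by
  have h : _ ∈ 𝓝[range (𝓡∂ (m + 1))] B.origin := extChartAt_target_mem_nhdsWithin B.center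
  rwa [nhdsWithin_eq_nhds.2 B.range_mem_nhds] at h

theorem contMDiffAt_param {u : Eu (m + 1)}
    (hu : (extChartAt (𝓡∂ (m + 1)) B.center).target ∈ 𝓝 (u + B.origin)) :
    ContMDiffAt 𝓘(ℝ, Eu (m + 1)) (𝓡∂ (m + 1)) ∞ B.param u := by
  have h1 : ContMDiffAt 𝓘(ℝ, Eu (m + 1)) (𝓡∂ (m + 1)) ∞ (extChartAt (𝓡∂ (m + 1)) B.center).symm
      (u + B.origin) := (contMDiffOn_extChartAt_symm B.center).contMDiffAt hu
  exact h1.comp u (contDiffAt_id.add contDiffAt_const).contMDiffAt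

variable [IsManifold (𝓡 (m + 1 + k)) ∞ M] [IsManifold (𝓡 k) ∞ N]

theorem exists_adaptedChart (hι : Manifold.IsSmoothEmbedding (𝓡 k) (𝓡 (m + 1 + k)) ∞ ι) :
    ∃ A : AdaptedChart k m ι B.point, ∀ u ∈ Metric.ball (0 : Eu (m + 1)) A.r,
      (extChartAt (𝓡∂ (m + 1)) B.center).target ∈ 𝓝 (u + B.origin) ∧
      A.map (u, extChartAt (𝓡 k) B.point B.point) = B.map (B.param u) := by
  set p := ι B.point with hp
  set E := extChartAt (𝓡∂ (m + 1)) B.center with hE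
  set W : Eu (m + 1) → Eu (m + 1 + k) := fun v =>
    extChartAt (𝓡 (m + 1 + k)) p (B.map (E.symm v)) with hW
  set b : Eu (m + 1) → Eu (m + 1 + k) := fun u =>
    W (u + B.origin) - extChartAt (𝓡 (m + 1 + k)) p p with hb
  have hev : ∀ᶠ u in 𝓝 (0 : Eu (m + 1)), E.target ∈ 𝓝 (u + B.origin) ∧
      B.map (B.param u) ∈ (extChartAt (𝓡 (m + 1 + k)) p).source := by
    have h1 : Tendsto (fun u => u + B.origin) (𝓝 0) (𝓝 B.origin) := by
      have : Tendsto (fun u => u + B.origin) (𝓝 0) (𝓝 (0 + B.origin)) :=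
        (continuous_id.add (continuous_const (y := B.origin))).tendsto (0 : Eu (m + 1))
      rwa [zero_add] at this
    refine (h1.eventually (eventually_mem_nhds_iff.2 B.target_mem_nhds)).and ?_
    have h2 : ContinuousAt (fun u => B.map (B.param u)) 0 :=
      B.embedding.isEmbedding.continuous.continuousAt.comp
        (B.contMDiffAt_param (by rw [zero_add]; exact B.target_mem_nhds)).continuousAt
    refine h2.preimage_mem_nhds ?_
    rw [B.param_zero, B.map_center]
    exact extChartAt_source_mem_nhds p
  obtain ⟨ε, hε, hεb⟩ := Metric.eventually_nhds_iff_ball.1 hev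
  have hbs : ContDiffOn ℝ ∞ b (Metric.ball 0 ε) := by
    intro u hu
    have h1 := (B.embedding.contMDiff _).comp u (B.contMDiffAt_param (hεb u hu).1)
    have h2 := (contMDiffAt_extChartAt' (n := ∞) (by simpa using (hεb u hu).2)).comp u h1
    exact (h2.contDiffAt.sub contDiffAt_const).contDiffWithinAt
  have hfb : fderiv ℝ b 0 = (mfderiv (𝓡∂ (m + 1)) (𝓡 (m + 1 + k)) B.map B.center :
      Eu (m + 1) →L[ℝ] Eu (m + 1 + k)) := by
    have h1 : W = writtenInExtChartAt (𝓡∂ (m + 1)) (𝓡 (m + 1 + k)) B.center B.map := by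
      funext v
      simp only [hW, hp, ← B.map_center]
      rfl
    rw [((B.embedding.contMDiff B.center).mdifferentiableAt (by simp)).mfderiv, ← h1,
      (fderivWithin_of_mem_nhds B.range_mem_nhds : fderivWithin ℝ W (range (𝓡∂ (m + 1)))
        (extChartAt (𝓡∂ (m + 1)) B.center B.center) = fderiv ℝ W B.origin), hb, fderiv_sub_const,
      fderiv_comp_add_right (f := W), zero_add]
    rfl
  obtain ⟨A, hAr, hA⟩ := exists_adaptedChart_of_slice hι B.point (Metric.ball_mem_nhds 0 hε) hbs
    (by
      rw [hb]
      change W (0 + B.origin) - _ = 0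
      rw [sub_eq_zero]
      change extChartAt (𝓡 (m + 1 + k)) p (B.map (B.param 0)) = _
      rw [B.param_zero, B.map_center])
    (by rw [hfb]; exact B.transverse) hε
  refine ⟨A, fun u hu => ?_⟩
  obtain ⟨h1, h2⟩ := hεb u (Metric.ball_subset_ball hAr hu)
  refine ⟨h1, ?_⟩
  rw [hA (u, _) ⟨hu, Metric.mem_ball_self A.r_pos⟩]
  simp only [extChartAt_to_inv, hb, sub_add_cancel, ← hp]
  exact (extChartAt (𝓡 (m + 1 + k)) p).left_inv h2

variable {B} {A : AdaptedChart k m ι B.point}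

theorem chartForm_pullback_map
    (hA : ∀ u ∈ Metric.ball (0 : Eu (m + 1)) A.r,
      (extChartAt (𝓡∂ (m + 1)) B.center).target ∈ 𝓝 (u + B.origin) ∧
      A.map (u, extChartAt (𝓡 k) B.point B.point) = B.map (B.param u)) {p : ℕ}
    (α : DiffForm (𝓡 (m + 1 + k)) M p) {u : Eu (m + 1)} (hu : u ∈ Metric.ball 0 A.r) :
    chartForm (chartAt (EuclideanHalfSpace (m + 1)) B.center)
        (pullback B.map α : DiffForm (𝓡∂ (m + 1)) B.carrier p) (u + B.origin) =
      (A.form α (u, extChartAt (𝓡 k) B.point B.point)).compContinuousLinearMap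
        (ContinuousLinearMap.inl ℝ (Eu (m + 1)) (Eu k)) := by
  have he := IsManifold.chart_mem_maximalAtlas (I := 𝓡∂ (m + 1)) (n := ∞) B.center
  set y₀ := extChartAt (𝓡 k) B.point B.point with hy₀
  have ht := (hA u hu).1
  have hz : (u, y₀) ∈ A.dom := ⟨hu, Metric.mem_ball_self A.r_pos⟩
  set θ : Eu (m + 1) → Pr m k := fun v => (v - B.origin, y₀) with hθ
  have hθ' : HasFDerivAt θ (ContinuousLinearMap.inl ℝ (Eu (m + 1)) (Eu k)) (u + B.origin) :=
    ((hasFDerivAt_id _).sub_const _).prodMk (hasFDerivAt_const _ _)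
  have hθu : θ (u + B.origin) = (u, y₀) := by rw [hθ]; simp only [add_sub_cancel_right]
  have h1 : pullMap (I := 𝓡 (m + 1 + k)) (B.map ∘ (extChartAt (𝓡∂ (m + 1)) B.center).symm) univ α
      (u + B.origin) = pullMap (A.map ∘ θ) univ α (u + B.origin) := by
    have h2 : B.map ∘ (extChartAt (𝓡∂ (m + 1)) B.center).symm =ᶠ[𝓝 (u + B.origin)] A.map ∘ θ := by
      have h3 : (fun v => v - B.origin) ⁻¹' Metric.ball 0 A.r ∈ 𝓝 (u + B.origin) :=
        (continuous_id.sub continuous_const).continuousAt.preimage_mem_nhds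
          (Metric.isOpen_ball.mem_nhds (by simpa using hu))
      filter_upwards [h3] with v hv
      have h4 := (hA _ hv).2
      rw [param, sub_add_cancel] at h4
      exact h4.symm
    exact pullMap_congr α (by rwa [nhdsWithin_univ]) h2.eq_of_nhds
  have h2 := pullMap_comp (θ := θ) (s := univ) (t := univ) (z := u + B.origin) α
    (by rw [hθu]; exact ((A.contMDiffAt_map hz).mdifferentiableAt
      (by simp)).mdifferentiableWithinAt)
    hθ'.differentiableAt.differentiableWithinAt uniqueDiffWithinAt_univ (mapsTo_univ _ _)
  rw [fderivWithin_univ, hθ'.fderiv, hθu] at h2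
  rw [chartForm_pullback B.embedding.contMDiff α he (mem_of_mem_nhds ht),
    pullMap_of_mem_nhds α (mem_of_superset ht (extend_target_subset_range _))]
  refine h1.trans (h2.trans ?_)
  rw [A.form_eq_pullMap α hz]

/-- The derivative of the parametrization in the direction of the disc. -/
theorem mfderiv_map_inl
    (hA : ∀ u ∈ Metric.ball (0 : Eu (m + 1)) A.r,
      (extChartAt (𝓡∂ (m + 1)) B.center).target ∈ 𝓝 (u + B.origin) ∧
      A.map (u, extChartAt (𝓡 k) B.point B.point) = B.map (B.param u)) (a : Eu (m + 1)) :
    (mfderiv 𝓘(ℝ, Pr m k) (𝓡 (m + 1 + k)) A.map (0, extChartAt (𝓡 k) B.point B.point) (a, 0) :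
        Eu (m + 1 + k)) =
      mfderiv (𝓡∂ (m + 1)) (𝓡 (m + 1 + k)) B.map B.center
        (mfderiv 𝓘(ℝ, Eu (m + 1)) (𝓡∂ (m + 1)) B.param 0 a : Eu (m + 1)) := by
  set y₀ := extChartAt (𝓡 k) B.point B.point with hy₀
  have h1 : HasMFDerivAt 𝓘(ℝ, Eu (m + 1)) (𝓡 (m + 1 + k))
      (A.map ∘ fun u : Eu (m + 1) => ((u, y₀) : Pr m k)) 0 _ :=
    HasMFDerivAt.comp (I' := 𝓘(ℝ, Pr m k)) (0 : Eu (m + 1))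
      ((A.contMDiffAt_map A.center_mem_dom).mdifferentiableAt (by simp)).hasMFDerivAt
      ((hasFDerivAt_id (𝕜 := ℝ) (0 : Eu (m + 1))).prodMk
        (hasFDerivAt_const y₀ (0 : Eu (m + 1)))).hasMFDerivAt
  have h2 : HasMFDerivAt 𝓘(ℝ, Eu (m + 1)) (𝓡 (m + 1 + k)) (B.map ∘ B.param) 0 _ :=
    HasMFDerivAt.comp (0 : Eu (m + 1))
      ((B.embedding.contMDiff (B.param 0)).mdifferentiableAt (by simp)).hasMFDerivAt
      ((B.contMDiffAt_param (by rw [zero_add]; exact B.target_mem_nhds)).mdifferentiableAt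
        (by simp)).hasMFDerivAt
  have h3 := hasMFDerivAt_unique h1 (h2.congr_of_eventuallyEq (by
    filter_upwards [Metric.ball_mem_nhds 0 A.r_pos] with u hu using (hA u hu).2))
  have h4 : (mfderiv (𝓡∂ (m + 1)) (𝓡 (m + 1 + k)) B.map (B.param 0) :
      Eu (m + 1) →L[ℝ] Eu (m + 1 + k)) = mfderiv (𝓡∂ (m + 1)) (𝓡 (m + 1 + k)) B.map B.center :=
    mfderiv_congr_point B.param_zero
  have h5 := DFunLike.congr_fun h3 a
  exact h5.trans (DFunLike.congr_fun h4 _)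

end TransverseDisc

end Discs

section DiscIntegrals

open IsManifold (maximalAtlas)

variable {k m : ℕ} {M : Type uM} [TopologicalSpace M] [ChartedSpace (Eu (m + 1 + k)) M]
  {N : Type uN} [TopologicalSpace N] [ChartedSpace (Eu k) N]
  {oM : ManifoldOrientation (𝓡 (m + 1 + k)) M} {oN : ManifoldOrientation (𝓡 k) N} {ι : N → M}

namespace TransverseDisc

variable {B : TransverseDisc.{uM, uN, v} oM oN ι}

theorem isCompact_image_param {r s : ℝ} (hs : s < r)
    (hB : ∀ u ∈ Metric.ball (0 : Eu (m + 1)) r,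
      (extChartAt (𝓡∂ (m + 1)) B.center).target ∈ 𝓝 (u + B.origin)) :
    IsCompact (B.param '' Metric.closedBall 0 s) :=
  (isCompact_closedBall 0 s).image_of_continuousOn fun u hu =>
    (B.contMDiffAt_param (hB u (Metric.closedBall_subset_ball hs
      hu))).continuousAt.continuousWithinAt

/-- A cut-off function around the center of the disc. -/
theorem exists_cutoff {r ε : ℝ} (hε : 0 < ε) (hr : 2 * ε < r)
    (hB : ∀ u ∈ Metric.ball (0 : Eu (m + 1)) r,
      (extChartAt (𝓡∂ (m + 1)) B.center).target ∈ 𝓝 (u + B.origin)) :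
    ∃ ρ : B.carrier → ℝ, ContMDiff (𝓡∂ (m + 1)) 𝓘(ℝ) ∞ ρ ∧
      (∀ u ∈ Metric.ball (0 : Eu (m + 1)) r, ρ (B.param u) = bump (ε⁻¹ • u)) ∧
      (∀ x ∉ B.param '' Metric.closedBall 0 (2 * ε), ρ x = 0) ∧ ∀ᶠ x in 𝓝 B.center, ρ x = 1 := by
  classical
  set E := extChartAt (𝓡∂ (m + 1)) B.center with hE
  have hEs : ∀ x ∈ E.source, B.param (E x - B.origin) = x := fun x hx => by
    rw [param, sub_add_cancel]
    exact E.left_inv hx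
  have hps : ∀ u ∈ Metric.ball (0 : Eu (m + 1)) r, B.param u ∈ E.source ∧
      E (B.param u) - B.origin = u := fun u hu => by
    have := mem_of_mem_nhds (hB u hu)
    exact ⟨E.map_target this, by rw [param, ← hE, E.right_inv this, add_sub_cancel_right]⟩
  set ρ : B.carrier → ℝ := fun x => if x ∈ E.source then bump (ε⁻¹ • (E x - B.origin)) else 0 with hρ
  have hρs : ∀ x ∈ E.source, ρ x = bump (ε⁻¹ • (E x - B.origin)) := fun x hx => if_pos hx
  have h0 : ∀ x ∉ B.param '' Metric.closedBall 0 (2 * ε), ρ x = 0 := by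
    intro x hx
    by_cases hxs : x ∈ E.source
    · rw [hρs x hxs]
      exact bump_inv_smul_eq_zero hε fun h => hx ⟨_, h, hEs x hxs⟩
    · exact if_neg hxs
  refine ⟨ρ, fun x => ?_, fun u hu => ?_, h0, ?_⟩
  · by_cases hx : x ∈ B.param '' Metric.closedBall 0 (2 * ε)
    · obtain ⟨u, hu, rfl⟩ := hx
      have hxs := (hps u (Metric.closedBall_subset_ball hr hu)).1
      have h1 : ContMDiffAt (𝓡∂ (m + 1)) 𝓘(ℝ, Eu (m + 1)) ∞ E (B.param u) :=
        contMDiffAt_extChartAt' (by simpa [hE] using hxs)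
      have h2 : ContDiff ℝ ∞ fun v : Eu (m + 1) => (bump (ε⁻¹ • (v - B.origin)) : ℝ) :=
        contDiff_bump.comp ((contDiff_id.sub contDiff_const).const_smul _)
      refine (h2.contDiffAt.contMDiffAt.comp _ h1).congr_of_eventuallyEq ?_
      filter_upwards [(isOpen_extChartAt_source B.center).mem_nhds hxs] with y hy using hρs y hy
    · refine (contMDiffAt_const (c := (0 : ℝ))).congr_of_eventuallyEq ?_
      filter_upwards [(isCompact_image_param hr hB).isClosed.isOpen_compl.mem_nhds hx] with y hy
        using h0 y hy
  · rw [hρs _ (hps u hu).1, (hps u hu).2]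
  · have h1 : Tendsto (fun x => E x - B.origin) (𝓝 B.center) (𝓝 (B.origin - B.origin)) :=
      (continuousAt_extChartAt B.center).sub continuousAt_const
    rw [sub_self] at h1
    filter_upwards [h1.eventually (eventually_bump_smul_eq_one ε⁻¹),
      extChartAt_source_mem_nhds (I := 𝓡∂ (m + 1)) B.center] with x hx hxs
    rw [hρs x hxs, hx]

theorem isInteriorPoint_param {u : Eu (m + 1)}
    (hu : (extChartAt (𝓡∂ (m + 1)) B.center).target ∈ 𝓝 (u + B.origin)) :
    (𝓡∂ (m + 1)).IsInteriorPoint (B.param u) := by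
  have h1 := mem_of_mem_nhds hu
  refine ((𝓡∂ (m + 1)).isInteriorPoint_iff_of_mem_atlas (n := ∞) (by simp)
    (chart_mem_atlas _ B.center) ?_).2 ?_
  · simpa [param] using (extChartAt (𝓡∂ (m + 1)) B.center).map_target h1
  · change extChartAt (𝓡∂ (m + 1)) B.center ((extChartAt (𝓡∂ (m + 1)) B.center).symm _) ∈ _
    rw [(extChartAt (𝓡∂ (m + 1)) B.center).right_inv h1]
    exact mem_interior_iff_mem_nhds.2 hu

theorem measurable_toBoundary : Measurable (toBoundary : Eu m → Eu (m + 1)) := by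
  rw [funext toBoundary_eq]
  exact ((consCLM m).continuous.comp (by fun_prop)).measurable

theorem not_isInteriorPoint_toBoundary {C : Type*} [TopologicalSpace C]
    [ChartedSpace (EuclideanHalfSpace (m + 1)) C] [IsManifold (𝓡∂ (m + 1)) ∞ C] {i : C} {y : Eu m}
    (hy : toBoundary y ∈ (extChartAt (𝓡∂ (m + 1)) i).target) :
    ¬ (𝓡∂ (m + 1)).IsInteriorPoint ((extChartAt (𝓡∂ (m + 1)) i).symm (toBoundary y)) := by
  intro h
  have h1 := ((𝓡∂ (m + 1)).isInteriorPoint_iff_of_mem_atlas (n := ∞) (by simp)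
    (chart_mem_atlas _ i) (by simpa using (extChartAt (𝓡∂ (m + 1)) i).map_target hy)).1 h
  change extChartAt (𝓡∂ (m + 1)) i ((extChartAt (𝓡∂ (m + 1)) i).symm _) ∈ _ at h1
  rw [(extChartAt (𝓡∂ (m + 1)) i).right_inv hy] at h1
  have h2 := interior_mono (extend_target_subset_range _) h1
  rw [interior_range_modelWithCornersEuclideanHalfSpace] at h2
  exact lt_irrefl (0 : ℝ) h2

/-- The boundary integral depends only on the values at the boundary points. -/
theorem boundaryIntegral_congr {C : Type*} [TopologicalSpace C]
    [ChartedSpace (EuclideanHalfSpace (m + 1)) C] [IsManifold (𝓡∂ (m + 1)) ∞ C] [T2Space C]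
    [SigmaCompactSpace C] (o : ManifoldOrientation (𝓡∂ (m + 1)) C)
    {α β : DiffForm (𝓡∂ (m + 1)) C m} (h : ∀ x, ¬ (𝓡∂ (m + 1)).IsInteriorPoint x → α x = β x) :
    boundaryIntegral o α = boundaryIntegral o β := by
  refine finsum_congr fun i => setIntegral_congr_fun
    ((measurableSet_extend_target (I := 𝓡∂ (m + 1)) (chartAt _ i)).preimage
      measurable_toBoundary) fun y hy => ?_
  have := chartForm_congr (e := chartAt (EuclideanHalfSpace (m + 1)) i)
    (h _ (not_isInteriorPoint_toBoundary hy))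
  simp only [localForm_eq_chartForm, this]

variable [IsManifold (𝓡 (m + 1 + k)) ∞ M] [IsManifold (𝓡 k) ∞ N]
variable {A : AdaptedChart k m ι B.point}

theorem mfderiv_param_zero (a : Eu (m + 1)) :
    (mfderiv 𝓘(ℝ, Eu (m + 1)) (𝓡∂ (m + 1)) B.param 0 a : Eu (m + 1)) =
      mfderivWithin 𝓘(ℝ, Eu (m + 1)) (𝓡∂ (m + 1)) (extChartAt (𝓡∂ (m + 1)) B.center).symm
        (range (𝓡∂ (m + 1))) B.origin a := by
  set E := extChartAt (𝓡∂ (m + 1)) B.center with hE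
  have h1 : HasMFDerivAt 𝓘(ℝ, Eu (m + 1)) (𝓡∂ (m + 1)) E.symm (0 + B.origin) _ :=
    (((contMDiffOn_extChartAt_symm B.center).contMDiffAt (n := ∞) (by
      rw [zero_add]; exact B.target_mem_nhds)).mdifferentiableAt (by simp)).hasMFDerivAt
  have h2 := HasMFDerivAt.comp (0 : Eu (m + 1)) h1 (f := fun u => u + B.origin)
    ((hasFDerivAt_id (𝕜 := ℝ) (0 : Eu (m + 1))).add_const B.origin).hasMFDerivAt
  have h3 : mfderiv 𝓘(ℝ, Eu (m + 1)) (𝓡∂ (m + 1)) B.param 0 = _ := h2.mfderiv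
  have h4 : (mfderiv 𝓘(ℝ, Eu (m + 1)) (𝓡∂ (m + 1)) E.symm (0 + B.origin) :
      Eu (m + 1) →L[ℝ] Eu (m + 1)) = mfderiv 𝓘(ℝ, Eu (m + 1)) (𝓡∂ (m + 1)) E.symm B.origin :=
    mfderiv_congr_point (zero_add _)
  rw [mfderivWithin_of_mem_nhds B.range_mem_nhds]
  exact (DFunLike.congr_fun h3 a).trans (DFunLike.congr_fun h4 a)

theorem chartSgn_mul (hι : ContMDiff (𝓡 k) (𝓡 (m + 1 + k)) ∞ ι)
    (hA : ∀ u ∈ Metric.ball (0 : Eu (m + 1)) A.r,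
      (extChartAt (𝓡∂ (m + 1)) B.center).target ∈ 𝓝 (u + B.origin) ∧
      A.map (u, extChartAt (𝓡 k) B.point B.point) = B.map (B.param u)) :
    A.sgn oM = chartSgn B.orientation (chartAt (EuclideanHalfSpace (m + 1)) B.center) B.origin *
      A.sgnN oN := by
  set y₀ := extChartAt (𝓡 k) B.point B.point with hy₀
  set v : Fin (m + 1) → Eu (m + 1) := fun i => mfderivWithin 𝓘(ℝ, Eu (m + 1)) (𝓡∂ (m + 1))
    (extChartAt (𝓡∂ (m + 1)) B.center).symm (range (𝓡∂ (m + 1))) B.origin (stdFrame (m + 1) i)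
    with hv
  set w : Fin k → Eu k := fun j => mfderivWithin 𝓘(ℝ, Eu k) (𝓡 k)
    (extChartAt (𝓡 k) B.point).symm (range (𝓡 k)) y₀ (stdFrame k j) with hw
  have h1 : chartSgn B.orientation (chartAt (EuclideanHalfSpace (m + 1)) B.center) B.origin =
      orientSign (V := Eu (m + 1)) (B.orientation.orient B.center) v :=
    congrArg (fun O : Orientation ℝ (Eu (m + 1)) (Fin (m + 1)) => orientSign O v)
      (orient_congr B.orientation (extChartAt_to_inv B.center))
  have h2 : A.sgnN oN = orientSign (V := Eu k) (oN.orient B.point) w :=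
    congrArg (fun O : Orientation ℝ (Eu k) (Fin k) => orientSign O w)
      (orient_congr oN (extChartAt_to_inv B.point))
  have h3 : ∀ z : Pr m k, (mfderiv 𝓘(ℝ, Pr m k) (𝓡 (m + 1 + k)) A.map (0, y₀) z :
      Eu (m + 1 + k)) = mfderivWithin 𝓘(ℝ, Eu (m + 1 + k)) (𝓡 (m + 1 + k))
        (A.chart.extend (𝓡 (m + 1 + k))).symm (range (𝓡 (m + 1 + k))) (prEquiv m k (0, y₀))
          (prEquiv m k z) := by
    have h4 := mdifferentiableWithinAt_extend_symm A.mem_maximalAtlas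
      (A.mem_target _ A.center_mem_dom)
    rw [ModelWithCorners.range_eq_univ] at h4 ⊢
    rw [mfderivWithin_univ]
    have h5 := (HasMFDerivAt.comp ((0 : Eu (m + 1)), y₀)
      (mdifferentiableWithinAt_univ.1 h4).hasMFDerivAt (f := prEquiv m k)
      (prEquiv m k).hasFDerivAt.hasMFDerivAt).mfderiv
    exact fun z => DFunLike.congr_fun h5 z
  have h4 : ∀ b : Eu k, (mfderiv 𝓘(ℝ, Pr m k) (𝓡 (m + 1 + k)) A.map (0, y₀) (0, b) :
      Eu (m + 1 + k)) = mfderiv (𝓡 k) (𝓡 (m + 1 + k)) ι B.point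
        (mfderivWithin 𝓘(ℝ, Eu k) (𝓡 k) (extChartAt (𝓡 k) B.point).symm (range (𝓡 k)) y₀ b :
          Eu k) := by
    intro b
    have h5 : HasMFDerivAt 𝓘(ℝ, Eu k) (𝓡 (m + 1 + k))
        (A.map ∘ fun y : Eu k => ((0, y) : Pr m k)) y₀ _ :=
      HasMFDerivAt.comp (I' := 𝓘(ℝ, Pr m k)) y₀
        ((A.contMDiffAt_map A.center_mem_dom).mdifferentiableAt (by simp)).hasMFDerivAt
        ((hasFDerivAt_const (𝕜 := ℝ) (0 : Eu (m + 1)) y₀).prodMk (hasFDerivAt_id y₀)).hasMFDerivAt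
    have h6 : HasMFDerivAt 𝓘(ℝ, Eu k) (𝓡 (m + 1 + k)) (ι ∘ (extChartAt (𝓡 k) B.point).symm) y₀ _ :=
      HasMFDerivAt.comp y₀ ((hι _).mdifferentiableAt (by simp)).hasMFDerivAt
        (((contMDiffOn_extChartAt_symm B.point).contMDiffAt (n := ∞)
          (extChartAt_target_mem_nhds B.point)).mdifferentiableAt (by simp)).hasMFDerivAt
    have h7 := hasMFDerivAt_unique h5 (h6.congr_of_eventuallyEq (by
      filter_upwards [Metric.ball_mem_nhds y₀ A.r_pos] with y hy using A.symm_zero y hy))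
    have h8 : (mfderiv (𝓡 k) (𝓡 (m + 1 + k)) ι ((extChartAt (𝓡 k) B.point).symm y₀) :
        Eu k →L[ℝ] Eu (m + 1 + k)) = mfderiv (𝓡 k) (𝓡 (m + 1 + k)) ι B.point :=
      mfderiv_congr_point (extChartAt_to_inv B.point)
    rw [ModelWithCorners.range_eq_univ, mfderivWithin_univ]
    exact (DFunLike.congr_fun h7 b).trans (DFunLike.congr_fun h8 _)
  rw [h1, h2]
  refine Eq.trans ?_ (B.oriented v w)
  have h5 : A.map (0, y₀) = ι B.point := A.map_zero_center
  refine congrArg₂ (fun (O : Orientation ℝ (Eu (m + 1 + k)) (Fin (m + 1 + k))) F => orientSign O F)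
    (orient_congr oM h5) (funext fun i => ?_)
  have h6 : stdFrame (m + 1 + k) i = prEquiv m k (pFrame m k i) := (prEquiv_pFrame i).symm
  refine (congrArg _ h6).trans ((h3 (pFrame m k i)).symm.trans ?_)
  refine Fin.addCases (fun a => ?_) (fun b => ?_) i
  · rw [pFrame, Fin.append_left]
    refine Eq.trans ?_ (Fin.append_left (α := Eu (m + 1 + k)) _ _ a).symm
    refine (mfderiv_map_inl hA (stdFrame (m + 1) a)).trans ?_
    exact congrArg _ (mfderiv_param_zero (stdFrame (m + 1) a))
  · rw [pFrame, Fin.append_right]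
    refine Eq.trans ?_ (Fin.append_right (α := Eu (m + 1 + k)) _ _ b).symm
    exact h4 (stdFrame k b)

end TransverseDisc

end DiscIntegrals

section DiscPairing

open IsManifold (maximalAtlas)

variable {k m : ℕ} {M : Type uM} [TopologicalSpace M] [ChartedSpace (Eu (m + 1 + k)) M]
  [IsManifold (𝓡 (m + 1 + k)) ∞ M]
  {N : Type uN} [TopologicalSpace N] [ChartedSpace (Eu k) N] [IsManifold (𝓡 k) ∞ N]
  {oM : ManifoldOrientation (𝓡 (m + 1 + k)) M} {oN : ManifoldOrientation (𝓡 k) N} {ι : N → M}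
  {Ω : DiffForm (𝓡 (m + 1 + k)) M m} {H : DiffForm (𝓡 (m + 1 + k)) M (m + 1)}

namespace TransverseDisc

variable {B : TransverseDisc.{uM, uN, v} oM oN ι}

theorem isCkAt_pullback_map (hcl : IsClosed (range ι)) (hΩ : IsCkOn 1 Ω (range ι)ᶜ) {x : B.carrier}
    (hx : x ≠ B.center) :
    IsCkAt 1 (pullback B.map Ω : DiffForm (𝓡∂ (m + 1)) B.carrier m) x :=
  IsCkAt.pullback (by norm_cast) B.embedding.contMDiff
    (hΩ.isCkAt hcl.isOpen_compl fun h => hx (B.eq_center x h))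

theorem isCkAt_cutoff (hcl : IsClosed (range ι)) (hΩ : IsCkOn 1 Ω (range ι)ᶜ) {ρ : B.carrier → ℝ}
    (hρ : ContMDiff (𝓡∂ (m + 1)) 𝓘(ℝ) ∞ ρ) (h1 : ∀ᶠ x in 𝓝 B.center, ρ x = 1) (x : B.carrier) :
    IsCkAt 1 (fun x => (1 - ρ x) • (pullback B.map Ω : DiffForm (𝓡∂ (m + 1)) B.carrier m) x :
      DiffForm (𝓡∂ (m + 1)) B.carrier m) x := by
  by_cases hx : x = B.center
  · rw [hx]
    refine IsCkAt.zero.congr ?_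
    filter_upwards [h1] with y hy
    rw [hy, sub_self, zero_smul]
    rfl
  · exact (isCkAt_pullback_map hcl hΩ hx).fun_smul (by norm_cast) (contMDiffAt_const.sub (hρ x))

theorem dForm_pullback_map (hcl : IsClosed (range ι)) (hΩ : IsCkOn 1 Ω (range ι)ᶜ)
    (hd : ∀ x ∉ range ι, dForm Ω x = - H x) {x : B.carrier} (hx : x ≠ B.center) :
    dForm (pullback B.map Ω : DiffForm (𝓡∂ (m + 1)) B.carrier m) x =
      - (pullback B.map H : DiffForm (𝓡∂ (m + 1)) B.carrier (m + 1)) x := by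
  have hxr : B.map x ∉ range ι := fun h => hx (B.eq_center x h)
  rw [dForm_pullback B.embedding.contMDiff (hΩ.isCkAt hcl.isOpen_compl hxr), pullback, hd _ hxr]
  rfl

/-- The integrand of the pairing, with the boundary term moved to the interior. -/
def residue (B : TransverseDisc.{uM, uN, v} oM oN ι) (Ω : DiffForm (𝓡 (m + 1 + k)) M m)
    (H : DiffForm (𝓡 (m + 1 + k)) M (m + 1)) (ρ : B.carrier → ℝ) :
    DiffForm (𝓡∂ (m + 1)) B.carrier (m + 1) :=
  (pullback B.map H : DiffForm (𝓡∂ (m + 1)) B.carrier (m + 1)) +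
    dForm (fun x => (1 - ρ x) • (pullback B.map Ω : DiffForm (𝓡∂ (m + 1)) B.carrier m) x :
      DiffForm (𝓡∂ (m + 1)) B.carrier m)

theorem isIntegrableForm_residue (hcl : IsClosed (range ι)) (hΩ : IsCkOn 1 Ω (range ι)ᶜ)
    (hH : ∀ x, IsCkAt 0 H x) {ρ : B.carrier → ℝ}
    (hρ : ContMDiff (𝓡∂ (m + 1)) 𝓘(ℝ) ∞ ρ) (h1 : ∀ᶠ x in 𝓝 B.center, ρ x = 1)
    (hρi : ∀ x, ¬ (𝓡∂ (m + 1)).IsInteriorPoint x → ρ x = 0) :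
    IsIntegrableForm (B.residue Ω H ρ) ∧
      B.pairIntegral H Ω = integral B.orientation (B.residue Ω H ρ) := by
  have hH' : IsIntegrableForm (pullback B.map H : DiffForm (𝓡∂ (m + 1)) B.carrier (m + 1)) :=
    isIntegrableForm_of_continuous (fun x => IsCkAt.pullback (r := 0) (by simp)
      B.embedding.contMDiff (hH _)) isCompact_univ fun x hx => (hx (mem_univ x)).elim
  have hβ := isCkAt_cutoff hcl hΩ hρ h1
  have hβ' := isIntegrableForm_dForm hβ isCompact_univ fun x hx => (hx (mem_univ x)).elim
  refine ⟨hH'.add hβ', ?_⟩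
  rw [pairIntegral, residue, integral_add _ hH' hβ', integral_dForm_eq_boundaryIntegral _ hβ]
  congr 1
  refine boundaryIntegral_congr _ fun x hx => ?_
  simp only [hρi x hx, sub_zero, one_smul]

theorem residue_eq_zero (hcl : IsClosed (range ι)) (hΩ : IsCkOn 1 Ω (range ι)ᶜ)
    (hd : ∀ x ∉ range ι, dForm Ω x = - H x) {ρ : B.carrier → ℝ} {x : B.carrier}
    (hx : x ≠ B.center) (h0 : ∀ᶠ y in 𝓝 x, ρ y = 0) : B.residue Ω H ρ x = 0 := by
  have h1 : dForm (fun x => (1 - ρ x) • (pullback B.map Ω : DiffForm (𝓡∂ (m + 1)) B.carrier m) x :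
      DiffForm (𝓡∂ (m + 1)) B.carrier m) x =
        dForm (pullback B.map Ω : DiffForm (𝓡∂ (m + 1)) B.carrier m) x := by
    refine dForm_congr ?_
    filter_upwards [h0] with y hy
    simp only [hy, sub_zero, one_smul]
  rw [residue, Pi.add_apply, h1, dForm_pullback_map hcl hΩ hd hx]
  exact add_neg_cancel _

variable {A : AdaptedChart k m ι B.point}

theorem chartForm_residue (hcl : IsClosed (range ι)) (hΩ : IsCkOn 1 Ω (range ι)ᶜ)
    (hd : ∀ x ∉ range ι, dForm Ω x = - H x)
    (hA : ∀ u ∈ Metric.ball (0 : Eu (m + 1)) A.r,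
      (extChartAt (𝓡∂ (m + 1)) B.center).target ∈ 𝓝 (u + B.origin) ∧
      A.map (u, extChartAt (𝓡 k) B.point B.point) = B.map (B.param u))
    {ρ : B.carrier → ℝ} (hρ : ContMDiff (𝓡∂ (m + 1)) 𝓘(ℝ) ∞ ρ)
    (h1 : ∀ᶠ x in 𝓝 B.center, ρ x = 1) {χ : Eu (m + 1) → ℝ} (hχ : ContDiff ℝ ∞ χ)
    (hρχ : ∀ u ∈ Metric.ball (0 : Eu (m + 1)) A.r, ρ (B.param u) = χ u) {u : Eu (m + 1)}
    (hu : u ∈ Metric.ball 0 A.r) (hu0 : u ≠ 0) :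
    chartForm (chartAt (EuclideanHalfSpace (m + 1)) B.center) (B.residue Ω H ρ) (u + B.origin)
        (stdFrame (m + 1)) =
      χ u * A.form H (u, extChartAt (𝓡 k) B.point B.point) (uFrame m k) -
        cutoffForm χ (A.form Ω) (u, extChartAt (𝓡 k) B.point B.point) (uFrame m k) := by
  set e := chartAt (EuclideanHalfSpace (m + 1)) B.center with he
  have hem : e ∈ maximalAtlas (𝓡∂ (m + 1)) ∞ B.carrier :=
    IsManifold.chart_mem_maximalAtlas B.center
  set y₀ := extChartAt (𝓡 k) B.point B.point with hy₀
  have ht : (e.extend (𝓡∂ (m + 1))).target ∈ 𝓝 (u + B.origin) := (hA u hu).1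
  have hut := mem_of_mem_nhds ht
  have hr : range (𝓡∂ (m + 1)) ∈ 𝓝 (u + B.origin) :=
    mem_of_superset ht (extend_target_subset_range _)
  have hx : B.param u ≠ B.center := by
    intro h
    have h2 := congrArg (extChartAt (𝓡∂ (m + 1)) B.center) h
    rw [param, (extChartAt (𝓡∂ (m + 1)) B.center).right_inv hut] at h2
    exact hu0 (by simpa [origin] using h2)
  set β : DiffForm (𝓡∂ (m + 1)) B.carrier m := pullback B.map Ω with hβ
  have hβ1 : IsCkAt 1 β (B.param u) := isCkAt_pullback_map hcl hΩ hx
  have h2 : extDeriv (chartForm e β) (u + B.origin) =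
      - chartForm e (pullback B.map H : DiffForm (𝓡∂ (m + 1)) B.carrier (m + 1))
        (u + B.origin) := by
    have h3 := chartForm_dForm hem hut hβ1
    rw [extDerivWithin, fderivWithin_of_mem_nhds hr, ← extDeriv] at h3
    rw [← h3]
    have h4 : dForm β (B.param u) = _ := dForm_pullback_map hcl hΩ hd hx
    rw [chartForm_congr (α := dForm β)
      (β := - (pullback B.map H : DiffForm (𝓡∂ (m + 1)) B.carrier (m + 1))) h4]
    rfl
  have h3 : DifferentiableAt ℝ (chartForm e β) (u + B.origin) :=
    ((hβ1.chartForm (by norm_cast) hem hut).contDiffAt hr).differentiableAt one_ne_zero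
  have hχ' : HasFDerivAt (fun v => 1 - χ (v - B.origin)) (- fderiv ℝ χ u) (u + B.origin) := by
    have h4 : HasFDerivAt χ (fderiv ℝ χ u) (u + B.origin - B.origin) := by
      rw [add_sub_cancel_right]
      exact (hχ.differentiable (by simp) u).hasFDerivAt
    have h5 := (h4.comp (u + B.origin) ((hasFDerivAt_id (𝕜 := ℝ) (u + B.origin)).sub_const
      B.origin)).const_sub 1
    exact h5
  have h4 : chartForm e (dForm (fun x => (1 - ρ x) • β x :
      DiffForm (𝓡∂ (m + 1)) B.carrier m)) (u + B.origin) =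
      oneWedge (- fderiv ℝ χ u) (chartForm e β (u + B.origin)) +
        (1 - χ u) • extDeriv (chartForm e β) (u + B.origin) := by
    rw [chartForm_dForm hem hut (isCkAt_cutoff hcl hΩ hρ h1 _), extDerivWithin, fderivWithin_of_mem_nhds hr, ← extDeriv]
    have h5 : chartForm e (fun x => (1 - ρ x) • β x : DiffForm (𝓡∂ (m + 1)) B.carrier m) =ᶠ[
        𝓝 (u + B.origin)] fun v => (1 - χ (v - B.origin)) • chartForm e β v := by
      have h6 : (fun v => v - B.origin) ⁻¹' Metric.ball 0 A.r ∈ 𝓝 (u + B.origin) :=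
        (continuous_id.sub continuous_const).continuousAt.preimage_mem_nhds
          (Metric.isOpen_ball.mem_nhds (by simpa using hu))
      filter_upwards [h6] with v hv
      have h7 := hρχ _ hv
      rw [param, sub_add_cancel] at h7
      rw [← h7]
      rfl
    rw [h5.extDeriv_eq, extDeriv_fun_smul hχ'.differentiableAt h3, hχ'.fderiv,
      add_sub_cancel_right]
  have h5 : chartForm e (B.residue Ω H ρ) (u + B.origin) =
      chartForm e (pullback B.map H : DiffForm (𝓡∂ (m + 1)) B.carrier (m + 1)) (u + B.origin) +
      chartForm e (dForm (fun x => (1 - ρ x) • β x :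
        DiffForm (𝓡∂ (m + 1)) B.carrier m)) (u + B.origin) := rfl
  rw [h5, h4, h2, hβ, chartForm_pullback_map hA _ hu, chartForm_pullback_map hA _ hu, cutoffForm,
    ← hy₀]
  simp only [ContinuousAlternatingMap.add_apply, ContinuousAlternatingMap.smul_apply,
    ContinuousAlternatingMap.neg_apply, smul_eq_mul, oneWedge_apply]
  have h6 : (A.form H (u, y₀)).compContinuousLinearMap
      (ContinuousLinearMap.inl ℝ (Eu (m + 1)) (Eu k)) (stdFrame (m + 1)) =
        A.form H (u, y₀) (uFrame m k) := rfl
  have h7 : ∀ i : Fin (m + 1), (A.form Ω (u, y₀)).compContinuousLinearMap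
      (ContinuousLinearMap.inl ℝ (Eu (m + 1)) (Eu k)) (i.removeNth (stdFrame (m + 1))) =
        A.form Ω (u, y₀) (i.removeNth (uFrame m k)) := fun i => rfl
  have h8 : ∀ i : Fin (m + 1), ((fderiv ℝ χ u).comp
      (ContinuousLinearMap.fst ℝ (Eu (m + 1)) (Eu k))) (uFrame m k i) =
        fderiv ℝ χ u (stdFrame (m + 1) i) := fun i => rfl
  simp only [h6, h7, h8, ContinuousLinearMap.neg_apply, neg_mul, mul_neg, Finset.sum_neg_distrib]
  ring

variable [T2Space M] [SigmaCompactSpace M] [T2Space N] [SigmaCompactSpace N] {f : N → ℝ}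

/-- The equation of currents determines the pairing with transverse discs. -/
theorem pairIntegral_eq (hιe : Manifold.IsSmoothEmbedding (𝓡 k) (𝓡 (m + 1 + k)) ∞ ι)
    (hcl : IsClosedEmbedding ι) (hf : Continuous f) (hΩ : IsCkOn 1 Ω (range ι)ᶜ)
    (hΩi : HasLocallyIntegrableCoeffs Ω) (hH : IsCkOn 0 H univ)
    (h : CurrentEquation oM oN ι f Ω H) (hd : ∀ x ∉ range ι, dForm Ω x = - H x)
    (B : TransverseDisc.{uM, uN, v} oM oN ι) : B.pairIntegral H Ω = f B.point := by
  have hH' : ∀ x, IsCkAt 0 H x := fun x => hH.isCkAt isOpen_univ (mem_univ x)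
  have hclr := hcl.isClosed_range
  obtain ⟨A, hA⟩ := B.exists_adaptedChart hιe
  set y₀ := extChartAt (𝓡 k) B.point B.point with hy₀
  set e := chartAt (EuclideanHalfSpace (m + 1)) B.center with he
  have hem : e ∈ maximalAtlas (𝓡∂ (m + 1)) ∞ B.carrier :=
    IsManifold.chart_mem_maximalAtlas B.center
  obtain ⟨ε, hε, hεr⟩ : ∃ ε : ℝ, 0 < ε ∧ 2 * ε < A.r :=
    ⟨A.r / 3, div_pos A.r_pos (by norm_num), by linarith [A.r_pos]⟩
  obtain ⟨ρ, hρ, hρχ, hρ0, hρ1⟩ := exists_cutoff hε hεr fun u hu => (hA u hu).1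
  set S := B.param '' Metric.closedBall 0 (2 * ε) with hS
  have hSc : IsClosed S := (isCompact_image_param hεr fun u hu => (hA u hu).1).isClosed
  have hSs : S ⊆ e.source := by
    rintro _ ⟨u, hu, rfl⟩
    simpa [param, he] using (extChartAt (𝓡∂ (m + 1)) B.center).map_target
      (mem_of_mem_nhds (hA u (Metric.closedBall_subset_ball hεr hu)).1)
  have hcS : B.center ∈ S := ⟨0, by simp [hε.le], B.param_zero⟩
  obtain ⟨hint, hpair⟩ := isIntegrableForm_residue (H := H) hclr hΩ hH' hρ hρ1 fun x hx =>
    hρ0 x (by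
      rintro ⟨u, hu, rfl⟩
      exact hx (isInteriorPoint_param (hA u (Metric.closedBall_subset_ball hεr hu)).1))
  have hres : ∀ x ∉ S, B.residue Ω H ρ x = 0 := fun x hx =>
    residue_eq_zero hclr hΩ hd (fun h => hx (h ▸ hcS)) (by
      filter_upwards [hSc.isOpen_compl.mem_nhds hx] with y hy using hρ0 y hy)
  set χ : Eu (m + 1) → ℝ := fun u => bump (ε⁻¹ • u) with hχ
  have hχs : ContDiff ℝ ∞ χ := contDiff_bump_smul _
  have hχ0 : ∀ u ∉ Metric.closedBall 0 (2 * ε), χ u = 0 := fun u hu => bump_inv_smul_eq_zero hε hu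
  have hflat := A.flatEq oM oN hιe.contMDiff hcl hΩi (.of_isCkAt hH') hf h
  have hslice := hflat.integral_slice
    (continuousOn_const.mul (hf.comp_continuousOn
      ((continuousOn_extChartAt_symm B.point).mono A.ball_subset)))
    (fun z hz => (A.contDiffAt_form (s := 0) (by simp) hz
      (hH' _)).continuousAt.continuousWithinAt)
    (fun z hz hz0 => (A.contDiffAt_form (s := 1) (by norm_cast) hz (hΩ.isCkAt hclr.isOpen_compl
      fun h => hz0 (A.of_mem_range z hz h))).continuousAt)
    hχs (eventually_bump_smul_eq_one _) (isCompact_closedBall 0 (2 * ε))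
    (Metric.closedBall_subset_ball hεr) hχ0 (Metric.mem_ball_self A.r_pos)
  set F : Eu (m + 1) → ℝ := fun u => χ u * A.form H (u, y₀) (uFrame m k) -
    cutoffForm χ (A.form Ω) (u, y₀) (uFrame m k) with hF
  have hF0 : ∀ u ∉ Metric.ball (0 : Eu (m + 1)) A.r, F u = 0 := by
    intro u hu
    have hz : (u, y₀) ∉ A.dom := fun h => hu h.1
    have h1 : cutoffForm χ (A.form Ω) (u, y₀) (uFrame m k) = 0 := by
      rw [cutoffForm, A.form_of_notMem Ω hz, oneWedge_apply]
      exact Finset.sum_eq_zero fun i _ => (congrArg _ (mul_zero _)).trans (mul_zero _)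
    simp only [hF, h1, A.form_of_notMem H hz, sub_zero]
    exact mul_zero _
  have hsgn : ∀ u ∈ Metric.ball (0 : Eu (m + 1)) A.r,
      chartSgn B.orientation e (u + B.origin) = chartSgn B.orientation e B.origin := by
    intro u hu
    have h2 := constant_of_sign (f := fun u => chartSgn B.orientation e (u + B.origin))
      (convex_ball (0 : Eu (m + 1)) A.r).isPreconnected
      ((continuousOn_chartSgn B.orientation hem).comp (by fun_prop)
        fun u hu => mem_of_mem_nhds (hA u hu).1)
      (fun u hu => chartSgn_eq_one_or B.orientation hem (mem_of_mem_nhds (hA u hu).1)) hu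
      (Metric.mem_ball_self A.r_pos)
    simpa using h2
  rw [hpair, (integral_eq_chart B.orientation hint hem fun x hx => hres x fun h => hx (hSs h)).2,
    ← MeasureTheory.integral_indicator (measurableSet_extend_target e)]
  have hae : (e.extend (𝓡∂ (m + 1))).target.indicator (fun y => chartSgn B.orientation e y *
      chartForm e (B.residue Ω H ρ) y (stdFrame (m + 1))) =ᵐ[volume]
        fun y => chartSgn B.orientation e B.origin * F (y - B.origin) := by
    filter_upwards [compl_mem_ae_iff.2 (measure_singleton B.origin)] with y hy
    by_cases hu : y - B.origin ∈ Metric.ball (0 : Eu (m + 1)) A.r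
    · have h1 := hsgn _ hu
      have h2 := chartForm_residue hclr hΩ hd hA hρ hρ1 hχs hρχ hu (sub_ne_zero.2 hy)
      have h3 := mem_of_mem_nhds (hA _ hu).1
      rw [sub_add_cancel] at h1 h2 h3
      rw [indicator_of_mem (show y ∈ (e.extend (𝓡∂ (m + 1))).target from h3), h1, h2]
    · rw [hF0 _ hu, mul_zero]
      by_cases hy' : y ∈ (e.extend (𝓡∂ (m + 1))).target
      · rw [indicator_of_mem hy', chartForm_eq_zero (hres _ ?_)]
        · exact mul_zero _
        · rintro ⟨u, hu', h1⟩
          have h2 := congrArg (e.extend (𝓡∂ (m + 1))) h1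
          have h3 : u + B.origin ∈ (e.extend (𝓡∂ (m + 1))).target :=
            mem_of_mem_nhds (hA u (Metric.closedBall_subset_ball hεr hu')).1
          rw [(e.extend (𝓡∂ (m + 1))).right_inv hy'] at h2
          have h4 : e.extend (𝓡∂ (m + 1)) (B.param u) = u + B.origin :=
            (e.extend (𝓡∂ (m + 1))).right_inv h3
          rw [h4] at h2
          refine hu ?_
          rw [← h2, add_sub_cancel_right]
          exact Metric.closedBall_subset_ball hεr hu'
      · exact indicator_of_notMem hy' _
  rw [integral_congr_ae hae, integral_const_mul, integral_sub_right_eq_self F B.origin, hslice,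
    extChartAt_to_inv]
  have h1 := chartSgn_mul hιe.contMDiff hA
  rcases chartSgn_eq_one_or B.orientation hem (mem_of_mem_nhds B.target_mem_nhds) with h2 | h2 <;>
  · rw [← he, h2] at h1
    rw [h2, h1]
    linear_combination (f B.point) * A.sgnN_mul_self oN

end TransverseDisc

end DiscPairing

section CurrentContinuity

variable {n a p : ℕ} {M : Type*} [TopologicalSpace M] [ChartedSpace (Eu n) M]
  [IsManifold (𝓡 n) ∞ M] [T2Space M] [SigmaCompactSpace M]

theorem exists_norm_le_clm {E F : Type*} [NormedAddCommGroup E] [NormedSpace ℝ E]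
    [NormedAddCommGroup F] [NormedSpace ℝ F] (B : E →L[ℝ] F) : ∃ C ≥ 0, ∀ a, ‖B a‖ ≤ C * ‖a‖ :=
  ⟨‖B‖, norm_nonneg B, B.le_opNorm⟩

theorem exists_norm_le_clm₂ {E F G : Type*} [NormedAddCommGroup E] [NormedSpace ℝ E]
    [NormedAddCommGroup F] [NormedSpace ℝ F] [NormedAddCommGroup G] [NormedSpace ℝ G]
    (B : E →L[ℝ] F →L[ℝ] G) : ∃ C ≥ 0, ∀ a b, ‖B a b‖ ≤ C * ‖a‖ * ‖b‖ :=
  ⟨‖B‖, norm_nonneg B, B.le_opNorm₂⟩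

theorem exists_norm_integralTerm_wedgeForm_le (o : ManifoldOrientation (𝓡 n) M) (h : a + p = n) :
    ∃ C ≥ 0, ∀ (α : DiffForm (𝓡 n) M a) (η : DiffForm (𝓡 n) M p) (i : M),
      ∀ y ∈ (extChartAt (𝓡 n) i).target,
        ‖integralTerm o (wedgeForm h α η) i y‖ ≤ C * ‖localForm α i y‖ * ‖localForm η i y‖ := by
  obtain ⟨C, hC0, hC⟩ := exists_norm_le_clm₂ (wedgeCLM (E := Eu n) h)
  have hP : 0 ≤ ∏ j, ‖stdFrame n j‖ := Finset.prod_nonneg fun j _ => norm_nonneg _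
  refine ⟨C * ∏ j, ‖stdFrame n j‖, mul_nonneg hC0 hP, fun α η i y hy => ?_⟩
  have h1 : ‖chartPartition (𝓡 n) M i ((extChartAt (𝓡 n) i).symm y)‖ ≤ 1 := by
    rw [Real.norm_of_nonneg ((chartPartition (𝓡 n) M).nonneg _ _)]
    exact (chartPartition (𝓡 n) M).le_one _ _
  have h2 : ‖o.chartSign i y‖ = 1 := by
    rcases chartSgn_eq_one_or o (IsManifold.chart_mem_maximalAtlas (I := 𝓡 n) (n := ∞) i) hy
      with h | h <;> · rw [chartSign_eq_chartSgn, h]; simp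
  have h3 : localForm (wedgeForm h α η) i y = wedgeCLM h (localForm α i y) (localForm η i y) := by
    rw [localForm_eq_chartForm, chartForm_wedgeForm]
    rfl
  rw [integralTerm, norm_mul, norm_mul, h2, one_mul, h3]
  have h4 := ((wedgeCLM h (localForm α i y) (localForm η i y)).le_opNorm (stdFrame n)).trans
    (mul_le_mul_of_nonneg_right (hC _ _) hP)
  calc _ ≤ 1 * ‖wedgeCLM h (localForm α i y) (localForm η i y) (stdFrame n)‖ :=
        mul_le_mul_of_nonneg_right h1 (norm_nonneg _)
    _ ≤ _ := by rw [one_mul]; exact h4.trans_eq (by ring)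

theorem tendsto_currentOfForm (o : ManifoldOrientation (𝓡 n) M) (h : a + p = n)
    {α : DiffForm (𝓡 n) M a} (hα : HasLocallyIntegrableCoeffs α) {η : ℕ → DiffForm (𝓡 n) M p}
    {K : Set M} (hK : IsCompact K) (h0 : ∀ j, ∀ x ∉ K, η j x = 0)
    (hu : ∀ (x₀ : M) (K : Set (Eu n)), IsCompact K → K ⊆ (extChartAt (𝓡 n) x₀).target →
      ∀ ε > 0, ∀ᶠ j in atTop, ∀ y ∈ K, ‖localForm (η j) x₀ y‖ ≤ ε) :
    Tendsto (fun j => currentOfForm o h α (η j)) atTop (𝓝 0) := by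
  have hfin := finite_chartPartition_ne_zero (I := 𝓡 n) hK
  have hw0 : ∀ j, ∀ x ∉ K, wedgeForm h α (η j) x = 0 := fun j x hx =>
    wedgeForm_eq_zero_right h α (h0 j x hx)
  have h1 : ∀ j, currentOfForm o h α (η j) = ∑ i ∈ hfin.toFinset,
      ∫ y in (extChartAt (𝓡 n) i).target, integralTerm o (wedgeForm h α (η j)) i y := fun j =>
    integral_eq_sum o fun i x hi hx => by
      rw [Finite.mem_toFinset]
      exact ⟨x, by_contra fun h => hx (hw0 j x h), hi⟩
  simp only [h1]
  obtain ⟨C, hC0, hC⟩ := exists_norm_integralTerm_wedgeForm_le o h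
  suffices hs : ∀ i ∈ hfin.toFinset, Tendsto (fun j => ∫ y in (extChartAt (𝓡 n) i).target,
      integralTerm o (wedgeForm h α (η j)) i y) atTop (𝓝 0) by
    simpa using tendsto_finsetSum _ hs
  intro i _
  set K' := extChartAt (𝓡 n) i '' (K ∩ tsupport (chartPartition (𝓡 n) M i)) with hK'
  have hsub : K ∩ tsupport (chartPartition (𝓡 n) M i) ⊆ (extChartAt (𝓡 n) i).source := by
    rw [extChartAt_source]
    exact inter_subset_right.trans (chartPartition_isSubordinate i)
  have hK'c : IsCompact K' := (hK.inter_right (isClosed_tsupport _)).image_of_continuousOn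
    ((continuousOn_extChartAt i).mono hsub)
  have hK't : K' ⊆ (extChartAt (𝓡 n) i).target := by
    rintro _ ⟨x, hx, rfl⟩
    exact (extChartAt (𝓡 n) i).map_source (hsub hx)
  have h2 : ∀ j, ∫ y in (extChartAt (𝓡 n) i).target, integralTerm o (wedgeForm h α (η j)) i y =
      ∫ y in K', integralTerm o (wedgeForm h α (η j)) i y := fun j =>
    setIntegral_eq_of_subset_of_forall_sdiff_eq_zero
      (measurableSet_extend_target (I := 𝓡 n) (chartAt _ i)) hK't fun y hy => by
        by_cases hx : (extChartAt (𝓡 n) i).symm y ∈ K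
        · have : chartPartition (𝓡 n) M i ((extChartAt (𝓡 n) i).symm y) = 0 := by
            by_contra h
            exact hy.2 ⟨_, ⟨hx, subset_tsupport _ h⟩, (extChartAt (𝓡 n) i).right_inv hy.1⟩
          rw [integralTerm, this, zero_mul]
        · have : localForm (wedgeForm h α (η j)) i y = 0 :=
            chartForm_eq_zero (e := chartAt (Eu n) i) (hw0 j _ hx)
          simp [integralTerm, this]
  simp only [h2]
  have hint : IntegrableOn (fun y => ‖localForm α i y‖) K' :=
    ((hα i).integrableOn_compact_subset hK't hK'c).norm
  set J := ∫ y in K', ‖localForm α i y‖ with hJ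
  have hJ0 : 0 ≤ J := integral_nonneg fun y => norm_nonneg _
  rw [Metric.tendsto_nhds]
  intro ε hε
  have hD : 0 < C * J + 1 := by positivity
  filter_upwards [hu i K' hK'c hK't (ε / (C * J + 1)) (by positivity)] with j hj
  rw [dist_zero_right]
  have h3 : ‖∫ y in K', integralTerm o (wedgeForm h α (η j)) i y‖ ≤
      ∫ y in K', C * (ε / (C * J + 1)) * ‖localForm α i y‖ := by
    refine norm_integral_le_of_norm_le (hint.const_mul _)
      ((ae_restrict_iff' hK'c.measurableSet).2 (ae_of_all _ fun y hy => ?_))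
    refine (hC α (η j) i y (hK't hy)).trans ?_
    calc C * ‖localForm α i y‖ * ‖localForm (η j) i y‖
        ≤ C * ‖localForm α i y‖ * (ε / (C * J + 1)) :=
          mul_le_mul_of_nonneg_left (hj y hy) (by positivity)
      _ = _ := by ring
  refine h3.trans_lt ?_
  rw [integral_const_mul, ← hJ]
  calc C * (ε / (C * J + 1)) * J = ε * ((C * J) / (C * J + 1)) := by ring
    _ < ε * 1 := mul_lt_mul_of_pos_left ((div_lt_one hD).2 (by linarith)) hε
    _ = ε := mul_one _

theorem TestFormsTendToZero.eventually_norm_le {η : ℕ → DiffForm (𝓡 n) M p}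
    (h : TestFormsTendToZero η) (r : ℕ) (x₀ : M) {K : Set (Eu n)} (hK : IsCompact K)
    (hKt : K ⊆ (extChartAt (𝓡 n) x₀).target) {ε : ℝ} (hε : 0 < ε) :
    ∀ᶠ j in atTop, ∀ y ∈ K, ‖iteratedFDeriv ℝ r (localForm (η j) x₀) y‖ ≤ ε := by
  filter_upwards [Metric.tendstoUniformlyOn_iff.1 (h.2.2 x₀ K hK hKt r) ε hε] with j hj y hy
  have := hj y hy
  rw [dist_comm, dist_eq_norm] at this
  exact (by simpa using this.le)

theorem isCurrent_currentOfForm (o : ManifoldOrientation (𝓡 n) M) (h : a + p = n)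
    {α : DiffForm (𝓡 n) M a} (hα : HasLocallyIntegrableCoeffs α) :
    IsCurrent (currentOfForm o h α) where
  map_add η ζ hη hζ := currentOfForm_add o h hα hη hζ
  map_smul c η _ := currentOfForm_smul o h α c η
  continuous η hη := by
    obtain ⟨K, hK, h0⟩ := hη.2.1
    refine tendsto_currentOfForm o h hα hK h0 fun x₀ K hK hKt ε hε => ?_
    filter_upwards [hη.eventually_norm_le 0 x₀ hK hKt hε] with j hj y hy
    exact norm_iteratedFDeriv_zero.symm.trans_le (hj y hy)

theorem tendsto_currentOfForm_dForm (o : ManifoldOrientation (𝓡 n) M) (h : a + (p + 1) = n)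
    {α : DiffForm (𝓡 n) M a} (hα : HasLocallyIntegrableCoeffs α) {η : ℕ → DiffForm (𝓡 n) M p}
    (hη : TestFormsTendToZero η) :
    Tendsto (fun j => currentOfForm o h α (dForm (η j))) atTop (𝓝 0) := by
  obtain ⟨K, hK, h0⟩ := hη.2.1
  refine tendsto_currentOfForm o h hα hK
    (fun j x hx => dForm_eq_zero_of_eq_zero hK.isClosed (h0 j) hx) fun x₀ K hK hKt ε hε => ?_
  set L := ContinuousAlternatingMap.alternatizeUncurryFinCLM ℝ (Eu n) ℝ (n := p) with hL
  obtain ⟨C, hC0, hC⟩ := exists_norm_le_clm (E := Eu n →L[ℝ] Eu n [⋀^Fin p]→L[ℝ] ℝ)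
    (F := Eu n [⋀^Fin (p + 1)]→L[ℝ] ℝ) L
  have hL0 : 0 < C + 1 := by positivity
  filter_upwards [hη.eventually_norm_le 1 x₀ hK hKt (ε := ε / (C + 1)) (by positivity)]
    with j hj y hy
  have h1 : localForm (dForm (η j)) x₀ y = L (fderiv ℝ (localForm (η j) x₀) y) := by
    have h2 := chartForm_dForm (IsManifold.chart_mem_maximalAtlas (I := 𝓡 n) (n := ∞) x₀) (hKt hy)
      ((hη.1 j).isCkAt (by norm_cast) _)
    rw [ModelWithCorners.range_eq_univ, extDerivWithin_univ] at h2
    exact h2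
  have h3 := hj y hy
  rw [norm_iteratedFDeriv_one] at h3
  rw [h1]
  calc _ ≤ C * (ε / (C + 1)) := (hC _).trans
        (mul_le_mul_of_nonneg_left h3 hC0)
    _ ≤ (C + 1) * (ε / (C + 1)) := by gcongr; linarith
    _ = ε := mul_div_cancel₀ _ hL0.ne'

end CurrentContinuity

section Duality

variable {k m : ℕ} {M : Type*} [TopologicalSpace M] [ChartedSpace (Eu (m + 1 + k)) M]
  [IsManifold (𝓡 (m + 1 + k)) ∞ M] [T2Space M] [SigmaCompactSpace M]
  {oM : ManifoldOrientation (𝓡 (m + 1 + k)) M}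
  {N : Type*} [TopologicalSpace N] [ChartedSpace (Eu k) N]
  [IsManifold (𝓡 k) ∞ N] [T2Space N] [SigmaCompactSpace N]
  {oN : ManifoldOrientation (𝓡 k) N} {ι : N → M}
  {Ω : DiffForm (𝓡 (m + 1 + k)) M m} {H : DiffForm (𝓡 (m + 1 + k)) M (m + 1)}

theorem weightedCurrent_smul (f : N → ℝ) (c : ℝ) (η : DiffForm (𝓡 (m + 1 + k)) M k) :
    weightedCurrent oN ι f (c • η) = c * weightedCurrent oN ι f η := by
  rw [weightedCurrent, weightedCurrent, ← integral_smul]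
  congr 1
  funext q
  exact smul_comm (f q) c ((pullback ι η : DiffForm (𝓡 k) N k) q)

theorem CurrentEquation.isCurrent {f : N → ℝ} (h : CurrentEquation oM oN ι f Ω H)
    (hι : ContMDiff (𝓡 k) (𝓡 (m + 1 + k)) ∞ ι) (hcl : IsClosedEmbedding ι) (hf : Continuous f)
    (hΩ : HasLocallyIntegrableCoeffs Ω) (hH : HasLocallyIntegrableCoeffs H) :
    IsCurrent (weightedCurrent oN ι f : FormFunctional (m + 1 + k) M k) where
  map_add η ζ hη hζ := weightedCurrent_add oN hι hcl hf hη hζ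
  map_smul c η _ := weightedCurrent_smul f c η
  continuous η hη := by
    have h1 := ((tendsto_currentOfForm_dForm oM (by omega : m + (k + 1) = m + 1 + k) hΩ
      hη).const_mul ((-1) ^ (m + 1))).add ((isCurrent_currentOfForm oM rfl hH).continuous η hη)
    rw [mul_zero, add_zero] at h1
    exact h1.congr fun j => (currentEquation_iff oM oN).1 h (η j) (hη.1 j)

end Duality

section ClosedCurrents

variable {k m : ℕ} {M : Type*} [TopologicalSpace M] [ChartedSpace (Eu (m + 1 + (k + 1))) M]
  [IsManifold (𝓡 (m + 1 + (k + 1))) ∞ M] [T2Space M] [SigmaCompactSpace M]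
  {oM : ManifoldOrientation (𝓡 (m + 1 + (k + 1))) M}
  {N : Type*} [TopologicalSpace N] [ChartedSpace (Eu (k + 1)) N]
  [IsManifold (𝓡 (k + 1)) ∞ N] [T2Space N] [SigmaCompactSpace N]
  {oN : ManifoldOrientation (𝓡 (k + 1)) N} {ι : N → M}
  {Ω : DiffForm (𝓡 (m + 1 + (k + 1))) M m} {H : DiffForm (𝓡 (m + 1 + (k + 1))) M (m + 1)}

theorem weightedCurrent_dForm (hι : ContMDiff (𝓡 (k + 1)) (𝓡 (m + 1 + (k + 1))) ∞ ι)
    (hcl : IsClosedEmbedding ι) (c : ℝ) {η : DiffForm (𝓡 (m + 1 + (k + 1))) M k}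
    (hη : IsTestForm η) : weightedCurrent oN ι (fun _ => c) (dForm η) = 0 := by
  obtain ⟨K, hK, h0⟩ := (isTestForm_iff.1 hη).2
  have h1 : (fun q => c • (pullback ι (dForm η) : DiffForm (𝓡 (k + 1)) N (k + 1)) q) =
      c • dForm (pullback ι η : DiffForm (𝓡 (k + 1)) N k) := funext fun q => by
    rw [Pi.smul_apply, dForm_pullback hι (hη.isCkAt (by norm_cast) _)]
  rw [weightedCurrent, h1, integral_smul, integral_dForm_eq_zero oN
    (fun q => IsCkAt.pullback (by norm_cast) hι (hη.isCkAt (by norm_cast) _))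
    (hcl.isCompact_preimage hK) fun q hq => ?_, mul_zero]
  rw [pullback, h0 _ hq]
  rfl

theorem CurrentEquation.currentOfForm_dForm {c : ℝ} (h : CurrentEquation oM oN ι (fun _ => c) Ω H)
    (hι : ContMDiff (𝓡 (k + 1)) (𝓡 (m + 1 + (k + 1))) ∞ ι) (hcl : IsClosedEmbedding ι)
    {η : DiffForm (𝓡 (m + 1 + (k + 1))) M k} (hη : IsTestForm η) :
    currentOfForm oM rfl H (dForm η) = 0 := by
  have h1 := (currentEquation_iff oM oN).1 h (dForm η) hη.dForm
  have h2 : dForm (dForm η) = 0 := funext fun x =>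
    dForm_dForm (Eventually.of_forall fun y => hη.isCkAt (by norm_cast) y)
  have h3 : ∀ e : m + (k + 1 + 1) = m + 1 + (k + 1), wedgeForm e Ω (dForm (dForm η)) = 0 :=
    fun e => funext fun x => wedgeForm_eq_zero_right e Ω (by rw [h2]; rfl)
  rw [weightedCurrent_dForm hι hcl c hη, pairing, h3, integral_zero, mul_zero, zero_add] at h1
  exact h1

theorem dForm_eq_zero_of_currentOfForm (hH : IsCkOn 1 H univ)
    (h : ∀ η : DiffForm (𝓡 (m + 1 + (k + 1))) M k, IsTestForm η →
      currentOfForm oM rfl H (dForm η) = 0) (x : M) : dForm H x = 0 := by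
  have hH' : ∀ x, IsCkAt 1 H x := fun x => hH.isCkAt isOpen_univ (mem_univ x)
  refine eq_zero_of_integral_wedgeForm oM (γ := dForm H)
    (by omega : m + 1 + 1 + k = m + 1 + (k + 1)) isOpen_univ
    (fun y _ => IsCkAt.dForm (r := 0) (Eventually.of_forall fun z => by
      simpa using hH' z)) (fun η hη K hK _ h0 => ?_) (mem_univ x)
  rw [integral_wedgeForm_dForm oM _ rfl hK (fun x _ => Eventually.of_forall hH')
    (fun x => hη.isCkAt (by norm_cast) x) h0]
  exact mul_eq_zero_of_right _ (h η hη)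

end ClosedCurrents

section Consequences

variable {k m : ℕ} {M : Type*} [TopologicalSpace M] [ChartedSpace (Eu (m + 1 + k)) M]
  [IsManifold (𝓡 (m + 1 + k)) ∞ M] [T2Space M] [SigmaCompactSpace M]
  {oM : ManifoldOrientation (𝓡 (m + 1 + k)) M}
  {N : Type*} [TopologicalSpace N] [ChartedSpace (Eu k) N]
  [IsManifold (𝓡 k) ∞ N] [T2Space N] [SigmaCompactSpace N]
  {oN : ManifoldOrientation (𝓡 k) N} {ι : N → M}
  {Ω : DiffForm (𝓡 (m + 1 + k)) M m} {H : DiffForm (𝓡 (m + 1 + k)) M (m + 1)}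

theorem isClosedCurrent_weightedCurrent (oN : ManifoldOrientation (𝓡 k) N)
    (hι : ContMDiff (𝓡 k) (𝓡 (m + 1 + k)) ∞ ι) (hcl : IsClosedEmbedding ι) (c : ℝ) :
    IsClosedCurrent (weightedCurrent oN ι (fun _ => c) : FormFunctional (m + 1 + k) M k) := by
  cases k with
  | zero => trivial
  | succ k => exact fun η hη => mul_eq_zero_of_right _ (weightedCurrent_dForm hι hcl c hη)

theorem CurrentEquation.isClosedCurrent {c : ℝ}
    (h : CurrentEquation oM oN ι (fun _ => c) Ω H)
    (hι : ContMDiff (𝓡 k) (𝓡 (m + 1 + k)) ∞ ι) (hcl : IsClosedEmbedding ι) :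
    IsClosedCurrent (currentOfForm oM rfl H : FormFunctional (m + 1 + k) M k) := by
  cases k with
  | zero => trivial
  | succ k => exact fun η hη => mul_eq_zero_of_right _ (h.currentOfForm_dForm hι hcl hη)

theorem CurrentEquation.dForm_eq_zero {c : ℝ} (h : CurrentEquation oM oN ι (fun _ => c) Ω H)
    (hι : ContMDiff (𝓡 k) (𝓡 (m + 1 + k)) ∞ ι) (hcl : IsClosedEmbedding ι)
    (hH : IsCkOn 1 H univ) (x : M) : dForm H x = 0 := by
  cases k with
  | zero => exact form_eq_zero_of_finrank_lt (E := Eu (m + 1 + 0)) (by simp) _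
  | succ k =>
    exact dForm_eq_zero_of_currentOfForm hH (fun η hη => h.currentOfForm_dForm hι hcl hη) x

theorem CurrentEquation.arePoincareDual {c : ℝ} (h : CurrentEquation oM oN ι (fun _ => c) Ω H)
    (hι : ContMDiff (𝓡 k) (𝓡 (m + 1 + k)) ∞ ι) (hcl : IsClosedEmbedding ι)
    (hΩ : HasLocallyIntegrableCoeffs Ω) (hH : HasLocallyIntegrableCoeffs H) :
    ArePoincareDual oM rfl (weightedCurrent oN ι fun _ => c) H :=
  ⟨h.isCurrent hι hcl continuous_const hΩ hH, isCurrent_currentOfForm oM rfl hH,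
    isClosedCurrent_weightedCurrent oN hι hcl c, h.isClosedCurrent hι hcl,
    currentOfForm oM (by omega : m + (k + 1) = m + 1 + k) Ω, isCurrent_currentOfForm oM _ hΩ,
    fun η hη => (h η hη).symm⟩

end Consequences

end BlowUpCurrents

end

theorem mainTheorem6 (k m : ℕ)
    {M : Type uM} [TopologicalSpace M] [ChartedSpace (Eu (m + 1 + k)) M]
    [IsManifold (𝓡 (m + 1 + k)) ∞ M] [T2Space M] [SigmaCompactSpace M]
    (oM : ManifoldOrientation (𝓡 (m + 1 + k)) M)
    {N : Type uN} [TopologicalSpace N] [ChartedSpace (Eu k) N]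
    [IsManifold (𝓡 k) ∞ N] [T2Space N] [SigmaCompactSpace N] [ConnectedSpace N]
    (oN : ManifoldOrientation (𝓡 k) N)
    (ι : N → M) (hι : Manifold.IsSmoothEmbedding (𝓡 k) (𝓡 (m + 1 + k)) ∞ ι)
    (hclosed : IsClosed (range ι))
    (f : N → ℝ) (hf : Continuous f)
    (Ω : DiffForm (𝓡 (m + 1 + k)) M m) (hΩ : IsCkOn 1 Ω (range ι)ᶜ)
    (hΩint : HasLocallyIntegrableCoeffs Ω)
    (H : DiffForm (𝓡 (m + 1 + k)) M (m + 1)) (hH : IsCkOn 0 H univ) :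
    -- `(a)` implies `(b1)`, and `(b2)` for every transverse submanifold
    (CurrentEquation oM oN ι f Ω H →
      (∀ x ∉ range ι, dForm Ω x = - H x) ∧
      ∀ B : TransverseDisc.{uM, uN, v} oM oN ι, B.pairIntegral H Ω = f B.point) ∧
    -- the converse, from one single `B(p)`: the equation with the constant weight `f(p)`
    (IsWeaklyExtendible ι Ω → (∀ x ∉ range ι, dForm Ω x = - H x) →
      ∀ B : TransverseDisc.{uM, uN, v} oM oN ι, B.pairIntegral H Ω = f B.point →
        CurrentEquation oM oN ι (fun _ => f B.point) Ω H) ∧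
    -- the converse, from one `B(p)` for each point `p` of `L`
    (IsWeaklyExtendible ι Ω → (∀ x ∉ range ι, dForm Ω x = - H x) →
      (∀ q : N, ∃ B : TransverseDisc.{uM, uN, v} oM oN ι,
        B.point = q ∧ B.pairIntegral H Ω = f B.point) →
      CurrentEquation oM oN ι f Ω H) ∧
    -- consequences of `(a)`
    (CurrentEquation oM oN ι f Ω H →
      (∃ c : ℝ, ∀ q, f q = c) ∧
      (IsCkOn 1 H univ → ∀ x, dForm H x = 0) ∧
      ArePoincareDual oM rfl (weightedCurrent oN ι f) H) := by
  have hcl : IsClosedEmbedding ι := ⟨hι.isEmbedding, hclosed⟩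
  have hHi : HasLocallyIntegrableCoeffs H := .of_isCkAt fun x => hH.isCkAt isOpen_univ (mem_univ x)
  have hconst (hext : IsWeaklyExtendible ι Ω) (hd : ∀ x ∉ range ι, dForm Ω x = - H x) :
      ∃ c : ℝ, CurrentEquation oM oN ι (fun _ => c) Ω H ∧
        ∀ B : TransverseDisc.{uM, uN, v} oM oN ι, B.pairIntegral H Ω = c := by
    obtain ⟨c, hc⟩ := exists_currentEquation_const hι hcl hΩ hΩint hH hd
      (exists_flatEq_of_isWeaklyExtendible hι hclosed hΩ hΩint hH hd hext oM)
    exact ⟨c, hc, fun B =>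
      TransverseDisc.pairIntegral_eq hι hcl continuous_const hΩ hΩint hH hc hd B⟩
  refine ⟨fun h => ?_, fun hext hd B hB => ?_, fun hext hd hB => ?_, fun h => ?_⟩
  · have hd := CurrentEquation.dForm_eq oM oN h hclosed hΩ hH
    exact ⟨hd, TransverseDisc.pairIntegral_eq hι hcl hf hΩ hΩint hH h hd⟩
  · obtain ⟨c, hc, hBc⟩ := hconst hext hd
    rwa [← hB, hBc B]
  · obtain ⟨c, hc, hBc⟩ := hconst hext hd
    have hfc : f = fun _ => c := funext fun q => by
      obtain ⟨B, rfl, hBq⟩ := hB q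
      rw [← hBq, hBc B]
    rwa [hfc]
  · have hloc : IsLocallyConstant f :=
      h.isLocallyConstant hι hcl hΩint hH hf
    obtain ⟨c, rfl⟩ : ∃ c : ℝ, f = fun _ => c :=
      ⟨f (Classical.arbitrary N), funext fun q => hloc.apply_eq_of_preconnectedSpace q _⟩
    exact ⟨⟨c, fun _ => rfl⟩, fun hH1 => h.dForm_eq_zero hι.contMDiff hcl hH1,
      h.arePoincareDual hι.contMDiff hcl hΩint hHi⟩
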